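/- **Definitions.** A *skeletal graph* is a connected simple graph $\Gamma$ embedded in $\mathbb{R}^3$ with straight edges. Let $\Gamma$ be invariant under a rank-three lattice $\Lambda$ of translations. The quotient multigraph $\Gamma/\Lambda$ is *of type* $\Gamma'_{g,v,d}$ if it has $v$ vertices, all of degree $d$ (loops count twice), its genus $e-v+1$ (where $e$ is its number of edges) equals $g$, and it is symmetric, that is, its automorphisms act transitively on ordered pairs of adjacent vertices. A ($\Lambda$-periodic) *decoration* of $\Gamma$ replaces the vertices and the edges of $\Gamma$, $\Lambda$-equivariantly, with convex polyhedral solids, where edges may also be replaced with the empty solid, such that: each vertex and each edge lies in the union of the solids that replace it and its end points; the solids of an incident vertex and edge intersect in a common face (if the edge carries the empty solid, the solids of its two end points intersect in a common face); any two other solids meet in a set of dimension at most one; and the union of all solids deformation retracts to $\Gamma$. The decoration is *Archimedean* if vertices are replaced with Platonic or Archimedean solids and edges with right prisms or antiprisms over regular polygons or with empty solids. Its boundary surface is tiled by the faces of the solids along which no solids are identified. The decoration is *regular*, with symbol $\{p,q\,|\,r\}$, if this boundary is an embedded connected surface without boundary tiled edge-to-edge by regular $p$-gons, $q$ at each vertex,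 and all identifications are along regular $r$-gons. The genus of the surface is that of its compact quotient by $\Lambda$. **Theorem.** Up to similarity of $\mathbb{R}^3$, there are only finitely many regular triply periodic polyhedral surfaces of genus four that are boundaries of regular Archimedean decorations of graphs with quotient of type $\Gamma'_{4,1,8}$ or $\Gamma'_{4,3,4}$. Moreover, the following decorations exist, have boundary surfaces of genus four, and can be realized over graphs $\Gamma$ whose Euclidean symmetries act transitively on ordered pairs of adjacent vertices: 1. (Octa-8) type $\Gamma'_{4,1,8}$, vertices replaced with regular octahedra and edges with triangular antiprisms, symbol $\{3,12\,|\,3\}$; 2. (Truncated Octa-8) type $\Gamma'_{4,1,8}$, vertices replaced with truncated octahedra and edges with hexagonal prisms, symbol $\{4,5\,|\,6\}$; 3. (three cubes) type $\Gamma'_{4,3,4}$, vertices replaced with cubes and edges with square prisms, symbol $\{4,5\,|\,4\}$; 4. (three octahedra) type $\Gamma'_{4,3,4}$, vertices replaced with regular octahedra and edges with triangular antiprisms, symbol $\{3,8\,|\,3\}$. -/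

import Mathlib

namespace TPPS

/-- Euclidean three-space. -/
abbrev E3 : Type := EuclideanSpace ℝ (Fin 3)

/-- The translate of a set by a vector. -/
def translate (l : E3) (S : Set E3) : Set E3 := (fun x => l + x) '' S

/-- `g` is a similarity of Euclidean space: an isometry followed by a scaling. -/
def IsSimilarity (g : E3 → E3) : Prop :=
  ∃ c : ℝ, 0 < c ∧ ∃ f : E3 ≃ᵃⁱ[ℝ] E3, ∀ x, g x = c • f x

/-- Two point sets are similar. -/
def AreSimilar (A B : Set E3) : Prop := ∃ g, IsSimilarity g ∧ B = g '' A

/-- Two tiled surfaces (sets of tiles) are similar: a similarity carries the tiles of the one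
onto the tiles of the other. -/
def AreSimilarTilings (S T : Set (Set E3)) : Prop :=
  ∃ g, IsSimilarity g ∧ T = (fun P => g '' P) '' S

/-! ### Polytopes, polygons, and the solids that are used -/

/-- A convex polyhedral solid: the convex hull of finitely many points, with an interior point. -/
def IsConvexSolid (K : Set E3) : Prop :=
  (∃ s : Set E3, s.Finite ∧ K = convexHull ℝ s) ∧ (interior K).Nonempty

/-- The faces of dimension `k` of a convex set. -/
def faces (k : ℕ) (K : Set E3) : Set (Set E3) :=
  {F | IsExposed ℝ K F ∧ F.Nonempty ∧ Module.finrank ℝ (vectorSpan ℝ F) = k}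

/-- The two-dimensional faces of a solid. -/
def facets (K : Set E3) : Set (Set E3) := faces 2 K

/-- The edges of a polygon (or of a solid). -/
def edges (K : Set E3) : Set (Set E3) := faces 1 K

/-- The vertices of a polygon (or of a solid). -/
def vertices (K : Set E3) : Set E3 := Set.extremePoints ℝ K

/-- The set has dimension at most one (it may be empty). -/
def IsThin (A : Set E3) : Prop := Module.finrank ℝ (vectorSpan ℝ A) ≤ 1

/-- The point at height `z` above, and at angle `t` and distance `R` from, the point `c`, in
cylindrical coordinates with respect to the orthonormal frame `b`. -/
noncomputable def cylPoint (c : E3) (b : OrthonormalBasis (Fin 3) ℝ E3) (R z t : ℝ) : E3 :=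
  c + (R * Real.cos t) • b 0 + (R * Real.sin t) • b 1 + z • b 2

/-- A regular convex `n`-gon in space. -/
def IsRegularPolygon (n : ℕ) (T : Set E3) : Prop :=
  3 ≤ n ∧ ∃ (c : E3) (b : OrthonormalBasis (Fin 3) ℝ E3) (R : ℝ), 0 < R ∧
    T = convexHull ℝ (Set.range fun k : Fin n => cylPoint c b R 0 (2 * Real.pi * (k : ℕ) / n))

/-- A (right) prism over a regular `n`-gon. -/
def IsPrism (n : ℕ) (K : Set E3) : Prop :=
  3 ≤ n ∧ ∃ (c : E3) (b : OrthonormalBasis (Fin 3) ℝ E3) (R h : ℝ), 0 < R ∧ 0 < h ∧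
    K = convexHull ℝ
      ((Set.range fun k : Fin n => cylPoint c b R h (2 * Real.pi * (k : ℕ) / n)) ∪
        (Set.range fun k : Fin n => cylPoint c b R (-h) (2 * Real.pi * (k : ℕ) / n)))

/-- An antiprism over a regular `n`-gon: the two bases are turned by `π / n` against
each other. -/
def IsAntiprism (n : ℕ) (K : Set E3) : Prop :=
  3 ≤ n ∧ ∃ (c : E3) (b : OrthonormalBasis (Fin 3) ℝ E3) (R h : ℝ), 0 < R ∧ 0 < h ∧
    K = convexHull ℝ
      ((Set.range fun k : Fin n => cylPoint c b R h (2 * Real.pi * (k : ℕ) / n)) ∪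
        (Set.range fun k : Fin n =>
          cylPoint c b R (-h) (2 * Real.pi * (k : ℕ) / n + Real.pi / n)))

/-- The points obtained from `(a₀, a₁, a₂)` by a permutation `σ` of the coordinates followed by
sign changes `s`, where `C` says which pairs (sign of `σ`, product of the `s i`) are admitted. -/
def orbitPoints (C : ℤˣ → ℤˣ → Prop) (a₀ a₁ a₂ : ℝ) : Set E3 :=
  {x | ∃ (σ : Equiv.Perm (Fin 3)) (s : Fin 3 → ℤˣ), C (Equiv.Perm.sign σ) (∏ i, s i) ∧
    ∀ i, x i = (((s i : ℤˣ) : ℤ) : ℝ) * (![a₀, a₁, a₂] : Fin 3 → ℝ) (σ i)}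

/-- All permutations and all sign changes. -/
def allPoints (a₀ a₁ a₂ : ℝ) : Set E3 := orbitPoints (fun _ _ => True) a₀ a₁ a₂

/-- Even permutations and all sign changes. -/
def evenPoints (a₀ a₁ a₂ : ℝ) : Set E3 := orbitPoints (fun g _ => g = 1) a₀ a₁ a₂

/-- All permutations, and an even number of sign changes. -/
def tetraPoints (a₀ a₁ a₂ : ℝ) : Set E3 := orbitPoints (fun _ p => p = 1) a₀ a₁ a₂

/-- Even permutations, and an odd number of sign changes. -/
def pyritoSnubPoints (a₀ a₁ a₂ : ℝ) : Set E3 :=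
  orbitPoints (fun g p => g = 1 ∧ p = -1) a₀ a₁ a₂

/-- Even permutations with an odd number of sign changes, and odd permutations with an even
number of sign changes. -/
def octaSnubPoints (a₀ a₁ a₂ : ℝ) : Set E3 := orbitPoints (fun g p => p = -g) a₀ a₁ a₂

/-- The five Platonic and the thirteen Archimedean solids. -/
inductive Solid
  | tetrahedron | cube | octahedron | dodecahedron | icosahedron
  | truncatedTetrahedron | cuboctahedron | truncatedCube | truncatedOctahedron
  | rhombicuboctahedron | truncatedCuboctahedron | snubCube
  | icosidodecahedron | truncatedDodecahedron | truncatedIcosahedron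
  | rhombicosidodecahedron | truncatedIcosidodecahedron | snubDodecahedron

local notation "φ" => Real.goldenRatio

/-- The vertices of a standard model of each solid. For the snub cube `t` is the tribonacci
constant, for the snub dodecahedron `ξ` is the positive root of `ξ ^ 3 - 2 * ξ = φ`; these two
solids are chiral, and their mirror images are similar to the models by a reflection. -/
noncomputable def Solid.points : Solid → Set E3
  | .tetrahedron => tetraPoints 1 1 1
  | .cube => allPoints 1 1 1
  | .octahedron => allPoints 1 0 0
  | .dodecahedron => allPoints 1 1 1 ∪ evenPoints 0 φ⁻¹ φ
  | .icosahedron => evenPoints 0 1 φ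
  | .truncatedTetrahedron => tetraPoints 3 1 1
  | .cuboctahedron => allPoints 1 1 0
  | .truncatedCube => allPoints (√2 - 1) 1 1
  | .truncatedOctahedron => allPoints 0 1 2
  | .rhombicuboctahedron => allPoints 1 1 (1 + √2)
  | .truncatedCuboctahedron => allPoints 1 (1 + √2) (1 + 2 * √2)
  | .snubCube => {x | ∃ t : ℝ, 0 < t ∧ t ^ 3 = t ^ 2 + t + 1 ∧ x ∈ octaSnubPoints 1 t⁻¹ t}
  | .icosidodecahedron => allPoints (2 * φ) 0 0 ∪ evenPoints 1 φ (φ ^ 2)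
  | .truncatedDodecahedron =>
      evenPoints 0 φ⁻¹ (2 + φ) ∪ evenPoints φ⁻¹ φ (2 * φ) ∪ evenPoints φ 2 (φ + 1)
  | .truncatedIcosahedron =>
      evenPoints 0 1 (3 * φ) ∪ evenPoints 1 (2 + φ) (2 * φ) ∪ evenPoints φ 2 (2 * φ + 1)
  | .rhombicosidodecahedron =>
      evenPoints 1 1 (φ ^ 3) ∪ evenPoints (φ ^ 2) φ (2 * φ) ∪ evenPoints (2 + φ) 0 (φ ^ 2)
  | .truncatedIcosidodecahedron =>
      evenPoints φ⁻¹ φ⁻¹ (3 + φ) ∪ evenPoints (2 * φ⁻¹) φ (1 + 2 * φ) ∪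
        evenPoints φ⁻¹ (φ ^ 2) (3 * φ - 1) ∪ evenPoints (2 * φ - 1) 2 (2 + φ) ∪
        evenPoints φ 3 (2 * φ)
  | .snubDodecahedron => {x | ∃ ξ α β : ℝ, 0 < ξ ∧ ξ ^ 3 - 2 * ξ = φ ∧ α = ξ - ξ⁻¹ ∧
      β = ξ * φ + φ ^ 2 + φ * ξ⁻¹ ∧
      x ∈ pyritoSnubPoints (2 * α) 2 (2 * β) ∪
        pyritoSnubPoints (α + β * φ⁻¹ + φ) (-α * φ + β + φ⁻¹) (α * φ⁻¹ + β * φ - 1) ∪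
        pyritoSnubPoints (α + β * φ⁻¹ - φ) (α * φ - β + φ⁻¹) (α * φ⁻¹ + β * φ + 1) ∪
        pyritoSnubPoints (-α * φ⁻¹ + β * φ + 1) (-α + β * φ⁻¹ - φ) (α * φ + β - φ⁻¹) ∪
        pyritoSnubPoints (-α * φ⁻¹ + β * φ - 1) (α - β * φ⁻¹ - φ) (α * φ + β + φ⁻¹)}

/-- `K` is a solid of the given shape, of any size and in any position. -/
def IsSolid (s : Solid) (K : Set E3) : Prop := AreSimilar (convexHull ℝ s.points) K

/-! ### Triply periodic skeletal graphs and their quotients -/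

/-- A lattice of rank three. -/
def IsRankThreeLattice (Λ : Submodule ℤ E3) : Prop :=
  DiscreteTopology Λ ∧ Submodule.span ℝ (Λ : Set E3) = ⊤

/-- A connected simple skeletal graph embedded in space with straight edges. Its vertex set is
`Γ.support`; two distinct edges meet at most in a common end point. -/
structure IsSkeletalGraph (Γ : SimpleGraph E3) : Prop where
  nonempty : Γ.support.Nonempty
  connected : ∀ u ∈ Γ.support, ∀ v ∈ Γ.support, Γ.Reachable u v
  embedded : ∀ u v u' v', Γ.Adj u v → Γ.Adj u' v' → s(u, v) ≠ s(u', v') →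
    segment ℝ u v ∩ segment ℝ u' v' ⊆ {u, v} ∩ {u', v'}

/-- The subset of space covered by the graph. -/
def realization (Γ : SimpleGraph E3) : Set E3 := {x | ∃ u v, Γ.Adj u v ∧ x ∈ segment ℝ u v}

/-- The graph is invariant under the lattice. -/
def IsPeriodic (Λ : Submodule ℤ E3) (Γ : SimpleGraph E3) : Prop :=
  ∀ l ∈ Λ, ∀ u v, Γ.Adj (l + u) (l + v) ↔ Γ.Adj u v

/-- The orbits, under translation by the lattice, of the members of a family of sets. -/
def orbits (Λ : Submodule ℤ E3) (𝓕 : Set (Set E3)) : Set (Set (Set E3)) :=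
  (fun S => {T | ∃ l ∈ Λ, T = translate l S}) '' 𝓕

/-- The vertices of the quotient graph `Γ / Λ`. -/
def quotientVertices (Λ : Submodule ℤ E3) (Γ : SimpleGraph E3) : Set (E3 ⧸ Λ.toAddSubgroup) :=
  (fun u => (QuotientAddGroup.mk u : E3 ⧸ Λ.toAddSubgroup)) '' Γ.support

/-- The edges of the quotient graph `Γ / Λ`: orbits of the edges `{u, v}` of `Γ`. -/
def quotientEdges (Λ : Submodule ℤ E3) (Γ : SimpleGraph E3) : Set (Set (Set E3)) :=
  orbits Λ {S | ∃ u v, Γ.Adj u v ∧ S = {u, v}}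

/-- The number of edges (loops, if `a = b`) of `Γ / Λ` between its vertices `a` and `b`. -/
noncomputable def multiplicity (Λ : Submodule ℤ E3) (Γ : SimpleGraph E3)
    (a b : E3 ⧸ Λ.toAddSubgroup) : ℕ :=
  (orbits Λ {S | ∃ u v, Γ.Adj u v ∧ (QuotientAddGroup.mk u : E3 ⧸ Λ.toAddSubgroup) = a ∧
    (QuotientAddGroup.mk v : E3 ⧸ Λ.toAddSubgroup) = b ∧ S = {u, v}}).ncard

/-- The quotient multigraph is symmetric: its automorphisms act transitively on ordered pairs of
adjacent vertices. -/
def HasSymmetricQuotient (Λ : Submodule ℤ E3) (Γ : SimpleGraph E3) : Prop :=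
  ∀ a b a' b' : quotientVertices Λ Γ, multiplicity Λ Γ a b ≠ 0 → multiplicity Λ Γ a' b' ≠ 0 →
    ∃ ψ : Equiv.Perm (quotientVertices Λ Γ),
      (∀ x y, multiplicity Λ Γ (ψ x) (ψ y) = multiplicity Λ Γ x y) ∧ ψ a = a' ∧ ψ b = b'

/-- `Γ / Λ` is a symmetric quotient graph of type `(g, v, d)`: it comes from a connected simple
embedded triply periodic graph `Γ`, is symmetric, has `v` vertices, all of degree `d`
(loops count twice), and genus `g = e - v + 1`, where `e` is its number of edges. -/
structure HasQuotientType (Λ : Submodule ℤ E3) (Γ : SimpleGraph E3) (g v d : ℕ) : Prop where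
  lattice : IsRankThreeLattice Λ
  graph : IsSkeletalGraph Γ
  periodic : IsPeriodic Λ Γ
  card_vertices : (quotientVertices Λ Γ).ncard = v
  degree : ∀ u ∈ Γ.support, (Γ.neighborSet u).ncard = d
  genus : (quotientEdges Λ Γ).ncard + 1 = g + v
  symmetric : HasSymmetricQuotient Λ Γ

/-- The graph is symmetric under Euclidean isometries: those that preserve it act transitively
on ordered pairs of adjacent vertices. -/
def IsEuclideanSymmetric (Γ : SimpleGraph E3) : Prop :=
  ∀ u v u' v', Γ.Adj u v → Γ.Adj u' v' → ∃ f : E3 ≃ᵃⁱ[ℝ] E3,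
    (∀ x y, Γ.Adj (f x) (f y) ↔ Γ.Adj x y) ∧ f u = u' ∧ f v = v'

/-! ### Decorations -/

/-- Solids that replace the vertices (`node`) and the edges (`link`) of a graph; `link u v = ∅`
means that the edge is replaced with the empty solid. Only the values at vertices and edges of
the graph matter. -/
structure Replacement where
  node : E3 → Set E3
  link : E3 → E3 → Set E3

/-- `G` is a (strong) deformation retract of `P`. -/
def IsDeformationRetract (P G : Set E3) : Prop :=
  G ⊆ P ∧ ∃ H : ℝ × E3 → E3, ContinuousOn H (Set.Icc 0 1 ×ˢ P) ∧
    (∀ t ∈ Set.Icc (0 : ℝ) 1, ∀ x ∈ P, H (t, x) ∈ P) ∧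
    (∀ x ∈ P, H (0, x) = x) ∧ (∀ x ∈ P, H (1, x) ∈ G) ∧
    (∀ t ∈ Set.Icc (0 : ℝ) 1, ∀ x ∈ G, H (t, x) = x)

/-- The polyhedron: the union of all solids. -/
def Replacement.polyhedron (D : Replacement) (Γ : SimpleGraph E3) : Set E3 :=
  {x | (∃ u ∈ Γ.support, x ∈ D.node u) ∨ ∃ u v, Γ.Adj u v ∧ x ∈ D.link u v}

open Classical in
/-- Where the solid of the vertex `u` is attached for the sake of the edge from `u` to `v`: to
the solid of that edge, or directly to the solid of `v` if the edge carries the empty solid. -/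
noncomputable def Replacement.contact (D : Replacement) (u v : E3) : Set E3 :=
  if D.link u v = ∅ then D.node u ∩ D.node v else D.node u ∩ D.link u v

/-- A `Λ`-periodic decoration of `Γ`. Vertices and edges are replaced with convex polyhedral
solids, edges possibly with the empty solid; each simplex lies in the solids that replace it and
its end points; the solids of incident simplices are identified along a common face; any two other
solids meet at most in a set of dimension one; the polyhedron retracts to the graph. -/
structure IsDecoration (Λ : Submodule ℤ E3) (Γ : SimpleGraph E3) (D : Replacement) : Prop where
  node_solid : ∀ u ∈ Γ.support, IsConvexSolid (D.node u)
  link_solid : ∀ u v, Γ.Adj u v → D.link u v = ∅ ∨ IsConvexSolid (D.link u v)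
  link_symm : ∀ u v, Γ.Adj u v → D.link u v = D.link v u
  node_periodic : ∀ l ∈ Λ, ∀ u ∈ Γ.support, D.node (l + u) = translate l (D.node u)
  link_periodic : ∀ l ∈ Λ, ∀ u v, Γ.Adj u v → D.link (l + u) (l + v) = translate l (D.link u v)
  vertex_mem : ∀ u ∈ Γ.support, u ∈ D.node u
  edge_subset : ∀ u v, Γ.Adj u v → segment ℝ u v ⊆ D.node u ∪ D.link u v ∪ D.node v
  contact_node : ∀ u v, Γ.Adj u v → D.contact u v ∈ facets (D.node u)
  contact_link : ∀ u v, Γ.Adj u v → D.link u v ≠ ∅ → D.contact u v ∈ facets (D.link u v)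
  node_node : ∀ u ∈ Γ.support, ∀ v ∈ Γ.support, u ≠ v →
    ¬ (Γ.Adj u v ∧ D.link u v = ∅) → IsThin (D.node u ∩ D.node v)
  node_link : ∀ w ∈ Γ.support, ∀ u v, Γ.Adj u v → w ≠ u → w ≠ v →
    IsThin (D.node w ∩ D.link u v)
  link_link : ∀ u v u' v', Γ.Adj u v → Γ.Adj u' v' → s(u, v) ≠ s(u', v') →
    IsThin (D.link u v ∩ D.link u' v')
  retract : IsDeformationRetract (D.polyhedron Γ) (realization Γ)

/-- Archimedean: vertices are replaced with Platonic or Archimedean solids, edges with prisms,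
antiprisms (over regular polygons) or empty solids. -/
structure IsArchimedean (Γ : SimpleGraph E3) (D : Replacement) : Prop where
  node : ∀ u ∈ Γ.support, ∃ s : Solid, IsSolid s (D.node u)
  link : ∀ u v, Γ.Adj u v →
    D.link u v = ∅ ∨ ∃ n, IsPrism n (D.link u v) ∨ IsAntiprism n (D.link u v)

/-- The boundary surface of the decoration, as the set of its tiles: the faces of the solids along
which no solids are identified. -/
def Replacement.boundary (D : Replacement) (Γ : SimpleGraph E3) : Set (Set E3) :=
  {F | (∃ u ∈ Γ.support, F ∈ facets (D.node u) ∧ ∀ v, Γ.Adj u v → F ≠ D.contact u v) ∨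
    ∃ u v, Γ.Adj u v ∧ F ∈ facets (D.link u v) ∧ F ≠ D.contact u v ∧ F ≠ D.contact v u}

/-! ### Regular polyhedral surfaces -/

/-- An embedded connected polyhedral surface without boundary that is tiled, edge to edge, by
regular `p`-gons, `q` of them around each vertex. -/
structure IsRegularSurface (p q : ℕ) (S : Set (Set E3)) : Prop where
  polygon : ∀ T ∈ S, IsRegularPolygon p T
  edge_to_edge : ∀ T ∈ S, ∀ T' ∈ S, T ≠ T' → T ∩ T' = ∅ ∨
    (∃ x, x ∈ vertices T ∧ x ∈ vertices T' ∧ T ∩ T' = {x}) ∨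
    (T ∩ T' ∈ edges T ∧ T ∩ T' ∈ edges T')
  two_tiles : ∀ T ∈ S, ∀ e ∈ edges T, ∃! T', T' ∈ S ∧ T' ≠ T ∧ e ∈ edges T'
  valency_pos : 0 < q
  valency : ∀ T ∈ S, ∀ x ∈ vertices T, {T' ∈ S | x ∈ T'}.ncard = q
  cycle : ∀ x, ∀ T ∈ S, ∀ T' ∈ S, x ∈ T → x ∈ T' →
    Relation.ReflTransGen (fun A B => A ∈ S ∧ B ∈ S ∧
      ∃ e, e ∈ edges A ∧ e ∈ edges B ∧ x ∈ e) T T'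
  connected : IsConnected (⋃₀ S)

/-- The compact quotient by `Λ` of the tiled surface has finitely many tiles, edges and vertices
and Euler characteristic `2 - 2 * g`. -/
def HasQuotientGenus (Λ : Submodule ℤ E3) (S : Set (Set E3)) (g : ℕ) : Prop :=
  let F := orbits Λ S
  let E := orbits Λ {e | ∃ T ∈ S, e ∈ edges T}
  let V := orbits Λ {z | ∃ T ∈ S, ∃ x ∈ vertices T, z = {x}}
  F.Finite ∧ E.Finite ∧ V.Finite ∧
    (V.ncard : ℤ) - (E.ncard : ℤ) + (F.ncard : ℤ) = 2 - 2 * (g : ℤ)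

/-- A regular Archimedean decoration with Schläfli symbol `{p, q | r}`: the boundary surface is
regular with `q` regular `p`-gons at each vertex, and all solids are identified along
regular `r`-gons. -/
structure IsRegularArchimedeanDecoration (Λ : Submodule ℤ E3) (Γ : SimpleGraph E3)
    (D : Replacement) (p q r : ℕ) : Prop where
  decoration : IsDecoration Λ Γ D
  archimedean : IsArchimedean Γ D
  regular : IsRegularSurface p q (D.boundary Γ)
  contact : ∀ u v, Γ.Adj u v → IsRegularPolygon r (D.contact u v)

/-- `S` is a regular triply periodic polyhedral surface of genus `h` that is the boundary of a
regular Archimedean decoration of a symmetric quotient graph of type `(g, v, d)`. -/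
def ArisesFrom (h g v d : ℕ) (S : Set (Set E3)) : Prop :=
  ∃ (Λ : Submodule ℤ E3) (Γ : SimpleGraph E3) (D : Replacement) (p q r : ℕ),
    HasQuotientType Λ Γ g v d ∧ IsRegularArchimedeanDecoration Λ Γ D p q r ∧
      S = D.boundary Γ ∧ HasQuotientGenus Λ S h

/-- A genus-`h` surface as in `ArisesFrom` exists with symbol `{p, q | r}`, with all vertices
replaced with solids of shape `s` and all edges with solids that satisfy `L`, and over a graph
that is even symmetric under Euclidean isometries. -/
def ExampleExists (h g v d p q r : ℕ) (s : Solid) (L : Set E3 → Prop) : Prop :=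
  ∃ (Λ : Submodule ℤ E3) (Γ : SimpleGraph E3) (D : Replacement),
    HasQuotientType Λ Γ g v d ∧ IsEuclideanSymmetric Γ ∧
      IsRegularArchimedeanDecoration Λ Γ D p q r ∧ HasQuotientGenus Λ (D.boundary Γ) h ∧
      (∀ u ∈ Γ.support, IsSolid s (D.node u)) ∧ ∀ u v, Γ.Adj u v → L (D.link u v)

end TPPS

namespace TPPS

open Real
open Bool (and_eq_true not_eq_true not_eq_true' or_eq_true)
open List (Nodup all_eq_true all_map any_eq_true exists_mem_of_ne_nil length_map map_cons map_id
  map_map mem_append mem_append_left mem_append_right mem_cons mem_cons_self mem_flatMap mem_map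
  mem_map_of_mem not_mem_nil pairwise_map)
open Set (image_comp image_mono mem_biUnion mem_iUnion mem_ofPred_eq range_comp)
open Relation (ReflTransGen)
open Function (Injective comp_apply comp_def)

section Hull

variable {E : Type*} [NormedAddCommGroup E] [NormedSpace ℝ E]

lemma convexHull_inter_le {s : Set E} {l : E →ₗ[ℝ] ℝ} {M : ℝ} (h : ∀ x ∈ s, l x ≤ M) {x : E}
    (hx : x ∈ convexHull ℝ s) : l x ≤ M :=
  convexHull_min (t := {x | l x ≤ M}) h (convex_halfSpace_le l.isLinear M) hx

/-- The face of a convex hull that a supporting functional cuts out is the hull of the generators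
on the supporting hyperplane. -/
lemma mem_convexHull_level {s : Set E} {l : E →ₗ[ℝ] ℝ} {M : ℝ} (h : ∀ x ∈ s, l x ≤ M) {x : E}
    (hx : x ∈ convexHull ℝ s) (hM : l x = M) : x ∈ convexHull ℝ {y ∈ s | l y = M} := by
  have key : convexHull ℝ s ⊆ {x | l x < M} ∪ convexHull ℝ {y ∈ s | l y = M} := by
    have hle : ∀ y ∈ convexHull ℝ {y ∈ s | l y = M}, l y ≤ M := fun y hy =>
      convexHull_inter_le (fun z hz => h z hz.1) hy
    apply convexHull_min
    · intro y hy
      rcases (h y hy).lt_or_eq with h1 | h1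
      · exact Or.inl h1
      · exact Or.inr (subset_convexHull ℝ _ ⟨hy, h1⟩)
    · intro a ha b hb α β hα hβ hαβ
      have hla : l a ≤ M := ha.elim (fun h => le_of_lt h) (hle a)
      have hlb : l b ≤ M := hb.elim (fun h => le_of_lt h) (hle b)
      rcases hα.eq_or_lt with rfl | hα'
      · have : β = 1 := by linarith
        subst this; simpa using hb
      rcases hβ.eq_or_lt with rfl | hβ'
      · have : α = 1 := by linarith
        subst this; simpa using ha
      have hM : M = α * M + β * M := by rw [← add_mul, hαβ, one_mul]
      rcases ha with ha | ha
      · left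
        simp only [mem_ofPred_eq, map_add, map_smul, smul_eq_mul] at ha ⊢
        nlinarith
      rcases hb with hb | hb
      · left
        simp only [mem_ofPred_eq, map_add, map_smul, smul_eq_mul] at hb ⊢
        nlinarith
      · exact Or.inr (convex_convexHull ℝ _ ha hb hα hβ hαβ)
  rcases key hx with h1 | h1
  · exact absurd hM (ne_of_lt h1)
  · exact h1

lemma exists_of_isExposed_convexHull {s F : Set E} (hF : IsExposed ℝ (convexHull ℝ s) F)
    (hne : F.Nonempty) : ∃ (l : E →L[ℝ] ℝ) (M : ℝ), (∀ x ∈ s, l x ≤ M) ∧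
      F = convexHull ℝ {x ∈ s | l x = M} := by
  obtain ⟨l, rfl⟩ := hF hne
  obtain ⟨x₀, hx₀, hmax⟩ := hne
  have hs : ∀ x ∈ s, l x ≤ l x₀ := fun x hx => hmax x (subset_convexHull ℝ _ hx)
  refine ⟨l, l x₀, hs, ?_⟩
  ext x
  constructor
  · rintro ⟨hx, hx'⟩
    exact mem_convexHull_level (l := l.toLinearMap) hs hx
      (le_antisymm (hmax x hx) (hx' x₀ hx₀))
  · intro hx
    refine ⟨convexHull_mono (fun y hy => hy.1) hx, fun y hy => ?_⟩
    have h1 : l x₀ ≤ l x := by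
      have := convexHull_inter_le (l := -l.toLinearMap) (M := -l x₀)
        (s := {x ∈ s | l x = l x₀}) (fun z hz => by simp [hz.2]) hx
      simpa using this
    exact (hmax y hy).trans h1

lemma isExposed_convexHull_level {s : Set E} (l : E →L[ℝ] ℝ) {M : ℝ} (h : ∀ x ∈ s, l x ≤ M)
    (hne : ∃ x ∈ s, l x = M) :
    IsExposed ℝ (convexHull ℝ s) (convexHull ℝ {x ∈ s | l x = M}) := by
  intro _
  refine ⟨l, ?_⟩
  obtain ⟨x₀, hx₀, hM⟩ := hne
  ext x
  constructor
  · intro hx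
    refine ⟨convexHull_mono (fun y hy => hy.1) hx, fun y hy => ?_⟩
    have h1 : M ≤ l x := by
      have := convexHull_inter_le (l := -l.toLinearMap) (M := -M)
        (s := {x ∈ s | l x = M}) (fun z hz => by simp [hz.2]) hx
      simpa using this
    exact (convexHull_inter_le (l := l.toLinearMap) h hy).trans h1
  · rintro ⟨hx, hx'⟩
    refine mem_convexHull_level (l := l.toLinearMap) h hx
      (le_antisymm (convexHull_inter_le (l := l.toLinearMap) h hx) ?_)
    have := hx' x₀ (subset_convexHull ℝ _ hx₀)
    rw [hM] at this
    exact this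

lemma vectorSpan_convexHull (s : Set E) : vectorSpan ℝ (convexHull ℝ s) = vectorSpan ℝ s := by
  rw [← direction_affineSpan, ← direction_affineSpan, affineSpan_convexHull]

lemma extremePoints_finite_of_convexHull {s : Set E} (hs : s.Finite) :
    ((convexHull ℝ s).extremePoints ℝ).Finite :=
  hs.subset extremePoints_convexHull_subset

lemma convexHull_extremePoints_of_finite {s : Set E} (hs : s.Finite) :
    convexHull ℝ ((convexHull ℝ s).extremePoints ℝ) = convexHull ℝ s := by
  have h := closure_convexHull_extremePoints (s := convexHull ℝ s)
    (hs.isCompact_convexHull (𝕜 := ℝ)) (convex_convexHull ℝ s)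
  rwa [((extremePoints_finite_of_convexHull hs).isClosed_convexHull ℝ).closure_eq] at h

lemma extremePoints_convexHull_of_sphere {F : Type*} [NormedAddCommGroup F]
    [InnerProductSpace ℝ F] {s : Set F} {c : F} {r : ℝ} (hs : ∀ x ∈ s, dist x c = r) :
    (convexHull ℝ s).extremePoints ℝ = s := by
  refine Set.Subset.antisymm (extremePoints_convexHull_subset (𝕜 := ℝ)) ?_
  intro x hx
  have hsub : convexHull ℝ s ⊆ Metric.closedBall c r :=
    convexHull_min (fun y hy => Metric.mem_closedBall.2 (hs y hy).le) (convex_closedBall c r)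
  by_cases hr : r = 0
  · have hsing : convexHull ℝ s = {x} := by
      apply Set.Subset.antisymm
      · intro y hy
        have h1 := hsub hy
        have h2 := hsub (subset_convexHull ℝ _ hx)
        rw [hr, Metric.closedBall_zero] at h1 h2
        rw [Set.mem_singleton_iff] at *
        rw [h1, h2]
      · simpa using subset_convexHull ℝ _ hx
    rw [hsing]; simp
  · refine inter_extremePoints_subset_extremePoints_of_subset (𝕜 := ℝ) hsub
      ⟨subset_convexHull ℝ _ hx, ?_⟩
    have : ∀ y z, y ∈ Metric.closedBall c r → z ∈ Metric.closedBall c r →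
        x ∈ openSegment ℝ y z → y = x := by
      intro y z hy hz hxyz
      by_contra hne
      have hyz : y ≠ z := by
        rintro rfl
        rw [openSegment_same] at hxyz
        exact hne (Set.mem_singleton_iff.1 hxyz).symm
      have h1 := (strictConvex_closedBall ℝ c r).openSegment_subset hy hz hyz hxyz
      rw [interior_closedBall c hr] at h1
      exact absurd (hs x hx) (ne_of_lt (Metric.mem_ball.1 h1))
    rw [mem_extremePoints_iff_left]
    exact ⟨Metric.mem_closedBall.2 (hs x hx).le, fun y hy z hz h => this y z hy hz h⟩

end Hull

lemma exists_linearIndependent_sub {E : Type*} [AddCommGroup E] [Module ℝ E] {t : Set E}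
    (h : 2 ≤ Module.finrank ℝ (vectorSpan ℝ t)) :
    ∃ x ∈ t, ∃ y ∈ t, ∃ z ∈ t, LinearIndependent ℝ ![y - x, z - x] := by
  have hne : t.Nonempty := by
    by_contra h0
    rw [Set.not_nonempty_iff_eq_empty] at h0
    rw [h0, vectorSpan_empty, finrank_bot] at h
    omega
  obtain ⟨x, hx⟩ := hne
  have hs : vectorSpan ℝ t = Submodule.span ℝ ((· -ᵥ x) '' t) :=
    vectorSpan_eq_span_vsub_set_right ℝ hx
  have hy : ∃ y ∈ t, y - x ≠ 0 := by
    by_contra! h0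
    have : vectorSpan ℝ t = ⊥ := by
      rw [hs, Submodule.span_eq_bot]
      rintro _ ⟨y, hy, rfl⟩
      exact h0 y hy
    rw [this] at h
    simp at h
  obtain ⟨y, hy, hyx⟩ := hy
  have hz : ∃ z ∈ t, ∀ a : ℝ, a • (y - x) ≠ z - x := by
    by_contra! h0
    have hle : vectorSpan ℝ t ≤ Submodule.span ℝ {y - x} := by
      rw [hs, Submodule.span_le]
      rintro _ ⟨z, hz, rfl⟩
      obtain ⟨a, ha⟩ := h0 z hz
      exact Submodule.mem_span_singleton.2 ⟨a, ha⟩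
    have h1 := Submodule.finrank_mono hle
    rw [finrank_span_singleton hyx] at h1
    omega
  obtain ⟨z, hz, hzx⟩ := hz
  exact ⟨x, hx, y, hy, z, hz, (LinearIndependent.pair_iff' hyx).2 hzx⟩

lemma faces_convexHull_finite (k : ℕ) {s : Set E3} (hs : s.Finite) :
    (faces k (convexHull ℝ s)).Finite := by
  refine (hs.finite_subsets.image (fun t => convexHull ℝ t)).subset ?_
  rintro F ⟨h1, h2, -⟩
  obtain ⟨l, M, -, rfl⟩ := exists_of_isExposed_convexHull h1 h2
  exact ⟨_, fun x hx => hx.1, rfl⟩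

/-- In space there are only finitely many points at given distances from three points that are
not collinear. -/
lemma finite_setOf_dist_eq {x y z : E3} (h : LinearIndependent ℝ ![y - x, z - x])
    (a b c : ℝ) : {p : E3 | dist p x = a ∧ dist p y = b ∧ dist p z = c}.Finite := by
  rcases Set.eq_empty_or_nonempty {p : E3 | dist p x = a ∧ dist p y = b ∧ dist p z = c} with h0 | h0
  · rw [h0]; exact Set.finite_empty
  obtain ⟨q, hq1, hq2, hq3⟩ := h0
  set W : Submodule ℝ E3 := Submodule.span ℝ (Set.range ![y - x, z - x]) with hW
  have hWr : Module.finrank ℝ W = 2 := by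
    rw [finrank_span_eq_card h]; simp
  have hperp : Module.finrank ℝ Wᗮ = 1 := by
    have := Submodule.finrank_add_finrank_orthogonal W
    rw [hWr, finrank_euclideanSpace_fin] at this
    omega
  obtain ⟨⟨n, hn⟩, hn0, hspan⟩ := finrank_eq_one_iff'.1 hperp
  have hn0' : n ≠ 0 := fun h => hn0 (Subtype.ext h)
  refine (Set.toFinite {q, q + (-2 * inner ℝ (q - x) n / ‖n‖ ^ 2) • n}).subset ?_
  rintro p ⟨h1, h2, h3⟩
  rw [dist_eq_norm] at *
  have hin : ∀ w : E3, ‖p - w‖ = ‖q - w‖ → inner ℝ (p - q) (w - x) = 0 := by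
    intro w hw
    have e1 : ‖p - w‖ ^ 2 = ‖p - x‖ ^ 2 - 2 * inner ℝ (p - x) (w - x) + ‖w - x‖ ^ 2 := by
      rw [← norm_sub_sq_real]; congr 2; abel
    have e2 : ‖q - w‖ ^ 2 = ‖q - x‖ ^ 2 - 2 * inner ℝ (q - x) (w - x) + ‖w - x‖ ^ 2 := by
      rw [← norm_sub_sq_real]; congr 2; abel
    have e3 : inner ℝ (p - q) (w - x) = inner ℝ (p - x) (w - x) - inner ℝ (q - x) (w - x) := by
      rw [← inner_sub_left]; congr 1; abel
    rw [hw, e2, h1, hq1] at e1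
    rw [e3]; linarith
  have hmem : p - q ∈ Wᗮ := by
    rw [Submodule.mem_orthogonal']
    intro w hw
    refine Submodule.span_induction ?_ (by simp) ?_ ?_ hw
    · rintro _ ⟨i, rfl⟩
      fin_cases i
      · exact hin y (h2.trans hq2.symm)
      · exact hin z (h3.trans hq3.symm)
    · intro u v _ _ hu hv
      rw [inner_add_right, hu, hv, add_zero]
    · intro r u _ hu
      rw [inner_smul_right, hu, mul_zero]
  obtain ⟨t, ht⟩ := hspan ⟨p - q, hmem⟩
  have ht' : p = q + t • n := by
    have := congrArg Subtype.val ht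
    simp only [Submodule.coe_smul] at this
    rw [this]; abel
  have hsq : ‖p - x‖ ^ 2 = ‖q - x‖ ^ 2 + 2 * (t * inner ℝ (q - x) n) + t ^ 2 * ‖n‖ ^ 2 := by
    have : p - x = (q - x) + t • n := by rw [ht']; abel
    rw [this, norm_add_sq_real, inner_smul_right, norm_smul, mul_pow, Real.norm_eq_abs, sq_abs]
  rw [h1, hq1] at hsq
  have hnn : ‖n‖ ^ 2 ≠ 0 := by positivity
  have hfac : t * (2 * inner ℝ (q - x) n + t * ‖n‖ ^ 2) = 0 := by linarith
  rcases mul_eq_zero.1 hfac with h0 | h0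
  · left; rw [ht', h0]; simp
  · right
    have : t = -2 * inner ℝ (q - x) n / ‖n‖ ^ 2 := by
      rw [eq_div_iff hnn]; linarith
    rw [Set.mem_singleton_iff, ht', ← this]

/-! ### Similarities -/

lemma isSimilarity_iff {g : E3 → E3} : IsSimilarity g ↔
    ∃ c : ℝ, 0 < c ∧ ∃ (L : E3 ≃ₗᵢ[ℝ] E3) (t : E3), ∀ x, g x = c • L x + t := by
  constructor
  · rintro ⟨c, hc, f, hf⟩
    refine ⟨c, hc, f.linearIsometryEquiv, c • f 0, fun x => ?_⟩
    have : f x = f.linearIsometryEquiv x + f 0 := by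
      have := f.map_vadd 0 x
      simpa using this
    rw [hf, this, smul_add]
  · rintro ⟨c, hc, L, t, h⟩
    refine ⟨c, hc, L.toAffineIsometryEquiv.trans (AffineIsometryEquiv.constVAdd ℝ E3 (c⁻¹ • t)),
      fun x => ?_⟩
    rw [h]
    simp [smul_smul, hc.ne', add_comm]

lemma IsSimilarity.comp {g g' : E3 → E3} (hg : IsSimilarity g) (hg' : IsSimilarity g') :
    IsSimilarity (g ∘ g') := by
  rw [isSimilarity_iff] at *
  obtain ⟨c, hc, L, t, h⟩ := hg
  obtain ⟨c', hc', L', t', h'⟩ := hg'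
  refine ⟨c * c', mul_pos hc hc', L'.trans L, c • L t' + t, fun x => ?_⟩
  simp only [Function.comp, h, h', map_add, map_smul, smul_add, smul_smul,
    LinearIsometryEquiv.trans_apply, add_assoc]

lemma IsSimilarity.exists_inverse {g : E3 → E3} (hg : IsSimilarity g) :
    ∃ g', IsSimilarity g' ∧ (∀ x, g' (g x) = x) ∧ ∀ x, g (g' x) = x := by
  obtain ⟨c, hc, L, t, h⟩ := isSimilarity_iff.1 hg
  refine ⟨fun y => c⁻¹ • L.symm y + -(c⁻¹ • L.symm t), isSimilarity_iff.2
    ⟨c⁻¹, inv_pos.2 hc, L.symm, _, fun _ => rfl⟩, fun x => ?_, fun x => ?_⟩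
  · simp [h, smul_smul, hc.ne']
  · simp [h, smul_smul, hc.ne']

lemma IsSimilarity.exists_affineMap {g : E3 → E3} (hg : IsSimilarity g) :
    ∃ A : E3 →ᵃ[ℝ] E3, ⇑A = g := by
  obtain ⟨c, hc, L, t, h⟩ := isSimilarity_iff.1 hg
  refine ⟨(c • L.toLinearEquiv.toLinearMap).toAffineMap + AffineMap.const ℝ E3 t, ?_⟩
  ext1 x
  simp [h]

lemma IsSimilarity.injective {g : E3 → E3} (hg : IsSimilarity g) : Injective g := by
  obtain ⟨g', -, h, -⟩ := hg.exists_inverse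
  exact Function.LeftInverse.injective h

lemma IsSimilarity.image_convexHull {g : E3 → E3} (hg : IsSimilarity g) (s : Set E3) :
    g '' convexHull ℝ s = convexHull ℝ (g '' s) := by
  obtain ⟨A, rfl⟩ := hg.exists_affineMap
  exact A.image_convexHull s

lemma IsSimilarity.image_mem_faces {g : E3 → E3} (hg : IsSimilarity g) {k : ℕ} {K F : Set E3}
    (hF : F ∈ faces k K) : g '' F ∈ faces k (g '' K) := by
  obtain ⟨h1, h2, h3⟩ := hF
  refine ⟨fun _ => ?_, h2.image g, ?_⟩
  · obtain ⟨l, rfl⟩ := h1 h2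
    obtain ⟨g', hg', hgg, hgg'⟩ := hg.exists_inverse
    obtain ⟨c, hc, L, t, h⟩ := isSimilarity_iff.1 hg'
    refine ⟨l.comp (L.toContinuousLinearEquiv : E3 →L[ℝ] E3), ?_⟩
    have key : ∀ x y, l x ≤ l y ↔ l (L (g x)) ≤ l (L (g y)) := by
      intro x y
      conv_lhs => rw [← hgg x, ← hgg y, h, h]
      simp only [map_add, map_smul, smul_eq_mul, add_le_add_iff_right]
      exact mul_le_mul_iff_right₀ hc
    ext y
    constructor
    · rintro ⟨x, ⟨hx, hx'⟩, rfl⟩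
      refine ⟨⟨x, hx, rfl⟩, ?_⟩
      rintro _ ⟨z, hz, rfl⟩
      exact (key _ _).1 (hx' z hz)
    · rintro ⟨⟨x, hx, rfl⟩, hx'⟩
      exact ⟨x, ⟨hx, fun z hz => (key _ _).2 (hx' _ ⟨z, hz, rfl⟩)⟩, rfl⟩
  · obtain ⟨c, hc, L, t, h⟩ := isSimilarity_iff.1 hg
    set A : E3 →ₗ[ℝ] E3 := c • L.toLinearEquiv.toLinearMap with hA
    have hAi : Injective A := by
      intro x y hxy
      simp only [hA, LinearMap.smul_apply] at hxy
      exact L.injective (smul_right_injective E3 hc.ne' hxy)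
    have : vectorSpan ℝ (g '' F) = (vectorSpan ℝ F).map A := by
      have h4 : g = ⇑(A.toAffineMap + AffineMap.const ℝ E3 t) := by
        ext1 x; simp [h, hA]
      rw [h4, ← AffineMap.map_vectorSpan]
      simp
    rw [this, ← h3]
    exact ((Submodule.equivMapOfInjective A hAi (vectorSpan ℝ F)).finrank_eq).symm

lemma IsSimilarity.exists_of_mem_faces_image {g : E3 → E3} (hg : IsSimilarity g) {k : ℕ}
    {K F : Set E3} (hF : F ∈ faces k (g '' K)) : ∃ F' ∈ faces k K, F = g '' F' := by
  obtain ⟨g', hg', h1, h2⟩ := hg.exists_inverse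
  have := hg'.image_mem_faces hF
  rw [← image_comp, show g' ∘ g = id from funext h1, Set.image_id] at this
  refine ⟨_, this, ?_⟩
  rw [← image_comp, show g ∘ g' = id from funext h2, Set.image_id]

lemma IsSimilarity.dist_eq {g : E3 → E3} (hg : IsSimilarity g) :
    ∃ c : ℝ, 0 < c ∧ ∀ x y, dist (g x) (g y) = c * dist x y := by
  obtain ⟨c, hc, L, t, h⟩ := isSimilarity_iff.1 hg
  refine ⟨c, hc, fun x y => ?_⟩
  rw [h, h, dist_add_right, dist_smul₀, L.dist_map, Real.norm_of_nonneg hc.le]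

/-! ### Solids that can be attached along a given face -/

/-- The similar copies of the hulls of the members of `P` that have `F` as a facet. -/
def attachable (P : Set (Set E3)) (F : Set E3) : Set (Set E3) :=
  {K | ∃ s ∈ P, ∃ g, IsSimilarity g ∧ K = g '' convexHull ℝ s ∧ F ∈ facets K}

lemma exists_extremePoints_of_mem_facets {s F : Set E3} (hs : s.Finite)
    (hF : F ∈ facets (convexHull ℝ s)) :
    (F.extremePoints ℝ).Finite ∧ F.extremePoints ℝ ⊆ s ∧ ∃ x ∈ F.extremePoints ℝ,
      ∃ y ∈ F.extremePoints ℝ, ∃ z ∈ F.extremePoints ℝ,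
        LinearIndependent ℝ ![y - x, z - x] := by
  obtain ⟨h1, h2, h3⟩ := hF
  obtain ⟨l, M, -, rfl⟩ := exists_of_isExposed_convexHull h1 h2
  have ht : {x ∈ s | l x = M}.Finite := hs.subset fun x hx => hx.1
  refine ⟨extremePoints_finite_of_convexHull ht,
    extremePoints_convexHull_subset.trans fun x hx => hx.1, ?_⟩
  apply exists_linearIndependent_sub
  rw [← vectorSpan_convexHull, convexHull_extremePoints_of_finite ht, h3]

lemma attachable_finite {P : Set (Set E3)} (hP : P.Finite) (hf : ∀ s ∈ P, s.Finite)
    (F : Set E3) : (attachable P F).Finite := by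
  have h1 : attachable P F = ⋃ s ∈ P,
      {K | ∃ g, IsSimilarity g ∧ K = g '' convexHull ℝ s ∧ F ∈ facets K} := by
    ext K; simp only [attachable, mem_iUnion, exists_prop]; rfl
  rw [h1]
  refine hP.biUnion fun s hs => ?_
  rcases Set.eq_empty_or_nonempty
    {K | ∃ g, IsSimilarity g ∧ K = g '' convexHull ℝ s ∧ F ∈ facets K} with h0 | h0
  · rw [h0]; exact Set.finite_empty
  have hsf := hf s hs
  obtain ⟨_, g, hg, rfl, hF⟩ := h0
  rw [hg.image_convexHull] at hF
  obtain ⟨hfin, -, x, hx, y, hy, z, hz, hxyz⟩ :=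
    exists_extremePoints_of_mem_facets (hsf.image g) hF
  set Q : Set E3 := ⋃ a ∈ s, ⋃ b ∈ s, ⋃ c ∈ s, ⋃ d ∈ s,
    {p : E3 | dist p x = dist x y / dist a b * dist d a ∧
      dist p y = dist x y / dist a b * dist d b ∧ dist p z = dist x y / dist a b * dist d c} with hQ
  have hQf : Q.Finite := hsf.biUnion fun a _ => hsf.biUnion fun b _ => hsf.biUnion fun c _ =>
    hsf.biUnion fun d _ => finite_setOf_dist_eq hxyz _ _ _
  refine (hQf.finite_subsets.image fun t => convexHull ℝ t).subset ?_
  rintro _ ⟨g', hg', rfl, hF'⟩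
  rw [hg'.image_convexHull] at hF'
  have hsub := (exists_extremePoints_of_mem_facets (hsf.image g') hF').2.1
  obtain ⟨a, ha, rfl⟩ := hsub hx
  obtain ⟨b, hb, rfl⟩ := hsub hy
  obtain ⟨c, hc, rfl⟩ := hsub hz
  refine ⟨g' '' s, ?_, (hg'.image_convexHull s).symm⟩
  rintro _ ⟨d, hd, rfl⟩
  obtain ⟨r, hr, hdist⟩ := hg'.dist_eq
  have hab : dist a b ≠ 0 := by
    rw [dist_ne_zero]
    rintro rfl
    exact hxyz.ne_zero 0 (by simp)
  simp only [hQ, mem_iUnion]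
  refine ⟨a, ha, b, hb, c, hc, d, hd, ?_⟩
  have : dist (g' a) (g' b) / dist a b = r := by rw [hdist]; field_simp
  rw [this]
  exact ⟨hdist _ _, hdist _ _, hdist _ _⟩

/-! ### Regular polygons, prisms and antiprisms in cylindrical coordinates -/

lemma linearIndependent_sub_of_sphere {E : Type*} [NormedAddCommGroup E] [InnerProductSpace ℝ E]
    {x y z c : E} {r : ℝ} (hx : dist x c = r) (hy : dist y c = r) (hz : dist z c = r)
    (hxy : x ≠ y) (hxz : x ≠ z) (hyz : y ≠ z) : LinearIndependent ℝ ![y - x, z - x] := by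
  have hyx : y - x ≠ 0 := sub_ne_zero.2 hxy.symm
  rw [LinearIndependent.pair_iff' hyx]
  intro a ha
  rw [dist_eq_norm] at hx hy hz
  have e1 : y - c = (x - c) + (y - x) := by abel
  have e2 : z - c = (x - c) + a • (y - x) := by rw [ha]; abel
  have f1 := norm_add_sq_real (x - c) (y - x)
  have f2 := norm_add_sq_real (x - c) (a • (y - x))
  rw [← e1, hy, hx] at f1
  rw [← e2, hz, hx, inner_smul_right, norm_smul, mul_pow, Real.norm_eq_abs, sq_abs] at f2
  have hpos : 0 < ‖y - x‖ ^ 2 := by positivity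
  have f3 : 2 * inner ℝ (x - c) (y - x) = -‖y - x‖ ^ 2 := by linarith
  have : a * (a - 1) * ‖y - x‖ ^ 2 = 0 := by linear_combination -a * f3 - f2
  rcases mul_eq_zero.1 this with h | h
  · rcases mul_eq_zero.1 h with h | h
    · rw [h, zero_smul] at ha
      exact hxz (sub_eq_zero.1 ha.symm).symm
    · rw [sub_eq_zero.1 h, one_smul] at ha
      exact hyz (sub_left_injective ha)
  · exact hpos.ne' h

lemma two_le_finrank_vectorSpan {t : Set E3} {x y z : E3} (hx : x ∈ t) (hy : y ∈ t) (hz : z ∈ t)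
    (h : LinearIndependent ℝ ![y - x, z - x]) : 2 ≤ Module.finrank ℝ (vectorSpan ℝ t) := by
  have hle : Submodule.span ℝ (Set.range ![y - x, z - x]) ≤ vectorSpan ℝ t := by
    rw [Submodule.span_le]
    rintro _ ⟨i, rfl⟩
    fin_cases i
    exacts [vsub_mem_vectorSpan ℝ hy hx, vsub_mem_vectorSpan ℝ hz hx]
  have h1 := Submodule.finrank_mono hle
  rw [finrank_span_eq_card h] at h1
  simpa using h1

lemma finrank_vectorSpan_eq_two {t : Set E3} {x y z : E3} (hx : x ∈ t) (hy : y ∈ t) (hz : z ∈ t)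
    (h : LinearIndependent ℝ ![y - x, z - x]) {l : E3 →ₗ[ℝ] ℝ} (hl : l ≠ 0) {M : ℝ}
    (hM : ∀ w ∈ t, l w = M) : Module.finrank ℝ (vectorSpan ℝ t) = 2 := by
  refine le_antisymm ?_ (two_le_finrank_vectorSpan hx hy hz h)
  have hle : vectorSpan ℝ t ≤ LinearMap.ker l := by
    rw [vectorSpan_def, Submodule.span_le]
    rintro _ ⟨a, ha, b, hb, rfl⟩
    simp [hM a ha, hM b hb]
  have h1 := Submodule.finrank_mono hle
  have h2 := Module.Dual.finrank_ker_add_one_of_ne_zero (f := l) hl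
  rw [finrank_euclideanSpace_fin] at h2
  omega

variable (c : E3) (b : OrthonormalBasis (Fin 3) ℝ E3)

lemma norm_sq_frame (x y z : ℝ) : ‖x • b 0 + y • b 1 + z • b 2‖ ^ 2 = x ^ 2 + y ^ 2 + z ^ 2 := by
  have h := orthonormal_iff_ite.1 b.orthonormal
  rw [← real_inner_self_eq_norm_sq]
  simp only [inner_add_left, inner_add_right, inner_smul_left, inner_smul_right, h]
  simp
  ring

lemma inner_frame (x y z x' y' z' : ℝ) :
    inner ℝ (x • b 0 + y • b 1 + z • b 2) (x' • b 0 + y' • b 1 + z' • b 2) =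
      x * x' + y * y' + z * z' := by
  have h := orthonormal_iff_ite.1 b.orthonormal
  simp only [inner_add_left, inner_add_right, inner_smul_left, inner_smul_right, h]
  simp
  ring

lemma dist_cylPoint_sq (R z t z' t' : ℝ) :
    dist (cylPoint c b R z t) (cylPoint c b R z' t') ^ 2 =
      R ^ 2 * (2 - 2 * cos (t - t')) + (z - z') ^ 2 := by
  have : cylPoint c b R z t - cylPoint c b R z' t' =
      (R * cos t - R * cos t') • b 0 + (R * sin t - R * sin t') • b 1 +
        (z - z') • b 2 := by
    simp only [cylPoint, sub_smul]; abel
  rw [dist_eq_norm, this, norm_sq_frame, cos_sub]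
  nlinarith [sin_sq_add_cos_sq t, sin_sq_add_cos_sq t']

lemma dist_cylPoint_center (R z t : ℝ) :
    dist (cylPoint c b R z t) c = √(R ^ 2 + z ^ 2) := by
  have : cylPoint c b R z t - c =
      (R * cos t) • b 0 + (R * sin t) • b 1 + z • b 2 := by
    simp only [cylPoint]; abel
  rw [eq_comm, Real.sqrt_eq_iff_mul_self_eq (by positivity) dist_nonneg, ← sq, dist_eq_norm, this,
    norm_sq_frame]
  nlinarith [sin_sq_add_cos_sq t]

lemma inner_cylPoint (R z t A m B : ℝ) :
    inner ℝ ((A * cos m) • b 0 + (A * sin m) • b 1 + B • b 2) (cylPoint c b R z t) =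
      inner ℝ ((A * cos m) • b 0 + (A * sin m) • b 1 + B • b 2) c +
        (A * R * cos (t - m) + B * z) := by
  have : cylPoint c b R z t = c +
      ((R * cos t) • b 0 + (R * sin t) • b 1 + z • b 2) := by
    simp only [cylPoint]; abel
  rw [this, inner_add_right, inner_frame, cos_sub]
  ring

lemma cylPoint_periodic (R z t : ℝ) (m : ℤ) :
    cylPoint c b R z (t + m * (2 * π)) = cylPoint c b R z t := by
  simp only [cylPoint, cos_add_int_mul_two_pi, sin_add_int_mul_two_pi]

lemma range_cylPoint_int {n : ℕ} (hn : n ≠ 0) (R z a : ℝ) :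
    (Set.range fun k : Fin n => cylPoint c b R z (2 * π * (k : ℕ) / n + a)) =
      Set.range fun k : ℤ => cylPoint c b R z (2 * π * k / n + a) := by
  have hn' : (n : ℝ) ≠ 0 := by exact_mod_cast hn
  ext x
  constructor
  · rintro ⟨k, rfl⟩
    exact ⟨(k : ℕ), by simp⟩
  · rintro ⟨k, rfl⟩
    have h1 := Int.emod_nonneg k (b := n) (by exact_mod_cast hn)
    have h2 := Int.emod_lt_of_pos k (b := n) (by omega)
    refine ⟨⟨(k % n).toNat, by omega⟩, ?_⟩
    dsimp only
    rw [← cylPoint_periodic c b R z _ (k / n)]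
    congr 1
    have h3 : (((k % n).toNat : ℕ) : ℝ) = k - n * ((k / n : ℤ) : ℝ) := by
      have h4 : (((k % n).toNat : ℕ) : ℤ) = k - n * (k / n) := by
        rw [Int.toNat_of_nonneg h1, Int.emod_def]
      exact_mod_cast congrArg (Int.cast : ℤ → ℝ) h4
    rw [h3]
    field_simp
    ring

lemma cylPoint_injective {n : ℕ} {R : ℝ} (hR : 0 < R) (z a : ℝ) :
    Injective fun k : Fin n => cylPoint c b R z (2 * π * (k : ℕ) / n + a) := by
  intro k k' h
  have hn : (n : ℝ) ≠ 0 := by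
    have := k.pos
    exact_mod_cast this.ne'
  have h1 := dist_cylPoint_sq c b R z (2 * π * (k : ℕ) / n + a) z
    (2 * π * (k' : ℕ) / n + a)
  dsimp only at h
  rw [h, dist_self] at h1
  have h2 : cos (2 * π * (k : ℕ) / n + a - (2 * π * (k' : ℕ) / n + a)) = 1 := by
    have : R ^ 2 ≠ 0 := by positivity
    have h3 : R ^ 2 * (2 - 2 * cos (2 * π * (k : ℕ) / n + a -
      (2 * π * (k' : ℕ) / n + a))) = 0 := by linarith
    have := (mul_eq_zero.1 h3).resolve_left this
    linarith
  obtain ⟨m, hm⟩ := (cos_eq_one_iff _).1 h2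
  have hpi := pi_ne_zero
  have h4 : (m : ℝ) * n = (k : ℕ) - (k' : ℕ) := by
    field_simp at hm
    have h5 : π * 2 * (m * n - ((k : ℕ) - (k' : ℕ))) = 0 := by linear_combination hm
    have := (mul_eq_zero.1 h5).resolve_left (by positivity)
    linarith
  have h5 : m * n = ((k : ℕ) : ℤ) - ((k' : ℕ) : ℤ) := by exact_mod_cast h4
  have hk := k.2
  have hk' := k'.2
  have h6 : m = 0 := by
    by_contra h0
    have : (n : ℤ) ≤ |m * n| := by
      rw [abs_mul, Nat.abs_cast]
      nlinarith [Int.one_le_abs h0]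
    rw [h5] at this
    have := abs_lt.2 (show -(n : ℤ) < ((k : ℕ) : ℤ) - ((k' : ℕ) : ℤ) ∧
      ((k : ℕ) : ℤ) - ((k' : ℕ) : ℤ) < n by omega)
    omega
  rw [h6] at h5
  ext
  omega

lemma extremePoints_regularPolygon {n : ℕ} (R z a : ℝ) :
    (convexHull ℝ (Set.range fun k : Fin n =>
      cylPoint c b R z (2 * π * (k : ℕ) / n + a))).extremePoints ℝ =
      Set.range fun k : Fin n => cylPoint c b R z (2 * π * (k : ℕ) / n + a) := by
  apply extremePoints_convexHull_of_sphere
  rintro _ ⟨k, rfl⟩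
  exact dist_cylPoint_center c b R z _

lemma IsRegularPolygon.ncard_extremePoints {n : ℕ} {T : Set E3} (h : IsRegularPolygon n T) :
    (T.extremePoints ℝ).ncard = n := by
  obtain ⟨-, c, b, R, hR, rfl⟩ := h
  have h1 := extremePoints_regularPolygon c b (n := n) R 0 0
  have h2 := cylPoint_injective c b (n := n) hR 0 0
  simp only [add_zero] at h1 h2
  rw [h1, ← Set.image_univ, Set.ncard_image_of_injective _ h2, Set.ncard_univ, Nat.card_fin]

lemma cos_two_pi_div_three : cos (2 * π / 3) = -1 / 2 := by
  rw [show 2 * π / 3 = π - π / 3 by ring, cos_pi_sub, cos_pi_div_three]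
  ring

lemma cos_four_pi_div_three : cos (4 * π / 3) = -1 / 2 := by
  rw [show 4 * π / 3 = π / 3 + π by ring, cos_add_pi,
    cos_pi_div_three]
  ring

lemma IsRegularPolygon.dist_sq_three {T : Set E3} (h : IsRegularPolygon 3 T) :
    ∃ d : ℝ, ∀ x ∈ T.extremePoints ℝ, ∀ y ∈ T.extremePoints ℝ, x ≠ y → dist x y ^ 2 = d := by
  obtain ⟨-, c, b, R, hR, rfl⟩ := h
  have h1 := extremePoints_regularPolygon c b (n := 3) R 0 0
  simp only [add_zero] at h1
  rw [h1]
  refine ⟨3 * R ^ 2, ?_⟩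
  rintro _ ⟨i, rfl⟩ _ ⟨j, rfl⟩ hij
  have hij' : i ≠ j := fun h => hij (by rw [h])
  dsimp only
  rw [dist_cylPoint_sq]
  have key : cos (2 * π * (i : ℕ) / (3 : ℕ) - 2 * π * (j : ℕ) / (3 : ℕ)) =
      -1 / 2 := by
    have e : ∀ x : ℝ, x = 2 * π / 3 ∨ x = -(2 * π / 3) ∨ x = 4 * π / 3 ∨
        x = -(4 * π / 3) → cos x = -1 / 2 := by
      rintro x (rfl | rfl | rfl | rfl) <;>
        simp only [cos_neg, cos_two_pi_div_three, cos_four_pi_div_three]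
    apply e
    fin_cases i <;> fin_cases j <;> first
      | exact absurd rfl hij'
      | (left; push_cast; ring1)
      | (right; left; push_cast; ring1)
      | (right; right; left; push_cast; ring1)
      | (right; right; right; push_cast; ring1)
  rw [key]; ring

lemma IsRegularPolygon.dist_sq_four {T : Set E3} (h : IsRegularPolygon 4 T) :
    ∃ d : ℝ, 0 < d ∧ ∀ x ∈ T.extremePoints ℝ, ∀ y ∈ T.extremePoints ℝ, x ≠ y →
      dist x y ^ 2 = d ∨ dist x y ^ 2 = 2 * d := by
  obtain ⟨-, c, b, R, hR, rfl⟩ := h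
  have h1 := extremePoints_regularPolygon c b (n := 4) R 0 0
  simp only [add_zero] at h1
  rw [h1]
  refine ⟨2 * R ^ 2, by positivity, ?_⟩
  rintro _ ⟨i, rfl⟩ _ ⟨j, rfl⟩ hij
  have hij' : i ≠ j := fun h => hij (by rw [h])
  dsimp only
  rw [dist_cylPoint_sq]
  have key : cos (2 * π * (i : ℕ) / (4 : ℕ) - 2 * π * (j : ℕ) / (4 : ℕ)) = 0 ∨
      cos (2 * π * (i : ℕ) / (4 : ℕ) - 2 * π * (j : ℕ) / (4 : ℕ)) = -1 := by
    have e : ∀ x : ℝ, x = π / 2 ∨ x = -(π / 2) ∨ x = π / 2 + π ∨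
        x = -(π / 2 + π) ∨ x = π ∨ x = -π →
          cos x = 0 ∨ cos x = -1 := by
      rintro x (rfl | rfl | rfl | rfl | rfl | rfl) <;>
        simp only [cos_neg, cos_add_pi, cos_pi_div_two, cos_pi] <;> simp
    apply e
    fin_cases i <;> fin_cases j <;> first
      | exact absurd rfl hij'
      | (left; push_cast; ring1)
      | (right; left; push_cast; ring1)
      | (right; right; left; push_cast; ring1)
      | (right; right; right; left; push_cast; ring1)
      | (right; right; right; right; left; push_cast; ring1)
      | (right; right; right; right; right; push_cast; ring1)
  rcases key with key | key
  · left; rw [key]; ring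
  · right; rw [key]; ring

/-- Among the odd multiples of `π / n`, those next to `0` modulo `2 π` have the largest cosine. -/
lemma cos_odd_mul_le {n : ℕ} (hn : 0 < n) (i : ℤ) :
    cos ((2 * i - 1) * (π / n)) ≤ cos (π / n) ∧
      (cos ((2 * i - 1) * (π / n)) = cos (π / n) →
        (n : ℤ) ∣ i ∨ (n : ℤ) ∣ i - 1) := by
  have hn' : (0 : ℝ) < n := by exact_mod_cast hn
  have hpi := pi_pos
  set j : ℤ := i % n with hj
  have hj0 : 0 ≤ j := Int.emod_nonneg _ (by omega)
  have hjn : j < n := Int.emod_lt_of_pos _ (by omega)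
  have hij : i = n * (i / n) + j := (Int.mul_ediv_add_emod i n).symm
  have hdvd : j = 0 → (n : ℤ) ∣ i := fun h => Int.dvd_of_emod_eq_zero h
  clear_value j
  clear hj
  set r : ℤ := |2 * j - 1| with hr
  have hcos : cos ((2 * i - 1) * (π / n)) = cos (r * (π / n)) := by
    have e1 : ((2 * i - 1 : ℤ) : ℝ) * (π / n) =
        ((2 * j - 1 : ℤ) : ℝ) * (π / n) + ((i / n : ℤ) : ℝ) * (2 * π) := by
      have : (i : ℝ) = n * ((i / n : ℤ) : ℝ) + j := by exact_mod_cast hij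
      push_cast
      rw [this]
      field_simp
      ring
    have e2 : ((2 * i - 1 : ℤ) : ℝ) = 2 * (i : ℝ) - 1 := by push_cast; ring
    rw [← e2, e1, cos_add_int_mul_two_pi, hr, Int.cast_abs]
    rw [← cos_abs, abs_mul, abs_of_pos (show 0 < π / n by positivity)]
  -- fold `(n, 2 n)` onto `(0, n)`
  set r' : ℤ := if r ≤ n then r else 2 * n - r with hr'
  have hcos' : cos (r * (π / n)) = cos (r' * (π / n)) := by
    rw [hr']
    split_ifs with h
    · rfl
    · push_cast
      rw [show (2 * (n : ℝ) - r) * (π / n) = 2 * π - r * (π / n) by field_simp,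
        cos_two_pi_sub]
  have hr1 : 1 ≤ r' ∧ r' ≤ n := by
    have : r = 2 * j - 1 ∨ (r = 1 ∧ j = 0) := by
      rcases abs_cases (2 * j - 1) with h | h <;> rw [← hr] at h <;> omega
    have h0 : 0 ≤ r := abs_nonneg _
    rw [hr']
    split_ifs <;> omega
  have ha : (1 : ℝ) ≤ r' := by exact_mod_cast hr1.1
  have hb : (r' : ℝ) ≤ n := by exact_mod_cast hr1.2
  have hc1 : π / n ≤ r' * (π / n) := le_mul_of_one_le_left (by positivity) ha
  have hc2 : r' * (π / n) ≤ π := by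
    calc r' * (π / n) ≤ n * (π / n) := by gcongr
      _ = π := by field_simp
  rw [hcos, hcos']
  refine ⟨cos_le_cos_of_nonneg_of_le_pi (by positivity) hc2 hc1, fun heq => ?_⟩
  have h1 := Real.injOn_cos ⟨by positivity, hc2⟩ ⟨by positivity, hc1.trans hc2⟩ heq
  have h2 : r' = 1 := by
    have : (r' - 1 : ℝ) * (π / n) = 0 := by linarith
    have h3 := (mul_eq_zero.1 this).resolve_right (by positivity)
    have : (r' : ℝ) = 1 := by linarith
    exact_mod_cast this
  have h3 : j = 0 ∨ j = 1 := by
    have : r = 2 * j - 1 ∨ (r = 1 ∧ j = 0) := by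
      rcases abs_cases (2 * j - 1) with h | h <;> rw [← hr] at h <;> omega
    have h0 : 0 ≤ r := abs_nonneg _
    rw [hr'] at h2
    split_ifs at h2 <;> omega
  rcases h3 with h3 | h3
  · left; exact hdvd h3
  · right; exact ⟨i / n, by linarith⟩

abbrev level (V : Set E3) (w : E3) (m : ℝ) : Set E3 := {x ∈ V | inner ℝ w x = m}

/-- A supporting plane through three points of a finite set of points on a sphere cuts out
a facet of their hull. -/
lemma level_mem_facets {V : Set E3} {o w : E3} {r M : ℝ} (hV : ∀ x ∈ V, dist x o = r)
    (hw : w ≠ 0) (hM : ∀ x ∈ V, inner ℝ w x ≤ M) {x y z : E3} (hx : x ∈ V) (hy : y ∈ V)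
    (hz : z ∈ V) (hxM : inner ℝ w x = M) (hyM : inner ℝ w y = M) (hzM : inner ℝ w z = M)
    (hxy : x ≠ y) (hxz : x ≠ z) (hyz : y ≠ z) :
    convexHull ℝ (level V w M) ∈ facets (convexHull ℝ V) := by
  refine ⟨isExposed_convexHull_level (innerSL ℝ w) hM ⟨x, hx, hxM⟩,
    ⟨x, subset_convexHull ℝ _ ⟨hx, hxM⟩⟩, ?_⟩
  rw [vectorSpan_convexHull]
  refine finrank_vectorSpan_eq_two (x := x) (y := y) (z := z) ⟨hx, hxM⟩ ⟨hy, hyM⟩ ⟨hz, hzM⟩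
    (linearIndependent_sub_of_sphere (hV x hx) (hV y hy) (hV z hz) hxy hxz hyz)
    (l := (innerSL ℝ w).toLinearMap) ?_ (M := M) fun v hv => hv.2
  intro h0
  have := congrArg (fun l => l w) h0
  simp at this
  exact hw this

lemma exists_ne_ne_of_three {α : Type*} {G : ℤ → α} (h01 : G 0 ≠ G 1) (h02 : G 0 ≠ G 2)
    (h12 : G 1 ≠ G 2) (A B : α) : ∃ j, G j ≠ A ∧ G j ≠ B := by
  by_contra! h
  grind +splitImp [h 0, h 1, h 2]

/-- Sets indexed cyclically modulo `n` that contain consecutive points only are distinct. -/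
lemma exists_lateral_ne {E : Type*} {n : ℕ} (hn : 3 ≤ n) {T : ℤ → E} {X : ℤ → Set E}
    {G : ℤ → Set E} (h1 : ∀ j, T j ∈ X j) (h2 : ∀ j, T (j + 1) ∈ X j)
    (h3 : ∀ j k, T k ∈ X j → (n : ℤ) ∣ k - j ∨ (n : ℤ) ∣ k - j - 1)
    (hG : ∀ i j, G i = G j → X i = X j) (A B : Set E) : ∃ j, G j ≠ A ∧ G j ≠ B := by
  have small (d : ℤ) (hd : d ≠ 0 ∧ -3 < d ∧ d < 3) : ¬ (n : ℤ) ∣ d := by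
    intro h
    have := Int.le_of_dvd (abs_pos.2 hd.1) ((dvd_abs _ _).2 h)
    have : |d| < 3 := abs_lt.2 hd.2
    omega
  have key : ∀ i j : ℤ, (i = 0 ∧ j = 1) ∨ (i = 0 ∧ j = 2) ∨ (i = 1 ∧ j = 2) → G i ≠ G j := by
    intro i j hij h
    have hX := hG i j h
    have e2 := h3 i j (hX ▸ h1 j)
    have e3 := h3 i (j + 1) (hX ▸ h2 j)
    rcases hij with ⟨rfl, rfl⟩ | ⟨rfl, rfl⟩ | ⟨rfl, rfl⟩
    · exact e3.elim (small _ (by norm_num)) (small _ (by norm_num))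
    · exact e2.elim (small _ (by norm_num)) (small _ (by norm_num))
    · exact e3.elim (small _ (by norm_num)) (small _ (by norm_num))
  exact exists_ne_ne_of_three (key 0 1 (by simp)) (key 0 2 (by simp)) (key 1 2 (by simp)) A B

/-- The vertices, in cylindrical coordinates, of a prism (`a = 0`) or an antiprism
(`a = π / n`). -/
def drumPoints (c : E3) (b : OrthonormalBasis (Fin 3) ℝ E3) (n : ℕ) (R h a : ℝ) : Set E3 :=
  (Set.range fun k : Fin n => cylPoint c b R h (2 * π * (k : ℕ) / n)) ∪
    (Set.range fun k : Fin n => cylPoint c b R (-h) (2 * π * (k : ℕ) / n + a))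

lemma drumPoints_finite (c : E3) (b : OrthonormalBasis (Fin 3) ℝ E3) (n : ℕ) (R h a : ℝ) :
    (drumPoints c b n R h a).Finite := (Set.finite_range _).union (Set.finite_range _)

section Drum

variable {c : E3} {b : OrthonormalBasis (Fin 3) ℝ E3} {n : ℕ} {R h : ℝ}

lemma dist_of_mem_drumPoints {a : ℝ} {x : E3} (hx : x ∈ drumPoints c b n R h a) :
    dist x c = √(R ^ 2 + h ^ 2) := by
  rcases hx with ⟨k, rfl⟩ | ⟨k, rfl⟩
  · exact dist_cylPoint_center c b R h _
  · have := dist_cylPoint_center c b R (-h) (2 * π * (k : ℕ) / n + a)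
    rwa [neg_sq] at this

lemma mem_drumPoints {a : ℝ} (hn : n ≠ 0) {x : E3} : x ∈ drumPoints c b n R h a ↔
    (∃ k : ℤ, x = cylPoint c b R h (2 * π * k / n)) ∨
      ∃ k : ℤ, x = cylPoint c b R (-h) (2 * π * k / n + a) := by
  have h1 := range_cylPoint_int c b hn R h 0
  have h2 := range_cylPoint_int c b hn R (-h) a
  simp only [add_zero] at h1
  rw [drumPoints, h1, h2]
  simp only [Set.mem_union, Set.mem_range, eq_comm]

lemma cylPoint_congr {k j : ℤ} (hn : n ≠ 0) (hd : (n : ℤ) ∣ k - j) (z a : ℝ) :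
    cylPoint c b R z (2 * π * k / n + a) = cylPoint c b R z (2 * π * j / n + a) := by
  obtain ⟨m, hm⟩ := hd
  have hk : (k : ℝ) = j + n * m := by
    have : k = j + n * m := by omega
    exact_mod_cast this
  have hn' : (n : ℝ) ≠ 0 := by exact_mod_cast hn
  rw [← cylPoint_periodic c b R z (2 * π * j / n + a) m, hk]
  congr 1
  field_simp
  ring

lemma cos_lt_one_of_three_le (hn : 3 ≤ n) : cos (2 * π / n) < cos (π / n) ∧
    cos (π / n) < 1 := by
  have hn' : (3 : ℝ) ≤ n := by exact_mod_cast hn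
  have hpi := pi_pos
  have h1 : 2 * π / n ≤ π := by
    rw [div_le_iff₀ (by linarith)]
    nlinarith
  have h2 : 0 < π / n := by positivity
  have h3 : π / n < 2 * π / n := by
    rw [mul_div_assoc]; linarith
  refine ⟨cos_lt_cos_of_nonneg_of_le_pi h2.le h1 h3, ?_⟩
  have := cos_lt_cos_of_nonneg_of_le_pi le_rfl (h3.le.trans h1) h2
  rwa [cos_zero] at this

lemma base_mem_facets (hn : 3 ≤ n) (hR : 0 < R) (hh : 0 < h) (a : ℝ) :
    ∃ F ∈ facets (convexHull ℝ (drumPoints c b n R h a)), IsRegularPolygon n F := by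
  have horth := orthonormal_iff_ite.1 b.orthonormal
  have hw : ∀ z t, inner ℝ (b 2) (cylPoint c b R z t) = inner ℝ (b 2) c + z := by
    intro z t
    have := inner_cylPoint c b R z t 0 0 1
    simpa using this
  have hinj := cylPoint_injective c b (n := n) hR h 0
  simp only [add_zero] at hinj
  have hlev : level (drumPoints c b n R h a) (b 2) (inner ℝ (b 2) c + h) =
      Set.range fun k : Fin n => cylPoint c b R h (2 * π * (k : ℕ) / n) := by
    ext x
    constructor
    · rintro ⟨hx | ⟨k, rfl⟩, h2⟩
      · exact hx
      · simp only [hw] at h2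
        linarith
    · rintro ⟨k, rfl⟩
      exact ⟨Or.inl ⟨k, rfl⟩, hw _ _⟩
  refine ⟨_, level_mem_facets (V := drumPoints c b n R h a) (w := b 2)
    (M := inner ℝ (b 2) c + h) (fun x hx => dist_of_mem_drumPoints hx) (b.orthonormal.ne_zero 2) ?_
    (x := cylPoint c b R h (2 * π * ((⟨0, by omega⟩ : Fin n) : ℕ) / n))
    (y := cylPoint c b R h (2 * π * ((⟨1, by omega⟩ : Fin n) : ℕ) / n))
    (z := cylPoint c b R h (2 * π * ((⟨2, by omega⟩ : Fin n) : ℕ) / n))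
    (Or.inl ⟨_, rfl⟩) (Or.inl ⟨_, rfl⟩) (Or.inl ⟨_, rfl⟩) (hw _ _) (hw _ _) (hw _ _)
    (fun h => by simpa using hinj h) (fun h => by simpa using hinj h)
    (fun h => by simpa using hinj h), ?_⟩
  · rintro x (⟨k, rfl⟩ | ⟨k, rfl⟩)
    · rw [hw]
    · rw [hw]; linarith
  · rw [hlev]
    refine ⟨hn, c + h • b 2, b, R, hR, ?_⟩
    congr 2
    ext1 k
    simp only [cylPoint]
    module

variable (b n) in
/-- A normal vector of the lateral facet over the `j`-th side of the upper base. -/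
noncomputable def lateralNormal (A B : ℝ) (j : ℤ) : E3 :=
  (A * cos ((2 * j + 1) * (π / n))) • b 0 +
    (A * sin ((2 * j + 1) * (π / n))) • b 1 + B • b 2

lemma lateralNormal_ne_zero {A B : ℝ} (hA : A ≠ 0) (j : ℤ) : lateralNormal b n A B j ≠ 0 := by
  intro h0
  have h1 := norm_sq_frame b (A * cos ((2 * j + 1) * (π / n)))
    (A * sin ((2 * j + 1) * (π / n))) B
  rw [lateralNormal] at h0
  rw [h0, norm_zero] at h1
  have : 0 < A ^ 2 := by positivity
  nlinarith [sin_sq_add_cos_sq ((2 * j + 1) * (π / n)), sq_nonneg B]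

lemma inner_lateralNormal (hn : 3 ≤ n) (A B z : ℝ) (j k : ℤ) :
    inner ℝ (lateralNormal b n A B j) (cylPoint c b R z (2 * π * k / n)) =
      inner ℝ (lateralNormal b n A B j) c +
        (A * R * cos ((2 * (k - j : ℤ) - 1) * (π / n)) + B * z) := by
  have hn' : (n : ℝ) ≠ 0 := by positivity
  refine (inner_cylPoint c b R z _ A _ B).trans ?_
  rw [lateralNormal]
  congr 4
  push_cast
  field_simp
  ring

lemma inner_lateralNormal_le (hn : 3 ≤ n) {A : ℝ} (hA : 0 < A * R) (B z : ℝ) (j k : ℤ) :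
    inner ℝ (lateralNormal b n A B j) (cylPoint c b R z (2 * π * k / n)) ≤
      inner ℝ (lateralNormal b n A B j) c + (A * R * cos (π / n) + B * z) := by
  rw [inner_lateralNormal hn]
  gcongr
  exact (cos_odd_mul_le (by omega) (k - j)).1

lemma dvd_of_inner_lateralNormal_eq (hn : 3 ≤ n) {A : ℝ} (hA : 0 < A * R) {B z : ℝ} {j k : ℤ}
    (h : inner ℝ (lateralNormal b n A B j) (cylPoint c b R z (2 * π * k / n)) =
      inner ℝ (lateralNormal b n A B j) c + (A * R * cos (π / n) + B * z)) :
    (n : ℤ) ∣ k - j ∨ (n : ℤ) ∣ k - j - 1 := by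
  rw [inner_lateralNormal hn, add_right_inj, add_left_inj] at h
  exact (cos_odd_mul_le (by omega) (k - j)).2 (mul_left_cancel₀ hA.ne' h)

lemma inner_lateralNormal_eq (hn : 3 ≤ n) (A B z : ℝ) {j k : ℤ} (hk : k = j ∨ k = j + 1) :
    inner ℝ (lateralNormal b n A B j) (cylPoint c b R z (2 * π * k / n)) =
      inner ℝ (lateralNormal b n A B j) c + (A * R * cos (π / n) + B * z) := by
  rw [inner_lateralNormal hn]
  rcases hk with rfl | rfl
  · rw [← cos_neg (π / n)]; norm_num
  · norm_num

lemma cylPoint_eq_of_dvd (hn : 3 ≤ n) {k j : ℤ} (z : ℝ)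
    (h : (n : ℤ) ∣ k - j ∨ (n : ℤ) ∣ k - j - 1) :
    cylPoint c b R z (2 * π * k / n) = cylPoint c b R z (2 * π * j / n) ∨
      cylPoint c b R z (2 * π * k / n) =
        cylPoint c b R z (2 * π * ((j + 1 : ℤ) : ℝ) / n) := by
  rw [sub_sub] at h
  refine h.imp (fun h => ?_) fun h => ?_ <;>
    simpa using cylPoint_congr (c := c) (b := b) (R := R) (by omega) h z 0

lemma ne_of_dist_sq {x y : E3} {d : ℝ} (hd : dist x y ^ 2 = d) (h0 : 0 < d) : x ≠ y := by
  rintro rfl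
  rw [dist_self] at hd
  norm_num at hd
  exact h0.ne hd

lemma exists_lateral (hn : 3 ≤ n) {V : Set E3} {o : E3} {r : ℝ} (hV : ∀ x ∈ V, dist x o = r)
    {w T B : ℤ → E3} {M : ℤ → ℝ} (hw : ∀ j, w j ≠ 0) (hle : ∀ j, ∀ x ∈ V, inner ℝ (w j) x ≤ M j)
    (h1 : ∀ j, T j ∈ level V (w j) (M j))
    (h2 : ∀ j, T (j + 1) ∈ level V (w j) (M j))
    (h3 : ∀ j, B j ∈ level V (w j) (M j)) (n1 : ∀ j, T j ≠ T (j + 1))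
    (n2 : ∀ j, T j ≠ B j) (n3 : ∀ j, T (j + 1) ≠ B j)
    (hdvd : ∀ j k, inner ℝ (w j) (T k) = M j → (n : ℤ) ∣ k - j ∨ (n : ℤ) ∣ k - j - 1)
    {C₁ C₂ : Set E3} {p : ℕ}
    (hreg : ∀ F ∈ facets (convexHull ℝ V), F ≠ C₁ → F ≠ C₂ → IsRegularPolygon p F) :
    ∃ j, IsRegularPolygon p (convexHull ℝ (level V (w j) (M j))) ∧
      (convexHull ℝ (level V (w j) (M j))).extremePoints ℝ =
        level V (w j) (M j) := by
  have hext : ∀ j, (convexHull ℝ (level V (w j) (M j))).extremePoints ℝ =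
      level V (w j) (M j) := fun j =>
    extremePoints_convexHull_of_sphere fun x hx => hV x hx.1
  obtain ⟨j, hj1, hj2⟩ := exists_lateral_ne (T := T)
    (X := fun j => level V (w j) (M j))
    (G := fun j => convexHull ℝ (level V (w j) (M j))) hn h1 h2
    (fun j k hk => hdvd j k hk.2)
    (fun i j hij => by
      have := congrArg (fun K => K.extremePoints ℝ) hij
      simpa only [hext] using this) C₁ C₂
  exact ⟨j, hreg _ (level_mem_facets hV (hw j) (hle j) (h1 j).1 (h2 j).1 (h3 j).1 (h1 j).2 (h2 j).2
    (h3 j).2 (n1 j) (n2 j) (n3 j)) hj1 hj2, hext j⟩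

lemma dist_side_sq (c : E3) (b : OrthonormalBasis (Fin 3) ℝ E3) (n : ℕ) (R z : ℝ) (j : ℤ) :
    dist (cylPoint c b R z (2 * π * j / n))
      (cylPoint c b R z (2 * π * ((j + 1 : ℤ) : ℝ) / n)) ^ 2 =
        R ^ 2 * (2 - 2 * cos (2 * π / n)) := by
  rw [dist_cylPoint_sq, show 2 * π * j / n - 2 * π * ((j + 1 : ℤ) : ℝ) / n =
    -(2 * π / n) by push_cast; ring, cos_neg]
  ring

lemma prism_lateral (hn : 3 ≤ n) (hR : 0 < R) (hh : 0 < h) (C₁ C₂ : Set E3) {p : ℕ}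
    (hreg : ∀ F ∈ facets (convexHull ℝ (drumPoints c b n R h 0)), F ≠ C₁ → F ≠ C₂ →
      IsRegularPolygon p F) :
    p = 4 ∧ h ^ 2 = (1 - cos (2 * π / n)) / 2 * R ^ 2 := by
  obtain ⟨hc1, hc2⟩ := cos_lt_one_of_three_le hn
  set V := drumPoints c b n R h 0 with hV
  let P : ℝ → ℤ → E3 := fun z k => cylPoint c b R z (2 * π * k / n)
  have hmem : ∀ x, x ∈ V ↔ ∃ z, (z = h ∨ z = -h) ∧ ∃ k, x = P z k := by
    intro x
    rw [hV, mem_drumPoints (by omega)]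
    simp [P]
  have h1R : 0 < 1 * R := by linarith
  have hin : ∀ {z : ℝ} {j k : ℤ}, (z = h ∨ z = -h) → k = j ∨ k = j + 1 →
      P z k ∈ level V (lateralNormal b n 1 0 j)
        (inner ℝ (lateralNormal b n 1 0 j) c + (1 * R * cos (π / n) + 0 * h)) :=
    fun hz hk => ⟨(hmem _).2 ⟨_, hz, _, rfl⟩, by
      simpa only [zero_mul] using inner_lateralNormal_eq hn 1 0 _ hk⟩
  have hpos1 : 0 < R ^ 2 * (2 - 2 * cos (2 * π / n)) :=
    mul_pos (by positivity) (by linarith)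
  have hpos2 : 0 < (2 * h) ^ 2 := by positivity
  have d1 : ∀ z j, dist (P z j) (P z (j + 1)) ^ 2 = _ := dist_side_sq c b n R
  have d2 : ∀ j, dist (P h j) (P (-h) j) ^ 2 = (2 * h) ^ 2 := by
    intro j
    simp only [P, dist_cylPoint_sq, sub_self, cos_zero]; ring
  have d3 : ∀ j, dist (P h j) (P (-h) (j + 1)) ^ 2 =
      R ^ 2 * (2 - 2 * cos (2 * π / n)) + (2 * h) ^ 2 := by
    intro j
    rw [dist_cylPoint_sq, ← dist_side_sq c b n R h j, dist_cylPoint_sq]; ring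
  have d4 : ∀ j, dist (P h (j + 1)) (P (-h) j) ^ 2 =
      R ^ 2 * (2 - 2 * cos (2 * π / n)) + (2 * h) ^ 2 := by
    intro j
    rw [dist_cylPoint_sq, ← dist_side_sq c b n R h j, dist_comm, dist_cylPoint_sq]; ring
  obtain ⟨j, hP, hext⟩ := exists_lateral hn (fun x hx => dist_of_mem_drumPoints hx)
    (lateralNormal_ne_zero one_ne_zero) (T := P h) (B := P (-h))
    (fun j x hx => by
      obtain ⟨z, hz, k, rfl⟩ := (hmem x).1 hx
      simpa only [zero_mul] using inner_lateralNormal_le hn h1R 0 z j k)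
    (fun j => hin (Or.inl rfl) (Or.inl rfl)) (fun j => hin (Or.inl rfl) (Or.inr rfl))
    (fun j => hin (Or.inr rfl) (Or.inl rfl)) (fun j => ne_of_dist_sq (d1 h j) hpos1)
    (fun j => ne_of_dist_sq (d2 j) hpos2) (fun j => ne_of_dist_sq (d4 j) (add_pos hpos1 hpos2))
    (fun j k => dvd_of_inner_lateralNormal_eq hn h1R) hreg
  have hlev : level V (lateralNormal b n 1 0 j)
      (inner ℝ (lateralNormal b n 1 0 j) c + (1 * R * cos (π / n) + 0 * h)) =
      {P h j, P h (j + 1), P (-h) j, P (-h) (j + 1)} := by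
    ext x
    constructor
    · rintro ⟨hx, h2⟩
      obtain ⟨z, hz, k, rfl⟩ := (hmem x).1 hx
      have := cylPoint_eq_of_dvd (c := c) (b := b) (R := R) hn z
        (dvd_of_inner_lateralNormal_eq (B := 0) (z := z) hn h1R (by rwa [zero_mul] at h2 ⊢))
      rcases hz with rfl | rfl <;> rcases this with h0 | h0 <;> simp only [P, h0] <;> simp
    · rintro (rfl | rfl | rfl | rfl)
      exacts [hin (Or.inl rfl) (Or.inl rfl), hin (Or.inl rfl) (Or.inr rfl),
        hin (Or.inr rfl) (Or.inl rfl), hin (Or.inr rfl) (Or.inr rfl)]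
  have hp := hP.ncard_extremePoints
  rw [hext, hlev] at hp
  have n1 := ne_of_dist_sq (d1 h j) hpos1
  have n2 := ne_of_dist_sq (d2 j) hpos2
  have n3 := ne_of_dist_sq (d3 j) (add_pos hpos1 hpos2)
  have n4 := ne_of_dist_sq (d4 j) (add_pos hpos1 hpos2)
  have n5 := ne_of_dist_sq (d2 (j + 1)) hpos2
  obtain rfl : p = 4 := by
    rw [← hp, Set.ncard_insert_of_notMem (by simp [n1, n2, n3]),
      Set.ncard_insert_of_notMem (by simp [n4, n5]),
      Set.ncard_pair (ne_of_dist_sq (d1 _ j) hpos1)]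
  refine ⟨rfl, ?_⟩
  obtain ⟨d, hd, hdist⟩ := hP.dist_sq_four
  rw [hext, hlev] at hdist
  have q1 := hdist (P h j) (by simp) (P h (j + 1)) (by simp) n1
  have q2 := hdist (P h j) (by simp) (P (-h) j) (by simp) n2
  have q3 := hdist (P h j) (by simp) (P (-h) (j + 1)) (by simp) n3
  rw [d1] at q1
  rw [d2] at q2
  rw [d3] at q3
  rcases q1 with q1 | q1 <;> rcases q2 with q2 | q2 <;> rcases q3 with q3 | q3 <;> nlinarith

lemma antiprism_lateral (hn : 3 ≤ n) (hR : 0 < R) (hh : 0 < h) (C₁ C₂ : Set E3) {p : ℕ}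
    (hreg : ∀ F ∈ facets (convexHull ℝ (drumPoints c b n R h (π / n))), F ≠ C₁ → F ≠ C₂ →
      IsRegularPolygon p F) :
    p = 3 ∧ h ^ 2 = (cos (π / n) - cos (2 * π / n)) / 2 * R ^ 2 := by
  obtain ⟨hc1, hc2⟩ := cos_lt_one_of_three_le hn
  set V := drumPoints c b n R h (π / n) with hV
  let T : ℤ → E3 := fun k => cylPoint c b R h (2 * π * k / n)
  let B : ℤ → E3 := fun k => cylPoint c b R (-h) (2 * π * k / n + π / n)
  have hmem : ∀ x, x ∈ V ↔ (∃ k, x = T k) ∨ ∃ k, x = B k := by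
    intro x; rw [hV, mem_drumPoints (by omega)]
  set A : ℝ := 2 * h / (R * (1 - cos (π / n))) with hA
  have hApos : 0 < A := div_pos (by positivity) (mul_pos hR (by linarith))
  have hAR : 0 < A * R := by positivity
  have hAeq : A * R - h = A * R * cos (π / n) + 1 * h := by
    have h1 : 1 - cos (π / n) ≠ 0 := by linarith
    have : A * (R * (1 - cos (π / n))) = 2 * h := by
      rw [hA, div_mul_cancel₀]
      positivity
    linarith
  let w := lateralNormal b n A 1
  let M : ℤ → ℝ := fun j => inner ℝ (w j) c + (A * R * cos (π / n) + 1 * h)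
  have hwB : ∀ j k, inner ℝ (w j) (B k) = inner ℝ (w j) c +
      (A * R * cos (2 * π * k / n - 2 * π * j / n) - h) := by
    intro j k
    refine (inner_cylPoint c b R (-h) _ A _ 1).trans ?_
    rw [show 2 * π * k / n + π / n - (2 * j + 1) * (π / n) =
      2 * π * k / n - 2 * π * j / n by ring, one_mul, ← sub_eq_add_neg]
    rfl
  have hleB : ∀ j k : ℤ, inner ℝ (w j) (B k) ≤ M j := fun j k => by
    rw [hwB]
    simp only [M, ← hAeq]
    have := cos_le_one (2 * π * k / n - 2 * π * j / n)
    nlinarith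
  have heqB : ∀ j k : ℤ, inner ℝ (w j) (B k) = M j → (n : ℤ) ∣ k - j := fun j k h => by
    rw [hwB] at h
    simp only [M, ← hAeq, add_right_inj, sub_left_inj] at h
    obtain ⟨m, hm⟩ := (cos_eq_one_iff _).1 (mul_left_cancel₀ hAR.ne' (h.trans (mul_one _).symm))
    have hn' : (n : ℝ) ≠ 0 := by positivity
    field_simp at hm
    have h4 : (k : ℝ) - j = n * m := by linarith
    exact ⟨m, by exact_mod_cast h4⟩
  have i1 : ∀ j, T j ∈ level V (w j) (M j) := fun j =>
    ⟨(hmem _).2 (Or.inl ⟨_, rfl⟩), inner_lateralNormal_eq hn A 1 h (Or.inl rfl)⟩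
  have i2 : ∀ j, T (j + 1) ∈ level V (w j) (M j) := fun j =>
    ⟨(hmem _).2 (Or.inl ⟨_, rfl⟩), inner_lateralNormal_eq hn A 1 h (Or.inr rfl)⟩
  have i3 : ∀ j, B j ∈ level V (w j) (M j) := fun j =>
    ⟨(hmem _).2 (Or.inr ⟨_, rfl⟩), by
      rw [hwB]
      simp only [M, ← hAeq, sub_self, cos_zero, mul_one]⟩
  have hpos1 : 0 < R ^ 2 * (2 - 2 * cos (2 * π / n)) :=
    mul_pos (by positivity) (by linarith)
  have hpos2 : 0 < R ^ 2 * (2 - 2 * cos (π / n)) + (2 * h) ^ 2 :=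
    add_pos (mul_pos (by positivity) (by linarith)) (by positivity)
  have d1 : ∀ j, dist (T j) (T (j + 1)) ^ 2 = _ := dist_side_sq c b n R h
  have d2 : ∀ j, dist (T j) (B j) ^ 2 =
      R ^ 2 * (2 - 2 * cos (π / n)) + (2 * h) ^ 2 := by
    intro j
    have : 2 * π * j / n - (2 * π * j / n + π / n) = -(π / n) := by ring
    simp only [T, B, dist_cylPoint_sq, this, cos_neg]; ring
  have d3 : ∀ j, dist (T (j + 1)) (B j) ^ 2 =
      R ^ 2 * (2 - 2 * cos (π / n)) + (2 * h) ^ 2 := by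
    intro j
    have : 2 * π * ((j + 1 : ℤ) : ℝ) / n - (2 * π * j / n + π / n) =
      π / n := by push_cast; ring
    simp only [T, B, dist_cylPoint_sq, this]; ring
  obtain ⟨j, hP, hext⟩ := exists_lateral hn (fun x hx => dist_of_mem_drumPoints hx)
    (lateralNormal_ne_zero hApos.ne') (fun j x hx => by
      rcases (hmem x).1 hx with ⟨k, rfl⟩ | ⟨k, rfl⟩
      · exact inner_lateralNormal_le hn hAR 1 h j k
      · exact hleB j k) i1 i2 i3 (fun j => ne_of_dist_sq (d1 j) hpos1)
    (fun j => ne_of_dist_sq (d2 j) hpos2) (fun j => ne_of_dist_sq (d3 j) hpos2)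
    (fun j k => dvd_of_inner_lateralNormal_eq hn hAR) hreg
  have hlev : level V (w j) (M j) = {T j, T (j + 1), B j} := by
    ext x
    constructor
    · rintro ⟨hx, h2⟩
      rcases (hmem x).1 hx with ⟨k, rfl⟩ | ⟨k, rfl⟩
      · rcases cylPoint_eq_of_dvd (c := c) (b := b) (R := R) hn h
          (dvd_of_inner_lateralNormal_eq hn hAR h2) with h0 | h0 <;> simp only [T, h0] <;> simp
      · exact Or.inr (Or.inr (cylPoint_congr (by omega) (heqB j k h2) _ _))
    · rintro (rfl | rfl | rfl)
      exacts [i1 j, i2 j, i3 j]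
  have hp := hP.ncard_extremePoints
  rw [hext, hlev] at hp
  have n1 := ne_of_dist_sq (d1 j) hpos1
  have n2 := ne_of_dist_sq (d2 j) hpos2
  obtain rfl : p = 3 := by
    rw [← hp, Set.ncard_insert_of_notMem (by simp [n1, n2]),
      Set.ncard_pair (ne_of_dist_sq (d3 j) hpos2)]
  refine ⟨rfl, ?_⟩
  obtain ⟨d, hdist⟩ := hP.dist_sq_three
  rw [hext, hlev] at hdist
  have q1 := hdist (T j) (by simp) (T (j + 1)) (by simp) n1
  have q2 := hdist (T j) (by simp) (B j) (by simp) n2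
  rw [d1] at q1
  rw [d2] at q2
  linarith

lemma drum_eq_image (c : E3) (b : OrthonormalBasis (Fin 3) ℝ E3) (n : ℕ) {R h κ : ℝ}
    (hR : 0 < R) (hh : 0 < h) (hκ : h ^ 2 = κ * R ^ 2) (a : ℝ) :
    ∃ g, IsSimilarity g ∧ convexHull ℝ (drumPoints c b n R h a) =
      g '' convexHull ℝ (drumPoints 0 (EuclideanSpace.basisFun (Fin 3) ℝ) n 1 (√κ) a) := by
  set e := EuclideanSpace.basisFun (Fin 3) ℝ with he
  have hk : h = R * √κ := by
    have h1 : 0 ≤ κ := by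
      by_contra! h0
      have : 0 < h ^ 2 := by positivity
      have : 0 < R ^ 2 := by positivity
      nlinarith
    have h2 : h ^ 2 = (R * √κ) ^ 2 := by rw [mul_pow, sq_sqrt h1, hκ]; ring
    exact (pow_left_inj₀ hh.le (by positivity) two_ne_zero).1 h2
  have hg : IsSimilarity fun x => R • (e.equiv b (Equiv.refl _)) x + c :=
    isSimilarity_iff.2 ⟨R, hR, _, c, fun _ => rfl⟩
  refine ⟨_, hg, ?_⟩
  have hpt : ∀ z t, cylPoint c b R (R * z) t =
      R • (e.equiv b (Equiv.refl _)) (cylPoint 0 e 1 z t) + c := by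
    intro z t
    simp only [cylPoint, map_add, map_smul, map_zero, OrthonormalBasis.equiv_apply_basis,
      Equiv.refl_apply]
    module
  rw [hg.image_convexHull]
  congr 1
  simp only [drumPoints, Set.image_union, ← range_comp, comp_def, ← hpt, hk, mul_neg]

end Drum

/-- Standard models of the prisms and antiprisms with regular faces over polygons with at most `N`
vertices. -/
def regularDrums (N : ℕ) : Set (Set E3) :=
  (fun n : ℕ => drumPoints 0 (EuclideanSpace.basisFun (Fin 3) ℝ) n 1
      (√((1 - cos (2 * π / n)) / 2)) 0) '' Set.Iic N ∪
    (fun n : ℕ => drumPoints 0 (EuclideanSpace.basisFun (Fin 3) ℝ) n 1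
      (√((cos (π / n) - cos (2 * π / n)) / 2)) (π / n)) '' Set.Iic N

lemma regularDrums_finite (N : ℕ) : (regularDrums N).Finite :=
  ((Set.finite_Iic N).image _).union ((Set.finite_Iic N).image _)

lemma finite_of_mem_regularDrums {N : ℕ} {s : Set E3} (hs : s ∈ regularDrums N) : s.Finite := by
  rcases hs with ⟨n, -, rfl⟩ | ⟨n, -, rfl⟩ <;> exact drumPoints_finite _ _ _ _ _ _

/-- A prism or antiprism all of whose facets but two are congruent regular polygons is similar to
one of finitely many, provided that the two facets have a bounded number of vertices. -/
lemma exists_regularDrum {n p N : ℕ} {K C₁ C₂ : Set E3} (hK : IsPrism n K ∨ IsAntiprism n K)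
    (hreg : ∀ F ∈ facets K, F ≠ C₁ → F ≠ C₂ → IsRegularPolygon p F)
    (h₁ : (C₁.extremePoints ℝ).ncard ≤ N) (h₂ : (C₂.extremePoints ℝ).ncard ≤ N) :
    ∃ s ∈ regularDrums (max N 4), ∃ g, IsSimilarity g ∧ K = g '' convexHull ℝ s := by
  have hbound : (∃ F ∈ facets K, IsRegularPolygon n F) → p ≤ 4 → n ≤ max N 4 := by
    rintro ⟨F, hF, hFn⟩ hp
    have hn := hFn.ncard_extremePoints
    by_cases e1 : F = C₁
    · exact le_max_of_le_left (by rwa [← hn, e1])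
    by_cases e2 : F = C₂
    · exact le_max_of_le_left (by rwa [← hn, e2])
    · have := (hreg F hF e1 e2).ncard_extremePoints
      exact le_max_of_le_right (by omega)
  rcases hK with ⟨hn, c, b, R, h, hR, hh, rfl⟩ | ⟨hn, c, b, R, h, hR, hh, rfl⟩
  · have e : (Set.range fun k : Fin n => cylPoint c b R h (2 * π * (k : ℕ) / n)) ∪
        (Set.range fun k : Fin n => cylPoint c b R (-h) (2 * π * (k : ℕ) / n)) =
        drumPoints c b n R h 0 := by simp [drumPoints]
    rw [e] at hreg hbound ⊢
    obtain ⟨rfl, hκ⟩ := prism_lateral hn hR hh C₁ C₂ hreg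
    exact ⟨_, Or.inl ⟨n, hbound (base_mem_facets hn hR hh 0) le_rfl, rfl⟩,
      drum_eq_image c b n hR hh hκ 0⟩
  · change ∀ F ∈ facets (convexHull ℝ (drumPoints c b n R h (π / n))), _ at hreg
    obtain ⟨rfl, hκ⟩ := antiprism_lateral hn hR hh C₁ C₂ hreg
    exact ⟨_, Or.inr ⟨n, hbound (base_mem_facets hn hR hh _) (by norm_num), rfl⟩,
      drum_eq_image c b n hR hh hκ _⟩

local notation "φ" => Real.goldenRatio

/-! ### Finiteness of the pieces within a bounded distance -/

lemma orbitPoints_finite (C : ℤˣ → ℤˣ → Prop) (a₀ a₁ a₂ : ℝ) : (orbitPoints C a₀ a₁ a₂).Finite := by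
  refine (Set.finite_range fun q : Equiv.Perm (Fin 3) × (Fin 3 → ℤˣ) =>
    (WithLp.toLp 2 fun i => (((q.2 i : ℤˣ) : ℤ) : ℝ) * (![a₀, a₁, a₂] : Fin 3 → ℝ) (q.1 i) :
      E3)).subset ?_
  rintro x ⟨σ, s, -, hx⟩
  refine ⟨(σ, s), ?_⟩
  ext i
  simp [hx i]

lemma finite_roots_cubic (a b c : ℝ) : {t : ℝ | t ^ 3 + a * t ^ 2 + b * t + c = 0}.Finite := by
  have h : (Polynomial.X ^ 3 + Polynomial.C a * Polynomial.X ^ 2 + Polynomial.C b * Polynomial.X +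
      Polynomial.C c : Polynomial ℝ) ≠ 0 := by
    intro h0
    have := congrArg (fun p => Polynomial.coeff p 3) h0
    simp at this
  refine (Polynomial.finite_setOfPred_isRoot h).subset fun t ht => ?_
  simpa [Polynomial.IsRoot.def] using ht

lemma Solid.points_finite (s : Solid) : s.points.Finite := by
  have hf := orbitPoints_finite
  cases s with
  | snubCube =>
    refine ((finite_roots_cubic (-1) (-1) (-1)).biUnion fun t _ =>
      hf (fun g p => p = -g) 1 t⁻¹ t).subset ?_
    rintro x ⟨t, -, ht, hx⟩
    refine mem_biUnion (x := t) ?_ hx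
    simp only [mem_ofPred_eq]
    linarith
  | snubDodecahedron =>
    let U : ℝ → ℝ → Set E3 := fun α β => pyritoSnubPoints (2 * α) 2 (2 * β) ∪
        pyritoSnubPoints (α + β * φ⁻¹ + φ) (-α * φ + β + φ⁻¹) (α * φ⁻¹ + β * φ - 1) ∪
        pyritoSnubPoints (α + β * φ⁻¹ - φ) (α * φ - β + φ⁻¹) (α * φ⁻¹ + β * φ + 1) ∪
        pyritoSnubPoints (-α * φ⁻¹ + β * φ + 1) (-α + β * φ⁻¹ - φ) (α * φ + β - φ⁻¹) ∪
        pyritoSnubPoints (-α * φ⁻¹ + β * φ - 1) (α - β * φ⁻¹ - φ) (α * φ + β + φ⁻¹)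
    have hU : ∀ α β, (U α β).Finite := by
      intro α β
      simp only [U, pyritoSnubPoints]
      repeat' apply Set.Finite.union
      all_goals exact hf _ _ _ _
    refine ((finite_roots_cubic 0 (-2) (-φ)).biUnion fun ξ _ =>
      hU (ξ - ξ⁻¹) (ξ * φ + φ ^ 2 + φ * ξ⁻¹)).subset ?_
    rintro x ⟨ξ, _, _, -, h1, rfl, rfl, h4⟩
    refine mem_biUnion (x := ξ) ?_ h4
    simp only [mem_ofPred_eq]
    linarith
  | _ =>
    simp only [Solid.points, allPoints, evenPoints, tetraPoints]
    repeat' apply Set.Finite.union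
    all_goals exact hf _ _ _ _

lemma Solid.finite_range_points : (Set.range Solid.points).Finite := by
  refine (Set.toFinite ({Solid.tetrahedron.points, Solid.cube.points, Solid.octahedron.points,
    Solid.dodecahedron.points, Solid.icosahedron.points, Solid.truncatedTetrahedron.points,
    Solid.cuboctahedron.points, Solid.truncatedCube.points, Solid.truncatedOctahedron.points,
    Solid.rhombicuboctahedron.points, Solid.truncatedCuboctahedron.points, Solid.snubCube.points,
    Solid.icosidodecahedron.points, Solid.truncatedDodecahedron.points,
    Solid.truncatedIcosahedron.points, Solid.rhombicosidodecahedron.points,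
    Solid.truncatedIcosidodecahedron.points, Solid.snubDodecahedron.points} :
      Set (Set E3))).subset ?_
  rintro _ ⟨s, rfl⟩
  cases s <;> simp only [Set.mem_insert_iff, true_or, or_true, Set.mem_singleton_iff]

lemma exists_ncard_points_le : ∃ N, ∀ s : Solid, s.points.ncard ≤ N := by
  obtain ⟨N, hN⟩ := (Solid.finite_range_points.image Set.ncard).bddAbove
  exact ⟨N, fun s => hN ⟨_, ⟨s, rfl⟩, rfl⟩⟩

/-- The solids that are reached from the Platonic and Archimedean models by attaching at most `k`
similar copies of members of `P` one after the other along facets. -/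
def pieces (P : Set (Set E3)) : ℕ → Set (Set E3)
  | 0 => (fun s => convexHull ℝ s) '' Set.range Solid.points
  | k + 1 => pieces P k ∪ ⋃ K ∈ pieces P k, ⋃ F ∈ facets K, attachable P F

lemma pieces_hull {P : Set (Set E3)} (hP : ∀ s ∈ P, s.Finite) {k : ℕ} {K : Set E3}
    (hK : K ∈ pieces P k) : ∃ s : Set E3, s.Finite ∧ K = convexHull ℝ s := by
  induction k generalizing K with
  | zero =>
    obtain ⟨_, ⟨s, rfl⟩, rfl⟩ := hK
    exact ⟨_, s.points_finite, rfl⟩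
  | succ k ih =>
    rcases hK with hK | hK
    · exact ih hK
    · simp only [mem_iUnion] at hK
      obtain ⟨-, -, -, -, s, hs, g, hg, rfl, -⟩ := hK
      exact ⟨g '' s, (hP s hs).image g, hg.image_convexHull s⟩

lemma pieces_finite {P : Set (Set E3)} (hPf : P.Finite) (hP : ∀ s ∈ P, s.Finite) (k : ℕ) :
    (pieces P k).Finite := by
  induction k with
  | zero => exact Solid.finite_range_points.image _
  | succ k ih =>
    refine ih.union (ih.biUnion fun K hK => ?_)
    obtain ⟨s, hs, rfl⟩ := pieces_hull hP hK
    exact (faces_convexHull_finite 2 hs).biUnion fun F _ => attachable_finite hPf hP F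

lemma pieces_mono (P : Set (Set E3)) : Monotone (pieces P) :=
  monotone_nat_of_le_succ fun _ => Set.subset_union_left

lemma exists_piece_of_common_facet {P : Set (Set E3)} {g g' : E3 → E3} (hg : IsSimilarity g)
    (hg' : IsSimilarity g') {k : ℕ} {K s F : Set E3} (hK : K ∈ pieces P k) (hs : s ∈ P)
    (h1 : F ∈ facets (g '' K)) (h2 : F ∈ facets (g' '' convexHull ℝ s)) :
    ∃ K' ∈ pieces P (k + 1), g' '' convexHull ℝ s = g '' K' := by
  obtain ⟨F', hF', rfl⟩ := hg.exists_of_mem_faces_image h1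
  obtain ⟨h, hh, h3, h4⟩ := hg.exists_inverse
  have hid : h ∘ g = id := funext h3
  have hid' : g ∘ h = id := funext h4
  refine ⟨(h ∘ g') '' convexHull ℝ s, Or.inr ?_, ?_⟩
  · simp only [mem_iUnion]
    refine ⟨K, hK, F', hF', s, hs, _, hh.comp hg', rfl, ?_⟩
    have := hh.image_mem_faces h2
    rwa [← image_comp, ← image_comp, hid, Set.image_id] at this
  · rw [← image_comp, ← Function.comp_assoc, hid', Function.id_comp]

/-- The tilings generated by translates of tiles. -/
def translates (D : Set E3) (T : Set (Set E3)) : Set (Set E3) :=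
  {X | ∃ l ∈ AddSubgroup.closure D, ∃ F ∈ T, X = translate l F}

lemma AreSimilarTilings.trans_symm {S T U : Set (Set E3)} (h1 : AreSimilarTilings S T)
    (h2 : AreSimilarTilings S U) : AreSimilarTilings T U := by
  obtain ⟨g, hg, rfl⟩ := h1
  obtain ⟨g', hg', rfl⟩ := h2
  obtain ⟨h, hh, h3, h4⟩ := hg.exists_inverse
  refine ⟨g' ∘ h, hg'.comp hh, ?_⟩
  rw [← image_comp]
  congr 1
  ext1 X
  simp only [comp_apply]
  rw [← image_comp]
  congr 1
  ext1 x
  simp [h3]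

lemma exists_finite_representatives {P : Set (Set E3) → Prop} {𝒮 : Set (Set (Set E3))}
    (hS : 𝒮.Finite) (h : ∀ S, P S → ∃ S' ∈ 𝒮, AreSimilarTilings S' S) :
    ∃ L : Set (Set (Set E3)), L.Finite ∧ (∀ S ∈ L, P S) ∧
      ∀ S, P S → ∃ S₀ ∈ L, AreSimilarTilings S₀ S := by
  classical
  let f : Set (Set E3) → Set (Set E3) := fun S' =>
    if h : ∃ S, P S ∧ AreSimilarTilings S' S then h.choose else ∅
  have hf : ∀ S' S, P S → AreSimilarTilings S' S → P (f S') ∧ AreSimilarTilings S' (f S') := by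
    intro S' S h1 h2
    have h3 : ∃ S, P S ∧ AreSimilarTilings S' S := ⟨S, h1, h2⟩
    simp only [f, dif_pos h3]
    exact h3.choose_spec
  refine ⟨f '' {S' ∈ 𝒮 | ∃ S, P S ∧ AreSimilarTilings S' S}, (hS.subset fun _ h => h.1).image f,
    ?_, ?_⟩
  · rintro _ ⟨S', ⟨-, S, h1, h2⟩, rfl⟩
    exact (hf S' S h1 h2).1
  · intro S hPS
    obtain ⟨S', hS', h2⟩ := h S hPS
    exact ⟨f S', ⟨S', ⟨hS', S, hPS, h2⟩, rfl⟩, (hf S' S hPS h2).2.trans_symm h2⟩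

/-! ### Connectedness of the graph modulo the lattice -/

lemma translate_add (l m : E3) (S : Set E3) :
    translate l (translate m S) = translate (l + m) S := by
  simp only [translate, ← image_comp]
  congr 1
  ext1 x
  simp [add_assoc]

lemma translate_zero (S : Set E3) : translate 0 S = S := by simp [translate]

lemma translate_injective (l : E3) : Injective (translate l) :=
  (add_right_injective l).image_injective

def walkBall (Γ : SimpleGraph E3) (u : E3) (k : ℕ) : Set E3 := {w | ∃ p : Γ.Walk u w, p.length ≤ k}

section Periodic

variable {Λ : Submodule ℤ E3} {Γ : SimpleGraph E3}

lemma walkBall_succ {u w w' : E3} {k : ℕ} (h : w ∈ walkBall Γ u k) (hw : Γ.Adj w w') :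
    w' ∈ walkBall Γ u (k + 1) := by
  obtain ⟨p, hp⟩ := h
  exact ⟨p.concat hw, by simpa using hp⟩

lemma walkBall_mono {u : E3} {j k : ℕ} (h : j ≤ k) : walkBall Γ u j ⊆ walkBall Γ u k :=
  fun _ ⟨p, hp⟩ => ⟨p, hp.trans h⟩

lemma walkBall_subset_support {u : E3} (hu : u ∈ Γ.support) {k : ℕ} :
    walkBall Γ u k ⊆ Γ.support := by
  rintro w ⟨p, -⟩
  cases p with
  | nil => exact hu
  | cons h q =>
    rw [SimpleGraph.mem_support]
    rcases q.reverse with _ | ⟨h', _⟩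
    · exact ⟨_, h.symm⟩
    · exact ⟨_, h'⟩

lemma IsPeriodic.adj_sub (hp : IsPeriodic Λ Γ) {l b w : E3} (hl : l ∈ Λ) (h : Γ.Adj (l + b) w) :
    Γ.Adj b (-l + w) := by
  have := (hp (-l) (Λ.neg_mem hl) (l + b) w).2 h
  rwa [neg_add_cancel_left] at this

lemma IsPeriodic.add_mem_support (hp : IsPeriodic Λ Γ) {l u : E3} (hl : l ∈ Λ)
    (hu : u ∈ Γ.support) : l + u ∈ Γ.support := by
  obtain ⟨v, hv⟩ := hu
  exact ⟨l + v, (hp l hl u v).2 hv⟩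

lemma IsPeriodic.translate_of_step (hp : IsPeriodic Λ Γ) {u : E3} {k : ℕ} {M : AddSubgroup E3}
    (hM : ∀ l ∈ M, l ∈ Λ)
    (h : ∀ w ∈ walkBall Γ u (k + 1), ∃ b ∈ walkBall Γ u k, ∃ l ∈ M, w = l + b)
    {w : E3} (hw : Γ.Reachable u w) : ∃ b ∈ walkBall Γ u k, ∃ l ∈ M, w = l + b := by
  obtain ⟨p⟩ := hw
  induction p using SimpleGraph.Walk.concatRec with
  | Hnil => exact ⟨_, ⟨.nil, by simp⟩, 0, M.zero_mem, by simp⟩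
  | Hconcat p hadj ih =>
    obtain ⟨b, hb, l, hl, rfl⟩ := ih h
    have := hp.adj_sub (hM l hl) hadj
    obtain ⟨b', hb', l', hl', h'⟩ := h _ (walkBall_succ hb this)
    refine ⟨b', hb', l + l', M.add_mem hl hl', ?_⟩
    rw [add_assoc, ← h']
    simp

lemma exists_translate_walkBall (hp : IsPeriodic Λ Γ) {u : E3} (hu : u ∈ Γ.support)
    (hconn : ∀ w ∈ Γ.support, Γ.Reachable u w) {v : ℕ} (hv : 0 < v)
    (hcard : (quotientVertices Λ Γ).ncard = v) {w : E3} (hw : w ∈ Γ.support) :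
    ∃ b ∈ walkBall Γ u v, ∃ l ∈ Λ, w = l + b := by
  set q : E3 → E3 ⧸ Λ.toAddSubgroup := fun x => QuotientAddGroup.mk x with hq
  have hfin : (quotientVertices Λ Γ).Finite := Set.finite_of_ncard_pos (by omega)
  have hsub : ∀ k, q '' walkBall Γ u k ⊆ quotientVertices Λ Γ := fun k =>
    image_mono (walkBall_subset_support hu)
  have hstep : ∃ k ≤ v, q '' walkBall Γ u (k + 1) ⊆ q '' walkBall Γ u k := by
    by_contra! h
    have hgrow : ∀ k ≤ v + 1, k ≤ (q '' walkBall Γ u k).ncard := by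
      intro k
      induction k with
      | zero => simp
      | succ k ih =>
        intro hk
        have h1 := ih (by omega)
        have h2 : q '' walkBall Γ u k ⊂ q '' walkBall Γ u (k + 1) :=
          ⟨image_mono (walkBall_mono (by omega)), h k (by omega)⟩
        have := Set.ncard_lt_ncard h2 (hfin.subset (hsub _))
        omega
    have h1 := hgrow (v + 1) le_rfl
    have h2 := Set.ncard_le_ncard (hsub (v + 1)) hfin
    omega
  obtain ⟨k, hk, h⟩ := hstep
  obtain ⟨b, hb, l, hl, rfl⟩ := hp.translate_of_step (M := Λ.toAddSubgroup) (fun l hl => hl)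
    (k := k) (fun w hw => by
      obtain ⟨b, hb, hbw⟩ := h ⟨w, hw, rfl⟩
      have := QuotientAddGroup.eq.1 hbw
      exact ⟨b, hb, -b + w, this, by abel⟩) (hconn w hw)
  exact ⟨b, walkBall_mono hk hb, l, hl, rfl⟩

end Periodic

section Decoration

variable {Λ : Submodule ℤ E3} {Γ : SimpleGraph E3} {D : Replacement}

lemma translate_inter (l : E3) (A B : Set E3) :
    translate l (A ∩ B) = translate l A ∩ translate l B :=
  Set.image_inter (add_right_injective l)

lemma translate_eq_empty {l : E3} {A : Set E3} : translate l A = ∅ ↔ A = ∅ := Set.image_eq_empty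

lemma isSimilarity_translate (l : E3) : IsSimilarity fun x => l + x :=
  isSimilarity_iff.2 ⟨1, one_pos, LinearIsometryEquiv.refl ℝ E3, l, fun x => by simp [add_comm]⟩

lemma translate_mem_facets {l : E3} {F K : Set E3} :
    translate l F ∈ facets (translate l K) ↔ F ∈ facets K := by
  refine ⟨fun h => ?_, (isSimilarity_translate l).image_mem_faces⟩
  obtain ⟨F', hF', h⟩ := (isSimilarity_translate l).exists_of_mem_faces_image h
  rwa [translate_injective l h]

lemma add_mem_extremePoints_translate {l x : E3} {K : Set E3} (hx : x ∈ K.extremePoints ℝ) :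
    l + x ∈ (translate l K).extremePoints ℝ := by
  rw [mem_extremePoints_iff_left] at hx ⊢
  refine ⟨⟨x, hx.1, rfl⟩, ?_⟩
  rintro _ ⟨y, hy, rfl⟩ _ ⟨z, hz, rfl⟩ h
  rw [mem_openSegment_translate] at h
  dsimp only
  rw [hx.2 y hy z hz h]

lemma IsDecoration.contact_periodic (hD : IsDecoration Λ Γ D) {l : E3} (hl : l ∈ Λ) {u v : E3}
    (h : Γ.Adj u v) : D.contact (l + u) (l + v) = translate l (D.contact u v) := by
  have hu : u ∈ Γ.support := ⟨v, h⟩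
  have hv : v ∈ Γ.support := ⟨u, h.symm⟩
  simp only [Replacement.contact, hD.link_periodic l hl u v h, hD.node_periodic l hl u hu,
    hD.node_periodic l hl v hv, translate_eq_empty, ← translate_inter]
  split_ifs <;> rfl

lemma IsDecoration.translate_mem_boundary (hp : IsPeriodic Λ Γ) (hD : IsDecoration Λ Γ D) {l : E3}
    (hl : l ∈ Λ) {F : Set E3} (hF : F ∈ D.boundary Γ) : translate l F ∈ D.boundary Γ := by
  rcases hF with ⟨u, hu, h1, h2⟩ | ⟨u, v, h, h1, h2, h3⟩
  · refine Or.inl ⟨l + u, hp.add_mem_support hl hu, ?_, fun v hv => ?_⟩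
    · rw [hD.node_periodic l hl u hu]
      exact translate_mem_facets.2 h1
    · have h3 := hp.adj_sub hl hv
      have h4 := hD.contact_periodic hl h3
      rw [add_neg_cancel_left] at h4
      rw [h4]
      exact fun h => h2 _ h3 (translate_injective l h)
  · refine Or.inr ⟨l + u, l + v, (hp l hl u v).2 h, ?_, ?_, ?_⟩
    · rw [hD.link_periodic l hl u v h]
      exact translate_mem_facets.2 h1
    · rw [hD.contact_periodic hl h]
      exact fun h => h2 (translate_injective l h)
    · rw [hD.contact_periodic hl h.symm]
      exact fun h => h3 (translate_injective l h)

lemma ncard_extremePoints_le {s : Solid} {K F : Set E3} (hK : IsSolid s K) (hF : F ∈ facets K)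
    {N : ℕ} (hN : s.points.ncard ≤ N) : (F.extremePoints ℝ).ncard ≤ N := by
  obtain ⟨g, hg, rfl⟩ := hK
  rw [hg.image_convexHull] at hF
  have hfin := s.points_finite.image g
  have := (exists_extremePoints_of_mem_facets hfin hF).2.1
  exact (Set.ncard_le_ncard this hfin).trans ((Set.ncard_image_le s.points_finite).trans hN)

/-- In a regular Archimedean decoration all pieces within a bounded distance of a given node are
taken, up to one similarity, from a finite set. -/
lemma mem_pieces_of_walk {p q r N : ℕ} (hN : ∀ s : Solid, s.points.ncard ≤ N)
    (h : IsRegularArchimedeanDecoration Λ Γ D p q r) {g : E3 → E3} (hg : IsSimilarity g)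
    {u : E3} (h₀ : ∃ s : Solid, D.node u = g '' convexHull ℝ s.points) {w : E3}
    (P : Γ.Walk u w) :
    (∃ K ∈ pieces (Set.range Solid.points ∪ regularDrums (max N 4)) (2 * P.length),
      D.node w = g '' K) ∧ ∀ v, Γ.Adj w v → D.link w v ≠ ∅ →
        ∃ K ∈ pieces (Set.range Solid.points ∪ regularDrums (max N 4)) (2 * P.length + 1),
          D.link w v = g '' K := by
  obtain ⟨hD, hA, hR, -⟩ := h
  set 𝓟 := Set.range Solid.points ∪ regularDrums (max N 4) with h𝓟
  have hlink : ∀ {w v : E3} {k : ℕ}, Γ.Adj w v → D.link w v ≠ ∅ →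
      (∃ K ∈ pieces 𝓟 k, D.node w = g '' K) → ∃ K ∈ pieces 𝓟 (k + 1), D.link w v = g '' K := by
    rintro w v k hwv hne ⟨K, hK, hKw⟩
    have hsub : ∀ {w v : E3}, Γ.Adj w v → ((D.contact w v).extremePoints ℝ).ncard ≤ N := by
      intro w v hwv
      obtain ⟨s, hs⟩ := hA.node w ⟨v, hwv⟩
      exact ncard_extremePoints_le hs (hD.contact_node w v hwv) (hN s)
    obtain ⟨n, hn⟩ := (hA.link w v hwv).resolve_left hne
    obtain ⟨s, hs, g', hg', hL⟩ := exists_regularDrum (p := p) hn (C₁ := D.contact w v)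
      (C₂ := D.contact v w) (fun F hF h1 h2 => hR.polygon F (Or.inr ⟨w, v, hwv, hF, h1, h2⟩))
      (hsub hwv) (hsub hwv.symm)
    have c1 := hD.contact_node w v hwv
    have c2 := hD.contact_link w v hwv hne
    rw [hKw] at c1
    rw [hL] at c2 ⊢
    exact exists_piece_of_common_facet hg hg' hK (Or.inr hs) c1 c2
  have hnode : ∀ {w : E3}, w ∈ Γ.support → ∀ {k : ℕ} {K F : Set E3}, K ∈ pieces 𝓟 k →
      F ∈ facets (g '' K) → F ∈ facets (D.node w) →
        ∃ K' ∈ pieces 𝓟 (k + 1), D.node w = g '' K' := by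
    intro w hw k K F hK h1 h2
    obtain ⟨s, g', hg', hs⟩ := hA.node w hw
    rw [hs] at h2 ⊢
    exact exists_piece_of_common_facet hg hg' hK (Or.inl ⟨s, rfl⟩) h1 h2
  have main : ∃ K ∈ pieces 𝓟 (2 * P.length), D.node w = g '' K := by
    induction P using SimpleGraph.Walk.concatRec with
    | Hnil =>
      obtain ⟨s, hs⟩ := h₀
      exact ⟨_, ⟨_, ⟨s, rfl⟩, rfl⟩, hs⟩
    | @Hconcat u v w P hadj ih =>
      obtain ⟨K, hK, hKv⟩ := ih h₀
      rw [SimpleGraph.Walk.length_concat]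
      have c2 := hD.contact_node w v hadj.symm
      by_cases hne : D.link v w = ∅
      · have c1 := hD.contact_node v w hadj
        have hne' : D.link w v = ∅ := by rwa [← hD.link_symm v w hadj]
        have hc : D.contact v w = D.contact w v := by
          simp only [Replacement.contact, hne, hne', if_true, Set.inter_comm]
        rw [hc, hKv] at c1
        obtain ⟨K', hK', h'⟩ := hnode ⟨v, hadj.symm⟩ hK c1 c2
        exact ⟨K', pieces_mono 𝓟 (by omega) hK', h'⟩
      · obtain ⟨L, hL, hLv⟩ := hlink hadj hne ⟨K, hK, hKv⟩
        have c1 := hD.contact_link w v hadj.symm (by rwa [hD.link_symm w v hadj.symm])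
        rw [hD.link_symm w v hadj.symm, hLv] at c1
        exact hnode ⟨v, hadj.symm⟩ hL c1 c2
  exact ⟨main, fun v hwv hne => hlink hwv hne main⟩

/-- The surfaces of the decorations of graphs with a given number of vertices in the quotient fall
into finitely many similarity classes. -/
lemma exists_finite_similarity_classes (v : ℕ) (hv : 0 < v) : ∃ 𝒮 : Set (Set (Set E3)),
    𝒮.Finite ∧ ∀ (Λ : Submodule ℤ E3) (Γ : SimpleGraph E3) (D : Replacement) (g d p q r : ℕ),
      HasQuotientType Λ Γ g v d → IsRegularArchimedeanDecoration Λ Γ D p q r →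
        ∃ S' ∈ 𝒮, AreSimilarTilings S' (D.boundary Γ) := by
  obtain ⟨N, hN⟩ := exists_ncard_points_le
  set 𝓟 := Set.range Solid.points ∪ regularDrums (max N 4) with h𝓟
  have hPf : 𝓟.Finite := Solid.finite_range_points.union (regularDrums_finite _)
  have hP : ∀ s ∈ 𝓟, s.Finite := by
    rintro _ (⟨s, rfl⟩ | hs)
    · exact s.points_finite
    · exact finite_of_mem_regularDrums hs
  set 𝒬 := pieces 𝓟 (2 * (v + 1) + 1) with h𝒬
  have h𝒬f : 𝒬.Finite := pieces_finite hPf hP _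
  set 𝔽 : Set (Set E3) := ⋃ K ∈ 𝒬, facets K with h𝔽
  have h𝔽f : 𝔽.Finite := h𝒬f.biUnion fun K hK => by
    obtain ⟨s, hs, rfl⟩ := pieces_hull hP hK
    exact faces_convexHull_finite 2 hs
  set X : Set E3 := ⋃ K ∈ 𝒬, K.extremePoints ℝ with hX
  have hXf : X.Finite := h𝒬f.biUnion fun K hK => by
    obtain ⟨s, hs, rfl⟩ := pieces_hull hP hK
    exact extremePoints_finite_of_convexHull hs
  set 𝒟 : Set E3 := Set.image2 (fun x y => x - y) X X with h𝒟
  have h𝒟f : 𝒟.Finite := hXf.image2 _ hXf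
  refine ⟨Set.image2 translates {A | A ⊆ 𝒟} {T | T ⊆ 𝔽},
    h𝒟f.finite_subsets.image2 _ h𝔽f.finite_subsets, ?_⟩
  intro Λ Γ D _ d p q r hQ h
  have hD := h.decoration
  have hp := hQ.periodic
  obtain ⟨u, hu⟩ := hQ.graph.nonempty
  obtain ⟨s, g, hg, hs⟩ := h.archimedean.node u hu
  have hnear : ∀ w ∈ walkBall Γ u (v + 1), (∃ K ∈ 𝒬, D.node w = g '' K) ∧
      ∀ v, Γ.Adj w v → D.link w v ≠ ∅ → ∃ K ∈ 𝒬, D.link w v = g '' K := by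
    rintro w ⟨P, hP⟩
    obtain ⟨⟨K, hK, h1⟩, h2⟩ := mem_pieces_of_walk hN h hg ⟨s, hs⟩ P
    refine ⟨⟨K, pieces_mono _ (by omega) hK, h1⟩, fun v hv hne => ?_⟩
    obtain ⟨K, hK, h3⟩ := h2 v hv hne
    exact ⟨K, pieces_mono _ (by omega) hK, h3⟩
  have hcover : ∀ w ∈ Γ.support, ∃ b ∈ walkBall Γ u v, ∃ l ∈ Λ, w = l + b := fun w hw =>
    exists_translate_walkBall hp hu (fun w hw => hQ.graph.connected u hu w hw) hv
      hQ.card_vertices hw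
  -- the lattice vectors that are needed
  set G : Set E3 := {l | l ∈ Λ ∧ ∃ b ∈ walkBall Γ u v, l + b ∈ walkBall Γ u (v + 1)} with hG
  have hGΛ : ∀ l ∈ AddSubgroup.closure G, l ∈ Λ := fun l hl =>
    (AddSubgroup.closure_le Λ.toAddSubgroup).2 (fun l hl => hl.1) hl
  have hcover' : ∀ w ∈ Γ.support, ∃ b ∈ walkBall Γ u v, ∃ l ∈ AddSubgroup.closure G, w = l + b := by
    intro w hw
    refine hp.translate_of_step hGΛ (fun w hw => ?_) (hQ.graph.connected u hu w hw)
    obtain ⟨b, hb, l, hl, rfl⟩ := hcover w (walkBall_subset_support hu hw)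
    exact ⟨b, hb, l, AddSubgroup.subset_closure ⟨hl, b, hb, hw⟩, rfl⟩
  -- pull everything back along `g`
  obtain ⟨c, hc, L, t, hgL⟩ := isSimilarity_iff.1 hg
  set A : E3 →+ E3 := (c⁻¹ • (L.symm.toLinearEquiv.toLinearMap)).toAddMonoidHom with hA
  have hAapp : ∀ l, A l = c⁻¹ • L.symm l := fun l => rfl
  have htr : ∀ l (Y : Set E3), translate l (g '' Y) = g '' translate (A l) Y := by
    intro l Y
    simp only [translate, ← image_comp]
    congr 1
    ext1 x
    simp only [comp_apply, hgL, hAapp, map_add, map_smul, smul_add, smul_smul,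
      mul_inv_cancel₀ hc.ne', one_smul, LinearIsometryEquiv.apply_symm_apply, add_assoc]
  have hginj : Injective fun Y : Set E3 => g '' Y := hg.injective.image_injective
  refine ⟨translates (A '' G) {F | F ∈ 𝔽 ∧ g '' F ∈ D.boundary Γ},
      ⟨_, ?_, _, fun F hF => hF.1, rfl⟩,
    g, hg, ?_⟩
  · rintro _ ⟨l, ⟨hl, b, hb, hlb⟩, rfl⟩
    obtain ⟨K, hK, h1⟩ := (hnear b (walkBall_mono (by omega) hb)).1
    obtain ⟨K', hK', h2⟩ := (hnear _ hlb).1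
    rw [hD.node_periodic l hl b (walkBall_subset_support hu hb), h1, htr] at h2
    have h3 : translate (A l) K = K' := hginj h2
    obtain ⟨s, hs, hKs⟩ := pieces_hull hP hK
    have hne : K.Nonempty := by
      have := hD.vertex_mem b (walkBall_subset_support hu hb)
      rw [h1] at this
      obtain ⟨x, hx, -⟩ := this
      exact ⟨x, hx⟩
    obtain ⟨x, hx⟩ : (K.extremePoints ℝ).Nonempty :=
      (hKs ▸ hs.isCompact_convexHull (𝕜 := ℝ) : IsCompact K).extremePoints_nonempty hne
    have hx' : A l + x ∈ K'.extremePoints ℝ := by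
      rw [← h3]
      exact add_mem_extremePoints_translate hx
    exact ⟨A l + x, mem_biUnion hK' hx', x, mem_biUnion hK hx, by simp⟩
  · have hclos : AddSubgroup.closure (A '' G) = (AddSubgroup.closure G).map A :=
      (AddMonoidHom.map_closure A G).symm
    have hfam : ∀ {F : Set E3} {b l : E3} {Y : Set E3}, l ∈ AddSubgroup.closure G →
        F ∈ D.boundary Γ → Y ∈ 𝒬 → F ∈ facets (translate l (g '' Y)) →
        F ∈ (fun P => g '' P) '' translates (A '' G) {F | F ∈ 𝔽 ∧ g '' F ∈ D.boundary Γ} := by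
      intro F b l Y hl hF hY hFY
      rw [htr] at hFY
      obtain ⟨F₁, hF₁, rfl⟩ := hg.exists_of_mem_faces_image hFY
      obtain ⟨F₂, hF₂, rfl⟩ := (isSimilarity_translate (A l)).exists_of_mem_faces_image hF₁
      refine ⟨_, ⟨A l, ?_, F₂, ⟨mem_biUnion hY hF₂, ?_⟩, rfl⟩, rfl⟩
      · rw [hclos]; exact ⟨l, hl, rfl⟩
      · have h1 : g '' translate (A l) F₂ = translate l (g '' F₂) := (htr l F₂).symm
        have h2 : g '' translate (A l) F₂ ∈ D.boundary Γ := hF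
        rw [h1] at h2
        have h3 := hD.translate_mem_boundary hp (Λ.neg_mem (hGΛ l hl)) h2
        rwa [translate_add, neg_add_cancel, translate_zero] at h3
    ext F
    constructor
    · intro hF
      rcases id hF with ⟨w, hw, h1, -⟩ | ⟨w, w', hww, h1, -, -⟩
      · obtain ⟨b, hb, l, hl, rfl⟩ := hcover' w hw
        obtain ⟨K, hK, h2⟩ := (hnear b (walkBall_mono (by omega) hb)).1
        rw [hD.node_periodic l (hGΛ l hl) b (walkBall_subset_support hu hb), h2] at h1
        exact hfam (b := b) hl hF hK h1
      · obtain ⟨b, hb, l, hl, rfl⟩ := hcover' w ⟨w', hww⟩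
        have hadj := hp.adj_sub (hGΛ l hl) hww
        have h3 := hD.link_periodic l (hGΛ l hl) b (-l + w') hadj
        rw [add_neg_cancel_left] at h3
        have hne : D.link b (-l + w') ≠ ∅ := by
          intro h0
          rw [h3, h0, translate_eq_empty.2 rfl] at h1
          exact h1.2.1.ne_empty (Set.subset_empty_iff.1 h1.1.subset)
        obtain ⟨K, hK, h2⟩ := (hnear b (walkBall_mono (by omega) hb)).2 _ hadj hne
        rw [h3, h2] at h1
        exact hfam (b := b) hl hF hK h1
    · rintro ⟨_, ⟨l, hl, F, ⟨-, hF⟩, rfl⟩, rfl⟩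
      rw [hclos] at hl
      obtain ⟨l, hl, rfl⟩ := hl
      change g '' translate (A l) F ∈ _
      rw [← htr]
      exact hD.translate_mem_boundary hp (hGΛ l hl) hF

end Decoration

lemma finite_similarity_classes : ∃ L : Set (Set (Set E3)), L.Finite ∧
    (∀ S ∈ L, ArisesFrom 4 4 1 8 S ∨ ArisesFrom 4 4 3 4 S) ∧
    ∀ S : Set (Set E3), ArisesFrom 4 4 1 8 S ∨ ArisesFrom 4 4 3 4 S →
      ∃ S₀ ∈ L, AreSimilarTilings S₀ S := by
  obtain ⟨𝒮₁, hf₁, h₁⟩ := exists_finite_similarity_classes 1 one_pos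
  obtain ⟨𝒮₃, hf₃, h₃⟩ := exists_finite_similarity_classes 3 (by norm_num)
  refine exists_finite_representatives (hf₁.union hf₃) ?_
  rintro S (⟨Λ, Γ, D, p, q, r, hQ, h, rfl, -⟩ | ⟨Λ, Γ, D, p, q, r, hQ, h, rfl, -⟩)
  · obtain ⟨S', hS', h'⟩ := h₁ Λ Γ D _ _ p q r hQ h
    exact ⟨S', Or.inl hS', h'⟩
  · obtain ⟨S', hS', h'⟩ := h₃ Λ Γ D _ _ p q r hQ h
    exact ⟨S', Or.inr hS', h'⟩

/-! ### Blueprints of periodic polyhedral complexes -/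

/-- The number `a + b * √6` with integers `a` and `b`. -/
abbrev Surd : Type := ℤ × ℤ

namespace Surd

noncomputable def val (x : Surd) : ℝ := x.1 + x.2 * √6

def add (x y : Surd) : Surd := (x.1 + y.1, x.2 + y.2)
def sub (x y : Surd) : Surd := (x.1 - y.1, x.2 - y.2)
def mul (x y : Surd) : Surd := (x.1 * y.1 + 6 * (x.2 * y.2), x.1 * y.2 + x.2 * y.1)
def smul (n : ℤ) (x : Surd) : Surd := (n * x.1, n * x.2)

def nonneg (x : Surd) : Bool :=
  decide (0 ≤ 1000 * x.1 + 2449 * x.2) && decide (0 ≤ 1000 * x.1 + 2450 * x.2)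

def pos (x : Surd) : Bool :=
  decide (0 < 1000 * x.1 + 2449 * x.2) && decide (0 < 1000 * x.1 + 2450 * x.2)

def le (x y : Surd) : Bool := nonneg (sub y x)
def lt (x y : Surd) : Bool := pos (sub y x)
def same (x y : Surd) : Bool := decide (x.1 = y.1) && decide (x.2 = y.2)
def min (x y : Surd) : Surd := if le x y then x else y
def max (x y : Surd) : Surd := if le x y then y else x

end Surd

/-- A triple of integers: a lattice vector in coordinates, or an integral linear functional. -/
abbrev Shift : Type := ℤ × ℤ × ℤ

abbrev Matrix3 : Type := Shift × Shift × Shift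

namespace Shift

def add (m n : Shift) : Shift := (m.1 + n.1, m.2.1 + n.2.1, m.2.2 + n.2.2)
def neg (n : Shift) : Shift := (-n.1, -n.2.1, -n.2.2)
def smul (a : ℤ) (n : Shift) : Shift := (a * n.1, a * n.2.1, a * n.2.2)
def dot (m n : Shift) : ℤ := m.1 * n.1 + m.2.1 * n.2.1 + m.2.2 * n.2.2
def same (m n : Shift) : Bool :=
  decide (m.1 = n.1) && (decide (m.2.1 = n.2.1) && decide (m.2.2 = n.2.2))

def window : List Shift :=
  [0, 1, -1].flatMap fun a => [0, 1, -1].flatMap fun b => [0, 1, -1].map fun c => (a, b, c)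

end Shift

/-- A point of space with coordinates of the form `a + b * √6`. -/
abbrev SurdPt : Type := Surd × Surd × Surd

namespace SurdPt

noncomputable def val (p : SurdPt) : E3 := !₂[p.1.val, p.2.1.val, p.2.2.val]

def zero : SurdPt := ((0, 0), (0, 0), (0, 0))
def add (p q : SurdPt) : SurdPt := (p.1.add q.1, p.2.1.add q.2.1, p.2.2.add q.2.2)
def sub (p q : SurdPt) : SurdPt := (p.1.sub q.1, p.2.1.sub q.2.1, p.2.2.sub q.2.2)
def smul (n : ℤ) (p : SurdPt) : SurdPt := (p.1.smul n, p.2.1.smul n, p.2.2.smul n)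
def mul (a : Surd) (p : SurdPt) : SurdPt := (a.mul p.1, a.mul p.2.1, a.mul p.2.2)
def dot (p q : SurdPt) : Surd := ((p.1.mul q.1).add (p.2.1.mul q.2.1)).add (p.2.2.mul q.2.2)
def cross (p q : SurdPt) : SurdPt :=
  ((p.2.1.mul q.2.2).sub (p.2.2.mul q.2.1), (p.2.2.mul q.1).sub (p.1.mul q.2.2),
    (p.1.mul q.2.1).sub (p.2.1.mul q.1))
def same (p q : SurdPt) : Bool := p.1.same q.1 && (p.2.1.same q.2.1 && p.2.2.same q.2.2)

def eval (f : Shift) (p : SurdPt) : Surd :=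
  (f.1 * p.1.1 + f.2.1 * p.2.1.1 + f.2.2 * p.2.2.1, f.1 * p.1.2 + f.2.1 * p.2.1.2 + f.2.2 * p.2.2.2)

end SurdPt

/-- A vertex of the graph: its class and a lattice vector. -/
abbrev Node : Type := ℕ × Shift

/-- A vertex of a solid that replaces a vertex of the graph. -/
abbrev Corner : Type := Node × ℕ

def Node.move (n : Shift) (A : Node) : Node := (A.1, A.2.add n)
def Node.same (A B : Node) : Bool := Nat.beq A.1 B.1 && Shift.same A.2 B.2
def Corner.move (n : Shift) (v : Corner) : Corner := (Node.move n v.1, v.2)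
def Corner.same (v w : Corner) : Bool := Nat.beq v.2 w.2 && Node.same v.1 w.1

/-- An edge from the vertex of class `src` in the base cell to the vertex `dst`; the corners of
its two contact polygons are listed in corresponding order. -/
structure Link where
  src : ℕ
  dst : Node
  base : List ℕ
  top : List ℕ

def Link.rev (L : Link) : Link := ⟨L.dst.1, (L.src, L.dst.2.neg), L.top, L.base⟩

/-- A symmetry of the graph: `x ↦ mat x + tr`, and what it and its inverse do to the vertices of
the base cell and to the generators of the lattice. -/
structure Sym where
  mat : Matrix3
  tr : SurdPt
  img : List Node
  sh : Matrix3
  invImg : List Node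
  invSh : Matrix3

/-- A periodic complex of solids. All vertices of the graph are replaced with translates of the
hull of `rel`, with facets `faces`; edges with prisms or (if `anti`) triangular antiprisms. -/
structure Blueprint where
  lam : SurdPt × SurdPt × SurdPt
  dual : Matrix3
  cen : List SurdPt
  rel : List SurdPt
  faces : List (List ℕ)
  links : List Link
  anti : Bool
  al : Surd
  den : ℤ
  syms : List Sym
  nodeChain : List (Node × Node)
  cornerChain : List (Corner × Corner)

namespace Blueprint

variable (M : Blueprint)

def lat (n : Shift) : SurdPt :=
  ((SurdPt.smul n.1 M.lam.1).add (SurdPt.smul n.2.1 M.lam.2.1)).add (SurdPt.smul n.2.2 M.lam.2.2)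

def center (A : Node) : SurdPt := (M.cen.getD A.1 SurdPt.zero).add (M.lat A.2)
def place (v : Corner) : SurdPt := (M.center v.1).add (M.rel.getD v.2 SurdPt.zero)

/-! #### Separation -/

/-- The shift `n` of `Y` lies on the upper side of a plane on which the functional `f` is constant,
and `X` on the lower side, up to common corners. -/
def sepBy {ι : Type} (same : ι → ι → Bool) (X : List (ι × Surd)) (Y : List (ι × Surd)) : Bool :=
  match Y with
  | [] => false
  | y :: Y' =>
    let c := Y'.foldl (fun a b => Surd.min a b.2) y.2
    Y.all (fun y => Surd.le c y.2) &&
      X.all fun x => Surd.lt x.2 c || (Surd.le x.2 c && Y.any fun y => same x.1 y.1)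

def normals : List Shift := [(-1, 0, 0), (0, -1, 0), (0, 0, -1), (0, 0, 1), (0, 1, 0), (1, 0, 0)] ++
  Shift.window

abbrev Bounds : Type := Surd × Surd

def bounds (f : Shift) (X : List SurdPt) : Bounds :=
  (X.foldl (fun a p => Surd.min a (p.eval f)) ((X.headD SurdPt.zero).eval f),
    X.foldl (fun a p => Surd.max a (p.eval f)) ((X.headD SurdPt.zero).eval f))

def apart (B C : Bounds) (s : Surd) : Bool := Surd.lt B.2 (C.1.add s) || Surd.lt (C.2.add s) B.1

structure Cell (ι : Type) where
  pts : List (ι × SurdPt)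
  box : Bounds × Bounds × Bounds

def mkCell {ι : Type} (p : ι → SurdPt) (X : List ι) : Cell ι where
  pts := X.map fun i => (i, p i)
  box := (bounds M.dual.1 (X.map p), bounds M.dual.2.1 (X.map p), bounds M.dual.2.2 (X.map p))

def farApart {ι : Type} (X Y : Cell ι) (n : Shift) : Bool :=
  apart X.box.1 Y.box.1 ((M.lat n).eval M.dual.1) ||
  (apart X.box.2.1 Y.box.2.1 ((M.lat n).eval M.dual.2.1) ||
  apart X.box.2.2 Y.box.2.2 ((M.lat n).eval M.dual.2.2))

def separated {ι : Type} (same : ι → ι → Bool) (mv : Shift → ι → ι) (X Y : Cell ι)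
    (n : Shift) : Bool :=
  M.farApart X Y n || normals.any fun f =>
    sepBy same (X.pts.map fun x => (x.1, x.2.eval f))
      (Y.pts.map fun y => (mv n y.1, (y.2.eval f).add ((M.lat n).eval f)))

def sepCheck {ι : Type} (same : ι → ι → Bool) (mv : Shift → ι → ι) : List (Cell ι) → Bool
  | [] => true
  | X :: C =>
    (Shift.window.all fun n => Shift.same n (0, 0, 0) || M.separated same mv X X n) &&
      ((C.all fun Y => Shift.window.all fun n => M.separated same mv X Y n) &&
        sepCheck same mv C)

def nodeCorners (k : ℕ) : List Corner := (List.range M.rel.length).map fun j => ((k, (0, 0, 0)), j)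
def linkCorners (L : Link) : List Corner :=
  (L.base.map fun j => ((L.src, (0, 0, 0)), j)) ++ (L.top.map fun j => (L.dst, j))

def solidCells : List (Cell Corner) :=
  ((List.range M.cen.length).map fun k => M.mkCell M.place (M.nodeCorners k)) ++
    (M.links.map fun L => M.mkCell M.place (linkCorners L))

def edgeCells : List (Cell Node) :=
  M.links.map fun L => M.mkCell M.center [(L.src, (0, 0, 0)), L.dst]

def boundsOK {ι : Type} (f : Shift) (B : Bounds) (X : List (ι × SurdPt)) : Bool :=
  X.all fun x => Surd.le B.1 (x.2.eval f) && Surd.le (x.2.eval f) B.2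

def near {ι : Type} (C : List (Cell ι)) : Bool :=
  (C.all fun X => boundsOK M.dual.1 X.box.1 X.pts &&
    (boundsOK M.dual.2.1 X.box.2.1 X.pts && boundsOK M.dual.2.2 X.box.2.2 X.pts)) &&
  C.all fun X => C.all fun Y =>
    Surd.lt X.box.1.2 (Y.box.1.1.add (Surd.smul 2 (M.lam.1.eval M.dual.1))) &&
    (Surd.lt X.box.2.1.2 (Y.box.2.1.1.add (Surd.smul 2 (M.lam.2.1.eval M.dual.2.1))) &&
    Surd.lt X.box.2.2.2 (Y.box.2.2.1.add (Surd.smul 2 (M.lam.2.2.eval M.dual.2.2))))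

/-- The functionals `dual` are positive multiples of the dual basis of the lattice. -/
def dualOK : Bool :=
  ((M.lam.1.eval M.dual.1).pos && ((M.lam.2.1.eval M.dual.1).same (0, 0) &&
    (M.lam.2.2.eval M.dual.1).same (0, 0))) &&
  (((M.lam.1.eval M.dual.2.1).same (0, 0) && ((M.lam.2.1.eval M.dual.2.1).pos &&
    (M.lam.2.2.eval M.dual.2.1).same (0, 0))) &&
  ((M.lam.1.eval M.dual.2.2).same (0, 0) && ((M.lam.2.1.eval M.dual.2.2).same (0, 0) &&
    (M.lam.2.2.eval M.dual.2.2).pos)))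

end Blueprint
namespace Blueprint

/-! #### Facets -/

/-- The determinant that tells on which side of the plane through `a`, `b` and `c` a point lies. -/
def planeNormal (a b c : SurdPt) : SurdPt := (b.sub a).cross (c.sub a)

def facetOK {ι : Type} (same : ι → ι → Bool) (p : ι → SurdPt) (X : List ι) (F : List ι) : Bool :=
  match F with
  | a :: b :: c :: _ =>
    let w := planeNormal (p a) (p b) (p c)
    let v := fun x => w.dot ((p x).sub (p a))
    F.all (fun x => X.any (same x)) && (X.any (fun x => !F.any (same x)) &&
    (X.all (fun x => if F.any (same x) then (v x).same (0, 0) else (v x).pos) ||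
      X.all (fun x => if F.any (same x) then (v x).same (0, 0) else (Surd.smul (-1) (v x)).pos)))
  | _ => false

def tripleOK {ι : Type} (same : ι → ι → Bool) (p : ι → SurdPt) (X : List ι) (Fs : List (List ι))
    (a b c : ι) : Bool :=
  Fs.any (fun F => F.any (same a) && (F.any (same b) && F.any (same c))) ||
    let w := planeNormal (p a) (p b) (p c)
    X.any (fun x => (w.dot ((p x).sub (p a))).pos) &&
      X.any (fun x => (Surd.smul (-1) (w.dot ((p x).sub (p a)))).pos)

def pairsAll {α : Type} (r : α → α → Bool) : List α → Bool
  | [] => true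
  | a :: l => l.all (r a) && pairsAll r l

def triplesAll {α : Type} (r : α → α → α → Bool) : List α → Bool
  | [] => true
  | a :: l => pairsAll (r a) l && triplesAll r l

def facetCheck {ι : Type} (same : ι → ι → Bool) (p : ι → SurdPt) (X : List ι)
    (Fs : List (List ι)) : Bool :=
  Fs.all (facetOK same p X) && triplesAll (tripleOK same p X Fs) X

variable (M : Blueprint)

/-! #### The tiles -/

def darts : List Link := M.links ++ M.links.map Link.rev

def sides {α : Type} : List α → List (α × α)
  | [] => []
  | a :: l => (a :: l).zip (l ++ [a])

def triangles {α : Type} : List α → List α → List (List α)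
  | [a, b, c], [a', b', c'] =>
    [[a, b, c'], [b, c, a'], [c, a, b'], [c, b', a'], [a, c', b'], [b, a', c']]
  | _, _ => []

def squares {α : Type} (l l' : List α) : List (List α) :=
  ((sides l).zip (sides l')).map fun s => [s.1.1, s.1.2, s.2.2, s.2.1]

def Link.baseCorners (L : Link) : List Corner := L.base.map fun j => ((L.src, (0, 0, 0)), j)
def Link.topCorners (L : Link) : List Corner := L.top.map fun j => (L.dst, j)

def laterals (L : Link) : List (List Corner) :=
  if M.anti then triangles (Link.baseCorners L) (Link.topCorners L)
  else squares (Link.baseCorners L) (Link.topCorners L)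

def isContact (k : ℕ) (f : List ℕ) : Bool :=
  M.darts.any fun d => Nat.beq d.src k && ((f.all fun j => d.base.any (Nat.beq j)) &&
    d.base.all fun j => f.any (Nat.beq j))

def freeTiles (k : ℕ) : List (List Corner) :=
  (M.faces.filter fun f => !M.isContact k f).map fun f => f.map fun j => ((k, (0, 0, 0)), j)

def tiles : List (List Corner) :=
  ((List.range M.cen.length).flatMap M.freeTiles) ++ M.links.flatMap M.laterals

def star (k j : ℕ) : List (List Corner) := M.tiles.flatMap fun T =>
  (T.filter fun w => Nat.beq w.1.1 k && Nat.beq w.2 j).map fun w => T.map (Corner.move w.1.2.neg)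

def has (T : List Corner) (v : Corner) : Bool := T.any (Corner.same v)
def adjacent (T : List Corner) (v w : Corner) : Bool :=
  (sides T).any fun s => (Corner.same v s.1 && Corner.same w s.2) ||
    (Corner.same w s.1 && Corner.same v s.2)

def meetOK (v : Corner) (S T : List Corner) : Bool :=
  match S.filter fun w => has T w && !Corner.same v w with
  | [] => true
  | [w] => adjacent S v w && adjacent T v w
  | _ => false

def sideOK (v : Corner) (S : List (List Corner)) (T : List Corner) : Bool :=
  T.all fun w => !adjacent T v w || Nat.beq (S.filter fun T' => has T' w).length 2

def linked (v : Corner) (S T : List Corner) : Bool := S.any fun w => has T w && !Corner.same v w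

def connect {α : Type} (r : α → α → Bool) : ℕ → List α → List α → Bool
  | 0, _, rest => rest.isEmpty
  | n + 1, seen, rest => connect r n (rest.filter (fun x => seen.any (r x)) ++ seen)
      (rest.filter fun x => !seen.any (r x))

def starOK (q : ℕ) (v : Corner) (S : List (List Corner)) : Bool :=
  Nat.beq S.length q && (pairsAll (meetOK v) S && (S.all (sideOK v S) &&
    connect (linked v) q (S.take 1) S))

def starCheck (q : ℕ) : Bool :=
  (List.range M.cen.length).all fun k => (List.range M.rel.length).all fun j =>
    starOK q ((k, (0, 0, 0)), j) (M.star k j)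

def normalSide (s : Corner × Corner) : Corner × Corner :=
  (s.1.move s.1.1.2.neg, s.2.move s.1.1.2.neg)
def sameSide (s t : Corner × Corner) : Bool := Corner.same s.1 t.1 && Corner.same s.2 t.2

def insertSide (s : Corner × Corner) (l : List (Corner × Corner)) : List (Corner × Corner) :=
  if l.any (fun t => sameSide (normalSide s) t || sameSide (normalSide s.swap) t) then l
  else normalSide s :: l

def sideReps : List (Corner × Corner) := (M.tiles.flatMap sides).foldr insertSide []

end Blueprint

namespace Surd

lemma sqrt_six_bounds : 2449 ≤ 1000 * √(6 : ℝ) ∧ 1000 * √(6 : ℝ) ≤ 2450 := by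
  constructor
  · nlinarith [sq_sqrt (show (0 : ℝ) ≤ 6 by norm_num), Real.sqrt_nonneg (6 : ℝ)]
  · nlinarith [sq_sqrt (show (0 : ℝ) ≤ 6 by norm_num), Real.sqrt_nonneg (6 : ℝ)]

lemma val_add (x y : Surd) : (x.add y).val = x.val + y.val := by
  simp only [val, add]; push_cast; ring

lemma val_sub (x y : Surd) : (x.sub y).val = x.val - y.val := by
  simp only [val, sub]; push_cast; ring

lemma val_smul (n : ℤ) (x : Surd) : (x.smul n).val = n * x.val := by
  simp only [val, smul]; push_cast; ring

lemma val_mul (x y : Surd) : (x.mul y).val = x.val * y.val := by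
  have h : √(6 : ℝ) * √6 = 6 := Real.mul_self_sqrt (by norm_num)
  simp only [val, mul]; push_cast
  linear_combination (-(x.2 : ℝ) * y.2) * h

lemma val_nonneg {x : Surd} (h : x.nonneg = true) : 0 ≤ x.val := by
  simp only [nonneg, and_eq_true, decide_eq_true_eq] at h
  obtain ⟨h₁, h₂⟩ := h
  have h₁' : (0 : ℝ) ≤ 1000 * x.1 + 2449 * x.2 := by exact_mod_cast h₁
  have h₂' : (0 : ℝ) ≤ 1000 * x.1 + 2450 * x.2 := by exact_mod_cast h₂
  obtain ⟨h₃, h₄⟩ := sqrt_six_bounds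
  simp only [val]
  nlinarith

lemma val_pos {x : Surd} (h : x.pos = true) : 0 < x.val := by
  simp only [pos, and_eq_true, decide_eq_true_eq] at h
  obtain ⟨h₁, h₂⟩ := h
  have h₁' : (0 : ℝ) < 1000 * x.1 + 2449 * x.2 := by exact_mod_cast h₁
  have h₂' : (0 : ℝ) < 1000 * x.1 + 2450 * x.2 := by exact_mod_cast h₂
  obtain ⟨h₃, h₄⟩ := sqrt_six_bounds
  simp only [val]
  rcases le_total 0 (x.2 : ℝ) with h | h <;> nlinarith

lemma val_le {x y : Surd} (h : x.le y = true) : x.val ≤ y.val := by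
  have := val_nonneg h
  rw [val_sub] at this
  linarith

lemma val_lt {x y : Surd} (h : x.lt y = true) : x.val < y.val := by
  have := val_pos h
  rw [val_sub] at this
  linarith

lemma same_iff {x y : Surd} : x.same y = true ↔ x = y := by
  simp [same, Prod.ext_iff]

lemma val_zero : val (0, 0) = 0 := by simp [val]

lemma val_intCast (n : ℤ) : val (n, 0) = n := by simp [val]

lemma val_injective : Injective val := by
  intro x y h
  have hirr : Irrational √(6 : ℝ) := by
    have := (Nat.Prime.irrational_sqrt (p := 2) (by norm_num))
    rw [show (6 : ℝ) = ((6 : ℕ) : ℝ) by norm_num]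
    rw [irrational_sqrt_natCast_iff]
    rintro ⟨r, hr⟩
    rcases Nat.lt_or_ge r 3 with h3 | h3
    · interval_cases r <;> omega
    · nlinarith
  simp only [val] at h
  by_cases h2 : x.2 = y.2
  · rw [h2] at h
    have h1 : (x.1 : ℝ) = y.1 := by linarith
    exact Prod.ext (by exact_mod_cast h1) h2
  · exfalso
    have hne : ((x.2 - y.2 : ℤ) : ℝ) ≠ 0 := by exact_mod_cast sub_ne_zero.2 h2
    apply (hirr.intCast_mul (sub_ne_zero.2 h2)).ne_int (y.1 - x.1)
    push_cast
    linarith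

end Surd

namespace Shift

noncomputable def form (f : Shift) : E3 →ₗ[ℝ] ℝ where
  toFun x := f.1 * x 0 + f.2.1 * x 1 + f.2.2 * x 2
  map_add' x y := by simp; ring
  map_smul' c x := by simp; ring

lemma form_apply (f : Shift) (x : E3) :
    form f x = f.1 * x 0 + f.2.1 * x 1 + f.2.2 * x 2 := rfl

lemma same_iff {m n : Shift} : m.same n = true ↔ m = n := by
  simp [same, Prod.ext_iff]

lemma add_eq (m n : Shift) : m.add n = m + n := rfl
lemma neg_eq (n : Shift) : n.neg = -n := rfl

lemma mem_window {n : Shift} (h₁ : |n.1| ≤ 1) (h₂ : |n.2.1| ≤ 1) (h₃ : |n.2.2| ≤ 1) :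
    n ∈ window := by
  have h : ∀ a : ℤ, |a| ≤ 1 → a = 0 ∨ a = 1 ∨ a = -1 := by
    intro a ha
    rw [abs_le] at ha
    omega
  obtain ⟨a, b, c⟩ := n
  rcases h a h₁ with rfl | rfl | rfl <;> rcases h b h₂ with rfl | rfl | rfl <;>
    rcases h c h₃ with rfl | rfl | rfl <;> decide

end Shift

namespace SurdPt

lemma val_add (p q : SurdPt) : (p.add q).val = p.val + q.val := by
  ext i; fin_cases i <;> simp [val, add, Surd.val_add]

lemma val_sub (p q : SurdPt) : (p.sub q).val = p.val - q.val := by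
  ext i; fin_cases i <;> simp [val, sub, Surd.val_sub]

lemma val_smul (n : ℤ) (p : SurdPt) : (p.smul n).val = (n : ℝ) • p.val := by
  ext i; fin_cases i <;> simp [val, smul, Surd.val_smul]

lemma val_mul (a : Surd) (p : SurdPt) : (mul a p).val = a.val • p.val := by
  ext i; fin_cases i <;> simp [val, mul, Surd.val_mul]

lemma val_zero : zero.val = 0 := by
  ext i; fin_cases i <;> simp [val, zero, Surd.val]

lemma val_dot (p q : SurdPt) : (p.dot q).val = inner ℝ p.val q.val := by
  simp [val, dot, Surd.val_mul, Surd.val_add, PiLp.inner_apply, Fin.sum_univ_three]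
  ring

lemma same_iff {p q : SurdPt} : p.same q = true ↔ p = q := by
  simp [same, Surd.same_iff, Prod.ext_iff]

lemma val_injective : Injective val := by
  intro p q h
  have h0 := congrArg (fun x : E3 => x 0) h
  have h1 := congrArg (fun x : E3 => x 1) h
  have h2 := congrArg (fun x : E3 => x 2) h
  simp only [val, PiLp.toLp_apply, Matrix.cons_val_zero, Matrix.cons_val_one, Matrix.cons_val]
    at h0 h1 h2
  exact Prod.ext (Surd.val_injective h0)
    (Prod.ext (Surd.val_injective h1) (Surd.val_injective h2))

lemma val_eval (f : Shift) (p : SurdPt) : (p.eval f).val = f.form p.val := by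
  simp [eval, Shift.form_apply, val, Surd.val]
  ring

end SurdPt

lemma Node.same_iff {A B : Node} : A.same B = true ↔ A = B := by
  simp [same, Shift.same_iff, Prod.ext_iff]

lemma Corner.same_iff {v w : Corner} : v.same w = true ↔ v = w := by
  simp [same, Node.same_iff, Prod.ext_iff]
  tauto

lemma Node.move_move (m n : Shift) (A : Node) : (A.move n).move m = A.move (n + m) := by
  simp [move, Shift.add_eq, add_assoc]

lemma Node.move_zero (A : Node) : A.move 0 = A := by
  simp [move, Shift.add_eq]

lemma Corner.move_move (m n : Shift) (v : Corner) : (v.move n).move m = v.move (n + m) := by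
  simp [move, Node.move_move]

lemma Corner.move_zero (v : Corner) : v.move 0 = v := by
  simp [move, Node.move_zero]

/-! ### Separation of convex hulls -/

def listHull {ι : Type} (p : ι → E3) (X : List ι) : Set E3 := convexHull ℝ (p '' {i | i ∈ X})

/-- Two hulls of labelled points meet in the hull of the common labels. -/
def Separated {ι : Type} (p : ι → E3) (X Y : List ι) : Prop :=
  listHull p X ∩ listHull p Y ⊆ convexHull ℝ (p '' {i | i ∈ X ∧ i ∈ Y})

lemma Separated.symm {ι : Type} {p : ι → E3} {X Y : List ι} (h : Separated p X Y) :
    Separated p Y X := by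
  intro x hx
  have := h ⟨hx.2, hx.1⟩
  simpa only [and_comm] using this

lemma separated_of_form {ι : Type} {p : ι → E3} {X Y : List ι} (l : E3 →ₗ[ℝ] ℝ) (c : ℝ)
    (hX : ∀ i ∈ X, l (p i) < c ∨ (l (p i) ≤ c ∧ i ∈ Y)) (hY : ∀ i ∈ Y, c ≤ l (p i)) :
    Separated p X Y := by
  rintro z ⟨hzX, hzY⟩
  have hX' : ∀ x ∈ p '' {i | i ∈ X}, l x ≤ c := by
    rintro _ ⟨i, hi, rfl⟩
    rcases hX i hi with h | h
    · exact h.le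
    · exact h.1
  have h₁ : l z ≤ c := by
    have hconv : Convex ℝ {x | l x ≤ c} := convex_halfSpace_le l.isLinear c
    exact convexHull_min hX' hconv hzX
  have h₂ : c ≤ l z := by
    have hconv : Convex ℝ {x | c ≤ l x} := convex_halfSpace_ge l.isLinear c
    refine convexHull_min ?_ hconv hzY
    rintro _ ⟨i, hi, rfl⟩
    exact hY i hi
  have := mem_convexHull_level (l := l) hX' hzX (le_antisymm h₁ h₂)
  refine convexHull_mono ?_ this
  rintro _ ⟨⟨i, hi, rfl⟩, hic⟩
  rcases hX i hi with h | h
  · exact absurd hic h.ne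
  · exact ⟨i, ⟨hi, h.2⟩, rfl⟩

lemma separated_of_lt {ι : Type} {p : ι → E3} {X Y : List ι} (l : E3 →ₗ[ℝ] ℝ) (a b : ℝ)
    (hab : a < b) (hX : ∀ i ∈ X, l (p i) ≤ a) (hY : ∀ i ∈ Y, b ≤ l (p i)) : Separated p X Y :=
  separated_of_form l b (fun i hi => Or.inl ((hX i hi).trans_lt hab)) hY

namespace Blueprint

variable (M : Blueprint)

noncomputable def vec (n : Shift) : E3 := (M.lat n).val

lemma vec_eq (n : Shift) :
    M.vec n = (n.1 : ℝ) • M.lam.1.val + (n.2.1 : ℝ) • M.lam.2.1.val +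
      (n.2.2 : ℝ) • M.lam.2.2.val := by
  simp [vec, lat, SurdPt.val_add, SurdPt.val_smul]

lemma vec_add (m n : Shift) : M.vec (m + n) = M.vec m + M.vec n := by
  simp only [vec_eq, Prod.fst_add, Prod.snd_add]
  push_cast
  module

lemma vec_zero : M.vec 0 = 0 := by simp [vec_eq]

lemma vec_neg (n : Shift) : M.vec (-n) = -M.vec n := by
  rw [eq_neg_iff_add_eq_zero, ← vec_add]; simp [vec_zero]

noncomputable def centerPt (A : Node) : E3 := (M.center A).val
noncomputable def cornerPt (v : Corner) : E3 := (M.place v).val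

lemma centerPt_move (n : Shift) (A : Node) : M.centerPt (A.move n) = M.centerPt A + M.vec n := by
  have : M.vec (A.2 + n) = M.vec A.2 + M.vec n := M.vec_add _ _
  simp only [centerPt, center, Node.move, SurdPt.val_add, Shift.add_eq]
  simp only [vec] at this ⊢
  rw [this, add_assoc]

/-- The position of a corner relative to the center of its solid. -/
noncomputable def relPt (j : ℕ) : E3 := (M.rel.getD j SurdPt.zero).val

lemma cornerPt_eq (v : Corner) : M.cornerPt v = M.centerPt v.1 + M.relPt v.2 := by
  simp [cornerPt, place, centerPt, relPt, SurdPt.val_add]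

lemma cornerPt_move (n : Shift) (v : Corner) :
    M.cornerPt (v.move n) = M.cornerPt v + M.vec n := by
  rw [cornerPt_eq, cornerPt_eq, Corner.move, centerPt_move, add_right_comm]

lemma form_vec (f : Shift) (n : Shift) : f.form (M.vec n) = n.1 * f.form M.lam.1.val +
    n.2.1 * f.form M.lam.2.1.val + n.2.2 * f.form M.lam.2.2.val := by
  simp [vec_eq, map_add]

structure IsDual : Prop where
  pos₁ : 0 < M.dual.1.form M.lam.1.val
  pos₂ : 0 < M.dual.2.1.form M.lam.2.1.val
  pos₃ : 0 < M.dual.2.2.form M.lam.2.2.val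
  vec₁ : ∀ n, M.dual.1.form (M.vec n) = n.1 * M.dual.1.form M.lam.1.val
  vec₂ : ∀ n, M.dual.2.1.form (M.vec n) = n.2.1 * M.dual.2.1.form M.lam.2.1.val
  vec₃ : ∀ n, M.dual.2.2.form (M.vec n) = n.2.2 * M.dual.2.2.form M.lam.2.2.val

lemma isDual_of_dualOK (h : M.dualOK = true) : M.IsDual := by
  simp only [dualOK, and_eq_true, Surd.same_iff] at h
  obtain ⟨⟨h11, h12, h13⟩, ⟨h21, h22, h23⟩, h31, h32, h33⟩ := h
  have zero {f : Shift} {p : SurdPt} (h : p.eval f = (0, 0)) : f.form p.val = 0 := by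
    rw [← SurdPt.val_eval, h, Surd.val_zero]
  have pos {f : Shift} {p : SurdPt} (h : (p.eval f).pos = true) : 0 < f.form p.val := by
    rw [← SurdPt.val_eval]; exact Surd.val_pos h
  refine ⟨pos h11, pos h22, pos h33, fun n => ?_, fun n => ?_, fun n => ?_⟩
  · rw [form_vec, zero h12, zero h13]; ring
  · rw [form_vec, zero h21, zero h23]; ring
  · rw [form_vec, zero h31, zero h32]; ring

variable {M} {ι : Type} {p : ι → SurdPt} {mv : Shift → ι → ι} {X Y : List ι}

lemma IsDual.vec_injective (h : M.IsDual) : Injective M.vec := by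
  intro m n hmn
  have h1 := h.vec₁ m
  have h2 := h.vec₂ m
  have h3 := h.vec₃ m
  rw [hmn, h.vec₁] at h1
  rw [hmn, h.vec₂] at h2
  rw [hmn, h.vec₃] at h3
  refine Prod.ext ?_ (Prod.ext ?_ ?_)
  · exact_mod_cast (mul_right_cancel₀ h.pos₁.ne' h1).symm
  · exact_mod_cast (mul_right_cancel₀ h.pos₂.ne' h2).symm
  · exact_mod_cast (mul_right_cancel₀ h.pos₃.ne' h3).symm

/-- Labelled points on which the lattice acts. -/
structure IsAction (M : Blueprint) {ι : Type} (p : ι → SurdPt) (mv : Shift → ι → ι) : Prop where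
  move : ∀ n i, (p (mv n i)).val = (p i).val + M.vec n
  zero : ∀ i, mv 0 i = i
  add : ∀ m n i, mv m (mv n i) = mv (n + m) i

lemma isAction_node : M.IsAction M.center Node.move :=
  ⟨M.centerPt_move, Node.move_zero, Node.move_move⟩

lemma isAction_corner : M.IsAction M.place Corner.move :=
  ⟨M.cornerPt_move, Corner.move_zero, Corner.move_move⟩

lemma IsAction.mv_injective (hp : M.IsAction p mv) (n : Shift) : Injective (mv n) := by
  intro i j h
  have := congrArg (mv (-n)) h
  simpa [hp.add, hp.zero] using this

lemma IsAction.image_map (hp : M.IsAction p mv) (n : Shift) (s : Set ι) :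
    (fun i => (p i).val) '' (mv n '' s) = translate (M.vec n) ((fun i => (p i).val) '' s) := by
  simp only [translate, Set.image_image, hp.move, add_comm]

lemma convexHull_translate (l : E3) (s : Set E3) :
    convexHull ℝ (translate l s) = translate l (convexHull ℝ s) := by
  simpa [translate, Set.image_vadd.symm] using convexHull_vadd (𝕜 := ℝ) l s

lemma setOf_mem_map {ι κ : Type} (f : ι → κ) (X : List ι) :
    {j | j ∈ X.map f} = f '' {i | i ∈ X} := by
  ext j; simp

lemma IsAction.listHull_map (hp : M.IsAction p mv) (n : Shift) (X : List ι) :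
    listHull (fun i => (p i).val) (X.map (mv n)) =
      translate (M.vec n) (listHull (fun i => (p i).val) X) := by
  rw [listHull, listHull, setOf_mem_map, hp.image_map, convexHull_translate]

lemma IsAction.separated_map (hp : M.IsAction p mv) (n : Shift)
    (h : Separated (fun i => (p i).val) X Y) :
    Separated (fun i => (p i).val) (X.map (mv n)) (Y.map (mv n)) := by
  unfold Separated at h ⊢
  have hset : {i | i ∈ X.map (mv n) ∧ i ∈ Y.map (mv n)} = mv n '' {i | i ∈ X ∧ i ∈ Y} := by
    ext j
    simp only [mem_map, mem_ofPred_eq, Set.mem_image]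
    constructor
    · rintro ⟨⟨i, hi, rfl⟩, k, hk, hki⟩
      exact ⟨i, ⟨hi, hp.mv_injective n hki ▸ hk⟩, rfl⟩
    · rintro ⟨i, ⟨h1, h2⟩, rfl⟩
      exact ⟨⟨i, h1, rfl⟩, i, h2, rfl⟩
  rw [hp.listHull_map, hp.listHull_map, hset, hp.image_map, convexHull_translate,
    ← translate_inter]
  exact image_mono h

lemma sepBy_sound {ι : Type} {p : ι → E3} {same : ι → ι → Bool}
    (hsame : ∀ i j, same i j = true → i = j) {X Y : List ι} {f g : ι → Surd} (l : E3 →ₗ[ℝ] ℝ)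
    (hf : ∀ i, (f i).val = l (p i)) {Y' : List ι} {t : ι → ι} (hY' : Y' = Y.map t)
    (hg : ∀ i, (g i).val = l (p (t i)))
    (h : sepBy same (X.map fun i => (i, f i)) (Y.map fun i => (t i, g i)) = true) :
    Separated p X Y' := by
  unfold sepBy at h
  split at h
  · simp at h
  · rename_i y L hy
    simp only [and_eq_true] at h
    obtain ⟨h1, h2⟩ := h
    generalize L.foldl (fun a b => Surd.min a b.2) y.2 = c at h1 h2
    simp only [all_map, all_eq_true, Function.comp, List.any_map, or_eq_true,
      and_eq_true, any_eq_true] at h1 h2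
    refine separated_of_form l c.val (fun i hi => ?_) ?_
    · rcases h2 i hi with h | ⟨h, j, hj, hij⟩
      · left; rw [← hf]; exact Surd.val_lt h
      · right
        refine ⟨by rw [← hf]; exact Surd.val_le h, ?_⟩
        rw [hsame _ _ hij, hY']
        exact mem_map_of_mem hj
    · intro i hi
      rw [hY'] at hi
      obtain ⟨j, hj, rfl⟩ := mem_map.1 hi
      rw [← hg]
      exact Surd.val_le (h1 j hj)

def InBox (M : Blueprint) {ι : Type} (p : ι → SurdPt) (X : List ι) : Prop :=
  ∀ i ∈ X, (((M.mkCell p X).box.1.1.val ≤ M.dual.1.form (p i).val ∧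
      M.dual.1.form (p i).val ≤ (M.mkCell p X).box.1.2.val) ∧
    ((M.mkCell p X).box.2.1.1.val ≤ M.dual.2.1.form (p i).val ∧
      M.dual.2.1.form (p i).val ≤ (M.mkCell p X).box.2.1.2.val)) ∧
    ((M.mkCell p X).box.2.2.1.val ≤ M.dual.2.2.form (p i).val ∧
      M.dual.2.2.form (p i).val ≤ (M.mkCell p X).box.2.2.2.val)

lemma bounds_sound {f : Shift} {B : Bounds}
    (h : boundsOK f B (X.map fun i => (i, p i)) = true) {i : ι} (hi : i ∈ X) :
    B.1.val ≤ f.form (p i).val ∧ f.form (p i).val ≤ B.2.val := by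
  simp only [boundsOK, all_map, all_eq_true, Function.comp, and_eq_true] at h
  obtain ⟨h1, h2⟩ := h i hi
  rw [← SurdPt.val_eval]
  exact ⟨Surd.val_le h1, Surd.val_le h2⟩

lemma separated_of_apart (hp : M.IsAction p mv) {n f : Shift} {a a' b b' : ℝ}
    (hX : ∀ i ∈ X, a ≤ f.form (p i).val ∧ f.form (p i).val ≤ a')
    (hY : ∀ i ∈ Y, b ≤ f.form (p i).val ∧ f.form (p i).val ≤ b')
    (h : a' < b + f.form (M.vec n) ∨ b' + f.form (M.vec n) < a) :
    Separated (fun i => (p i).val) X (Y.map (mv n)) := by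
  have hY' : ∀ i ∈ Y.map (mv n), b + f.form (M.vec n) ≤ f.form (p i).val ∧
      f.form (p i).val ≤ b' + f.form (M.vec n) := by
    intro i hi
    obtain ⟨j, hj, rfl⟩ := mem_map.1 hi
    rw [hp.move, map_add]
    exact ⟨by linarith [(hY j hj).1], by linarith [(hY j hj).2]⟩
  rcases h with h | h
  · exact separated_of_lt f.form _ _ h (fun i hi => (hX i hi).2) fun i hi => (hY' i hi).1
  · exact (separated_of_lt f.form _ _ h (fun i hi => (hY' i hi).2) fun i hi => (hX i hi).1).symm

lemma apart_sound {B C : Bounds} {s : Surd} (h : apart B C s = true) :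
    B.2.val < C.1.val + s.val ∨ C.2.val + s.val < B.1.val := by
  simp only [apart, or_eq_true] at h
  rw [← Surd.val_add, ← Surd.val_add]
  exact h.imp Surd.val_lt Surd.val_lt

lemma separated_sound (hp : M.IsAction p mv) {same : ι → ι → Bool}
    (hsame : ∀ i j, same i j = true → i = j) {n : Shift} (hX : M.InBox p X) (hY : M.InBox p Y)
    (h : M.separated same mv (M.mkCell p X) (M.mkCell p Y) n = true) :
    Separated (fun i => (p i).val) X (Y.map (mv n)) := by
  simp only [separated, farApart, or_eq_true, any_eq_true] at h
  rcases h with (h | h | h) | ⟨f, -, h⟩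
  · refine separated_of_apart hp (f := M.dual.1) (fun i hi => (hX i hi).1.1)
      (fun i hi => (hY i hi).1.1) ?_
    rw [show M.vec n = (M.lat n).val from rfl, ← SurdPt.val_eval]
    exact apart_sound h
  · refine separated_of_apart hp (f := M.dual.2.1) (fun i hi => (hX i hi).1.2)
      (fun i hi => (hY i hi).1.2) ?_
    rw [show M.vec n = (M.lat n).val from rfl, ← SurdPt.val_eval]
    exact apart_sound h
  · refine separated_of_apart hp (f := M.dual.2.2) (fun i hi => (hX i hi).2)
      (fun i hi => (hY i hi).2) ?_
    rw [show M.vec n = (M.lat n).val from rfl, ← SurdPt.val_eval]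
    exact apart_sound h
  · simp only [mkCell, map_map, comp_def] at h
    refine sepBy_sound hsame (p := fun i => (p i).val) f.form (f := fun i => (p i).eval f)
      (fun i => SurdPt.val_eval f (p i))
      rfl (g := fun i => ((p i).eval f).add ((M.lat n).eval f)) (fun i => ?_) h
    rw [Surd.val_add, SurdPt.val_eval, SurdPt.val_eval, hp.move, map_add]
    rfl

lemma separated_of_far (hp : M.IsAction p mv) {n f : Shift} {k : ℤ} {s a a' b b' : ℝ}
    (hX : ∀ i ∈ X, a ≤ f.form (p i).val ∧ f.form (p i).val ≤ a')
    (hY : ∀ i ∈ Y, b ≤ f.form (p i).val ∧ f.form (p i).val ≤ b') (hs : 0 < s)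
    (hf : f.form (M.vec n) = k * s) (h₁ : a' < b + 2 * s) (h₂ : b' < a + 2 * s)
    (hk : ¬ |k| ≤ 1) : Separated (fun i => (p i).val) X (Y.map (mv n)) := by
  refine separated_of_apart hp hX hY ?_
  rw [hf]
  rw [abs_le, not_and_or, not_le, not_le] at hk
  rcases hk with hk | hk
  · right
    have : (k : ℝ) ≤ -2 := by exact_mod_cast (show k ≤ -2 by omega)
    nlinarith
  · left
    have : (2 : ℝ) ≤ k := by exact_mod_cast (show 2 ≤ k by omega)
    nlinarith

lemma near_sound {𝒳 : List (List ι)}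
    (h : M.near (𝒳.map (M.mkCell p)) = true) :
    (∀ X ∈ 𝒳, M.InBox p X) ∧ ∀ X ∈ 𝒳, ∀ Y ∈ 𝒳,
      ((M.mkCell p X).box.1.2.val < (M.mkCell p Y).box.1.1.val + 2 * M.dual.1.form M.lam.1.val) ∧
      ((M.mkCell p X).box.2.1.2.val <
        (M.mkCell p Y).box.2.1.1.val + 2 * M.dual.2.1.form M.lam.2.1.val) ∧
      ((M.mkCell p X).box.2.2.2.val <
        (M.mkCell p Y).box.2.2.1.val + 2 * M.dual.2.2.form M.lam.2.2.val) := by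
  simp only [near, and_eq_true, all_map, all_eq_true, Function.comp] at h
  obtain ⟨h1, h2⟩ := h
  refine ⟨fun X hX i hi => ?_, fun X hX Y hY => ?_⟩
  · obtain ⟨ha, hb, hc⟩ := h1 X hX
    exact ⟨⟨bounds_sound ha hi, bounds_sound hb hi⟩, bounds_sound hc hi⟩
  · obtain ⟨ha, hb, hc⟩ := h2 X hX Y hY
    have ha' := Surd.val_lt ha
    have hb' := Surd.val_lt hb
    have hc' := Surd.val_lt hc
    simp only [Surd.val_add, Surd.val_smul, SurdPt.val_eval] at ha' hb' hc'
    push_cast at ha' hb' hc'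
    exact ⟨ha', hb', hc'⟩

lemma sepCheck_window (hp : M.IsAction p mv) {same : ι → ι → Bool}
    (hsame : ∀ i j, same i j = true → i = j) :
    ∀ {𝒳 : List (List ι)}, (∀ X ∈ 𝒳, M.InBox p X) →
      M.sepCheck same mv (𝒳.map (M.mkCell p)) = true → ∀ X ∈ 𝒳, ∀ Y ∈ 𝒳, ∀ n,
        (∀ m : Shift, m = n ∨ m = -n → m ∈ Shift.window) → (X = Y ∧ n = 0) ∨
        Separated (fun i => (p i).val) X (Y.map (mv n))
  | [], _, _, X, hX => by simp at hX
  | Z :: 𝒳, hb, h, X, hX => by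
    simp only [map_cons, sepCheck, and_eq_true, all_map, all_eq_true,
      or_eq_true, Function.comp] at h
    obtain ⟨h1, h2, h3⟩ := h
    intro Y hY n hn
    rcases mem_cons.1 hX with rfl | hX'
    · rcases mem_cons.1 hY with rfl | hY
      · rcases h1 n (hn n (Or.inl rfl)) with h | h
        · exact Or.inl ⟨rfl, Shift.same_iff.1 h⟩
        · exact Or.inr (separated_sound hp hsame (hb _ (by simp)) (hb _ (by simp)) h)
      · exact Or.inr (separated_sound hp hsame (hb _ (by simp)) (hb _ (by simp [hY]))
          (h2 Y hY n (hn n (Or.inl rfl))))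
    · rcases mem_cons.1 hY with rfl | hY
      · right
        have := hp.separated_map n (separated_sound hp hsame (hb _ (by simp)) (hb _ (by simp [hX']))
          (h2 X hX' (-n) (hn _ (Or.inr rfl))))
        rw [map_map] at this
        have hid : (mv n ∘ mv (-n)) = id := by
          funext i; simp [hp.add, hp.zero]
        rw [hid, map_id] at this
        exact this.symm
      · exact sepCheck_window hp hsame (fun X hX => hb X (by simp [hX])) h3 X hX' Y hY n hn

lemma sepCheck_sound (hd : M.IsDual) (hp : M.IsAction p mv) {same : ι → ι → Bool}
    (hsame : ∀ i j, same i j = true → i = j) {𝒳 : List (List ι)}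
    (hnear : M.near (𝒳.map (M.mkCell p)) = true)
    (h : M.sepCheck same mv (𝒳.map (M.mkCell p)) = true) (hX : X ∈ 𝒳)
    (hY : Y ∈ 𝒳) (m n : Shift) :
    (X = Y ∧ m = n) ∨ Separated (fun i => (p i).val) (X.map (mv m)) (Y.map (mv n)) := by
  obtain ⟨hb, hr⟩ := near_sound hnear
  obtain ⟨rX, rX', rX''⟩ := hr X hX Y hY
  obtain ⟨rY, rY', rY''⟩ := hr Y hY X hX
  have key : (X = Y ∧ n - m = 0) ∨ Separated (fun i => (p i).val) X (Y.map (mv (n - m))) := by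
    by_cases h1 : |(n - m).1| ≤ 1
    swap
    · exact Or.inr (separated_of_far hp (fun i hi => (hb X hX i hi).1.1)
        (fun i hi => (hb Y hY i hi).1.1) hd.pos₁ (hd.vec₁ _) rX rY h1)
    by_cases h2 : |(n - m).2.1| ≤ 1
    swap
    · exact Or.inr (separated_of_far hp (fun i hi => (hb X hX i hi).1.2)
        (fun i hi => (hb Y hY i hi).1.2) hd.pos₂ (hd.vec₂ _) rX' rY' h2)
    by_cases h3 : |(n - m).2.2| ≤ 1
    swap
    · exact Or.inr (separated_of_far hp (fun i hi => (hb X hX i hi).2)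
        (fun i hi => (hb Y hY i hi).2) hd.pos₃ (hd.vec₃ _) rX'' rY'' h3)
    refine sepCheck_window hp hsame hb h X hX Y hY (n - m) ?_
    rintro k (rfl | rfl)
    · exact Shift.mem_window h1 h2 h3
    · apply Shift.mem_window
      · rwa [Prod.fst_neg, abs_neg]
      · rwa [Prod.snd_neg, Prod.fst_neg, abs_neg]
      · rwa [Prod.snd_neg, Prod.snd_neg, abs_neg]
  rcases key with ⟨h1, h2⟩ | h
  · exact Or.inl ⟨h1, (sub_eq_zero.1 h2).symm⟩
  · right
    have := hp.separated_map m h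
    rw [map_map] at this
    convert this using 2
    funext i
    simp [hp.add]

end Blueprint

/-! ### The facets of a convex hull -/

lemma linearIndependent_three_of_form {u v x : E3} (h : LinearIndependent ℝ ![u, v])
    {m : E3 →ₗ[ℝ] ℝ} (hu : m u = 0) (hv : m v = 0) (hx : m x ≠ 0) :
    LinearIndependent ℝ ![u, v, x] := by
  rw [Fintype.linearIndependent_iff]
  intro g hg
  rw [Fin.sum_univ_three] at hg
  simp only [Matrix.cons_val_zero, Matrix.cons_val_one, Matrix.cons_val] at hg
  have h2 : g 2 = 0 := by
    have := congrArg m hg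
    simp only [map_add, map_smul, hu, hv, smul_eq_mul, mul_zero, zero_add, map_zero] at this
    exact (mul_eq_zero.1 this).resolve_right hx
  rw [h2, zero_smul, add_zero] at hg
  obtain ⟨h0, h1⟩ := LinearIndependent.pair_iff.1 h _ _ hg
  intro i
  fin_cases i
  · exact h0
  · exact h1
  · exact h2

lemma span_three_eq_top {u v x : E3} (h : LinearIndependent ℝ ![u, v, x]) :
    Submodule.span ℝ {u, v, x} = ⊤ := by
  have := h.span_eq_top_of_card_eq_finrank (by simp)
  rw [← this]
  congr 1
  ext y
  simp [eq_comm]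
  tauto

lemma form_proportional {u v x : E3} (h : LinearIndependent ℝ ![u, v])
    {l m : E3 →ₗ[ℝ] ℝ} (hlu : l u = 0) (hlv : l v = 0) (hu : m u = 0) (hv : m v = 0)
    (hx : m x ≠ 0) (y : E3) : l y = l x / m x * m y := by
  have key : l = (l x / m x) • m := by
    apply LinearMap.ext_on (span_three_eq_top (linearIndependent_three_of_form h hu hv hx))
    rintro z (rfl | rfl | rfl)
    · simp [hlu, hu]
    · simp [hlv, hv]
    · simp [hx]
  conv_lhs => rw [key]
  simp

lemma vectorSpan_eq_top_of_form {s : Set E3} {a b c x : E3} (ha : a ∈ s) (hb : b ∈ s) (hc : c ∈ s)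
    (hx : x ∈ s) (h : LinearIndependent ℝ ![b - a, c - a]) {m : E3 →ₗ[ℝ] ℝ}
    (hu : m (b - a) = 0) (hv : m (c - a) = 0) (hm : m (x - a) ≠ 0) : vectorSpan ℝ s = ⊤ := by
  rw [eq_top_iff, ← span_three_eq_top (linearIndependent_three_of_form h hu hv hm),
    Submodule.span_le]
  rintro z (rfl | rfl | rfl)
  · exact vsub_mem_vectorSpan ℝ hb ha
  · exact vsub_mem_vectorSpan ℝ hc ha
  · exact vsub_mem_vectorSpan ℝ hx ha

lemma interior_convexHull_nonempty_of_vectorSpan {s : Set E3} (hs : s.Nonempty)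
    (h : vectorSpan ℝ s = ⊤) : (interior (convexHull ℝ s)).Nonempty := by
  rw [interior_convexHull_nonempty_iff_affineSpan_eq_top]
  exact (AffineSubspace.affineSpan_eq_top_iff_vectorSpan_eq_top_of_nonempty ℝ E3 E3 hs).2 h

/-- A facet of a hull is known if the plane of any three points of it is either known to split the
points or to be the plane of a known facet. -/
lemma mem_facets_convexHull {V : Set E3} {o : E3} {r : ℝ} (hV : ∀ x ∈ V, dist x o = r)
    {𝒲 : Set (Set E3)}
    (h𝒲 : ∀ W ∈ 𝒲, ∃ m : E3 →ₗ[ℝ] ℝ, ∃ c : ℝ, (∀ x ∈ V, m x ≤ c) ∧ W = {x ∈ V | m x = c} ∧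
      ∃ x ∈ V, m x < c)
    (hT : ∀ Q : Set E3, Q ⊆ V → ∀ a ∈ Q, ∀ b ∈ Q, ∀ c ∈ Q, a ≠ b → a ≠ c → b ≠ c →
      ∃ a ∈ Q, ∃ b ∈ Q, ∃ c ∈ Q, a ≠ b ∧ a ≠ c ∧ b ≠ c ∧
      ((∃ W ∈ 𝒲, a ∈ W ∧ b ∈ W ∧ c ∈ W) ∨ ∃ m : E3 →ₗ[ℝ] ℝ, m (b - a) = 0 ∧ m (c - a) = 0 ∧
        ∃ x ∈ V, ∃ y ∈ V, 0 < m (x - a) ∧ m (y - a) < 0)) {F : Set E3}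
    (hF : F ∈ facets (convexHull ℝ V)) : ∃ W ∈ 𝒲, F = convexHull ℝ W := by
  obtain ⟨hexp, hne, hdim⟩ := hF
  obtain ⟨l, M, hl, hFl⟩ := exists_of_isExposed_convexHull hexp hne
  rw [hFl, vectorSpan_convexHull] at hdim
  obtain ⟨a, ha, b, hb, c, hc, hli⟩ := exists_linearIndependent_sub hdim.ge
  have hab : a ≠ b := by
    rintro rfl
    exact hli.ne_zero 0 (by simp)
  have hac : a ≠ c := by
    rintro rfl
    exact hli.ne_zero 1 (by simp)
  have hbc : b ≠ c := by
    rintro rfl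
    have := hli.injective.ne (show (0 : Fin 2) ≠ 1 by decide)
    simp at this
  obtain ⟨a, ha, b, hb, c, hc, hab, hac, hbc, h⟩ := hT _ (Set.sep_subset _ _) a ha b hb c hc
    hab hac hbc
  have hli : LinearIndependent ℝ ![b - a, c - a] :=
    linearIndependent_sub_of_sphere (hV a ha.1) (hV b hb.1) (hV c hc.1) hab hac hbc
  have hlu : l.toLinearMap (b - a) = 0 := by
    have h1 := ha.2; have h2 := hb.2
    simp only [ContinuousLinearMap.coe_coe, map_sub]; linarith
  have hlv : l.toLinearMap (c - a) = 0 := by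
    have h1 := ha.2; have h2 := hc.2
    simp only [ContinuousLinearMap.coe_coe, map_sub]; linarith
  have hnot : ∀ (m : E3 →ₗ[ℝ] ℝ) (x : E3), m (b - a) = 0 → m (c - a) = 0 → m (x - a) ≠ 0 →
      x ∈ V → l (x - a) ≠ 0 := by
    intro m x hmu hmv hmx hx h0
    have hx' : x ∈ {x ∈ V | l x = M} := ⟨hx, by
      have := ha.2
      rw [map_sub] at h0; linarith⟩
    have htop := vectorSpan_eq_top_of_form ha hb hc hx' hli hmu hmv hmx
    rw [htop, finrank_top] at hdim
    simp at hdim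
  have hle : ∀ x ∈ V, l (x - a) ≤ 0 := by
    intro x hx
    have := ha.2; have := hl x hx
    rw [map_sub]; linarith
  rcases h with ⟨W, hW, haW, hbW, hcW⟩ | ⟨m, hmu, hmv, x, hx, y, hy, hmx, hmy⟩
  · obtain ⟨m, d, hmd, hWm, x, hx, hmx⟩ := h𝒲 W hW
    rw [hWm] at haW hbW hcW
    have hmu : m (b - a) = 0 := by
      have h1 := haW.2; have h2 := hbW.2
      rw [map_sub]; linarith
    have hmv : m (c - a) = 0 := by
      have h1 := haW.2; have h2 := hcW.2
      rw [map_sub]; linarith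
    have hmx' : m (x - a) < 0 := by
      have h1 := haW.2
      rw [map_sub]; linarith
    have hprop := form_proportional hli hlu hlv hmu hmv hmx'.ne
    have hk : 0 < l (x - a) / m (x - a) :=
      div_pos_of_neg_of_neg (lt_of_le_of_ne (hle x hx) (hnot m x hmu hmv hmx'.ne hx)) hmx'
    refine ⟨W, hW, ?_⟩
    rw [hFl, hWm]
    congr 1
    ext z
    refine and_congr_right fun hz => ?_
    have h1 := hprop (z - a)
    have h2 := ha.2
    have h3 := haW.2
    simp only [ContinuousLinearMap.coe_coe, map_sub] at h1 hk
    constructor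
    · intro h4
      have : (l x - l a) / (m x - m a) * (m z - m a) = 0 := by rw [← h1]; linarith
      have := (mul_eq_zero.1 this).resolve_left hk.ne'
      linarith
    · intro h4
      rw [h4, h3, sub_self, mul_zero] at h1
      linarith
  · exfalso
    have h1 := form_proportional hli hlu hlv hmu hmv hmx.ne' (y - a)
    have h2 : l (x - a) < 0 := lt_of_le_of_ne (hle x hx) (hnot m x hmu hmv hmx.ne' hx)
    have h3 := hle y hy
    have h4 : 0 < l.toLinearMap (x - a) / m (x - a) * m (y - a) :=
      mul_pos_of_neg_of_neg (div_neg_of_neg_of_pos h2 hmx) hmy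
    rw [← h1] at h4
    exact absurd h3 (not_le.2 h4)

namespace Blueprint

lemma pairsAll_sound {α : Type} {r : α → α → Bool} : ∀ {l : List α}, pairsAll r l = true →
    ∀ a ∈ l, ∀ b ∈ l, a ≠ b → r a b = true ∨ r b a = true
  | [], _, a, ha => by simp at ha
  | c :: l, h, a, ha => by
    simp only [pairsAll, and_eq_true, all_eq_true] at h
    intro b hb hab
    rcases mem_cons.1 ha with ha' | ha'
    · rcases mem_cons.1 hb with hb' | hb'
      · exact absurd (ha'.trans hb'.symm) hab
      · exact Or.inl (ha' ▸ h.1 b hb')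
    · rcases mem_cons.1 hb with hb' | hb'
      · exact Or.inr (hb' ▸ h.1 a ha')
      · exact pairsAll_sound h.2 a ha' b hb' hab

lemma triplesAll_sound {α : Type} {r : α → α → α → Bool} {Q : α → Prop} : ∀ {l : List α},
    triplesAll r l = true → ∀ a ∈ l, ∀ b ∈ l, ∀ c ∈ l, a ≠ b → a ≠ c → b ≠ c → Q a → Q b → Q c →
    ∃ a ∈ l, ∃ b ∈ l, ∃ c ∈ l, (a ≠ b ∧ a ≠ c ∧ b ≠ c) ∧ (Q a ∧ Q b ∧ Q c) ∧ r a b c = true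
  | [], _, a, ha => by simp at ha
  | d :: l, h, a, ha => by
    simp only [triplesAll, and_eq_true] at h
    intro b hb c hc hab hac hbc hQa hQb hQc
    have pair : ∀ x ∈ l, ∀ y ∈ l, d ≠ x → d ≠ y → x ≠ y → Q d → Q x → Q y →
        ∃ a ∈ d :: l, ∃ b ∈ d :: l, ∃ c ∈ d :: l, (a ≠ b ∧ a ≠ c ∧ b ≠ c) ∧ (Q a ∧ Q b ∧ Q c) ∧
          r a b c = true := by
      intro x hx y hy hdx hdy hxy hQd hQx hQy
      rcases pairsAll_sound h.1 x hx y hy hxy with h | h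
      · exact ⟨d, by simp, x, by simp [hx], y, by simp [hy], ⟨hdx, hdy, hxy⟩, ⟨hQd, hQx, hQy⟩, h⟩
      · exact ⟨d, by simp, y, by simp [hy], x, by simp [hx], ⟨hdy, hdx, hxy.symm⟩,
          ⟨hQd, hQy, hQx⟩, h⟩
    by_cases ha' : a = d
    · subst ha'
      exact pair b ((mem_cons.1 hb).resolve_left hab.symm) c
        ((mem_cons.1 hc).resolve_left hac.symm) hab hac hbc hQa hQb hQc
    by_cases hb' : b = d
    · subst hb'
      exact pair a ((mem_cons.1 ha).resolve_left ha') c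
        ((mem_cons.1 hc).resolve_left hbc.symm) hab.symm hbc hac hQb hQa hQc
    by_cases hc' : c = d
    · subst hc'
      exact pair a ((mem_cons.1 ha).resolve_left ha') b
        ((mem_cons.1 hb).resolve_left hb') hac.symm hbc.symm hab hQc hQa hQb
    obtain ⟨x, hx, y, hy, z, hz, h⟩ := triplesAll_sound h.2 a ((mem_cons.1 ha).resolve_left ha')
      b ((mem_cons.1 hb).resolve_left hb') c ((mem_cons.1 hc).resolve_left hc')
      hab hac hbc hQa hQb hQc
    exact ⟨x, by simp [hx], y, by simp [hy], z, by simp [hz], h⟩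

lemma inner_cross_left (p q : SurdPt) : inner ℝ (p.cross q).val p.val = 0 := by
  simp [SurdPt.val, SurdPt.cross, Surd.val_sub, Surd.val_mul, PiLp.inner_apply, Fin.sum_univ_three]
  ring

lemma inner_cross_right (p q : SurdPt) : inner ℝ (p.cross q).val q.val = 0 := by
  simp [SurdPt.val, SurdPt.cross, Surd.val_sub, Surd.val_mul, PiLp.inner_apply, Fin.sum_univ_three]
  ring

section

variable {ι : Type} {same : ι → ι → Bool} {p : ι → SurdPt}

lemma any_same_iff (hsame : ∀ i j, same i j = true ↔ i = j) {L : List ι} {i : ι} :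
    L.any (same i) = true ↔ i ∈ L := by
  simp [hsame]

lemma facetOK_sound (hsame : ∀ i j, same i j = true ↔ i = j) {X F : List ι}
    (h : facetOK same p X F = true) : F ⊆ X ∧ ∃ a ∈ F, ∃ b ∈ F, ∃ c ∈ F, ∃ w : E3,
      (p a).val ≠ (p b).val ∧ (p a).val ≠ (p c).val ∧ (p b).val ≠ (p c).val ∧
      (∃ x ∈ X, x ∉ F) ∧ (∀ x ∈ F, inner ℝ w ((p x).val - (p a).val) = 0) ∧
      ∀ x ∈ X, x ∉ F → inner ℝ w ((p x).val - (p a).val) < 0 := by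
  unfold facetOK at h
  split at h
  · rename_i F a b c L
    simp only [and_eq_true, or_eq_true, all_eq_true, any_same_iff hsame,
      any_eq_true (p := fun x => !_), not_eq_true', ← not_eq_true] at h
    obtain ⟨h1, ⟨x, hx, hxF⟩, h2⟩ := h
    have hw : (planeNormal (p a) (p b) (p c)).val ≠ 0 := by
      intro h0
      rcases h2 with h2 | h2 <;> have := h2 x hx <;>
        rw [if_neg (mt (any_same_iff hsame).1 hxF)] at this <;> have := Surd.val_pos this
      · rw [SurdPt.val_dot, h0, inner_zero_left] at this
        exact this.false
      · rw [Surd.val_smul, SurdPt.val_dot, h0, inner_zero_left, mul_zero] at this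
        exact this.false
    refine ⟨h1, a, by simp, b, by simp, c, by simp, ?_⟩
    obtain ⟨hab, hac, hbc⟩ : (p a).val ≠ (p b).val ∧ (p a).val ≠ (p c).val ∧
        (p b).val ≠ (p c).val := by
      refine ⟨?_, ?_, ?_⟩ <;> intro h0 <;> apply hw <;>
        rw [SurdPt.val_injective h0, ← SurdPt.val_zero] <;> congr 1 <;>
        simp only [planeNormal, SurdPt.cross, SurdPt.sub, Surd.sub, Surd.mul, SurdPt.zero,
          Prod.mk.injEq] <;> refine ⟨⟨?_, ?_⟩, ⟨?_, ?_⟩, ?_, ?_⟩ <;> ring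
    rcases h2 with h2 | h2
    · refine ⟨-(planeNormal (p a) (p b) (p c)).val, hab, hac, hbc, ⟨x, hx, hxF⟩, fun y hy => ?_,
        fun y hy hyF => ?_⟩
      · have := h2 y (h1 y hy)
        rw [if_pos ((any_same_iff hsame).2 hy), Surd.same_iff] at this
        rw [inner_neg_left, ← SurdPt.val_sub, ← SurdPt.val_dot, this, Surd.val_zero, neg_zero]
      · have := h2 y hy
        rw [if_neg (mt (any_same_iff hsame).1 hyF)] at this
        rw [inner_neg_left, ← SurdPt.val_sub, ← SurdPt.val_dot]
        linarith [Surd.val_pos this]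
    · refine ⟨(planeNormal (p a) (p b) (p c)).val, hab, hac, hbc, ⟨x, hx, hxF⟩, fun y hy => ?_,
        fun y hy hyF => ?_⟩
      · have := h2 y (h1 y hy)
        rw [if_pos ((any_same_iff hsame).2 hy), Surd.same_iff] at this
        rw [← SurdPt.val_sub, ← SurdPt.val_dot, this, Surd.val_zero]
      · have := h2 y hy
        rw [if_neg (mt (any_same_iff hsame).1 hyF)] at this
        have := Surd.val_pos this
        rw [Surd.val_smul] at this
        rw [← SurdPt.val_sub, ← SurdPt.val_dot]
        push_cast at this
        linarith
  · simp at h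

lemma tripleOK_sound (hsame : ∀ i j, same i j = true ↔ i = j) {X : List ι} {Fs : List (List ι)}
    {a b c : ι} (h : tripleOK same p X Fs a b c = true) :
    (∃ F ∈ Fs, a ∈ F ∧ b ∈ F ∧ c ∈ F) ∨ ∃ w : E3, inner ℝ w ((p b).val - (p a).val) = 0 ∧
      inner ℝ w ((p c).val - (p a).val) = 0 ∧ ∃ x ∈ X, ∃ y ∈ X,
        0 < inner ℝ w ((p x).val - (p a).val) ∧ inner ℝ w ((p y).val - (p a).val) < 0 := by
  simp only [tripleOK, or_eq_true, and_eq_true, any_same_iff hsame,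
    any_eq_true (p := fun F => _ && _), any_eq_true (p := fun x => Surd.pos _)] at h
  refine h.imp id ?_
  rintro ⟨⟨x, hx, h1⟩, y, hy, h2⟩
  refine ⟨(planeNormal (p a) (p b) (p c)).val, ?_, ?_, x, hx, y, hy, ?_, ?_⟩
  · rw [← SurdPt.val_sub]; exact inner_cross_left _ _
  · rw [← SurdPt.val_sub]; exact inner_cross_right _ _
  · rw [← SurdPt.val_sub, ← SurdPt.val_dot]; exact Surd.val_pos h1
  · have := Surd.val_pos h2
    rw [Surd.val_smul] at this
    rw [← SurdPt.val_sub, ← SurdPt.val_dot]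
    push_cast at this
    linarith

end

lemma facetCheck_sound {ι : Type} {same : ι → ι → Bool} (hsame : ∀ i j, same i j = true ↔ i = j)
    {p : ι → SurdPt} {X : List ι} {Fs : List (List ι)} (hne : Fs ≠ []) {o : E3} {r : ℝ}
    (hX : ∀ i ∈ X, dist (p i).val o = r)
    (hinj : ∀ i ∈ X, ∀ j ∈ X, (p i).val = (p j).val → i = j) (h : facetCheck same p X Fs = true) :
    (interior (listHull (fun i => (p i).val) X)).Nonempty ∧
      ∀ F, F ∈ facets (listHull (fun i => (p i).val) X) ↔
        ∃ L ∈ Fs, F = listHull (fun i => (p i).val) L := by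
  simp only [facetCheck, and_eq_true, all_eq_true] at h
  obtain ⟨h1, h2⟩ := h
  have hV : ∀ x ∈ (fun i => (p i).val) '' {i | i ∈ X}, dist x o = r := by
    rintro _ ⟨i, hi, rfl⟩; exact hX i hi
  have key : ∀ L ∈ Fs, L ⊆ X ∧ ∃ a ∈ L, ∃ b ∈ L, ∃ c ∈ L, (p a).val ≠ (p b).val ∧
      (p a).val ≠ (p c).val ∧ (p b).val ≠ (p c).val ∧ ∃ w : E3, ∃ M : ℝ,
      inner ℝ w (p a).val = M ∧ inner ℝ w (p b).val = M ∧ inner ℝ w (p c).val = M ∧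
      (∃ i ∈ X, inner ℝ w (p i).val < M) ∧ (∀ i ∈ X, inner ℝ w (p i).val ≤ M) ∧
      (fun i => (p i).val) '' {i | i ∈ L} =
        {x ∈ (fun i => (p i).val) '' {i | i ∈ X} | inner ℝ w x = M} := by
    intro L hL
    obtain ⟨hLX, a, ha, b, hb, c, hc, w, hab, hac, hbc, ⟨x, hx, hxL⟩, hon, hoff⟩ :=
      facetOK_sound hsame (h1 L hL)
    have hon' : ∀ i ∈ L, inner ℝ w (p i).val = inner ℝ w (p a).val := fun i hi => by
      have := hon i hi
      rw [inner_sub_right] at this; linarith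
    have hoff' : ∀ i ∈ X, i ∉ L → inner ℝ w (p i).val < inner ℝ w (p a).val := fun i hi hiL => by
      have := hoff i hi hiL
      rw [inner_sub_right] at this; linarith
    refine ⟨hLX, a, ha, b, hb, c, hc, hab, hac, hbc, w, inner ℝ w (p a).val, rfl, hon' b hb,
      hon' c hc, ⟨x, hx, hoff' x hx hxL⟩, fun i hi => ?_, ?_⟩
    · by_cases hiL : i ∈ L
      · exact (hon' i hiL).le
      · exact (hoff' i hi hiL).le
    · ext z
      constructor
      · rintro ⟨i, hi, rfl⟩
        exact ⟨⟨i, hLX hi, rfl⟩, hon' i hi⟩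
      · rintro ⟨⟨i, hi, rfl⟩, hz⟩
        by_cases hiL : i ∈ L
        · exact ⟨i, hiL, rfl⟩
        · exact absurd hz (hoff' i hi hiL).ne
  constructor
  · obtain ⟨L, hL⟩ := exists_mem_of_ne_nil _ hne
    obtain ⟨hLX, a, ha, b, hb, c, hc, hab, hac, hbc, w, M, hwa, hwb, hwc, ⟨x, hx, hxM⟩, -, -⟩ :=
      key L hL
    refine interior_convexHull_nonempty_of_vectorSpan ⟨_, x, hx, rfl⟩
      (vectorSpan_eq_top_of_form (a := (p a).val) (b := (p b).val) (c := (p c).val) (x := (p x).val)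
        ⟨a, hLX ha, rfl⟩ ⟨b, hLX hb, rfl⟩ ⟨c, hLX hc, rfl⟩
        ⟨x, hx, rfl⟩ (linearIndependent_sub_of_sphere (hX a (hLX ha)) (hX b (hLX hb))
          (hX c (hLX hc)) hab hac hbc) (m := (innerSL ℝ w).toLinearMap) ?_ ?_ ?_)
    · simp [inner_sub_right, hwa, hwb]
    · simp [inner_sub_right, hwa, hwc]
    · have : inner ℝ w ((p x).val - (p a).val) < 0 := by
        rw [inner_sub_right, hwa]; exact sub_neg.2 hxM
      exact this.ne
  · intro F
    constructor
    · intro hF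
      suffices h : ∃ W ∈ {W | ∃ L ∈ Fs, W = (fun i => (p i).val) '' {i | i ∈ L}},
          F = convexHull ℝ W by
        obtain ⟨W, ⟨L, hL, rfl⟩, hFW⟩ := h
        exact ⟨L, hL, hFW⟩
      refine mem_facets_convexHull hV ?_ ?_ hF
      · rintro _ ⟨L, hL, rfl⟩
        obtain ⟨-, -, -, -, -, -, -, -, -, -, w, M, -, -, -, ⟨x, hx, hxM⟩, hle, heq⟩ := key L hL
        refine ⟨(innerSL ℝ w).toLinearMap, M, ?_, heq, _, ⟨x, hx, rfl⟩, hxM⟩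
        rintro _ ⟨i, hi, rfl⟩
        exact hle i hi
      · intro Q hQ a ha b hb c hc hab hac hbc
        obtain ⟨i, hi, rfl⟩ := hQ ha
        obtain ⟨j, hj, rfl⟩ := hQ hb
        obtain ⟨k, hk, rfl⟩ := hQ hc
        obtain ⟨i, hi, j, hj, k, hk, ⟨hij, hik, hjk⟩, ⟨hQi, hQj, hQk⟩, h⟩ :=
          triplesAll_sound (Q := fun i => (p i).val ∈ Q) h2 i hi j hj k hk
            (fun h => hab (by rw [h])) (fun h => hac (by rw [h])) (fun h => hbc (by rw [h]))
              ha hb hc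
        refine ⟨_, hQi, _, hQj, _, hQk, fun h => hij (hinj i hi j hj h),
          fun h => hik (hinj i hi k hk h), fun h => hjk (hinj j hj k hk h), ?_⟩
        rcases tripleOK_sound hsame h with ⟨F, hF, hiF, hjF, hkF⟩ |
          ⟨w, hw1, hw2, x, hx, y, hy, h1, h2⟩
        · exact Or.inl ⟨_, ⟨F, hF, rfl⟩, ⟨i, hiF, rfl⟩, ⟨j, hjF, rfl⟩, ⟨k, hkF, rfl⟩⟩
        · exact Or.inr ⟨(innerSL ℝ w).toLinearMap, hw1, hw2, _, ⟨x, hx, rfl⟩, _, ⟨y, hy, rfl⟩,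
            h1, h2⟩
    · rintro ⟨L, hL, rfl⟩
      obtain ⟨hLX, a, ha, b, hb, c, hc, hab, hac, hbc, w, M, hwa, hwb, hwc, ⟨x, hx, hxM⟩, hle,
        heq⟩ :=
        key L hL
      simp only [listHull, heq]
      refine level_mem_facets hV ?_ ?_ ⟨a, hLX ha, rfl⟩ ⟨b, hLX hb, rfl⟩ ⟨c, hLX hc, rfl⟩
        hwa hwb hwc
        hab hac hbc
      · rintro rfl
        simp only [inner_zero_left] at hwa hxM
        exact hxM.ne hwa
      · rintro _ ⟨i, hi, rfl⟩
        exact hle i hi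

end Blueprint

/-! ### Recognizing regular polygons, prisms and antiprisms -/

def IsGon (n : ℕ) (s : Set E3) : Prop := ∃ o X Y : E3, inner ℝ X Y = 0 ∧ ‖X‖ = ‖Y‖ ∧ X ≠ 0 ∧
  X ∈ vectorSpan ℝ s ∧ Y ∈ vectorSpan ℝ s ∧ s = Set.range fun k : Fin n =>
    o + cos (2 * π * (k : ℕ) / n) • X + sin (2 * π * (k : ℕ) / n) • Y

lemma exists_frame {X Y : E3} (h : inner ℝ X Y = 0) (hXY : ‖X‖ = ‖Y‖) (hX : X ≠ 0) :
    ∃ b : OrthonormalBasis (Fin 3) ℝ E3, ‖X‖ • b 0 = X ∧ ‖X‖ • b 1 = Y := by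
  have hn : ‖X‖ ≠ 0 := norm_ne_zero_iff.2 hX
  obtain ⟨b, hb⟩ := Orthonormal.exists_orthonormalBasis_extension_of_card_eq (𝕜 := ℝ) (E := E3)
    (ι := Fin 3) (by simp) (v := ![‖X‖⁻¹ • X, ‖X‖⁻¹ • Y, 0]) (s := {0, 1}) (by
      constructor
      · rintro ⟨i, rfl | rfl⟩
        · simp [norm_smul, hn]
        · simp [norm_smul, ← hXY, hn]
      · rintro ⟨i, rfl | rfl⟩ ⟨j, rfl | rfl⟩ hij
        · exact absurd rfl hij
        · simp [inner_smul_left, inner_smul_right, h]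
        · simp [inner_smul_left, inner_smul_right, h, real_inner_comm X Y]
        · exact absurd rfl hij)
  refine ⟨b, ?_, ?_⟩
  · rw [hb 0 (by simp)]; simp [smul_smul, hn]
  · rw [hb 1 (by simp)]; simp [smul_smul, hn]

lemma exists_frame_normal {X Y W : E3} (h : inner ℝ X Y = 0) (hXY : ‖X‖ = ‖Y‖) (hX : X ≠ 0)
    (hW : W ≠ 0) (hWX : inner ℝ W X = 0) (hWY : inner ℝ W Y = 0) :
    ∃ b : OrthonormalBasis (Fin 3) ℝ E3, ‖X‖ • b 0 = X ∧ ‖X‖ • b 1 = Y ∧ ‖W‖ • b 2 = W := by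
  have hn : ‖X‖ ≠ 0 := norm_ne_zero_iff.2 hX
  have hnW : ‖W‖ ≠ 0 := norm_ne_zero_iff.2 hW
  obtain ⟨b, hb⟩ := Orthonormal.exists_orthonormalBasis_extension_of_card_eq (𝕜 := ℝ) (E := E3)
    (ι := Fin 3) (by simp) (v := ![‖X‖⁻¹ • X, ‖X‖⁻¹ • Y, ‖W‖⁻¹ • W]) (s := Set.univ) (by
      constructor
      · rintro ⟨i, -⟩
        fin_cases i
        · simp [norm_smul, hn]
        · simp [norm_smul, ← hXY, hn]
        · simp [norm_smul, hnW]
      · rintro ⟨i, hi⟩ ⟨j, hj⟩ hij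
        have hne : i ≠ j := fun h => hij (Subtype.ext h)
        clear hij
        fin_cases i <;> fin_cases j <;> first | exact (hne rfl).elim |
          simp [inner_smul_left, inner_smul_right, h, real_inner_comm X Y, real_inner_comm W X,
            real_inner_comm W Y, hWX, hWY])
  refine ⟨b, ?_, ?_, ?_⟩
  · rw [hb 0 (by simp)]; simp [smul_smul, hn]
  · rw [hb 1 (by simp)]; simp [smul_smul, hn]
  · rw [hb 2 (by simp)]; simp [smul_smul, hnW]

lemma cylPoint_frame {b : OrthonormalBasis (Fin 3) ℝ E3} {X Y : E3} (h₀ : ‖X‖ • b 0 = X)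
    (h₁ : ‖X‖ • b 1 = Y) (c : E3) (z t : ℝ) :
    cylPoint c b ‖X‖ z t = c + cos t • X + sin t • Y + z • b 2 := by
  rw [cylPoint, ← h₁, mul_comm, mul_smul, h₀]
  module

lemma IsGon.isRegularPolygon {n : ℕ} (hn : 3 ≤ n) {s : Set E3} (h : IsGon n s) :
    IsRegularPolygon n (convexHull ℝ s) := by
  obtain ⟨o, X, Y, h0, hXY, hX, -, -, rfl⟩ := h
  obtain ⟨b, hb0, hb1⟩ := exists_frame h0 hXY hX
  refine ⟨hn, o, b, ‖X‖, norm_pos_iff.2 hX, ?_⟩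
  congr 2
  funext k
  rw [cylPoint_frame hb0 hb1, zero_smul, add_zero]

lemma inner_eq_zero_of_mem_vectorSpan {s : Set E3} {W v : E3}
    (hW : ∀ x ∈ s, ∀ y ∈ s, inner ℝ W (x - y) = 0) (hv : v ∈ vectorSpan ℝ s) : inner ℝ W v = 0 := by
  have : vectorSpan ℝ s ≤ LinearMap.ker (innerSL ℝ W).toLinearMap := by
    rw [vectorSpan_def, Submodule.span_le]
    rintro _ ⟨x, hx, y, hy, rfl⟩
    exact hW x hx y hy
  exact this hv

lemma IsGon.isPrism {n : ℕ} (hn : 3 ≤ n) {s : Set E3} (h : IsGon n s) {W : E3} (hW : W ≠ 0)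
    (hs : ∀ x ∈ s, ∀ y ∈ s, inner ℝ W (x - y) = 0) :
    IsPrism n (convexHull ℝ (s ∪ (fun x => x + W) '' s)) := by
  obtain ⟨o, X, Y, h0, hXY, hX, hXs, hYs, hse⟩ := h
  obtain ⟨b, hb0, hb1, hb2⟩ := exists_frame_normal h0 hXY hX hW
    (inner_eq_zero_of_mem_vectorSpan hs hXs) (inner_eq_zero_of_mem_vectorSpan hs hYs)
  refine ⟨hn, o + (1 / 2 : ℝ) • W, b, ‖X‖, ‖W‖ / 2, norm_pos_iff.2 hX, half_pos (norm_pos_iff.2 hW),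
    ?_⟩
  rw [Set.union_comm, hse, ← range_comp]
  have hb : (‖W‖ / 2) • b 2 = (1 / 2 : ℝ) • W := by rw [div_eq_inv_mul, mul_smul, hb2]; norm_num
  congr 3
  · funext k
    rw [comp_apply, cylPoint_frame hb0 hb1, hb]
    module
  · funext k
    rw [cylPoint_frame hb0 hb1, neg_smul, hb]
    module

lemma range_angles_three {α : Type*} (f : ℝ → α) :
    Set.range (fun k : Fin 3 => f (2 * π * (k : ℕ) / (3 : ℕ))) =
      {f 0, f (π - π / 3), f (π / 3 + π)} := by
  rw [show π - π / 3 = 2 * π * ((1 : ℕ) : ℝ) / ((3 : ℕ) : ℝ) by push_cast; ring,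
    show π / 3 + π = 2 * π * ((2 : ℕ) : ℝ) / ((3 : ℕ) : ℝ) by push_cast; ring]
  ext x
  constructor
  · rintro ⟨k, rfl⟩
    fin_cases k <;> simp
  · rintro (rfl | rfl | rfl)
    exacts [⟨0, by simp⟩, ⟨1, rfl⟩, ⟨2, rfl⟩]

lemma range_angles_four {α : Type*} (f : ℝ → α) :
    Set.range (fun k : Fin 4 => f (2 * π * (k : ℕ) / (4 : ℕ))) =
      {f 0, f (π / 2), f π, f (π / 2 + π)} := by
  rw [show π / 2 = 2 * π * ((1 : ℕ) : ℝ) / ((4 : ℕ) : ℝ) by push_cast; ring,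
    show f π = f (2 * π * ((2 : ℕ) : ℝ) / ((4 : ℕ) : ℝ)) by congr 1; push_cast; ring,
    show _ + π = 2 * π * ((3 : ℕ) : ℝ) / ((4 : ℕ) : ℝ) by push_cast; ring]
  ext x
  constructor
  · rintro ⟨k, rfl⟩
    fin_cases k <;> simp
  · rintro (rfl | rfl | rfl | rfl)
    exacts [⟨0, by simp⟩, ⟨1, rfl⟩, ⟨2, rfl⟩, ⟨3, rfl⟩]

lemma range_angles_six {α : Type*} (f : ℝ → α) :
    Set.range (fun k : Fin 6 => f (2 * π * (k : ℕ) / (6 : ℕ))) =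
      {f 0, f (π / 3), f (π - π / 3), f π, f (π / 3 + π),
        f (2 * π - π / 3)} := by
  have h (k : ℕ) {t : ℝ} (ht : t = π / 3 * k) : f t = f (2 * π * k / (6 : ℕ)) := by
    rw [ht]; congr 1; push_cast; ring
  rw [h 1 (t := π / 3) (by simp), h 2 (t := π - π / 3) (by push_cast; ring),
    h 3 (t := π) (by push_cast; ring), h 4 (t := π / 3 + π) (by push_cast; ring),
    h 5 (t := 2 * π - π / 3) (by push_cast; ring)]
  ext x
  constructor
  · rintro ⟨k, rfl⟩
    fin_cases k <;> simp
  · rintro (rfl | rfl | rfl | rfl | rfl | rfl)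
    exacts [⟨0, by simp⟩, ⟨1, rfl⟩, ⟨2, rfl⟩, ⟨3, rfl⟩, ⟨4, rfl⟩, ⟨5, rfl⟩]

lemma isGon_three {a b c : E3} (h₁ : ‖a - b‖ = ‖a - c‖) (h₂ : ‖a - b‖ = ‖b - c‖) (hab : a ≠ b) :
    IsGon 3 {a, b, c} := by
  have ha : a ∈ ({a, b, c} : Set E3) := by simp
  have hu : a - b ∈ vectorSpan ℝ ({a, b, c} : Set E3) := vsub_mem_vectorSpan ℝ ha (by simp)
  have hv : a - c ∈ vectorSpan ℝ ({a, b, c} : Set E3) := vsub_mem_vectorSpan ℝ ha (by simp)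
  have e1 : inner ℝ (a - b) (a - b) = inner ℝ (a - c) (a - c) := by
    rw [real_inner_self_eq_norm_sq, real_inner_self_eq_norm_sq, h₁]
  have e2 : inner ℝ (a - b) (a - b) = inner ℝ (b - c) (b - c) := by
    rw [real_inner_self_eq_norm_sq, real_inner_self_eq_norm_sq, h₂]
  rw [show b - c = (a - c) - (a - b) by abel] at e2
  have hb : b = a - (a - b) := by abel
  have hc : c = a - (a - c) := by abel
  have hu0 : 0 < inner ℝ (a - b) (a - b) := real_inner_self_pos.2 (sub_ne_zero.2 hab)
  set u := a - b
  set v := a - c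
  have huv : inner ℝ u v = inner ℝ u u / 2 := by
    simp only [inner_sub_left, inner_sub_right, real_inner_comm u v] at e2
    linarith [real_inner_comm u v]
  have hvu : inner ℝ v u = inner ℝ u u / 2 := by rw [real_inner_comm, huv]
  have hX : inner ℝ ((1 / 3 : ℝ) • (u + v)) ((1 / 3 : ℝ) • (u + v)) = inner ℝ u u / 3 := by
    simp only [inner_smul_left, inner_smul_right, inner_add_left, inner_add_right, huv, hvu, ← e1]
    simp; ring
  have hY : inner ℝ ((√3)⁻¹ • (v - u)) ((√3)⁻¹ • (v - u)) = inner ℝ u u / 3 := by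
    simp only [inner_smul_left, inner_smul_right, inner_sub_left, inner_sub_right, huv, hvu, ← e1]
    simp only [conj_trivial]
    field_simp
    rw [sq_sqrt (by norm_num)]; ring
  refine ⟨a - (1 / 3 : ℝ) • (u + v), (1 / 3 : ℝ) • (u + v), (√3)⁻¹ • (v - u), ?_, ?_, ?_,
    Submodule.smul_mem _ _ (Submodule.add_mem _ hu hv),
    Submodule.smul_mem _ _ (Submodule.sub_mem _ hv hu), ?_⟩
  · simp only [inner_smul_left, inner_smul_right, inner_add_left, inner_sub_right, huv, hvu, ← e1]
    ring
  · rw [norm_eq_sqrt_real_inner, norm_eq_sqrt_real_inner, hX, hY]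
  · intro h0
    rw [h0, inner_zero_left] at hX
    linarith
  · have hs : √(3 : ℝ) / 2 * (√3)⁻¹ = 1 / 2 := by field_simp
    rw [range_angles_three fun t => a - (1 / 3 : ℝ) • (u + v) +
      cos t • (1 / 3 : ℝ) • (u + v) + sin t • (√3)⁻¹ • (v - u), hb, hc]
    simp only [cos_zero, sin_zero, cos_pi_sub, sin_pi_sub, cos_add_pi,
      sin_add_pi, cos_pi_div_three, sin_pi_div_three, smul_smul, neg_mul, hs]
    exact congrArg₂ insert (by module) (congrArg₂ insert (by module)
      (congrArg singleton (by module)))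

lemma isGon_four {a b c d : E3} (h : a + c = b + d) (h₁ : ‖b - a‖ = ‖d - a‖)
    (h₂ : inner ℝ (b - a) (d - a) = 0) (hab : a ≠ b) : IsGon 4 {a, b, c, d} := by
  have ha : a ∈ ({a, b, c, d} : Set E3) := by simp
  have hu : b - a ∈ vectorSpan ℝ ({a, b, c, d} : Set E3) := vsub_mem_vectorSpan ℝ (by simp) ha
  have hv : d - a ∈ vectorSpan ℝ ({a, b, c, d} : Set E3) := vsub_mem_vectorSpan ℝ (by simp) ha
  have hu0 : 0 < inner ℝ (b - a) (b - a) := real_inner_self_pos.2 (sub_ne_zero.2 hab.symm)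
  have hb : b = a + (b - a) := by abel
  have hd : d = a + (d - a) := by abel
  have hc : c = a + (b - a) + (d - a) := by rw [eq_sub_of_add_eq' h]; abel
  set u := b - a
  set v := d - a
  have e1 : inner ℝ u u = inner ℝ v v := by
    rw [real_inner_self_eq_norm_sq, real_inner_self_eq_norm_sq, h₁]
  have h₂' : inner ℝ v u = 0 := by rw [real_inner_comm, h₂]
  have hX : inner ℝ ((-1 / 2 : ℝ) • (u + v)) ((-1 / 2 : ℝ) • (u + v)) = inner ℝ u u / 2 := by
    simp only [inner_smul_left, inner_smul_right, inner_add_left, inner_add_right, h₂, h₂', ← e1]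
    simp only [conj_trivial]; ring
  have hY : inner ℝ ((1 / 2 : ℝ) • (u - v)) ((1 / 2 : ℝ) • (u - v)) = inner ℝ u u / 2 := by
    simp only [inner_smul_left, inner_smul_right, inner_sub_left, inner_sub_right, h₂, h₂', ← e1]
    simp only [conj_trivial]; ring
  refine ⟨a + (1 / 2 : ℝ) • (u + v), (-1 / 2 : ℝ) • (u + v), (1 / 2 : ℝ) • (u - v), ?_, ?_, ?_,
    Submodule.smul_mem _ _ (Submodule.add_mem _ hu hv),
    Submodule.smul_mem _ _ (Submodule.sub_mem _ hu hv), ?_⟩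
  · simp only [inner_smul_left, inner_smul_right, inner_add_left, inner_sub_right, h₂, h₂', ← e1]
    ring
  · rw [norm_eq_sqrt_real_inner, norm_eq_sqrt_real_inner, hX, hY]
  · intro h0
    rw [h0, inner_zero_left] at hX
    linarith
  · rw [range_angles_four fun t => a + (1 / 2 : ℝ) • (u + v) + cos t • (-1 / 2 : ℝ) • (u + v) +
      sin t • (1 / 2 : ℝ) • (u - v), hb, hc, hd]
    simp only [cos_zero, sin_zero, cos_add_pi, sin_add_pi, cos_pi_div_two,
      sin_pi_div_two, cos_pi, sin_pi]
    exact congrArg₂ insert (by module) (congrArg₂ insert (by module) (congrArg₂ insert (by module)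
      (congrArg singleton (by module))))

lemma isGon_six {o u v : E3} (h₁ : ‖u‖ = ‖v‖) (h₂ : ‖u + v‖ = ‖u‖) (hu : u ≠ 0) :
    IsGon 6 {o + u, o + (u + v), o + v, o - u, o - (u + v), o - v} := by
  have e1 : inner ℝ u u = inner ℝ v v := by
    rw [real_inner_self_eq_norm_sq, real_inner_self_eq_norm_sq, h₁]
  have e2 : inner ℝ (u + v) (u + v) = inner ℝ u u := by
    rw [real_inner_self_eq_norm_sq, real_inner_self_eq_norm_sq, h₂]
  have huv : inner ℝ u v = -inner ℝ u u / 2 := by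
    simp only [inner_add_left, inner_add_right] at e2
    linarith [real_inner_comm u v]
  have hvu : inner ℝ v u = -inner ℝ u u / 2 := by rw [real_inner_comm, huv]
  set s : Set E3 := {o + u, o + (u + v), o + v, o - u, o - (u + v), o - v} with hs
  have hus : u ∈ vectorSpan ℝ s := by
    simpa using vsub_mem_vectorSpan ℝ (s := s) (p₁ := o + (u + v)) (p₂ := o + v) (by simp [hs])
      (by simp [hs])
  have hvs : v ∈ vectorSpan ℝ s := by
    simpa using vsub_mem_vectorSpan ℝ (s := s) (p₁ := o + (u + v)) (p₂ := o + u) (by simp [hs])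
      (by simp [hs])
  have hY : inner ℝ ((√3)⁻¹ • ((2 : ℝ) • v + u)) ((√3)⁻¹ • ((2 : ℝ) • v + u)) = inner ℝ u u := by
    simp only [inner_smul_left, inner_smul_right, inner_add_left, inner_add_right, huv, hvu, ← e1]
    simp only [conj_trivial]
    field_simp
    rw [sq_sqrt (by norm_num)]; ring
  refine ⟨o, u, (√3)⁻¹ • ((2 : ℝ) • v + u), ?_, ?_, hu, hus, Submodule.smul_mem _ _
    (Submodule.add_mem _ (Submodule.smul_mem _ _ hvs) hus), ?_⟩
  · simp only [inner_smul_right, inner_add_right, huv]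
    ring
  · rw [norm_eq_sqrt_real_inner, norm_eq_sqrt_real_inner, hY]
  · have hs : √(3 : ℝ) / 2 * (√3)⁻¹ = 1 / 2 := by field_simp
    rw [range_angles_six fun t => o + cos t • u + sin t • (√3)⁻¹ • ((2 : ℝ) • v + u)]
    simp only [cos_zero, sin_zero, cos_pi_sub, sin_pi_sub, cos_add_pi,
      sin_add_pi, cos_pi_div_three, sin_pi_div_three, cos_pi, sin_pi,
      cos_two_pi_sub, sin_two_pi_sub, smul_smul, neg_mul, hs]
    exact congrArg₂ insert (by module) (congrArg₂ insert (by module) (congrArg₂ insert (by module)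
      (congrArg₂ insert (by module) (congrArg₂ insert (by module) (congrArg singleton
      (by module))))))

lemma IsGon.isAntiprism {s : Set E3} (h : IsGon 3 s) {c : E3}
    (hs : ∀ x ∈ s, ∀ y ∈ s, dist x c = dist y c)
    (hp : ∀ x ∈ s, ∀ y ∈ s, x ≠ y → inner ℝ (x - c) (y - c) = 0) :
    IsAntiprism 3 (convexHull ℝ (s ∪ (fun x => (2 : ℝ) • c - x) '' s)) := by
  obtain ⟨o, X, Y, h0, hXY, hX, -, -, hse⟩ := h
  obtain ⟨W, rfl⟩ : ∃ W, o = c + W := ⟨o - c, by abel⟩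
  have hse' := hse
  rw [range_angles_three fun t => c + W + cos t • X + sin t • Y] at hse'
  simp only [cos_zero, sin_zero, cos_pi_sub, sin_pi_sub, cos_add_pi,
    sin_add_pi, cos_pi_div_three, sin_pi_div_three, add_assoc] at hse'
  have hXX : 0 < inner ℝ X X := real_inner_self_pos.2 hX
  have hYY : inner ℝ Y Y = inner ℝ X X := by
    rw [real_inner_self_eq_norm_sq, real_inner_self_eq_norm_sq, hXY]
  have h0' : inner ℝ Y X = 0 := by rw [real_inner_comm, h0]
  have dist_eq : ∀ v w : E3, c + v ∈ s → c + w ∈ s → inner ℝ v v = inner ℝ w w := by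
    intro v w hv hw
    have := hs _ hv _ hw
    rw [dist_eq_norm, dist_eq_norm, add_sub_cancel_left, add_sub_cancel_left] at this
    rw [real_inner_self_eq_norm_sq, real_inner_self_eq_norm_sq, this]
  have m0 : c + (W + ((1 : ℝ) • X + (0 : ℝ) • Y)) ∈ s := by simp [hse']
  have m1 : c + (W + (-(1 / 2 : ℝ) • X + (√3 / 2) • Y)) ∈ s := by simp [hse']
  have d01 := dist_eq _ _ m0 m1
  have d12 := dist_eq _ (W + (-(1 / 2 : ℝ) • X + (-(√3 / 2)) • Y)) m1 (by simp [hse'])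
  simp only [inner_add_left, inner_add_right, inner_smul_left, inner_smul_right, h0, h0', hYY,
    conj_trivial, real_inner_comm W X, real_inner_comm W Y] at d01 d12
  have hsq : √(3 : ℝ) ^ 2 = 3 := sq_sqrt (by norm_num)
  have hs3 : 0 < √(3 : ℝ) := by positivity
  have hWY : inner ℝ W Y = 0 := by
    have : √3 * inner ℝ W Y = 0 := by linarith
    exact (mul_eq_zero.1 this).resolve_left hs3.ne'
  have hWX : inner ℝ W X = 0 := by
    rw [hWY] at d01
    nlinarith
  have hW : W ≠ 0 := by
    rintro rfl
    have key : ∀ z : E3, inner ℝ X (((1 : ℝ) • X + (0 : ℝ) • Y)) ≠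
        inner ℝ X (-(1 / 2 : ℝ) • X + (√3 / 2) • Y) ∧ inner ℝ ((1 : ℝ) • X + (0 : ℝ) • Y)
          (-(1 / 2 : ℝ) • X + (√3 / 2) • Y) ≠ 0 := by
      simp only [inner_add_left, inner_add_right, inner_smul_left, inner_smul_right, h0, h0',
        conj_trivial]
      exact fun _ => ⟨fun h => by linarith, fun h => by linarith⟩
    refine (key 0).2 ?_
    have := hp _ m0 _ m1 fun h => (key 0).1 (by
      rw [zero_add, zero_add, add_right_inj] at h; rw [h])
    rwa [add_sub_cancel_left, add_sub_cancel_left, zero_add, zero_add] at this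
  obtain ⟨b, hb0, hb1, hb2⟩ := exists_frame_normal h0 hXY hX hW hWX hWY
  refine ⟨le_rfl, c, b, ‖X‖, ‖W‖, norm_pos_iff.2 hX, norm_pos_iff.2 hW, ?_⟩
  rw [range_cylPoint_int c b three_ne_zero]
  have e : (Set.range fun k : ℤ => cylPoint c b ‖X‖ (-‖W‖)
      (2 * π * k / (3 : ℕ) + π / (3 : ℕ))) =
      Set.range fun k : ℤ => cylPoint c b ‖X‖ (-‖W‖) (2 * π * k / (3 : ℕ) + π) := by
    refine (Equiv.addRight (1 : ℤ)).surjective.range_comp _ |>.symm.trans ?_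
    congr 1
    funext k
    simp only [comp_apply, Equiv.coe_addRight]
    congr 1
    push_cast
    ring
  rw [e, ← range_cylPoint_int c b three_ne_zero, hse, ← range_comp]
  congr 3
  · funext k
    rw [cylPoint_frame hb0 hb1, hb2]
    module
  · funext k
    rw [comp_apply, cylPoint_frame hb0 hb1, neg_smul, hb2, cos_add_pi, sin_add_pi]
    module

/-! ### The edges of a polygon -/

lemma mem_edges_iff {V : Set E3} {o : E3} {r : ℝ} (hV : ∀ x ∈ V, dist x o = r) {F : Set E3} :
    F ∈ edges (convexHull ℝ V) ↔ ∃ x ∈ V, ∃ y ∈ V, x ≠ y ∧ F = segment ℝ x y ∧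
      ∃ (l : E3 →L[ℝ] ℝ) (M : ℝ), l x = M ∧ l y = M ∧ ∀ z ∈ V, z ≠ x → z ≠ y → l z < M := by
  have key {x y : E3} (hx : x ∈ V) (hy : y ∈ V) {l : E3 →L[ℝ] ℝ} {M : ℝ} (hlx : l x = M)
      (hly : l y = M) (hlt : ∀ z ∈ V, z ≠ x → z ≠ y → l z < M) : {z ∈ V | l z = M} = {x, y} := by
    ext z
    constructor
    · rintro ⟨hz, hzM⟩
      by_contra hn
      simp only [Set.mem_insert_iff, Set.mem_singleton_iff, not_or] at hn
      exact (hlt z hz hn.1 hn.2).ne hzM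
    · rintro (rfl | rfl)
      exacts [⟨hx, hlx⟩, ⟨hy, hly⟩]
  constructor
  · rintro ⟨hexp, hne, hdim⟩
    obtain ⟨l, M, hl, hFl⟩ := exists_of_isExposed_convexHull hexp hne
    rw [hFl, vectorSpan_convexHull] at hdim
    have hnt : ¬ {x ∈ V | l x = M}.Subsingleton := by
      intro h
      rw [(vectorSpan_of_subsingleton ℝ h), finrank_bot] at hdim
      exact zero_ne_one hdim
    obtain ⟨x, hx, y, hy, hxy⟩ := Set.not_subsingleton_iff.1 hnt
    have hlt : ∀ z ∈ V, z ≠ x → z ≠ y → l z < M := by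
      intro z hz hzx hzy
      refine lt_of_le_of_ne (hl z hz) fun hzM => ?_
      have := two_le_finrank_vectorSpan hx hy (z := z) ⟨hz, hzM⟩
        (linearIndependent_sub_of_sphere (hV x hx.1) (hV y hy.1) (hV z hz) hxy hzx.symm hzy.symm)
      omega
    refine ⟨x, hx.1, y, hy.1, hxy, ?_, l, M, hx.2, hy.2, hlt⟩
    rw [hFl, ← convexHull_pair, key hx.1 hy.1 hx.2 hy.2 hlt]
  · rintro ⟨x, hx, y, hy, hxy, rfl, l, M, hlx, hly, hlt⟩
    have hl : ∀ z ∈ V, l z ≤ M := by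
      intro z hz
      by_cases hzx : z = x
      · exact (hzx ▸ hlx).le
      by_cases hzy : z = y
      · exact (hzy ▸ hly).le
      exact (hlt z hz hzx hzy).le
    rw [← convexHull_pair]
    refine ⟨?_, ⟨x, subset_convexHull ℝ _ (by simp)⟩, ?_⟩
    · rw [← key hx hy hlx hly hlt]
      exact isExposed_convexHull_level l hl ⟨x, hx, hlx⟩
    · rw [vectorSpan_convexHull, vectorSpan_pair, finrank_span_singleton]
      exact sub_ne_zero.2 hxy

namespace Blueprint

/-! #### Checks on the pieces of a blueprint -/

def polygonOK : List SurdPt → Bool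
  | [a, b, c] => ((a.sub b).dot (a.sub b)).pos &&
      (((a.sub b).dot (a.sub b)).same ((a.sub c).dot (a.sub c)) &&
        ((a.sub b).dot (a.sub b)).same ((b.sub c).dot (b.sub c)))
  | [a, b, c, d] => ((a.sub b).dot (a.sub b)).pos && ((a.add c).same (b.add d) &&
      (((b.sub a).dot (b.sub a)).same ((d.sub a).dot (d.sub a)) &&
        ((b.sub a).dot (d.sub a)).same (0, 0)))
  | [a, b, c, d, e, f] =>
      let v := fun x => (SurdPt.smul 2 x).sub (a.add d)
      let w := fun x => (v x).dot (v x)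
      (w a).pos && ((w a).same (w b) && ((w a).same (w c) && ((a.add d).same (b.add e) &&
        ((a.add d).same (c.add f) && (v b).same ((v a).add (v c))))))
  | _ => false

variable (M : Blueprint)

def relAt (j : ℕ) : SurdPt := M.rel.getD j SurdPt.zero

/-- From the source to the target of a link. -/
def direction (L : Link) : SurdPt := (M.center L.dst).sub (M.center (L.src, (0, 0, 0)))

def oppositeOK (L : Link) (i j : ℕ) : Bool :=
  if M.anti then (M.relAt j).same (SurdPt.smul (-1) (M.relAt i)) else
    (SurdPt.smul M.den ((M.relAt i).sub (M.relAt j))).same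
      (SurdPt.smul 2 (SurdPt.mul M.al (M.direction L)))

/-- The vector from the middle of a link to a corner of its base, doubled. -/
def spoke (L : Link) (i : ℕ) : SurdPt := (SurdPt.smul 2 (M.relAt i)).sub (M.direction L)

def ltAll (n : ℕ) (l : List ℕ) : Bool := l.all fun i => Nat.blt i n

def dartOK (r : ℕ) (L : Link) : Bool :=
  let d := M.direction L
  let dd := d.dot d
  (Nat.blt L.src M.cen.length && (Nat.blt L.dst.1 M.cen.length &&
    (ltAll M.rel.length L.base && ltAll M.rel.length L.top))) &&
  ((Nat.beq L.base.length r && Nat.beq L.top.length r) &&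
  (((L.base.zip L.top).all fun s => M.oppositeOK L s.1 s.2) &&
  ((L.base.all fun i => (Surd.smul M.den ((M.relAt i).dot d)).same (M.al.mul dd)) &&
  ((SurdPt.smul M.den (L.base.foldr (fun i s => (M.relAt i).add s) SurdPt.zero)).same
      (SurdPt.smul r (SurdPt.mul M.al d)) &&
  (polygonOK (L.base.map M.relAt) &&
  ((!M.anti || (L.base.all fun i => L.base.all fun j => Nat.beq i j ||
      ((M.spoke L i).dot (M.spoke L j)).same (0, 0))) &&
  ((M.faces.any fun f => (f.all fun j => L.base.any (Nat.beq j)) &&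
      L.base.all fun j => f.any (Nat.beq j)) &&
  ((List.range M.rel.length).all fun j =>
    Surd.le (Surd.smul M.den ((M.relAt j).dot d)) (M.al.mul dd)))))))))

def spokesOK (L : Link) : Bool :=
  match L.base with
  | [] => false
  | i :: _ => let s := (M.spoke L i).dot (M.spoke L i)
    (L.base.all fun j => ((M.spoke L j).dot (M.spoke L j)).same s) &&
      L.top.all fun j => ((M.spoke L.rev j).dot (M.spoke L.rev j)).same s

def dartPairOK (L K : Link) : Bool :=
  !Nat.beq L.src K.src || (!Node.same L.dst K.dst &&
    (Surd.le (Surd.smul 3 ((M.direction L).dot (M.direction K)))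
        ((M.direction L).dot (M.direction L))
      && Nat.ble (L.base.filter fun j => K.base.any (Nat.beq j)).length 2))

def linksOK (r : ℕ) : Bool :=
  (M.al.pos && (Surd.lt (Surd.smul 2 M.al) (M.den, 0) &&
    (!M.anti || (Nat.beq r 3 && Surd.le (Surd.smul 3 M.al) (M.den, 0))))) &&
  ((M.darts.all (M.dartOK r) && (M.links.all M.spokesOK && pairsAll M.dartPairOK M.darts)) &&
  match M.links with
  | [] => false
  | L :: _ => ((M.direction L).dot (M.direction L)).pos && M.darts.all fun K =>
      ((M.direction K).dot (M.direction K)).same ((M.direction L).dot (M.direction L)))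

def nodeOK : Bool :=
  match M.rel with
  | [] => false
  | p :: _ => (p.dot p).pos && ((M.rel.all fun q => (q.dot q).same (p.dot p)) &&
    (pairsAll (fun p q => !SurdPt.same p q) M.rel &&
      (M.rel.any fun p => M.rel.any fun q => SurdPt.same q (SurdPt.smul (-1) p))))

def nodeFacetCheck : Bool :=
  !M.faces.isEmpty && facetCheck Nat.beq M.relAt (List.range M.rel.length) M.faces

def linkFacetCheck : Bool := M.links.all fun L => facetCheck Corner.same M.place (linkCorners L)
  (Link.baseCorners L :: Link.topCorners L :: M.laterals L)

def signedPermutations (a : Shift) : List Shift :=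
  [(a.1, a.2.1, a.2.2), (a.1, a.2.2, a.2.1), (a.2.1, a.1, a.2.2), (a.2.1, a.2.2, a.1),
    (a.2.2, a.1, a.2.1), (a.2.2, a.2.1, a.1)].flatMap fun b =>
  [1, -1].flatMap fun s => [1, -1].flatMap fun t => [1, -1].map fun u =>
    (s * b.1, t * b.2.1, u * b.2.2)

def scaled (c : ℤ) (a : Shift) : SurdPt := ((c * a.1, 0), (c * a.2.1, 0), (c * a.2.2, 0))

def solidOK (c : ℤ) (a : Shift) : Bool :=
  ((signedPermutations a).all fun b => M.rel.any (SurdPt.same (scaled c b))) &&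
    M.rel.all fun p => (signedPermutations a).any fun b => SurdPt.same p (scaled c b)

/-! #### The graph -/

def adjacentNodes (A B : Node) : Bool :=
  M.darts.any fun d => Nat.beq d.src A.1 && Node.same (d.dst.move A.2) B

def chainOK {α : Type} (same adj : α → α → Bool) (targets : List α) :
    List α → List (α × α) → Bool
  | seen, [] => targets.all fun t => seen.any (same t)
  | seen, s :: l => seen.any (same s.1) && (adj s.1 s.2 && chainOK same adj targets (s.2 :: seen) l)

def generators : List Shift := [(1, 0, 0), (0, 1, 0), (0, 0, 1)]

def nodeChainOK : Bool :=
  chainOK Node.same M.adjacentNodes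
    (((List.range M.cen.length).map fun k => (k, (0, 0, 0))) ++ generators.map fun n => (0, n))
    [(0, (0, 0, 0))] M.nodeChain

def inTile (T : List Corner) (v w : Corner) : Bool :=
  T.any fun x => Nat.beq x.1.1 v.1.1 && (Nat.beq x.2 v.2 &&
    has T (w.move (x.1.2.add v.1.2.neg)))

def cornerChainOK : Bool :=
  chainOK Corner.same (fun v w => M.tiles.any fun T => inTile T v w)
    (((List.range M.cen.length).flatMap fun k => (List.range M.rel.length).map fun j =>
      ((k, (0, 0, 0)), j)) ++ generators.map fun n => ((0, n), 0))
    [((0, (0, 0, 0)), 0)] M.cornerChain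

def degreeOK (d : ℕ) : Bool := (List.range M.cen.length).all fun k =>
  Nat.beq (M.darts.filter fun L => Nat.beq L.src k).length d

def between (a b : ℕ) : List Link := M.links.filter fun L =>
  (Nat.beq L.src a && Nat.beq L.dst.1 b) || (Nat.beq L.src b && Nat.beq L.dst.1 a)

def symmetricOK : Bool := Nat.beq M.cen.length 1 ||
  (List.range M.cen.length).all fun a => (List.range M.cen.length).all fun b =>
    Nat.beq (M.between a b).length (if Nat.beq a b then 0 else 2)

def sameTile (T T' : List Corner) : Bool :=
  match T with
  | [] => true
  | v :: _ => T'.any fun y => Nat.beq y.1.1 v.1.1 && (Nat.beq y.2 v.2 &&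
      T.all fun x => has T' (x.move (y.1.2.add v.1.2.neg)))

def tilesOK (p : ℕ) : Bool :=
  (M.tiles.all fun T => Nat.beq T.length p && polygonOK (T.map M.place)) &&
    pairsAll (fun T T' => !sameTile T T') M.tiles

def genusOK (g : ℤ) : Bool := decide (((M.cen.length * M.rel.length : ℕ) : ℤ) -
  (M.sideReps.length : ℤ) + (M.tiles.length : ℤ) = 2 - 2 * g)

/-! #### Symmetries of the graph -/

def applyMat (m : Matrix3) (p : SurdPt) : SurdPt :=
  (p.eval m.1, p.eval m.2.1, p.eval m.2.2)

def transposeMat (m : Matrix3) : Matrix3 :=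
  ((m.1.1, m.2.1.1, m.2.2.1), (m.1.2.1, m.2.1.2.1, m.2.2.2.1), (m.1.2.2, m.2.1.2.2, m.2.2.2.2))

def combine (sh : Matrix3) (n : Shift) : Shift :=
  ((Shift.smul n.1 sh.1).add (Shift.smul n.2.1 sh.2.1)).add (Shift.smul n.2.2 sh.2.2)

def mapNode (img : List Node) (sh : Matrix3) (A : Node) : Node :=
  (img.getD A.1 (0, (0, 0, 0))).move (combine sh A.2)

def mapOK (m : Matrix3) (t : SurdPt) (img : List Node) (sh : Matrix3) :
    Bool :=
  ((List.range M.cen.length).all fun k =>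
    ((applyMat m (M.center (k, (0, 0, 0)))).add t).same (M.center (img.getD k (0, (0, 0, 0))))) &&
  (((applyMat m M.lam.1).same (M.lat sh.1) && ((applyMat m M.lam.2.1).same (M.lat sh.2.1) &&
    (applyMat m M.lam.2.2).same (M.lat sh.2.2))) &&
  M.darts.all fun d => M.adjacentNodes (mapNode img sh (d.src, (0, 0, 0))) (mapNode img sh d.dst))

def orthogonalMat (m : Matrix3) : Bool :=
  (decide (m.1.dot m.1 = 1) && (decide (m.2.1.dot m.2.1 = 1) && decide (m.2.2.dot m.2.2 = 1))) &&
    (decide (m.1.dot m.2.1 = 0) && (decide (m.1.dot m.2.2 = 0) && decide (m.2.1.dot m.2.2 = 0)))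

def symOK (s : Sym) : Bool :=
  (orthogonalMat s.mat && orthogonalMat (transposeMat s.mat)) && (M.mapOK s.mat s.tr s.img s.sh &&
    M.mapOK (transposeMat s.mat) (SurdPt.smul (-1) (applyMat (transposeMat s.mat) s.tr))
      s.invImg s.invSh)

def carries (s : Sym) (d e : Link) : Bool :=
  let A := mapNode s.img s.sh (d.src, (0, 0, 0))
  Nat.beq A.1 e.src && Node.same (mapNode s.img s.sh d.dst) (e.dst.move A.2)

def symsOK : Bool := M.syms.all M.symOK &&
  match M.darts with
  | [] => false
  | d :: _ => M.darts.all fun e => M.syms.any fun s => carries s d e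

structure Valid (p q r d : ℕ) (g : ℤ) : Prop where
  dual : M.dualOK = true
  near_solids : M.near M.solidCells = true
  sep_solids : M.sepCheck Corner.same Corner.move M.solidCells = true
  near_edges : M.near M.edgeCells = true
  sep_edges : M.sepCheck Node.same Node.move M.edgeCells = true
  node_facets : M.nodeFacetCheck = true
  link_facets : M.linkFacetCheck = true
  node : M.nodeOK = true
  links : M.linksOK r = true
  node_chain : M.nodeChainOK = true
  corner_chain : M.cornerChainOK = true
  degree : M.degreeOK d = true
  symmetric : M.symmetricOK = true
  syms : M.symsOK = true
  tiles : M.tilesOK p = true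
  star : M.starCheck q = true
  genus : M.genusOK g = true
  p_eq : p = 3 ∨ p = 4
  q_pos : 0 < q
  d_pos : 0 < d
  euler : (M.links.length : ℤ) + 1 = g + M.cen.length

end Blueprint

namespace Blueprint

lemma ltAll_iff {n : ℕ} {l : List ℕ} : ltAll n l = true ↔ ∀ i ∈ l, i < n := by
  simp [ltAll]

lemma any_beq_iff {l : List ℕ} {j : ℕ} : l.any (Nat.beq j) = true ↔ j ∈ l := by
  simp

lemma image_cons {ι : Type} (f : ι → E3) (a : ι) (l : List ι) :
    f '' {i | i ∈ a :: l} = insert (f a) (f '' {i | i ∈ l}) := by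
  ext x; simp [eq_comm]

lemma image_nil {ι : Type} (f : ι → E3) : f '' {i | i ∈ ([] : List ι)} = ∅ := by
  ext x; simp

lemma polygonOK_three {a b c : SurdPt} (h : polygonOK [a, b, c] = true) :
    ‖a.val - b.val‖ = ‖a.val - c.val‖ ∧ ‖a.val - b.val‖ = ‖b.val - c.val‖ ∧ a.val ≠ b.val := by
  simp only [polygonOK, and_eq_true, Surd.same_iff] at h
  have h1 := Surd.val_pos h.1
  have h2 := congrArg Surd.val h.2.1
  have h3 := congrArg Surd.val h.2.2
  simp only [SurdPt.val_dot, SurdPt.val_sub, real_inner_self_eq_norm_sq] at h1 h2 h3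
  refine ⟨(sq_eq_sq₀ (norm_nonneg _) (norm_nonneg _)).1 h2,
    (sq_eq_sq₀ (norm_nonneg _) (norm_nonneg _)).1 h3, fun h0 => ?_⟩
  simp [h0] at h1

lemma polygonOK_four {a b c d : SurdPt} (h : polygonOK [a, b, c, d] = true) :
    a.val + c.val = b.val + d.val ∧ ‖b.val - a.val‖ = ‖d.val - a.val‖ ∧
      inner ℝ (b.val - a.val) (d.val - a.val) = 0 ∧ a.val ≠ b.val := by
  simp only [polygonOK, and_eq_true, Surd.same_iff, SurdPt.same_iff] at h
  have h1 := Surd.val_pos h.1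
  have h2 := congrArg SurdPt.val h.2.1
  have h3 := congrArg Surd.val h.2.2.1
  have h4 := congrArg Surd.val h.2.2.2
  simp only [SurdPt.val_dot, SurdPt.val_sub, SurdPt.val_add, real_inner_self_eq_norm_sq,
    Surd.val_zero] at h1 h2 h3 h4
  refine ⟨h2, (sq_eq_sq₀ (norm_nonneg _) (norm_nonneg _)).1 h3, h4, fun h0 => ?_⟩
  simp [h0] at h1

lemma polygonOK_sound {ι : Type} {p : ι → SurdPt} {L : List ι}
    (h : polygonOK (L.map p) = true) : IsGon L.length ((fun i => (p i).val) '' {i | i ∈ L}) := by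
  match L, h with
  | [a, b, c], h =>
    obtain ⟨h1, h2, h3⟩ := polygonOK_three h
    simp only [image_cons, image_nil, insert_empty_eq]
    exact isGon_three h1 h2 h3
  | [a, b, c, d], h =>
    obtain ⟨h1, h2, h3, h4⟩ := polygonOK_four h
    simp only [image_cons, image_nil, insert_empty_eq]
    exact isGon_four h1 h2 h3 h4
  | [a, b, c, d, e, f], h =>
    simp only [map_cons, List.map_nil, polygonOK, and_eq_true, Surd.same_iff,
      SurdPt.same_iff] at h
    obtain ⟨h1, h2, h3, h4, h5, h6⟩ := h
    have h1 := Surd.val_pos h1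
    have h2 := congrArg Surd.val h2
    have h3 := congrArg Surd.val h3
    have h4 := congrArg SurdPt.val h4
    have h5 := congrArg SurdPt.val h5
    have h6 := congrArg SurdPt.val h6
    simp only [SurdPt.val_dot, SurdPt.val_sub, SurdPt.val_add, SurdPt.val_smul,
      real_inner_self_eq_norm_sq] at h1 h2 h3 h4 h5 h6
    push_cast at h1 h2 h3 h4 h5 h6
    simp only [image_cons, image_nil, insert_empty_eq]
    have n2 := (sq_eq_sq₀ (norm_nonneg _) (norm_nonneg _)).1 h2
    have n3 := (sq_eq_sq₀ (norm_nonneg _) (norm_nonneg _)).1 h3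
    have half (x : E3) : ‖(1 / 2 : ℝ) • x‖ = 1 / 2 * ‖x‖ := by rw [norm_smul]; norm_num
    have key := isGon_six (o := (1 / 2 : ℝ) • ((p a).val + (p d).val))
      (u := (1 / 2 : ℝ) • ((2 : ℝ) • (p a).val - ((p a).val + (p d).val)))
      (v := (1 / 2 : ℝ) • ((2 : ℝ) • (p c).val - ((p a).val + (p d).val)))
      (by rw [half, half, n3]) (by rw [← smul_add, ← h6, half, half, n2]) (by
        intro h0
        have h0 := congrArg norm h0
        rw [half, norm_zero] at h0
        have : ‖(2 : ℝ) • (p a).val - ((p a).val + (p d).val)‖ = 0 := by linarith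
        rw [this] at h1
        norm_num at h1)
    have hsum : (1 / 2 : ℝ) • ((2 : ℝ) • (p a).val - ((p a).val + (p d).val)) +
        (1 / 2 : ℝ) • ((2 : ℝ) • (p c).val - ((p a).val + (p d).val)) =
        (1 / 2 : ℝ) • ((2 : ℝ) • (p b).val - ((p a).val + (p d).val)) := by
      rw [← smul_add, ← h6]
    rw [hsum] at key
    change IsGon 6 _
    convert key using 1
    have six {x₁ x₂ x₃ x₄ x₅ x₆ y₁ y₂ y₃ y₄ y₅ y₆ : E3} (e₁ : x₁ = y₁) (e₂ : x₂ = y₂)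
        (e₃ : x₃ = y₃) (e₄ : x₄ = y₄) (e₅ : x₅ = y₅) (e₆ : x₆ = y₆) :
        ({x₁, x₂, x₃, x₄, x₅, x₆} : Set E3) = {y₁, y₂, y₃, y₄, y₅, y₆} := by
      rw [e₁, e₂, e₃, e₄, e₅, e₆]
    refine six ?_ ?_ ?_ ?_ ?_ ?_
    · module
    · module
    · module
    · module
    · rw [h4]
      module
    · rw [h5]
      module

variable (M : Blueprint)

noncomputable def alpha : ℝ := M.al.val / M.den

/-- From the source to the target of a link. -/
noncomputable def dir (L : Link) : E3 := (M.direction L).val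

lemma dir_eq (L : Link) : M.dir L = M.centerPt L.dst - M.centerPt (L.src, 0) := by
  rw [dir, direction, SurdPt.val_sub]; rfl

lemma centerPt_eq (k : ℕ) (n : Shift) : M.centerPt (k, n) = M.centerPt (k, 0) + M.vec n := by
  rw [← centerPt_move]
  simp [Node.move, Shift.add_eq]

lemma centerPt_dst_move (L : Link) (n : Shift) :
    M.centerPt (L.dst.move n) = M.centerPt (L.src, n) + M.dir L := by
  rw [centerPt_move, dir_eq, centerPt_eq M L.src n]
  abel

lemma dir_rev (L : Link) : M.dir L.rev = -M.dir L := by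
  rw [dir_eq, dir_eq, Link.rev]
  change M.centerPt (L.src, L.dst.2.neg) - M.centerPt (L.dst.1, 0) =
    -(M.centerPt (L.dst.1, L.dst.2) - M.centerPt (L.src, 0))
  rw [centerPt_eq M L.src, centerPt_eq M L.dst.1 L.dst.2, Shift.neg_eq, vec_neg]
  abel

lemma rev_rev (L : Link) : L.rev.rev = L := by
  obtain ⟨s, ⟨k, a, b, c⟩, bs, tp⟩ := L
  simp [Link.rev, Shift.neg]

lemma rev_mem_darts {L : Link} (hL : L ∈ M.darts) : L.rev ∈ M.darts := by
  simp only [darts, mem_append, mem_map] at hL ⊢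
  rcases hL with hL | ⟨K, hK, rfl⟩
  · exact Or.inr ⟨L, hL, rfl⟩
  · left; rwa [rev_rev]

lemma exists_link_of_dart {L : Link} (hL : L ∈ M.darts) : L ∈ M.links ∨ L.rev ∈ M.links := by
  simp only [darts, mem_append, mem_map] at hL
  rcases hL with hL | ⟨K, hK, rfl⟩
  · exact Or.inl hL
  · right; rwa [rev_rev]

lemma mem_darts_of_mem_links {L : Link} (hL : L ∈ M.links) : L ∈ M.darts := by
  simp [darts, hL]

variable {M}

/-- What the checks say about a dart. -/
structure DartFacts (M : Blueprint) (r : ℕ) (L : Link) : Prop where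
  src_lt : L.src < M.cen.length
  dst_lt : L.dst.1 < M.cen.length
  base_lt : ∀ i ∈ L.base, i < M.rel.length
  base_length : L.base.length = r
  top_length : L.top.length = r
  opposite : ∀ s ∈ L.base.zip L.top, (M.anti = true → M.relPt s.2 = -M.relPt s.1) ∧
    (M.anti = false → M.relPt s.2 = M.relPt s.1 - (2 * M.alpha) • M.dir L)
  level : ∀ i ∈ L.base, inner ℝ (M.relPt i) (M.dir L) = M.alpha * inner ℝ (M.dir L) (M.dir L)
  sum : (L.base.map M.relPt).sum = (r * M.alpha) • M.dir L
  gon : IsGon r (M.relPt '' {i | i ∈ L.base})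
  perp : M.anti = true → ∀ i ∈ L.base, ∀ j ∈ L.base, i ≠ j →
    inner ℝ ((2 : ℝ) • M.relPt i - M.dir L) ((2 : ℝ) • M.relPt j - M.dir L) = 0
  face : ∃ f ∈ M.faces, ∀ j, j ∈ f ↔ j ∈ L.base
  le : ∀ j < M.rel.length, inner ℝ (M.relPt j) (M.dir L) ≤ M.alpha * inner ℝ (M.dir L) (M.dir L)

variable {p q r d : ℕ} {g : ℤ}

lemma Valid.links₁ (h : M.Valid p q r d g) : 0 < M.al.val ∧ 2 * M.al.val < M.den ∧
    (M.anti = true → r = 3 ∧ 3 * M.al.val ≤ M.den) := by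
  have h1 := h.links
  simp only [linksOK, and_eq_true, or_eq_true, not_eq_true'] at h1
  obtain ⟨⟨h1, h2, h3⟩, -⟩ := h1
  have h2 := Surd.val_lt h2
  rw [Surd.val_smul, Surd.val_intCast] at h2
  refine ⟨Surd.val_pos h1, by exact_mod_cast h2, fun ha => ?_⟩
  rcases h3 with h3 | ⟨h3, h4⟩
  · rw [ha] at h3; exact absurd h3 (by decide)
  · have h4 := Surd.val_le h4
    rw [Surd.val_smul, Surd.val_intCast] at h4
    exact ⟨by simpa using h3, by exact_mod_cast h4⟩

lemma Valid.den_pos (h : M.Valid p q r d g) : (0 : ℝ) < M.den := by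
  linarith [h.links₁.1, h.links₁.2.1]

lemma Valid.alpha_pos (h : M.Valid p q r d g) : 0 < M.alpha := div_pos h.links₁.1 h.den_pos

lemma Valid.alpha_lt (h : M.Valid p q r d g) : M.alpha < 1 / 2 := by
  rw [alpha, div_lt_iff₀ h.den_pos]; linarith [h.links₁.2.1]

lemma Valid.alpha_le (h : M.Valid p q r d g) (ha : M.anti = true) : M.alpha ≤ 1 / 3 := by
  rw [alpha, div_le_iff₀ h.den_pos]; linarith [(h.links₁.2.2 ha).2]

lemma Valid.den_mul_alpha (h : M.Valid p q r d g) : M.den * M.alpha = M.al.val :=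
  mul_div_cancel₀ _ h.den_pos.ne'

lemma Valid.dartFacts (h : M.Valid p q r d g) {L : Link} (hL : L ∈ M.darts) :
    M.DartFacts r L := by
  have h1 := h.links
  simp only [linksOK, and_eq_true, all_eq_true] at h1
  have h2 := h1.2.1.1 L hL
  simp only [dartOK, and_eq_true, all_eq_true, ltAll_iff, Surd.same_iff, SurdPt.same_iff,
    or_eq_true, not_eq_true', any_eq_true (p := fun f => _ && _),
    any_beq_iff, List.mem_range] at h2
  obtain ⟨⟨a1, a2, a3, -⟩, ⟨b1, b2⟩, c1, c2, c3, c4, c5, ⟨f, hf, hf1, hf2⟩, c7⟩ := h2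
  have hden := h.den_pos
  have hα := h.den_mul_alpha
  refine ⟨by simpa using a1, by simpa using a2, a3, by simpa using b1, by simpa using b2,
    fun s hs => ?_, fun i hi => ?_, ?_, ?_, fun ha i hi j hj hij => ?_,
    ⟨f, hf, fun j => ⟨hf1 j, hf2 j⟩⟩, fun j hj => ?_⟩
  · have := c1 s hs
    unfold oppositeOK at this
    split_ifs at this with ha
    · refine ⟨fun _ => ?_, fun ha' => absurd (ha.symm.trans ha') (by decide)⟩
      have := congrArg SurdPt.val (SurdPt.same_iff.1 this)
      rw [SurdPt.val_smul] at this
      simpa [relPt, relAt] using this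
    · refine ⟨fun ha' => absurd ha' ha, fun _ => ?_⟩
      have := congrArg SurdPt.val (SurdPt.same_iff.1 this)
      simp only [SurdPt.val_smul, SurdPt.val_mul, SurdPt.val_sub] at this
      rw [← hα] at this
      have h3 : (M.relAt s.1).val - (M.relAt s.2).val = (2 * M.alpha) • M.dir L := by
        apply smul_right_injective E3 hden.ne'
        change (M.den : ℝ) • ((M.relAt s.1).val - (M.relAt s.2).val) = (M.den : ℝ) • _
        rw [this, dir, smul_smul, smul_smul]
        congr 1
        push_cast
        ring
      change (M.relAt s.2).val = (M.relAt s.1).val - _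
      rw [← h3]; abel
  · have := congrArg Surd.val (c2 i hi)
    rw [Surd.val_smul, Surd.val_mul, SurdPt.val_dot, SurdPt.val_dot, ← hα, mul_assoc] at this
    exact mul_left_cancel₀ hden.ne' this
  · have hs : ∀ l : List ℕ, (l.foldr (fun i s => (M.relAt i).add s) SurdPt.zero).val =
        (l.map M.relPt).sum := by
      intro l
      induction l with
      | nil => exact SurdPt.val_zero
      | cons a l ih => rw [List.foldr_cons, SurdPt.val_add, ih, map_cons, List.sum_cons]; rfl
    have := congrArg SurdPt.val c3
    rw [SurdPt.val_smul, SurdPt.val_smul, SurdPt.val_mul, hs, ← hα] at this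
    apply smul_right_injective E3 hden.ne'
    change (M.den : ℝ) • (L.base.map M.relPt).sum = (M.den : ℝ) • _
    rw [this, dir, smul_smul, smul_smul]
    congr 1
    push_cast
    ring
  · have := polygonOK_sound c4
    have hr : L.base.length = r := by simpa using b1
    rw [hr] at this
    exact this
  · rcases c5 with c5 | c5
    · rw [ha] at c5; exact absurd c5 (by decide)
    · rcases c5 i hi j hj with h3 | h3
      · exact absurd (by simpa using h3) hij
      · have := congrArg Surd.val h3
        rw [SurdPt.val_dot, spoke, spoke, SurdPt.val_sub, SurdPt.val_sub, SurdPt.val_smul,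
          SurdPt.val_smul, Surd.val_zero] at this
        exact_mod_cast this
  · have := Surd.val_le (c7 j hj)
    rw [Surd.val_smul, Surd.val_mul, SurdPt.val_dot, SurdPt.val_dot, ← hα, mul_assoc] at this
    exact le_of_mul_le_mul_left this hden

lemma Valid.exists_length (h : M.Valid p q r d g) : ∃ D : ℝ, 0 < D ∧ M.darts ≠ [] ∧
    ∀ L ∈ M.darts, inner ℝ (M.dir L) (M.dir L) = D := by
  have h1 := h.links
  simp only [linksOK, and_eq_true] at h1
  have h2 := h1.2.2
  split at h2
  · exact absurd h2 (by decide)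
  · rename_i L l hl
    simp only [and_eq_true, all_eq_true, Surd.same_iff] at h2
    refine ⟨inner ℝ (M.dir L) (M.dir L), ?_, ?_, fun K hK => ?_⟩
    · rw [dir, ← SurdPt.val_dot]; exact Surd.val_pos h2.1
    · simp [darts, hl]
    · rw [dir, dir, ← SurdPt.val_dot, ← SurdPt.val_dot, h2.2 K hK]

lemma Valid.dart_pair (h : M.Valid p q r d g) {L K : Link} (hL : L ∈ M.darts) (hK : K ∈ M.darts)
    (hLK : L ≠ K) (hs : L.src = K.src) : L.dst ≠ K.dst ∧
    3 * inner ℝ (M.dir L) (M.dir K) ≤ inner ℝ (M.dir L) (M.dir L) ∧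
    ∃ l : List ℕ, l.length ≤ 2 ∧ ∀ j, j ∈ L.base → j ∈ K.base → j ∈ l := by
  have h1 := h.links
  simp only [linksOK, and_eq_true] at h1
  obtain ⟨D, -, -, hD⟩ := h.exists_length
  have key : ∀ {L K : Link}, L ∈ M.darts → K ∈ M.darts → L.src = K.src →
      M.dartPairOK L K = true → L.dst ≠ K.dst ∧
      3 * inner ℝ (M.dir L) (M.dir K) ≤ inner ℝ (M.dir L) (M.dir L) ∧
      ∃ l : List ℕ, l.length ≤ 2 ∧ ∀ j, j ∈ L.base → j ∈ K.base → j ∈ l := by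
    intro L K hL hK hs h2
    simp only [dartPairOK, or_eq_true, and_eq_true, not_eq_true', hs] at h2
    rcases h2 with h2 | ⟨h2, h3, h4⟩
    · simp at h2
    · refine ⟨fun h5 => ?_, ?_, _, Nat.le_of_ble_eq_true h4, fun j hj hj' => ?_⟩
      · rw [← not_eq_true, Node.same_iff] at h2
        exact h2 h5
      · have := Surd.val_le h3
        rw [Surd.val_smul, SurdPt.val_dot, SurdPt.val_dot] at this
        exact_mod_cast this
      · exact List.mem_filter.2 ⟨hj, any_beq_iff.2 hj'⟩
  rcases pairsAll_sound h1.2.1.2.2 L hL K hK hLK with h2 | h2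
  · exact key hL hK hs h2
  · obtain ⟨h3, h4, l, h5, h6⟩ := key hK hL hs.symm h2
    refine ⟨h3.symm, ?_, l, h5, fun j hj hj' => h6 j hj' hj⟩
    rw [real_inner_comm, hD L hL]
    rw [hD K hK] at h4
    exact h4

lemma Valid.dart_unique (h : M.Valid p q r d g) {L K : Link} (hL : L ∈ M.darts)
    (hK : K ∈ M.darts) (hs : L.src = K.src) (hd : L.dst = K.dst) : L = K := by
  by_contra hne
  exact (h.dart_pair hL hK hne hs).1 hd

lemma Valid.node_facts (h : M.Valid p q r d g) : (∃ R : ℝ, 0 < R ∧ ∀ j < M.rel.length,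
    ‖M.relPt j‖ = R) ∧ (∀ i < M.rel.length, ∀ j < M.rel.length, M.relPt i = M.relPt j → i = j) ∧
    ∃ i < M.rel.length, ∃ j < M.rel.length, M.relPt j = -M.relPt i := by
  have h1 := h.node
  unfold nodeOK at h1
  split at h1
  · exact absurd h1 (by decide)
  · rename_i p l hl
    simp only [and_eq_true, all_eq_true, Surd.same_iff, any_eq_true,
      SurdPt.same_iff] at h1
    obtain ⟨h1, h2, h3, P, hP, Q, hQ, hPQ⟩ := h1
    have hget : ∀ j (hj : j < M.rel.length), M.relPt j = (M.rel[j]).val := by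
      intro j hj
      rw [relPt, List.getD_eq_getElem _ _ hj]
    refine ⟨⟨‖p.val‖, ?_, fun j hj => ?_⟩, fun i hi j hj hij => ?_, ?_⟩
    · have := Surd.val_pos h1
      rw [SurdPt.val_dot, real_inner_self_pos] at this
      exact norm_pos_iff.2 this
    · have := congrArg Surd.val (h2 _ (List.getElem_mem hj))
      rw [SurdPt.val_dot, SurdPt.val_dot, real_inner_self_eq_norm_sq, real_inner_self_eq_norm_sq,
        ← hget] at this
      exact (sq_eq_sq₀ (norm_nonneg _) (norm_nonneg _)).1 this
    · rw [hget i hi, hget j hj] at hij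
      have hij := SurdPt.val_injective hij
      have hnd : M.rel.Nodup := by
        clear * - h3
        generalize M.rel = l at h3
        induction l with
        | nil => exact List.nodup_nil
        | cons a l ih =>
          simp only [pairsAll, and_eq_true, all_eq_true, not_eq_true',
            ← not_eq_true, SurdPt.same_iff] at h3
          exact List.nodup_cons.2 ⟨fun ha => h3.1 a ha rfl, ih h3.2⟩
      exact (Nodup.getElem_inj_iff hnd).1 hij
    · obtain ⟨i, hi, rfl⟩ := List.getElem_of_mem hP
      obtain ⟨j, hj, rfl⟩ := List.getElem_of_mem hQ
      refine ⟨i, hi, j, hj, ?_⟩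
      rw [hget i hi, hget j hj, hPQ, SurdPt.val_smul]
      simp

end Blueprint

namespace Blueprint

/-! ### The complex that a blueprint describes -/

lemma length_of_polygonOK : ∀ {l : List SurdPt}, polygonOK l = true →
    l.length = 3 ∨ l.length = 4 ∨ l.length = 6
  | [_, _, _], _ => by simp
  | [_, _, _, _], _ => by simp
  | [_, _, _, _, _, _], _ => by simp

lemma listHull_congr {ι : Type} {f : ι → E3} {X Y : List ι} (h : ∀ i, i ∈ X ↔ i ∈ Y) :
    listHull f X = listHull f Y := by
  simp only [listHull, h]

lemma listHull_mono {ι : Type} {f : ι → E3} {X Y : List ι} (h : ∀ i ∈ X, i ∈ Y) :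
    listHull f X ⊆ listHull f Y :=
  convexHull_mono (image_mono h)

lemma mem_listHull {ι : Type} {f : ι → E3} {X : List ι} {i : ι} (h : i ∈ X) :
    f i ∈ listHull f X :=
  subset_convexHull ℝ _ ⟨i, h, rfl⟩

lemma finite_image_mem {ι : Type} (f : ι → E3) (X : List ι) : (f '' {i | i ∈ X}).Finite :=
  X.finite_toSet.image f

lemma add_smul_mem {K : Set E3} (hK : Convex ℝ K) {u e : E3} {s t c : ℝ} (hs : u + s • e ∈ K)
    (ht : u + t • e ∈ K) (h1 : s ≤ c) (h2 : c ≤ t) : u + c • e ∈ K := by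
  have hf := (hK.affine_preimage (AffineMap.lineMap u (u + e) : ℝ →ᵃ[ℝ] E3)).ordConnected
  have e1 (c : ℝ) : AffineMap.lineMap u (u + e) c = u + c • e := by
    rw [AffineMap.lineMap_apply]; simp [add_comm]
  have := hf.out (x := s) (y := t) (by rw [Set.mem_preimage, e1]; exact hs)
    (by rw [Set.mem_preimage, e1]; exact ht) ⟨h1, h2⟩
  rwa [Set.mem_preimage, e1] at this

lemma mem_map_pair {α β : Type} {a : α} {l : List β} {v : α × β} :
    v ∈ l.map (fun j => (a, j)) ↔ v.1 = a ∧ v.2 ∈ l :=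
  mem_map.trans ⟨by rintro ⟨j, hj, rfl⟩; exact ⟨rfl, hj⟩,
    fun h => ⟨v.2, h.2, Prod.ext h.1.symm rfl⟩⟩

lemma inter_eq_empty {ι : Type} {f : ι → E3} {X Y : List ι} (h : Separated f X Y)
    (hXY : ∀ i ∈ X, i ∉ Y) : listHull f X ∩ listHull f Y = ∅ := by
  have : {i | i ∈ X ∧ i ∈ Y} = ∅ := Set.eq_empty_of_forall_notMem fun i hi => hXY i hi.1 hi.2
  rwa [Separated, this, Set.image_empty, convexHull_empty, Set.subset_empty_iff] at h

/-- A translate of a link or of its reverse: an ordered pair of adjacent vertices. -/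
abbrev Arc : Type := Link × Shift

namespace Arc

def src (a : Arc) : Node := (a.1.src, a.2)
def dst (a : Arc) : Node := a.1.dst.move a.2
def rev (a : Arc) : Arc := (a.1.rev, a.dst.2)
def base (a : Arc) : List Corner := a.1.base.map fun j => (a.src, j)
def top (a : Arc) : List Corner := a.1.top.map fun j => (a.dst, j)
def corners (a : Arc) : List Corner := a.base ++ a.top
def move (n : Shift) (a : Arc) : Arc := (a.1, a.2.add n)

lemma src_rev (a : Arc) : a.rev.src = a.dst := rfl

lemma dst_rev (a : Arc) : a.rev.dst = a.src := by
  obtain ⟨⟨s, ⟨k, m⟩, bs, tp⟩, n⟩ := a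
  simp [rev, dst, src, Link.rev, Node.move, Shift.add_eq, Shift.neg_eq]

lemma rev_rev (a : Arc) : a.rev.rev = a :=
  Prod.ext (Blueprint.rev_rev a.1) (congrArg (fun A : Node => A.2) a.dst_rev)

lemma base_rev (a : Arc) : a.rev.base = a.top := rfl

lemma top_rev (a : Arc) : a.rev.top = a.base := by
  simp only [top, base, dst_rev]; rfl

lemma mem_corners_rev (a : Arc) (v : Corner) : v ∈ a.rev.corners ↔ v ∈ a.corners := by
  rw [corners, corners, base_rev, top_rev, mem_append, mem_append, or_comm]

lemma src_move (n : Shift) (a : Arc) : (a.move n).src = a.src.move n := rfl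

lemma dst_move (n : Shift) (a : Arc) : (a.move n).dst = a.dst.move n := by
  simp [move, dst, Node.move_move, Shift.add_eq]

lemma base_move (n : Shift) (a : Arc) : (a.move n).base = a.base.map (Corner.move n) := by
  simp [base, src_move, Corner.move, comp_def]; rfl

lemma top_move (n : Shift) (a : Arc) : (a.move n).top = a.top.map (Corner.move n) := by
  simp [top, dst_move, Corner.move, comp_def]; rfl

lemma corners_move (n : Shift) (a : Arc) :
    (a.move n).corners = a.corners.map (Corner.move n) := by
  rw [corners, corners, base_move, top_move, List.map_append]

lemma corners_eq (a : Arc) : a.corners = (linkCorners a.1).map (Corner.move a.2) := by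
  simp [corners, base, top, linkCorners, Corner.move, comp_def, src, dst, Node.move,
    Shift.add_eq, ← Prod.zero_eq_mk]

lemma mem_base {a : Arc} {v : Corner} : v ∈ a.base ↔ v.1 = a.src ∧ v.2 ∈ a.1.base := mem_map_pair

lemma mem_top {a : Arc} {v : Corner} : v ∈ a.top ↔ v.1 = a.dst ∧ v.2 ∈ a.1.top := mem_map_pair

lemma mem_corners {a : Arc} {v : Corner} : v ∈ a.corners ↔ v ∈ a.base ∨ v ∈ a.top :=
  mem_append

lemma fst_of_mem_corners {a : Arc} {v : Corner} (hv : v ∈ a.corners) :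
    v.1 = a.src ∨ v.1 = a.dst :=
  (mem_corners.1 hv).imp (fun h => (mem_base.1 h).1) fun h => (mem_top.1 h).1

lemma exists_base {a : Arc} {v : Corner} (hv : v ∈ a.corners) :
    ∃ b : Arc, (b = a ∨ b = a.rev) ∧ v ∈ b.base :=
  (mem_corners.1 hv).elim (fun h => ⟨a, Or.inl rfl, h⟩) fun h => ⟨a.rev, Or.inr rfl, h⟩

lemma corners_iff {a b : Arc} (h : b = a ∨ b = a.rev) (v : Corner) :
    v ∈ b.corners ↔ v ∈ a.corners := by
  rcases h with rfl | rfl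
  exacts [Iff.rfl, mem_corners_rev _ v]

lemma eq_or_eq_rev {a b c : Arc} (ha : c = a ∨ c = a.rev) (hb : c = b ∨ c = b.rev) :
    b = a ∨ b = a.rev := by
  rcases ha with rfl | rfl <;> rcases hb with hb | hb
  · exact Or.inl hb.symm
  · exact Or.inr (by rw [hb, rev_rev])
  · exact Or.inr hb.symm
  · left; rw [← b.rev_rev, ← hb, rev_rev]

end Arc

variable (M : Blueprint)

def IsNode (A : Node) : Prop := A.1 < M.cen.length

def IsArc (a : Arc) : Prop := a.1 ∈ M.darts

def nodeList (A : Node) : List Corner := (List.range M.rel.length).map fun j => (A, j)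
noncomputable def nodeSet (A : Node) : Set E3 := listHull M.cornerPt (M.nodeList A)
noncomputable def arcSet (a : Arc) : Set E3 := listHull M.cornerPt a.corners
noncomputable def baseSet (a : Arc) : Set E3 := listHull M.cornerPt a.base

def IsCorner (v : Corner) : Prop := M.IsNode v.1 ∧ v.2 < M.rel.length

lemma mem_nodeList {A : Node} {v : Corner} :
    v ∈ M.nodeList A ↔ v.1 = A ∧ v.2 < M.rel.length :=
  mem_map_pair.trans (by rw [List.mem_range])

lemma nodeList_eq (A : Node) : M.nodeList A = (M.nodeCorners A.1).map (Corner.move A.2) := by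
  simp [nodeList, nodeCorners, Corner.move, comp_def, Node.move, Shift.add_eq,
    ← Prod.zero_eq_mk]

lemma nodeList_move (n : Shift) (A : Node) :
    M.nodeList (A.move n) = (M.nodeList A).map (Corner.move n) := by
  simp [nodeList, Corner.move, comp_def]

lemma nodeSet_move (n : Shift) (A : Node) :
    M.nodeSet (A.move n) = translate (M.vec n) (M.nodeSet A) := by
  rw [nodeSet, nodeList_move]
  exact M.isAction_corner.listHull_map n _

lemma arcSet_move (n : Shift) (a : Arc) :
    M.arcSet (a.move n) = translate (M.vec n) (M.arcSet a) := by
  rw [arcSet, Arc.corners_move]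
  exact M.isAction_corner.listHull_map n _

lemma arcSet_rev (a : Arc) : M.arcSet a.rev = M.arcSet a :=
  listHull_congr a.mem_corners_rev

lemma baseSet_subset_arcSet (a : Arc) : M.baseSet a ⊆ M.arcSet a :=
  listHull_mono fun _ h => Arc.mem_corners.2 (Or.inl h)

variable {M} {p q r d : ℕ} {g : ℤ}

lemma IsArc.rev {a : Arc} (ha : M.IsArc a) : M.IsArc a.rev := M.rev_mem_darts ha

lemma IsArc.of_eq {a b : Arc} (ha : M.IsArc a) (h : b = a ∨ b = a.rev) : M.IsArc b := by
  rcases h with rfl | rfl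
  exacts [ha, ha.rev]

lemma IsArc.move {a : Arc} (ha : M.IsArc a) (n : Shift) : M.IsArc (a.move n) := ha

lemma centerPt_dst (a : Arc) : M.centerPt a.dst = M.centerPt a.src + M.dir a.1 :=
  M.centerPt_dst_move a.1 a.2

namespace Valid

variable (h : M.Valid p q r d g) {a : Arc} {A : Node} {v : Corner}
include h

lemma isDual : M.IsDual := M.isDual_of_dualOK h.dual

lemma three_le : 3 ≤ r := by
  obtain ⟨D, -, hne, -⟩ := h.exists_length
  obtain ⟨L, hL⟩ := exists_mem_of_ne_nil _ hne
  have h1 := h.links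
  simp only [linksOK, and_eq_true, all_eq_true] at h1
  have h2 := h1.2.1.1 L hL
  simp only [dartOK, and_eq_true] at h2
  have h3 := length_of_polygonOK h2.2.2.2.2.2.1
  rw [length_map, (h.dartFacts hL).base_length] at h3
  omega

lemma isNode_src (ha : M.IsArc a) : M.IsNode a.src := (h.dartFacts ha).src_lt
lemma isNode_dst (ha : M.IsArc a) : M.IsNode a.dst := (h.dartFacts ha).dst_lt

lemma dir_ne_zero {L : Link} (hL : L ∈ M.darts) : M.dir L ≠ 0 := by
  obtain ⟨D, hD, -, hL'⟩ := h.exists_length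
  intro h0
  have := hL' L hL
  rw [h0, inner_zero_left] at this
  exact hD.ne this

lemma src_ne_dst (ha : M.IsArc a) : a.src ≠ a.dst := by
  intro h0
  have := centerPt_dst (M := M) a
  rw [← h0, left_eq_add] at this
  exact h.dir_ne_zero ha this

lemma base_ne_nil (ha : M.IsArc a) : a.1.base ≠ [] := by
  intro h0
  have := (h.dartFacts ha).base_length
  rw [h0] at this
  have := h.three_le
  simp at *
  omega

lemma top_ne_nil (ha : M.IsArc a) : a.1.top ≠ [] := h.base_ne_nil ha.rev

lemma isCorner_of_mem_base (ha : M.IsArc a) (hv : v ∈ a.base) :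
    M.IsCorner v := by
  obtain ⟨h1, h2⟩ := Arc.mem_base.1 hv
  exact ⟨h1 ▸ h.isNode_src ha, (h.dartFacts ha).base_lt _ h2⟩

lemma isCorner_of_mem_corners (ha : M.IsArc a) (hv : v ∈ a.corners) :
    M.IsCorner v := by
  rcases Arc.mem_corners.1 hv with hv | hv
  · exact h.isCorner_of_mem_base ha hv
  · rw [← Arc.base_rev] at hv
    exact h.isCorner_of_mem_base ha.rev hv

lemma arc_unique {a b : Arc} (ha : M.IsArc a) (hb : M.IsArc b) (hs : a.src = b.src)
    (hd : a.dst = b.dst) : a = b := by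
  have h2 : a.2 = b.2 := congrArg (fun A : Node => A.2) hs
  refine Prod.ext (h.dart_unique ha hb (congrArg Prod.fst hs) ?_) h2
  rw [Arc.dst, Arc.dst, h2] at hd
  exact M.isAction_node.mv_injective _ hd

lemma exists_corners (ha : M.IsArc a) :
    (∃ v ∈ a.corners, v.1 = a.src) ∧ ∃ v ∈ a.corners, v.1 = a.dst := by
  obtain ⟨i, hi⟩ := exists_mem_of_ne_nil _ (h.base_ne_nil ha)
  obtain ⟨j, hj⟩ := exists_mem_of_ne_nil _ (h.top_ne_nil ha)
  exact ⟨⟨(a.src, i), Arc.mem_corners.2 (Or.inl (Arc.mem_base.2 ⟨rfl, hi⟩)), rfl⟩,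
    (a.dst, j), Arc.mem_corners.2 (Or.inr (Arc.mem_top.2 ⟨rfl, hj⟩)), rfl⟩

lemma corners_unique {a b : Arc} (ha : M.IsArc a) (hb : M.IsArc b)
    (hab : ∀ v, v ∈ a.corners ↔ v ∈ b.corners) : b = a ∨ b = a.rev := by
  obtain ⟨⟨v, hv, hv'⟩, w, hw, hw'⟩ := h.exists_corners ha
  have hne := h.src_ne_dst ha
  rcases Arc.fst_of_mem_corners ((hab v).1 hv) with h1 | h1 <;>
    rcases Arc.fst_of_mem_corners ((hab w).1 hw) with h2 | h2 <;> rw [hv'] at h1 <;> rw [hw'] at h2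
  · exact absurd (h1.trans h2.symm) hne
  · exact Or.inl (h.arc_unique hb ha h1.symm h2.symm)
  · exact Or.inr (h.arc_unique hb ha.rev h2.symm (by rw [Arc.dst_rev]; exact h1.symm))
  · exact absurd (h1.trans h2.symm) hne

omit h in
lemma exists_link (ha : M.IsArc a) : ∃ b : Arc, b.1 ∈ M.links ∧ (b = a ∨ b = a.rev) := by
  rcases M.exists_link_of_dart ha with h1 | h1
  · exact ⟨a, h1, Or.inl rfl⟩
  · exact ⟨a.rev, h1, Or.inr rfl⟩

lemma rel_pos : 0 < M.rel.length := by
  obtain ⟨-, -, i, hi, -⟩ := h.node_facts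
  exact Nat.zero_lt_of_lt hi

omit h in
variable (M) in
def solidLists : List (List Corner) :=
  (List.range M.cen.length).map M.nodeCorners ++ M.links.map linkCorners

lemma cell_separated {X Y : List Corner} (hX : X ∈ solidLists M) (hY : Y ∈ solidLists M)
    (m n : Shift) : (X = Y ∧ m = n) ∨
      Separated M.cornerPt (X.map (Corner.move m)) (Y.map (Corner.move n)) := by
  have e : M.solidCells = (solidLists M).map (M.mkCell M.place) := by
    simp [solidCells, solidLists, comp_def]
  exact sepCheck_sound h.isDual M.isAction_corner (fun i j => Corner.same_iff.1)
    (e ▸ h.near_solids) (e ▸ h.sep_solids) hX hY m n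

omit h in
lemma nodeCorners_mem (hA : M.IsNode A) : M.nodeCorners A.1 ∈ solidLists M :=
  mem_append_left _ (mem_map.2 ⟨A.1, List.mem_range.2 hA, rfl⟩)

omit h in
lemma linkCorners_mem {L : Link} (hL : L ∈ M.links) : linkCorners L ∈ solidLists M :=
  mem_append_right _ (mem_map_of_mem hL)

lemma node_separated {A B : Node} (hA : M.IsNode A) (hB : M.IsNode B) (hAB : A ≠ B) :
    Disjoint (M.nodeSet A) (M.nodeSet B) := by
  rw [Set.disjoint_iff_inter_eq_empty]
  rcases h.cell_separated (nodeCorners_mem hA) (nodeCorners_mem hB) A.2 B.2 with ⟨h1, h2⟩ | h1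
  · have h3 : (A, 0) ∈ M.nodeList B := by
      rw [nodeList_eq, ← h1, ← h2, ← nodeList_eq]
      exact M.mem_nodeList.2 ⟨rfl, h.rel_pos⟩
    exact absurd (M.mem_nodeList.1 h3).1 hAB
  · rw [← nodeList_eq, ← nodeList_eq] at h1
    exact inter_eq_empty h1 fun v h2 h3 =>
      hAB ((M.mem_nodeList.1 h2).1.symm.trans (M.mem_nodeList.1 h3).1)

lemma node_arc_separated (hA : M.IsNode A) (ha : M.IsArc a) :
    Separated M.cornerPt (M.nodeList A) a.corners := by
  obtain ⟨b, hb, hba⟩ := exists_link ha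
  rcases h.cell_separated (nodeCorners_mem hA) (linkCorners_mem hb) A.2 b.2 with ⟨h1, h2⟩ | h1
  · have h3 : M.nodeList A = b.corners := by rw [nodeList_eq, Arc.corners_eq, h1, h2]
    obtain ⟨⟨v, hv, hv'⟩, w, hw, hw'⟩ := h.exists_corners (ha.of_eq hba)
    rw [← h3, mem_nodeList] at hv hw
    exact absurd (hv'.symm.trans (hv.1.trans (hw.1.symm.trans hw'))) (h.src_ne_dst (ha.of_eq hba))
  · rw [← nodeList_eq, ← Arc.corners_eq] at h1
    simpa only [Separated, listHull, Arc.corners_iff hba] using h1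

lemma arc_separated {a b : Arc} (ha : M.IsArc a) (hb : M.IsArc b) :
    (b = a ∨ b = a.rev) ∨ Separated M.cornerPt a.corners b.corners := by
  obtain ⟨a', ha1, ha2⟩ := exists_link ha
  obtain ⟨b', hb1, hb2⟩ := exists_link hb
  rcases h.cell_separated (linkCorners_mem ha1) (linkCorners_mem hb1) a'.2 b'.2 with ⟨h1, h2⟩ | h1
  · have : a'.corners = b'.corners := by rw [Arc.corners_eq, Arc.corners_eq, h1, h2]
    exact Or.inl (h.corners_unique ha hb fun v => by
      rw [← Arc.corners_iff ha2, ← Arc.corners_iff hb2, this])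
  · rw [← Arc.corners_eq, ← Arc.corners_eq] at h1
    right
    simpa only [Separated, listHull, Arc.corners_iff ha2, Arc.corners_iff hb2] using h1

lemma center_mem : M.centerPt A ∈ M.nodeSet A := by
  obtain ⟨-, -, i, hi, j, hj, hij⟩ := h.node_facts
  have h1 : M.cornerPt (A, i) ∈ M.nodeSet A := mem_listHull (M.mem_nodeList.2 ⟨rfl, hi⟩)
  have h2 : M.cornerPt (A, j) ∈ M.nodeSet A := mem_listHull (M.mem_nodeList.2 ⟨rfl, hj⟩)
  have h3 := (convex_convexHull ℝ _) h1 h2 (by norm_num : (0 : ℝ) ≤ 1 / 2)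
    (by norm_num : (0 : ℝ) ≤ 1 / 2) (by norm_num)
  rw [cornerPt_eq, cornerPt_eq] at h3
  simp only [hij] at h3
  have e : (1 / 2 : ℝ) • (M.centerPt A + M.relPt i) + (1 / 2 : ℝ) • (M.centerPt A + -M.relPt i) =
      M.centerPt A := by module
  rwa [e] at h3

lemma center_injective {A B : Node} (hA : M.IsNode A) (hB : M.IsNode B)
    (hAB : M.centerPt A = M.centerPt B) : A = B := by
  by_contra hne
  exact Set.disjoint_left.1 (h.node_separated hA hB hne) h.center_mem (hAB ▸ h.center_mem)

omit h in
lemma corner_mem_nodeSet (hv : M.IsCorner v) : M.cornerPt v ∈ M.nodeSet v.1 :=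
  mem_listHull (M.mem_nodeList.2 ⟨rfl, hv.2⟩)

lemma corner_injective {v w : Corner} (hv : M.IsCorner v) (hw : M.IsCorner w)
    (hvw : M.cornerPt v = M.cornerPt w) : v = w := by
  have h1 : v.1 = w.1 := by
    by_contra hne
    exact Set.disjoint_left.1 (h.node_separated hv.1 hw.1 hne) (corner_mem_nodeSet hv)
      (hvw ▸ corner_mem_nodeSet hw)
  rw [cornerPt_eq, cornerPt_eq, h1, add_right_inj] at hvw
  exact Prod.ext h1 (h.node_facts.2.1 _ hv.2 _ hw.2 hvw)

lemma node_inter_arc (hA : M.IsNode A) (ha : M.IsArc a) (h1 : A ≠ a.src)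
    (h2 : A ≠ a.dst) : M.nodeSet A ∩ M.arcSet a = ∅ :=
  inter_eq_empty (h.node_arc_separated hA ha) fun _ h3 h4 => by
    rw [mem_nodeList] at h3
    exact (Arc.fst_of_mem_corners h4).elim (fun h5 => h1 (h3.1.symm.trans h5))
      fun h5 => h2 (h3.1.symm.trans h5)

lemma baseSet_subset_nodeSet (ha : M.IsArc a) : M.baseSet a ⊆ M.nodeSet a.src :=
  listHull_mono fun _ hv => M.mem_nodeList.2
    ⟨(Arc.mem_base.1 hv).1, (h.isCorner_of_mem_base ha hv).2⟩

lemma src_inter_arc (ha : M.IsArc a) :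
    M.nodeSet a.src ∩ M.arcSet a = M.baseSet a := by
  refine Set.Subset.antisymm ((h.node_arc_separated (h.isNode_src ha) ha).trans ?_)
    (Set.subset_inter (h.baseSet_subset_nodeSet ha) (M.baseSet_subset_arcSet a))
  apply convexHull_mono
  apply image_mono
  rintro v ⟨h1, h2⟩
  rw [mem_nodeList] at h1
  rcases Arc.mem_corners.1 h2 with h2 | h2
  · exact h2
  · exact absurd (h1.1.symm.trans (Arc.mem_top.1 h2).1) (h.src_ne_dst ha)

lemma dst_inter_arc (ha : M.IsArc a) :
    M.nodeSet a.dst ∩ M.arcSet a = M.baseSet a.rev := by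
  have := h.src_inter_arc ha.rev
  rwa [arcSet_rev, Arc.src_rev] at this

lemma arc_inter_arc {a b : Arc} (ha : M.IsArc a) (hb : M.IsArc b) (hab : ¬(b = a ∨ b = a.rev)) :
    M.arcSet a ∩ M.arcSet b = ∅ ∨ ∃ a' b' : Arc, (a' = a ∨ a' = a.rev) ∧ (b' = b ∨ b' = b.rev) ∧
      a'.src = b'.src ∧ ∃ l : List Corner, l.length ≤ 2 ∧
        (∀ v ∈ l, v ∈ a'.base ∧ v ∈ b'.base) ∧ M.arcSet a ∩ M.arcSet b ⊆ listHull M.cornerPt l := by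
  have hsep := (h.arc_separated ha hb).resolve_left hab
  by_cases hne : ∀ v ∈ a.corners, v ∉ b.corners
  · exact Or.inl (inter_eq_empty hsep hne)
  right
  push Not at hne
  obtain ⟨v, hva, hvb⟩ := hne
  obtain ⟨a', ha', hva'⟩ := Arc.exists_base hva
  obtain ⟨b', hb', hvb'⟩ := Arc.exists_base hvb
  have hs : a'.src = b'.src := (Arc.mem_base.1 hva').1.symm.trans (Arc.mem_base.1 hvb').1
  have haa := ha.of_eq ha'
  have hbb := hb.of_eq hb'
  have hab : a' ≠ b' := by
    rintro rfl
    exact hab (Arc.eq_or_eq_rev ha' hb')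
  have hab1 : a'.1 ≠ b'.1 := fun h0 => hab (Prod.ext h0 (congrArg (fun A : Node => A.2) hs))
  have hdd : a'.dst ≠ b'.dst := fun h0 => hab (h.arc_unique haa hbb hs h0)
  obtain ⟨-, -, l, hl, hl'⟩ := h.dart_pair haa hbb hab1 (congrArg Prod.fst hs)
  refine ⟨a', b', ha', hb', hs, (l.filter fun j => decide (j ∈ a'.1.base ∧ j ∈ b'.1.base)).map
    fun j => (a'.src, j), ?_, ?_, ?_⟩
  · rw [length_map]
    exact (List.length_filter_le _ _).trans hl
  · intro w hw
    obtain ⟨j, hj, rfl⟩ := mem_map.1 hw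
    have hj := (List.mem_filter.1 hj).2
    simp only [decide_eq_true_eq] at hj
    exact ⟨Arc.mem_base.2 ⟨rfl, hj.1⟩, Arc.mem_base.2 ⟨hs, hj.2⟩⟩
  · refine hsep.trans ?_
    apply convexHull_mono
    apply image_mono
    rintro w ⟨hwa, hwb⟩
    rw [← Arc.corners_iff ha', Arc.mem_corners, Arc.mem_base, Arc.mem_top] at hwa
    rw [← Arc.corners_iff hb', Arc.mem_corners, Arc.mem_base, Arc.mem_top] at hwb
    rcases hwa with ⟨h3, h4⟩ | ⟨h3, h4⟩ <;> rcases hwb with ⟨h5, h6⟩ | ⟨h5, h6⟩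
    · refine mem_map.2 ⟨w.2, List.mem_filter.2 ⟨hl' _ h4 h6, ?_⟩, Prod.ext h3.symm rfl⟩
      simp [h4, h6]
    · exact absurd (hs.symm.trans (h3.symm.trans h5)) (h.src_ne_dst hbb)
    · exact absurd (hs.trans (h5.symm.trans h3)) (h.src_ne_dst haa)
    · exact absurd (h3.symm.trans h5) hdd

end Valid

end Blueprint

namespace Blueprint

variable (M : Blueprint)

def graph : SimpleGraph E3 where
  Adj x y := x ≠ y ∧ ∃ a, M.IsArc a ∧ x = M.centerPt a.src ∧ y = M.centerPt a.dst
  symm := ⟨by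
    rintro x y ⟨hne, a, ha, hx, hy⟩
    exact ⟨hne.symm, a.rev, ha.rev, hy, by rw [Arc.dst_rev]; exact hx⟩⟩
  loopless := ⟨fun _ hx => hx.1 rfl⟩

def replacement : Replacement where
  node x := {z | ∃ A, M.IsNode A ∧ x = M.centerPt A ∧ z ∈ M.nodeSet A}
  link x y := {z | ∃ a, M.IsArc a ∧ x = M.centerPt a.src ∧ y = M.centerPt a.dst ∧ z ∈ M.arcSet a}

def lattice : Submodule ℤ E3 := Submodule.span ℤ {M.lam.1.val, M.lam.2.1.val, M.lam.2.2.val}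

lemma mem_lattice {x : E3} : x ∈ M.lattice ↔ ∃ n, x = M.vec n := by
  simp only [lattice, Submodule.mem_span_triple, vec_eq, ← Int.cast_smul_eq_zsmul ℝ]
  exact ⟨fun ⟨a, b, c, h⟩ => ⟨(a, b, c), h.symm⟩, fun ⟨n, h⟩ => ⟨n.1, n.2.1, n.2.2, h.symm⟩⟩

lemma vec_mem_lattice (n : Shift) : M.vec n ∈ M.lattice := M.mem_lattice.2 ⟨n, rfl⟩

lemma vec_add_centerPt (n : Shift) (A : Node) :
    M.vec n + M.centerPt A = M.centerPt (A.move n) := by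
  rw [centerPt_move, add_comm]

lemma vec_add_cornerPt (n : Shift) (v : Corner) :
    M.vec n + M.cornerPt v = M.cornerPt (v.move n) := by
  rw [cornerPt_move, add_comm]

variable {M} {p q r d : ℕ} {g : ℤ}

lemma related_of_generators {R : Shift → Shift → Prop} (hR : Equivalence R)
    (hmove : ∀ m {n n'}, R n n' → R (m + n) (m + n')) (h1 : R 0 (1, 0, 0)) (h2 : R 0 (0, 1, 0))
    (h3 : R 0 (0, 0, 1)) (n : Shift) : R 0 n := by
  let G : AddSubgroup Shift :=
    { carrier := {n | R 0 n}
      zero_mem' := hR.refl 0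
      add_mem' {m n} hm hn := by
        have := hmove m hn
        rw [add_zero] at this
        exact hR.trans hm this
      neg_mem' {n} hn := by
        have := hmove (-n) hn
        rw [add_zero, neg_add_cancel] at this
        exact hR.symm this }
  have : n.1 • (1, 0, 0) + n.2.1 • (0, 1, 0) + n.2.2 • (0, 0, 1) ∈ G :=
    add_mem (add_mem (zsmul_mem h1 n.1) (zsmul_mem h2 n.2.1)) (zsmul_mem h3 n.2.2)
  exact (by simpa using this : n ∈ G)

lemma chainOK_sound {α : Type} {same adj : α → α → Bool} (hsame : ∀ a b, same a b = true → a = b)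
    {P : α → Prop} (hadj : ∀ a b, adj a b = true → P a → P b) {targets : List α} :
    ∀ {l : List (α × α)} {seen : List α}, (∀ a ∈ seen, P a) →
      chainOK same adj targets seen l = true → ∀ t ∈ targets, P t
  | [], seen, hs, h, t, ht => by
    simp only [chainOK, all_eq_true, any_eq_true] at h
    obtain ⟨a, ha, hta⟩ := h t ht
    rw [hsame _ _ hta]
    exact hs a ha
  | s :: l, seen, hs, h, t, ht => by
    simp only [chainOK, and_eq_true, any_eq_true] at h
    obtain ⟨⟨a, ha, hsa⟩, h1, h2⟩ := h
    refine chainOK_sound hsame hadj (seen := s.2 :: seen) ?_ h2 t ht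
    intro b hb
    rcases mem_cons.1 hb with rfl | hb
    · exact hadj _ _ h1 (hsame _ _ hsa ▸ hs a ha)
    · exact hs b hb

lemma adjacentNodes_iff {A B : Node} : M.adjacentNodes A B = true ↔
    ∃ a, M.IsArc a ∧ a.src = A ∧ a.dst = B := by
  simp only [adjacentNodes, any_eq_true, and_eq_true, Node.same_iff, Nat.beq_eq]
  constructor
  · rintro ⟨L, hL, h1, h2⟩
    exact ⟨(L, A.2), hL, Prod.ext h1 rfl, h2⟩
  · rintro ⟨a, ha, rfl, rfl⟩
    exact ⟨a.1, ha, rfl, rfl⟩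

lemma isThin_listHull {l : List Corner} (hl : l.length ≤ 2) : IsThin (listHull M.cornerPt l) := by
  obtain ⟨x, y, hxy⟩ : ∃ x y : E3, M.cornerPt '' {i | i ∈ l} ⊆ {x, y} := by
    match l, hl with
    | [], _ => exact ⟨0, 0, by simp⟩
    | [a], _ => exact ⟨M.cornerPt a, M.cornerPt a, by simp⟩
    | [a, b], _ =>
      refine ⟨M.cornerPt a, M.cornerPt b, ?_⟩
      rintro _ ⟨i, hi, rfl⟩
      rcases List.mem_pair.1 hi with rfl | rfl <;> simp
  rw [IsThin, listHull, vectorSpan_convexHull]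
  calc _ ≤ Module.finrank ℝ (vectorSpan ℝ ({x, y} : Set E3)) :=
        Submodule.finrank_mono (vectorSpan_mono ℝ hxy)
    _ ≤ 1 := by
      rw [vectorSpan_pair]
      exact (finrank_span_le_card _).trans (by simp)

lemma IsThin.mono {A B : Set E3} (h : IsThin B) (hAB : A ⊆ B) : IsThin A :=
  (Submodule.finrank_mono (vectorSpan_mono ℝ hAB)).trans h

lemma isThin_empty : IsThin ∅ := by rw [IsThin, vectorSpan_empty, finrank_bot]; exact zero_le_one

lemma listHull_node (A : Node) (f : List ℕ) :
    listHull M.cornerPt (f.map fun j => (A, j)) =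
      translate (M.centerPt A) (listHull M.relPt f) := by
  rw [listHull, listHull, ← convexHull_translate, setOf_mem_map, Set.image_image, translate,
    Set.image_image]
  simp only [cornerPt_eq]

lemma isConvexSolid_translate {K : Set E3} (l : E3) (hK : IsConvexSolid K) :
    IsConvexSolid (translate l K) := by
  obtain ⟨⟨s, hs, rfl⟩, hi⟩ := hK
  refine ⟨⟨translate l s, hs.image _, (convexHull_translate l s).symm⟩, ?_⟩
  have : interior (translate l (convexHull ℝ s)) = translate l (interior (convexHull ℝ s)) :=
    ((Homeomorph.addLeft l).image_interior _).symm
  rw [this]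
  exact hi.image _

noncomputable def mid (M : Blueprint) (a : Arc) : E3 := M.centerPt a.src + (1 / 2 : ℝ) • M.dir a.1

lemma mid_rev (a : Arc) : M.mid a.rev = M.mid a := by
  rw [mid, mid, Arc.src_rev, centerPt_dst, Arc.rev, dir_rev]
  module

namespace Valid

variable (h : M.Valid p q r d g) {a : Arc} {A : Node} {x : E3}
include h

lemma adj_iff {x y : E3} : M.graph.Adj x y ↔
    ∃ a, M.IsArc a ∧ x = M.centerPt a.src ∧ y = M.centerPt a.dst := by
  refine ⟨fun hxy => hxy.2, ?_⟩
  rintro ⟨a, ha, rfl, rfl⟩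
  exact ⟨fun h0 => h.src_ne_dst ha (h.center_injective (h.isNode_src ha) (h.isNode_dst ha) h0),
    a, ha, rfl, rfl⟩

lemma adj_arc (ha : M.IsArc a) :
    M.graph.Adj (M.centerPt a.src) (M.centerPt a.dst) := h.adj_iff.2 ⟨a, ha, rfl, rfl⟩

lemma exists_arc (hA : M.IsNode A) : ∃ a, M.IsArc a ∧ a.src = A := by
  have h1 := h.degree
  simp only [degreeOK, all_eq_true, List.mem_range] at h1
  have h2 := Nat.eq_of_beq_eq_true (h1 A.1 hA)
  have h3 : M.darts.filter (fun L => Nat.beq L.src A.1) ≠ [] := by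
    intro h0
    rw [h0] at h2
    exact h.d_pos.ne h2
  obtain ⟨L, hL⟩ := exists_mem_of_ne_nil _ h3
  obtain ⟨hL1, hL2⟩ := List.mem_filter.1 hL
  exact ⟨(L, A.2), hL1, Prod.ext (Nat.eq_of_beq_eq_true hL2) rfl⟩

lemma mem_support_iff : x ∈ M.graph.support ↔ ∃ A, M.IsNode A ∧ x = M.centerPt A := by
  rw [SimpleGraph.mem_support]
  constructor
  · rintro ⟨y, hy⟩
    obtain ⟨a, ha, rfl, -⟩ := h.adj_iff.1 hy
    exact ⟨a.src, h.isNode_src ha, rfl⟩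
  · rintro ⟨A, hA, rfl⟩
    obtain ⟨a, ha, rfl⟩ := h.exists_arc hA
    exact ⟨_, h.adj_arc ha⟩

lemma node_center (hA : M.IsNode A) :
    M.replacement.node (M.centerPt A) = M.nodeSet A := by
  ext z
  constructor
  · rintro ⟨B, hB, hAB, hz⟩
    rwa [h.center_injective hA hB hAB]
  · exact fun hz => ⟨A, hA, rfl, hz⟩

lemma link_center (ha : M.IsArc a) :
    M.replacement.link (M.centerPt a.src) (M.centerPt a.dst) = M.arcSet a := by
  ext z
  constructor
  · rintro ⟨b, hb, hs, hd, hz⟩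
    rwa [h.arc_unique ha hb (h.center_injective (h.isNode_src ha) (h.isNode_src hb) hs)
      (h.center_injective (h.isNode_dst ha) (h.isNode_dst hb) hd)]
  · exact fun hz => ⟨a, ha, rfl, rfl, hz⟩

lemma baseSet_nonempty (ha : M.IsArc a) : (M.baseSet a).Nonempty := by
  obtain ⟨i, hi⟩ := exists_mem_of_ne_nil _ (h.base_ne_nil ha)
  exact ⟨_, mem_listHull (i := (a.src, i)) (Arc.mem_base.2 ⟨rfl, hi⟩)⟩

lemma arcSet_nonempty (ha : M.IsArc a) : (M.arcSet a).Nonempty :=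
  (h.baseSet_nonempty ha).mono (M.baseSet_subset_arcSet a)

lemma contact_center (ha : M.IsArc a) :
    M.replacement.contact (M.centerPt a.src) (M.centerPt a.dst) = M.baseSet a := by
  rw [Replacement.contact, h.link_center ha, if_neg (h.arcSet_nonempty ha).ne_empty,
    h.node_center (h.isNode_src ha), h.src_inter_arc ha]

lemma contact_center_rev (ha : M.IsArc a) :
    M.replacement.contact (M.centerPt a.dst) (M.centerPt a.src) = M.baseSet a.rev := by
  have := h.contact_center ha.rev
  rwa [Arc.src_rev, Arc.dst_rev] at this

lemma isPeriodic : IsPeriodic M.lattice M.graph := by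
  intro l hl u v
  obtain ⟨n, rfl⟩ := M.mem_lattice.1 hl
  rw [h.adj_iff, h.adj_iff]
  constructor
  · rintro ⟨a, ha, h1, h2⟩
    refine ⟨a.move (-n), ha.move _, ?_, ?_⟩
    · rw [Arc.src_move, ← vec_add_centerPt, ← h1, vec_neg, neg_add_cancel_left]
    · rw [Arc.dst_move, ← vec_add_centerPt, ← h2, vec_neg, neg_add_cancel_left]
  · rintro ⟨a, ha, rfl, rfl⟩
    exact ⟨a.move n, ha.move _, by rw [Arc.src_move, vec_add_centerPt],
      by rw [Arc.dst_move, vec_add_centerPt]⟩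

lemma isRankThreeLattice : IsRankThreeLattice M.lattice := by
  have hd := h.isDual
  have hli : LinearIndependent ℝ ![M.lam.1.val, M.lam.2.1.val, M.lam.2.2.val] := by
    rw [Fintype.linearIndependent_iff]
    intro c hc
    rw [Fin.sum_univ_three] at hc
    simp only [Matrix.cons_val_zero, Matrix.cons_val_one, Matrix.cons_val] at hc
    have e (f : Shift) := congrArg f.form hc
    simp only [map_add, map_smul, map_zero, smul_eq_mul] at e
    have v1 := M.vec_eq (1, 0, 0)
    have v2 := M.vec_eq (0, 1, 0)
    have v3 := M.vec_eq (0, 0, 1)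
    simp only [Int.cast_one, Int.cast_zero, one_smul, zero_smul, add_zero, zero_add] at v1 v2 v3
    have e1 := e M.dual.1
    have e2 := e M.dual.2.1
    have e3 := e M.dual.2.2
    have p1 := hd.pos₁
    have p2 := hd.pos₂
    have p3 := hd.pos₃
    rw [← v1, ← v2, ← v3, hd.vec₁, hd.vec₁, hd.vec₁] at e1
    rw [← v1, ← v2, ← v3, hd.vec₂, hd.vec₂, hd.vec₂] at e2
    rw [← v1, ← v2, ← v3, hd.vec₃, hd.vec₃, hd.vec₃] at e3
    simp only [Int.cast_one, Int.cast_zero, one_mul, zero_mul, mul_zero, add_zero, zero_add,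
      mul_eq_zero] at e1 e2 e3
    intro i
    fin_cases i
    · exact e1.resolve_right p1.ne'
    · exact e2.resolve_right p2.ne'
    · exact e3.resolve_right p3.ne'
  let b := basisOfLinearIndependentOfCardEqFinrank hli (by simp)
  have hb : Set.range b = {M.lam.1.val, M.lam.2.1.val, M.lam.2.2.val} := by
    rw [coe_basisOfLinearIndependentOfCardEqFinrank]
    ext x
    simp
    tauto
  have hL : M.lattice = Submodule.span ℤ (Set.range b) := by rw [hb]; rfl
  rw [hL]
  refine ⟨inferInstance, ?_⟩
  rw [Submodule.span_span_of_tower, b.span_eq]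

lemma reachable_translate (n : Shift) {x y : E3} (hxy : M.graph.Reachable x y) :
    M.graph.Reachable (M.vec n + x) (M.vec n + y) :=
  hxy.map ⟨fun z => M.vec n + z, fun {a b} hab =>
    (h.isPeriodic _ (M.vec_mem_lattice n) a b).2 hab⟩

lemma reachable_base (hA : M.IsNode A) :
    M.graph.Reachable (M.centerPt (0, 0)) (M.centerPt A) := by
  have h1 := h.node_chain
  rw [nodeChainOK] at h1
  have h2 := chainOK_sound (P := fun A => M.graph.Reachable (M.centerPt (0, 0)) (M.centerPt A))
    (fun a b => Node.same_iff.1) (fun a b hab ha => by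
      obtain ⟨e, he, rfl, rfl⟩ := adjacentNodes_iff.1 hab
      exact ha.trans (h.adj_arc he).reachable) (by
      intro a ha
      rw [List.mem_singleton.1 ha]
      exact SimpleGraph.Reachable.refl _) h1
  have shift (k : ℕ) (m n : Shift) : M.vec m + M.centerPt (k, n) = M.centerPt (k, m + n) := by
    rw [vec_add_centerPt]
    simp [Node.move, Shift.add_eq, add_comm]
  have hG : M.graph.Reachable (M.centerPt (0, 0)) (M.centerPt (0, A.2)) := by
    refine related_of_generators (R := fun m n => M.graph.Reachable (M.centerPt (0, m))
      (M.centerPt (0, n))) ⟨fun _ => .refl _, .symm, .trans⟩ (fun m n n' hn => ?_) ?_ ?_ ?_ _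
    · have := h.reachable_translate m hn
      rwa [shift, shift] at this
    all_goals exact h2 _ (mem_append_right _ (by simp [generators]))
  have h3 : M.graph.Reachable (M.centerPt (0, 0)) (M.centerPt (A.1, 0)) :=
    h2 _ (mem_append_left _ (mem_map.2 ⟨A.1, List.mem_range.2 hA, rfl⟩))
  have h4 := h.reachable_translate A.2 h3
  rw [shift, shift, add_zero] at h4
  exact hG.trans h4

omit h in
lemma segment_eq_listHull (x y : Node) :
    segment ℝ (M.centerPt x) (M.centerPt y) = listHull M.centerPt [x, y] := by
  rw [listHull, ← convexHull_pair]
  congr 1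
  ext z
  simp [eq_comm]

lemma isSkeletalGraph : IsSkeletalGraph M.graph where
  nonempty := by
    obtain ⟨D, -, hne, -⟩ := h.exists_length
    obtain ⟨L, hL⟩ := exists_mem_of_ne_nil _ hne
    exact ⟨_, h.mem_support_iff.2 ⟨(L.src, 0), (h.dartFacts hL).src_lt, rfl⟩⟩
  connected := by
    intro u hu v hv
    obtain ⟨A, hA, rfl⟩ := h.mem_support_iff.1 hu
    obtain ⟨B, hB, rfl⟩ := h.mem_support_iff.1 hv
    exact (h.reachable_base hA).symm.trans (h.reachable_base hB)
  embedded := by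
    have key : ∀ a b : Arc, a.1 ∈ M.links → b.1 ∈ M.links → a ≠ b →
        Separated M.centerPt [a.src, a.dst] [b.src, b.dst] := by
      intro a b ha hb hab
      have e : M.edgeCells =
          (M.links.map fun L => [(L.src, (0, 0, 0)), L.dst]).map (M.mkCell M.center) := by
        simp [edgeCells, comp_def]
      have e2 (a : Arc) : [(a.1.src, (0, 0, 0)), a.1.dst].map (Node.move a.2) = [a.src, a.dst] := by
        simp [Arc.src, Arc.dst, Node.move, Shift.add_eq, ← Prod.zero_eq_mk]
      rcases sepCheck_sound h.isDual M.isAction_node (fun i j => Node.same_iff.1)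
        (e ▸ h.near_edges) (e ▸ h.sep_edges) (mem_map.2 ⟨a.1, ha, rfl⟩)
        (mem_map.2 ⟨b.1, hb, rfl⟩) a.2 b.2 with ⟨h1, h2⟩ | h1
      · exfalso
        simp only [List.cons.injEq, Prod.mk.injEq, and_true] at h1
        exact hab (Prod.ext (h.dart_unique (M.mem_darts_of_mem_links ha)
          (M.mem_darts_of_mem_links hb) h1.1 h1.2) h2)
      · rw [e2, e2] at h1
        exact h1
    intro u v u' v' huv huv' hne
    obtain ⟨a, ha, rfl, rfl⟩ := h.adj_iff.1 huv
    obtain ⟨b, hb, rfl, rfl⟩ := h.adj_iff.1 huv'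
    obtain ⟨a', ha1, ha2⟩ := exists_link ha
    obtain ⟨b', hb1, hb2⟩ := exists_link hb
    have hl {a a' : Arc} (ha : a' = a ∨ a' = a.rev) (A : Node) :
        A ∈ [a'.src, a'.dst] ↔ A ∈ [a.src, a.dst] := by
      rcases ha with rfl | rfl
      · rfl
      · simp only [Arc.src_rev, Arc.dst_rev, List.mem_pair, or_comm]
    have hab : a' ≠ b' := by
      rintro rfl
      rcases Arc.eq_or_eq_rev ha2 hb2 with rfl | rfl
      · exact hne rfl
      · exact hne (by rw [Arc.src_rev, Arc.dst_rev, Sym2.eq_swap])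
    have h1 := key a' b' ha1 hb1 hab
    simp only [Separated, listHull, hl ha2, hl hb2] at h1
    rw [segment_eq_listHull, segment_eq_listHull]
    refine Set.Subset.trans h1 ?_
    have hsub : (M.centerPt '' {i | i ∈ [a.src, a.dst] ∧ i ∈ [b.src, b.dst]}).Subsingleton := by
      apply Set.Subsingleton.image
      intro A hA B hB
      by_contra hAB
      obtain ⟨hA1, hA2⟩ := hA
      obtain ⟨hB1, hB2⟩ := hB
      have e1 : s(a.src, a.dst) = s(A, B) := (Sym2.mem_and_mem_iff hAB).1
        ⟨Sym2.mem_iff.2 (List.mem_pair.1 hA1), Sym2.mem_iff.2 (List.mem_pair.1 hB1)⟩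
      have e2 : s(b.src, b.dst) = s(A, B) := (Sym2.mem_and_mem_iff hAB).1
        ⟨Sym2.mem_iff.2 (List.mem_pair.1 hA2), Sym2.mem_iff.2 (List.mem_pair.1 hB2)⟩
      exact hne (congrArg (Sym2.map M.centerPt) (e1.trans e2.symm))
    rw [hsub.convex.convexHull_eq]
    rintro _ ⟨A, ⟨h1, h2⟩, rfl⟩
    simp only [List.mem_pair] at h1 h2
    constructor
    · rcases h1 with rfl | rfl <;> simp
    · rcases h2 with rfl | rfl <;> simp

/-! #### The facets of the solids -/

omit h in
lemma facets_translate {K : Set E3} {ι : Type} {L : List ι} {f : ι → Set E3}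
    (hK : ∀ F, F ∈ facets K ↔ ∃ T ∈ L, F = f T) {l : E3} {F : Set E3} :
    F ∈ facets (translate l K) ↔ ∃ T ∈ L, F = translate l (f T) := by
  obtain ⟨F, rfl⟩ : ∃ F', F = translate l F' :=
    ⟨translate (-l) F, by rw [translate_add, add_neg_cancel, translate_zero]⟩
  simp only [translate_mem_facets, hK, (translate_injective _).eq_iff]

lemma node_facetCheck : (interior (listHull M.relPt (List.range M.rel.length))).Nonempty ∧
    ∀ F, F ∈ facets (listHull M.relPt (List.range M.rel.length)) ↔
      ∃ f ∈ M.faces, F = listHull M.relPt f := by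
  have h1 := h.node_facets
  simp only [nodeFacetCheck, and_eq_true, not_eq_true', List.isEmpty_eq_false_iff] at h1
  obtain ⟨⟨R, hR, hR'⟩, hinj, -⟩ := h.node_facts
  exact facetCheck_sound (fun i j => Nat.beq_eq ▸ Iff.rfl) h1.1 (o := 0) (r := R)
    (fun i hi => by rw [dist_zero_right]; exact hR' i (List.mem_range.1 hi))
    (fun i hi j hj => hinj i (List.mem_range.1 hi) j (List.mem_range.1 hj)) h1.2

omit h in
lemma nodeSet_eq (A : Node) : M.nodeSet A =
    translate (M.centerPt A) (listHull M.relPt (List.range M.rel.length)) := listHull_node A _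

lemma node_facets_iff {F : Set E3} : F ∈ facets (M.nodeSet A) ↔
    ∃ f ∈ M.faces, F = listHull M.cornerPt (f.map fun j => (A, j)) := by
  simp only [nodeSet_eq, facets_translate h.node_facetCheck.2, listHull_node]

lemma isConvexSolid_nodeSet (A : Node) : IsConvexSolid (M.nodeSet A) := by
  rw [nodeSet_eq]
  exact isConvexSolid_translate _ ⟨⟨_, finite_image_mem _ _, rfl⟩, h.node_facetCheck.1⟩

lemma dist_mid {L : Link} (hL : L ∈ M.links) : ∃ R : ℝ, ∀ n, ∀ v ∈ Arc.corners (L, n),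
    dist (M.cornerPt v) (M.mid (L, n)) = R := by
  have h1 := h.links
  simp only [linksOK, and_eq_true, all_eq_true] at h1
  have h2 := h1.2.1.2.1 L hL
  unfold spokesOK at h2
  split at h2
  · exact absurd h2 (by decide)
  · rename_i i l hl
    simp only [and_eq_true, all_eq_true, Surd.same_iff] at h2
    have hv (L : Link) (j : ℕ) : (M.spoke L j).val = (2 : ℝ) • M.relPt j - M.dir L := by
      rw [spoke, SurdPt.val_sub, SurdPt.val_smul]; simp [relPt, relAt, dir]
    have hd {L K : Link} {j k : ℕ}
        (hjk : (M.spoke L j).dot (M.spoke L j) = (M.spoke K k).dot (M.spoke K k)) :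
        ‖(2 : ℝ) • M.relPt j - M.dir L‖ = ‖(2 : ℝ) • M.relPt k - M.dir K‖ := by
      have := congrArg Surd.val hjk
      rw [SurdPt.val_dot, SurdPt.val_dot, hv, hv, real_inner_self_eq_norm_sq,
        real_inner_self_eq_norm_sq] at this
      exact (sq_eq_sq₀ (norm_nonneg _) (norm_nonneg _)).1 this
    refine ⟨1 / 2 * ‖(2 : ℝ) • M.relPt i - M.dir L‖, fun n v hv => ?_⟩
    rw [dist_eq_norm]
    have half (x : E3) : ‖(1 / 2 : ℝ) • x‖ = 1 / 2 * ‖x‖ := by rw [norm_smul]; norm_num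
    rcases Arc.mem_corners.1 hv with hv | hv
    · obtain ⟨h3, h4⟩ := Arc.mem_base.1 hv
      rw [← hd (h2.1 _ h4), ← half, cornerPt_eq, h3, mid]
      congr 1
      module
    · obtain ⟨h3, h4⟩ := Arc.mem_top.1 hv
      rw [← hd (h2.2 _ h4), ← half, cornerPt_eq, h3, mid, centerPt_dst, dir_rev]
      congr 1
      module

lemma link_facetCheck {L : Link} (hL : L ∈ M.links) :
    (interior (M.arcSet (L, 0))).Nonempty ∧ ∀ F, F ∈ facets (M.arcSet (L, 0)) ↔
      ∃ T ∈ Link.baseCorners L :: Link.topCorners L :: M.laterals L,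
        F = listHull M.cornerPt T := by
  have h1 := h.link_facets
  simp only [linkFacetCheck, all_eq_true] at h1
  have e : Arc.corners (L, 0) = linkCorners L := by
    rw [Arc.corners_eq]
    have : Corner.move ((L, 0) : Arc).2 = id := funext Corner.move_zero
    rw [this, map_id]
  obtain ⟨R, hR⟩ := h.dist_mid hL
  have hL' : M.IsArc (L, 0) := M.mem_darts_of_mem_links hL
  have := facetCheck_sound (fun i j => Corner.same_iff) (List.cons_ne_nil _ _) (hR 0)
    (fun i hi j hj => h.corner_injective (h.isCorner_of_mem_corners hL' hi)
      (h.isCorner_of_mem_corners hL' hj)) (e ▸ h1 L hL)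
  exact this

omit h in
lemma arcSet_eq_translate (a : Arc) : M.arcSet a = translate (M.vec a.2) (M.arcSet (a.1, 0)) := by
  rw [← arcSet_move]
  simp [Arc.move, Shift.add_eq]

lemma arc_facets_iff (ha : a.1 ∈ M.links) {F : Set E3} : F ∈ facets (M.arcSet a) ↔
    F = M.baseSet a ∨ F = M.baseSet a.rev ∨
      ∃ T ∈ M.laterals a.1, F = listHull M.cornerPt (T.map (Corner.move a.2)) := by
  have hbase : (Link.baseCorners a.1).map (Corner.move a.2) = a.base := by
    simp [Link.baseCorners, Arc.base, Arc.src, Corner.move, comp_def, Node.move, Shift.add_eq,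
      ← Prod.zero_eq_mk]
  have htop : (Link.topCorners a.1).map (Corner.move a.2) = a.rev.base := by
    simp only [Arc.base_rev, Arc.top, Link.topCorners, map_map, comp_def, Corner.move, Arc.dst]
  have e (T : List Corner) : translate (M.vec a.2) (listHull M.cornerPt T) =
      listHull M.cornerPt (T.map (Corner.move a.2)) := (M.isAction_corner.listHull_map _ _).symm
  rw [arcSet_eq_translate, facets_translate (h.link_facetCheck ha).2]
  simp only [mem_cons, exists_eq_or_imp, e, hbase, htop, baseSet]

omit h in
lemma exists_link_arcSet (ha : M.IsArc a) :
    ∃ b : Arc, b.1 ∈ M.links ∧ (b = a ∨ b = a.rev) ∧ M.arcSet a = M.arcSet b := by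
  obtain ⟨b, hb, hba⟩ := exists_link ha
  exact ⟨b, hb, hba, listHull_congr fun v => (Arc.corners_iff hba v).symm⟩

lemma isConvexSolid_arcSet (ha : M.IsArc a) : IsConvexSolid (M.arcSet a) := by
  obtain ⟨b, hb, -, e⟩ := exists_link_arcSet ha
  rw [e, arcSet_eq_translate]
  exact isConvexSolid_translate _ ⟨⟨_, finite_image_mem _ _, rfl⟩, (h.link_facetCheck hb).1⟩

lemma baseSet_mem_node_facets (ha : M.IsArc a) :
    M.baseSet a ∈ facets (M.nodeSet a.src) := by
  obtain ⟨f, hf, hf'⟩ := (h.dartFacts ha).face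
  refine h.node_facets_iff.2 ⟨f, hf, listHull_congr fun v => ?_⟩
  rw [Arc.mem_base, mem_map_pair, hf']

lemma baseSet_mem_arc_facets (ha : M.IsArc a) :
    M.baseSet a ∈ facets (M.arcSet a) := by
  obtain ⟨b, hb, rfl | rfl⟩ := exists_link ha
  · exact (h.arc_facets_iff hb).2 (Or.inl rfl)
  · rw [← arcSet_rev]
    refine (h.arc_facets_iff hb).2 (Or.inr (Or.inl ?_))
    rw [Arc.rev_rev]

lemma contact_center_mem (ha : M.IsArc a) :
    M.centerPt a.src + M.alpha • M.dir a.1 ∈ M.baseSet a := by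
  have hf := h.dartFacts ha
  have hr : (0 : ℝ) < r := by exact_mod_cast (by have := h.three_le; omega : 0 < r)
  have h1 : M.alpha • M.dir a.1 ∈ listHull M.relPt a.1.base := by
    have h2 : M.alpha • M.dir a.1 = ∑ k : Fin a.1.base.length,
        (1 / r : ℝ) • M.relPt a.1.base[k.1] := by
      rw [← Finset.smul_sum, Fin.sum_univ_fun_getElem a.1.base M.relPt, hf.sum, smul_smul]
      congr 1
      field_simp
    rw [h2]
    refine (convex_convexHull ℝ _).sum_mem (fun _ _ => by positivity) ?_ fun k _ =>
      mem_listHull (List.getElem_mem _)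
    rw [Finset.sum_const, Finset.card_univ, Fintype.card_fin, hf.base_length, nsmul_eq_mul]
    field_simp
  rw [baseSet, Arc.base, listHull_node]
  exact ⟨_, h1, rfl⟩

omit h in
lemma axis_rev (a : Arc) (c : ℝ) : M.centerPt a.rev.src + (1 - c) • M.dir a.rev.1 =
    M.centerPt a.src + c • M.dir a.1 := by
  rw [Arc.src_rev, centerPt_dst, show M.dir a.rev.1 = -M.dir a.1 from dir_rev _ _]
  module

lemma axis_mem_nodeSet (ha : M.IsArc a) {c : ℝ} (h0 : 0 ≤ c) (h1 : c ≤ M.alpha) :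
    M.centerPt a.src + c • M.dir a.1 ∈ M.nodeSet a.src :=
  add_smul_mem (K := M.nodeSet a.src) (convex_convexHull ℝ _) (s := 0) (by simpa using h.center_mem)
    (h.baseSet_subset_nodeSet ha (h.contact_center_mem ha)) h0 h1

lemma axis_mem_arcSet (ha : M.IsArc a) {c : ℝ} (h0 : M.alpha ≤ c)
    (h1 : c ≤ 1 - M.alpha) : M.centerPt a.src + c • M.dir a.1 ∈ M.arcSet a := by
  refine add_smul_mem (convex_convexHull ℝ _) (M.baseSet_subset_arcSet a (h.contact_center_mem ha))
    ?_ h0 h1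
  have := M.baseSet_subset_arcSet _ (h.contact_center_mem ha.rev)
  rw [arcSet_rev] at this
  rw [← axis_rev a, sub_sub_cancel]
  exact this

lemma edge_subset (ha : M.IsArc a) :
    segment ℝ (M.centerPt a.src) (M.centerPt a.dst) ⊆
      M.nodeSet a.src ∪ M.arcSet a ∪ M.nodeSet a.dst := by
  rw [segment_eq_image']
  rintro _ ⟨t, ⟨ht0, ht1⟩, rfl⟩
  simp only [centerPt_dst, add_sub_cancel_left]
  rcases le_total t M.alpha with h2 | h2
  · exact Or.inl (Or.inl (h.axis_mem_nodeSet ha ht0 h2))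
  rcases le_total t (1 - M.alpha) with h3 | h3
  · exact Or.inl (Or.inr (h.axis_mem_arcSet ha h2 h3))
  · have := h.axis_mem_nodeSet ha.rev (c := 1 - t) (by linarith) (by linarith)
    rw [axis_rev] at this
    exact Or.inr this

end Valid

end Blueprint

namespace Blueprint

/-! ### The tiles of the boundary surface -/

lemma face_inter {V₁ V₂ S₁ S₂ : Set E3} {o₁ o₂ : E3} {r₁ r₂ : ℝ} (h₁ : ∀ x ∈ V₁, dist x o₁ = r₁)
    (h₂ : ∀ x ∈ V₂, dist x o₂ = r₂) (hS₁ : S₁ ⊆ V₁) (hS₂ : S₂ ⊆ V₂)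
    (hF₁ : IsExposed ℝ (convexHull ℝ V₁) (convexHull ℝ S₁))
    (hF₂ : IsExposed ℝ (convexHull ℝ V₂) (convexHull ℝ S₂))
    (hV : convexHull ℝ V₁ ∩ convexHull ℝ V₂ ⊆ convexHull ℝ (V₁ ∩ V₂)) :
    convexHull ℝ S₁ ∩ convexHull ℝ S₂ ⊆ convexHull ℝ (S₁ ∩ S₂) := by
  rintro x ⟨hx₁, hx₂⟩
  have key {V S : Set E3} {o : E3} {r : ℝ} (h : ∀ x ∈ V, dist x o = r) (hS : S ⊆ V)
      (hF : IsExposed ℝ (convexHull ℝ V) (convexHull ℝ S)) (hne : (convexHull ℝ S).Nonempty) :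
      ∃ (l : E3 →L[ℝ] ℝ) (m : ℝ), (∀ x ∈ V, l x ≤ m) ∧ S = {x ∈ V | l x = m} := by
    obtain ⟨l, m, hl, hlm⟩ := exists_of_isExposed_convexHull hF hne
    refine ⟨l, m, hl, ?_⟩
    have e1 := extremePoints_convexHull_of_sphere fun x hx => h x (hS hx)
    have e2 := extremePoints_convexHull_of_sphere (s := {x ∈ V | l x = m}) fun x hx => h x hx.1
    rw [← e1, hlm, e2]
  obtain ⟨l₁, m₁, hl₁, rfl⟩ := key h₁ hS₁ hF₁ ⟨x, hx₁⟩
  obtain ⟨l₂, m₂, hl₂, rfl⟩ := key h₂ hS₂ hF₂ ⟨x, hx₂⟩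
  have level {V : Set E3} {l : E3 →L[ℝ] ℝ} {m : ℝ} (hx : x ∈ convexHull ℝ {x ∈ V | l x = m}) :
      l x = m := by
    have hc : Convex ℝ {x | l x = m} := convex_hyperplane l.toLinearMap.isLinear m
    exact convexHull_min (fun y hy => hy.2) hc hx
  have h3 := hV ⟨convexHull_mono (fun y hy => hy.1) hx₁, convexHull_mono (fun y hy => hy.1) hx₂⟩
  have h4 := mem_convexHull_level (l := l₁.toLinearMap) (fun y hy => hl₁ y hy.1) h3 (level hx₁)
  have h5 := mem_convexHull_level (l := l₂.toLinearMap) (fun y hy => hl₂ y hy.1.2) h4 (level hx₂)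
  refine convexHull_mono ?_ h5
  rintro y ⟨⟨⟨hy1, hy2⟩, hy3⟩, hy4⟩
  exact ⟨⟨hy1, hy3⟩, hy2, hy4⟩

lemma mem_of_mem_sides {α : Type} {l : List α} {s : α × α} (hs : s ∈ sides l) :
    s.1 ∈ l ∧ s.2 ∈ l := by
  match l, hs with
  | a :: l, hs =>
    obtain ⟨h1, h2⟩ := List.of_mem_zip (a := s.1) (b := s.2) hs
    refine ⟨h1, ?_⟩
    simpa [or_comm] using h2

lemma sides_map {α β : Type} (f : α → β) (l : List α) :
    sides (l.map f) = (sides l).map (Prod.map f f) := by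
  match l with
  | [] => rfl
  | a :: l =>
    have e : l.map f ++ [f a] = (l ++ [a]).map f := by simp
    rw [map_cons, sides, sides, ← map_cons, e, List.zip_map]

variable (M : Blueprint)

def IsTile (T : List Corner) : Prop := ∃ T₀ ∈ M.tiles, ∃ n, T = T₀.map (Corner.move n)

noncomputable def tileSet (T : List Corner) : Set E3 := listHull M.cornerPt T

def IsSolidList (X : List Corner) : Prop :=
  (∃ A, M.IsNode A ∧ X = M.nodeList A) ∨ ∃ a : Arc, a.1 ∈ M.links ∧ X = a.corners

lemma mem_tiles {T : List Corner} : T ∈ M.tiles ↔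
    (∃ k < M.cen.length, ∃ f ∈ M.faces, M.isContact k f = false ∧
      T = f.map fun j => ((k, (0, 0, 0)), j)) ∨ ∃ L ∈ M.links, T ∈ M.laterals L := by
  simp only [tiles, mem_append, mem_flatMap, List.mem_range, freeTiles, mem_map,
    List.mem_filter, not_eq_true', and_assoc, eq_comm (a := T)]

lemma mem_laterals {L : Link} {T : List Corner} (hT : T ∈ M.laterals L) :
    (∃ v ∈ T, v ∈ Link.baseCorners L) ∧ (∃ v ∈ T, v ∈ Link.topCorners L) ∧
      ∀ v ∈ T, v ∈ linkCorners L := by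
  have e : linkCorners L = Link.baseCorners L ++ Link.topCorners L := rfl
  rw [e]
  unfold laterals at hT
  generalize Link.baseCorners L = B at *
  generalize Link.topCorners L = B' at *
  split_ifs at hT
  · unfold triangles at hT
    split at hT
    · rename_i a b c a' b' c'
      simp only [mem_cons, not_mem_nil, or_false] at hT
      rcases hT with rfl | rfl | rfl | rfl | rfl | rfl <;> simp
    · simp at hT
  · simp only [squares, mem_map] at hT
    obtain ⟨s, hs, rfl⟩ := hT
    obtain ⟨h1, h2⟩ := List.of_mem_zip (a := s.1) (b := s.2) hs
    obtain ⟨h3, h4⟩ := mem_of_mem_sides h1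
    obtain ⟨h5, h6⟩ := mem_of_mem_sides h2
    refine ⟨⟨_, mem_cons_self, h3⟩, ⟨s.2.1, by simp, h5⟩, ?_⟩
    simp only [List.forall_mem_cons, mem_append]
    exact ⟨Or.inl h3, Or.inl h4, Or.inr h6, Or.inr h5, by simp⟩

lemma isContact_iff {k : ℕ} {f : List ℕ} : M.isContact k f = true ↔
    ∃ L ∈ M.darts, L.src = k ∧ ∀ j, j ∈ f ↔ j ∈ L.base := by
  simp only [isContact, any_eq_true (p := fun d : Link => _ && _), and_eq_true,
    all_eq_true, any_beq_iff, Nat.beq_eq]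
  refine exists_congr fun L => and_congr_right fun _ => and_congr_right fun _ => ?_
  exact ⟨fun h j => ⟨h.1 j, h.2 j⟩, fun h => ⟨fun j => (h j).1, fun j => (h j).2⟩⟩

variable {M} {p q r d : ℕ} {g : ℤ}

lemma IsTile.move {T : List Corner} (hT : M.IsTile T) (n : Shift) :
    M.IsTile (T.map (Corner.move n)) := by
  obtain ⟨T₀, hT₀, m, rfl⟩ := hT
  refine ⟨T₀, hT₀, m + n, ?_⟩
  rw [map_map]
  congr 1
  funext v
  exact Corner.move_move _ _ _

lemma tileSet_move (n : Shift) (T : List Corner) :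
    M.tileSet (T.map (Corner.move n)) = translate (M.vec n) (M.tileSet T) :=
  M.isAction_corner.listHull_map n T

namespace Valid

variable (h : M.Valid p q r d g) {T : List Corner} {v : Corner}
include h

lemma solid_corner {X : List Corner} (hX : M.IsSolidList X) (hv : v ∈ X) :
    M.IsCorner v := by
  rcases hX with ⟨A, hA, rfl⟩ | ⟨a, ha, rfl⟩
  · obtain ⟨rfl, h2⟩ := M.mem_nodeList.1 hv
    exact ⟨hA, h2⟩
  · exact h.isCorner_of_mem_corners (M.mem_darts_of_mem_links ha) hv

lemma solid_sphere {X : List Corner} (hX : M.IsSolidList X) :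
    ∃ o R, ∀ x ∈ M.cornerPt '' {v | v ∈ X}, dist x o = R := by
  rcases hX with ⟨A, hA, rfl⟩ | ⟨a, ha, rfl⟩
  · obtain ⟨⟨R, -, hR⟩, -⟩ := h.node_facts
    refine ⟨M.centerPt A, R, ?_⟩
    rintro _ ⟨v, hv, rfl⟩
    obtain ⟨rfl, h2⟩ := M.mem_nodeList.1 hv
    rw [cornerPt_eq, dist_eq_norm, add_sub_cancel_left, hR _ h2]
  · obtain ⟨R, hR⟩ := h.dist_mid ha
    refine ⟨M.mid a, R, ?_⟩
    rintro _ ⟨v, hv, rfl⟩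
    exact hR a.2 v hv

lemma solid_separated {X Y : List Corner} (hX : M.IsSolidList X) (hY : M.IsSolidList Y) :
    X = Y ∨ Separated M.cornerPt X Y := by
  have key : ∀ X, M.IsSolidList X → ∃ X₀ ∈ solidLists M, ∃ n, X = X₀.map (Corner.move n) := by
    rintro X (⟨A, hA, rfl⟩ | ⟨a, ha, rfl⟩)
    · exact ⟨_, nodeCorners_mem hA, A.2, M.nodeList_eq A⟩
    · exact ⟨_, linkCorners_mem ha, a.2, a.corners_eq⟩
  obtain ⟨X₀, hX₀, m, rfl⟩ := key X hX
  obtain ⟨Y₀, hY₀, n, rfl⟩ := key Y hY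
  exact (h.cell_separated hX₀ hY₀ m n).imp_left fun ⟨h1, h2⟩ => by rw [h1, h2]

omit h in
lemma map_pair_move (k : ℕ) (n : Shift) (f : List ℕ) :
    (f.map fun j => (((k, (0, 0, 0)), j) : Corner)).map (Corner.move n) =
      f.map fun j => ((k, n), j) := by
  simp [Corner.move, Node.move, Shift.add_eq, ← Prod.zero_eq_mk]

lemma tile_solid (hT : M.IsTile T) : ∃ X, M.IsSolidList X ∧ (∀ v ∈ T, v ∈ X) ∧
    M.tileSet T ∈ facets (listHull M.cornerPt X) := by
  obtain ⟨T₀, hT₀, n, rfl⟩ := hT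
  rcases M.mem_tiles.1 hT₀ with ⟨k, hk, f, hf, hfk, rfl⟩ | ⟨L, hL, hTL⟩
  · rw [map_pair_move]
    have hfac := (h.node_facets_iff (A := (k, n))).2 ⟨f, hf, rfl⟩
    refine ⟨M.nodeList (k, n), Or.inl ⟨(k, n), hk, rfl⟩, fun v hv => ?_, hfac⟩
    obtain ⟨j, hj, rfl⟩ := mem_map.1 hv
    refine M.mem_nodeList.2 ⟨rfl, ?_⟩
    have h1 := h.node_facets
    simp only [nodeFacetCheck, and_eq_true, facetCheck, all_eq_true] at h1
    have := (facetOK_sound (fun i j => Nat.beq_eq ▸ Iff.rfl) (h1.2.1 f hf)).1 hj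
    exact List.mem_range.1 this
  · refine ⟨Arc.corners (L, n), Or.inr ⟨_, hL, rfl⟩, fun v hv => ?_,
      (h.arc_facets_iff hL).2 (Or.inr (Or.inr ⟨T₀, hTL, rfl⟩))⟩
    rw [Arc.corners_eq]
    obtain ⟨w, hw, rfl⟩ := mem_map.1 hv
    exact mem_map.2 ⟨w, (M.mem_laterals hTL).2.2 w hw, rfl⟩

lemma tile_corner (hT : M.IsTile T) (hv : v ∈ T) :
    M.IsCorner v := by
  obtain ⟨X, hX, hTX, -⟩ := h.tile_solid hT
  exact h.solid_corner hX (hTX v hv)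

lemma tile_sphere (hT : M.IsTile T) :
    ∃ o R, ∀ x ∈ M.cornerPt '' {v | v ∈ T}, dist x o = R := by
  obtain ⟨X, hX, hTX, -⟩ := h.tile_solid hT
  obtain ⟨o, R, hR⟩ := h.solid_sphere hX
  exact ⟨o, R, fun x hx => hR x (image_mono hTX hx)⟩

lemma vertices_tile (hT : M.IsTile T) :
    vertices (M.tileSet T) = M.cornerPt '' {v | v ∈ T} := by
  obtain ⟨o, R, hR⟩ := h.tile_sphere hT
  exact extremePoints_convexHull_of_sphere hR

lemma image_inter {T T' : List Corner} (hT : ∀ v ∈ T, M.IsCorner v) (hT' : ∀ v ∈ T', M.IsCorner v) :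
    M.cornerPt '' {v | v ∈ T} ∩ M.cornerPt '' {v | v ∈ T'} =
      M.cornerPt '' {v | v ∈ T ∧ v ∈ T'} := by
  ext x
  constructor
  · rintro ⟨⟨v, hv, rfl⟩, w, hw, hvw⟩
    rw [h.corner_injective (hT' w hw) (hT v hv) hvw] at hw
    exact ⟨v, ⟨hv, hw⟩, rfl⟩
  · rintro ⟨v, ⟨hv, hw⟩, rfl⟩
    exact ⟨⟨v, hv, rfl⟩, v, hw, rfl⟩

lemma mem_iff_of_listHull_eq {X Y : List Corner} (hX : ∀ v ∈ X, M.IsCorner v)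
    (hY : ∀ v ∈ Y, M.IsCorner v) {o o' : E3} {R R' : ℝ}
    (hsX : ∀ x ∈ M.cornerPt '' {v | v ∈ X}, dist x o = R)
    (hsY : ∀ x ∈ M.cornerPt '' {v | v ∈ Y}, dist x o' = R')
    (he : listHull M.cornerPt X = listHull M.cornerPt Y) (v : Corner) : v ∈ X ↔ v ∈ Y := by
  have e : M.cornerPt '' {v | v ∈ X} = M.cornerPt '' {v | v ∈ Y} := by
    rw [← extremePoints_convexHull_of_sphere hsX, ← extremePoints_convexHull_of_sphere hsY]
    exact congrArg (Set.extremePoints ℝ) he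
  have key {X Y : List Corner} (hX : ∀ v ∈ X, M.IsCorner v) (hY : ∀ v ∈ Y, M.IsCorner v)
      (e : M.cornerPt '' {v | v ∈ X} = M.cornerPt '' {v | v ∈ Y}) (hv : v ∈ X) : v ∈ Y := by
    obtain ⟨w, hw, hwv⟩ : M.cornerPt v ∈ M.cornerPt '' {v | v ∈ Y} := e ▸ ⟨v, hv, rfl⟩
    rwa [← h.corner_injective (hY w hw) (hX v hv) hwv]
  exact ⟨key hX hY e, key hY hX e.symm⟩

lemma tileSet_eq_iff {T T' : List Corner} (hT : M.IsTile T) (hT' : M.IsTile T') :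
    M.tileSet T = M.tileSet T' ↔ ∀ v, v ∈ T ↔ v ∈ T' := by
  obtain ⟨o, R, hR⟩ := h.tile_sphere hT
  obtain ⟨o', R', hR'⟩ := h.tile_sphere hT'
  exact ⟨fun he => h.mem_iff_of_listHull_eq (fun v => h.tile_corner hT) (fun v => h.tile_corner hT')
    hR hR' he, listHull_congr⟩

lemma tile_inter {T T' : List Corner} (hT : M.IsTile T) (hT' : M.IsTile T') :
    Separated M.cornerPt T T' := by
  obtain ⟨X, hX, hTX, hF⟩ := h.tile_solid hT
  obtain ⟨Y, hY, hTY, hF'⟩ := h.tile_solid hT'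
  obtain ⟨o, R, hR⟩ := h.solid_sphere hX
  obtain ⟨o', R', hR'⟩ := h.solid_sphere hY
  rw [Separated, ← h.image_inter (fun v => h.tile_corner hT) (fun v => h.tile_corner hT')]
  refine face_inter hR hR' (image_mono hTX) (image_mono hTY) hF.1 hF'.1 ?_
  rw [h.image_inter (fun v => h.solid_corner hX) (fun v => h.solid_corner hY)]
  rcases h.solid_separated hX hY with rfl | h1
  · simp only [Set.inter_self, and_self]
    exact subset_rfl
  · exact h1

lemma corner_mem_tileSet {T T' : List Corner} (hT : M.IsTile T) (hT' : M.IsTile T')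
    (hv : v ∈ T') : M.cornerPt v ∈ M.tileSet T ↔ v ∈ T := by
  refine ⟨fun hvT => ?_, mem_listHull⟩
  have h1 := h.tile_inter hT hT' ⟨hvT, mem_listHull hv⟩
  have h2 : M.cornerPt v ∈ vertices (M.tileSet T') := by
    rw [h.vertices_tile hT']; exact ⟨v, hv, rfl⟩
  have h3 : convexHull ℝ (M.cornerPt '' {v | v ∈ T ∧ v ∈ T'}) ⊆ M.tileSet T' :=
    convexHull_mono (image_mono fun v hv => hv.2)
  have h4 := inter_extremePoints_subset_extremePoints_of_subset h3 ⟨h1, h2⟩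
  obtain ⟨w, hw, hwv⟩ := extremePoints_convexHull_subset h4
  rw [← h.corner_injective (h.tile_corner hT hw.1) (h.tile_corner hT' hv) hwv]
  exact hw.1

lemma tile_ok (hT : T ∈ M.tiles) :
    T.length = p ∧ polygonOK (T.map M.place) = true := by
  have h1 := h.tiles
  simp only [tilesOK, and_eq_true, all_eq_true, Nat.beq_eq] at h1
  exact h1.1 T hT

lemma tile_isRegularPolygon (hT : M.IsTile T) :
    IsRegularPolygon p (M.tileSet T) := by
  obtain ⟨T₀, hT₀, n, rfl⟩ := hT
  obtain ⟨h2, h3⟩ := h.tile_ok hT₀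
  have h4 := (h2 ▸ polygonOK_sound h3).isRegularPolygon (by rcases h.p_eq with h | h <;> omega)
  obtain ⟨hp, c, b, R, hR, he⟩ := h4
  refine ⟨hp, M.vec n + c, b, R, hR, ?_⟩
  rw [tileSet_move]
  have e : M.tileSet T₀ = convexHull ℝ (Set.range fun k : Fin p =>
    cylPoint c b R 0 (2 * π * (k : ℕ) / p)) := he
  rw [e, ← convexHull_translate, translate, ← range_comp]
  congr 2
  funext k
  simp [cylPoint, add_assoc]

lemma tile_length (hT : M.IsTile T) : T.length = p := by
  obtain ⟨T₀, hT₀, n, rfl⟩ := hT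
  rw [length_map, (h.tile_ok hT₀).1]

lemma not_subset_pair (hT : M.IsTile T) (v w : Corner) :
    ¬ ∀ x ∈ T, x = v ∨ x = w := by
  intro hsub
  obtain ⟨X, -, -, hF⟩ := h.tile_solid hT
  have h1 : IsThin (M.tileSet T) := IsThin.mono (isThin_listHull (M := M) (l := [v, w]) le_rfl)
    (listHull_mono fun x hx => by simpa using hsub x hx)
  have h2 : Module.finrank ℝ (vectorSpan ℝ (M.tileSet T)) = 2 := hF.2.2
  rw [IsThin, h2] at h1
  omega

lemma boundary_eq : M.replacement.boundary M.graph = {F | ∃ T, M.IsTile T ∧ F = M.tileSet T} := by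
  ext F
  constructor
  · rintro (⟨u, hu, hF, hne⟩ | ⟨u, v, huv, hF, h1, h2⟩)
    · obtain ⟨A, hA, rfl⟩ := h.mem_support_iff.1 hu
      rw [h.node_center hA] at hF
      obtain ⟨f, hf, rfl⟩ := h.node_facets_iff.1 hF
      refine ⟨f.map fun j => (A, j), ⟨_, M.mem_tiles.2 (Or.inl ⟨A.1, hA, f, hf, ?_, rfl⟩), A.2,
        (map_pair_move _ _ _).symm⟩, rfl⟩
      rw [← not_eq_true, isContact_iff]
      rintro ⟨L, hL, hLA, hfL⟩
      have ha : M.IsArc (L, A.2) := hL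
      have hs : Arc.src (L, A.2) = A := Prod.ext hLA rfl
      apply hne (M.centerPt (Arc.dst (L, A.2)))
      · have := h.adj_arc ha
        rwa [hs] at this
      · have := h.contact_center ha
        rw [hs] at this
        rw [this]
        refine listHull_congr fun v => ?_
        rw [Arc.mem_base, hs, mem_map_pair, hfL]
    · obtain ⟨a, ha, rfl, rfl⟩ := h.adj_iff.1 huv
      rw [h.link_center ha] at hF
      rw [h.contact_center ha] at h1
      rw [h.contact_center_rev ha] at h2
      obtain ⟨b, hb, hba, h3⟩ := exists_link_arcSet ha
      rw [h3, h.arc_facets_iff hb] at hF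
      rcases hF with hF | hF | ⟨T, hT, hF⟩
      · rcases hba with rfl | rfl
        exacts [absurd hF h1, absurd hF h2]
      · rcases hba with rfl | rfl
        exacts [absurd hF h2, absurd (by rwa [Arc.rev_rev] at hF) h1]
      · exact ⟨_, ⟨T, M.mem_tiles.2 (Or.inr ⟨_, hb, hT⟩), b.2, rfl⟩, hF⟩
  · rintro ⟨T, hT, rfl⟩
    obtain ⟨o', R', hsT⟩ := h.tile_sphere hT
    have hcT : ∀ v ∈ T, M.IsCorner v := fun v => h.tile_corner hT
    obtain ⟨T₀, hT₀, n, rfl⟩ := hT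
    have hbase {a : Arc} (ha : M.IsArc a)
        (he : M.tileSet (T₀.map (Corner.move n)) = M.baseSet a) (v : Corner) :
        v ∈ T₀.map (Corner.move n) ↔ v ∈ a.base := by
      obtain ⟨⟨R, -, hR⟩, -⟩ := h.node_facts
      refine h.mem_iff_of_listHull_eq hcT (fun v => h.isCorner_of_mem_base ha)
        hsT (o' := M.centerPt a.src) (R' := R) ?_ he v
      rintro _ ⟨v, hv, rfl⟩
      rw [cornerPt_eq, (Arc.mem_base.1 hv).1, dist_eq_norm, add_sub_cancel_left,
        hR _ (h.isCorner_of_mem_base ha hv).2]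
    rcases M.mem_tiles.1 hT₀ with ⟨k, hk, f, hf, hfk, rfl⟩ | ⟨L, hL, hTL⟩
    · have hA : M.IsNode (k, n) := hk
      refine Or.inl ⟨_, h.mem_support_iff.2 ⟨(k, n), hA, rfl⟩, ?_, ?_⟩
      · rw [h.node_center hA, map_pair_move]
        exact h.node_facets_iff.2 ⟨f, hf, rfl⟩
      · intro v hv he
        obtain ⟨a, ha, hs, rfl⟩ := h.adj_iff.1 hv
        have hs := h.center_injective hA (h.isNode_src ha) hs
        rw [hs, h.contact_center ha] at he
        have h1 := hbase ha he
        rw [← not_eq_true, isContact_iff] at hfk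
        refine hfk ⟨a.1, ha, (congrArg Prod.fst hs).symm, fun j => ?_⟩
        have h2 := h1 ((k, n), j)
        rw [map_pair_move, Arc.mem_base, mem_map_pair] at h2
        exact ⟨fun hj => (h2.1 ⟨rfl, hj⟩).2, fun hj => (h2.2 ⟨hs, hj⟩).2⟩
    · have ha : M.IsArc (L, n) := M.mem_darts_of_mem_links hL
      obtain ⟨⟨v, hv, hvb⟩, ⟨w, hw, hwt⟩, -⟩ := M.mem_laterals hTL
      have hne := h.src_ne_dst ha
      have hv1 : (v.move n).1 = Arc.src (L, n) := by
        obtain ⟨j, -, rfl⟩ := mem_map.1 hvb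
        simp [Corner.move, Node.move, Shift.add_eq, ← Prod.zero_eq_mk, Arc.src]
      have hw1 : (w.move n).1 = Arc.dst (L, n) := by
        obtain ⟨j, -, rfl⟩ := mem_map.1 hwt
        rfl
      refine Or.inr ⟨_, _, h.adj_arc ha, ?_, ?_, ?_⟩
      · rw [h.link_center ha]
        exact (h.arc_facets_iff hL).2 (Or.inr (Or.inr ⟨T₀, hTL, rfl⟩))
      · rw [h.contact_center ha]
        intro he
        have := (hbase ha he (w.move n)).1 (mem_map.2 ⟨w, hw, rfl⟩)
        exact hne ((Arc.mem_base.1 this).1.symm.trans hw1)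
      · rw [h.contact_center_rev ha]
        intro he
        have := (hbase ha.rev he (v.move n)).1 (mem_map.2 ⟨v, hv, rfl⟩)
        exact hne (hv1.symm.trans (Arc.mem_base.1 this).1)

end Valid

end Blueprint

namespace Blueprint

/-! ### The boundary is a regular surface -/

def Adjacent {α : Type} (T : List α) (v w : α) : Prop :=
  ∃ s ∈ sides T, (v = s.1 ∧ w = s.2) ∨ (w = s.1 ∧ v = s.2)

lemma Adjacent.mem {α : Type} {T : List α} {v w : α} (h : Adjacent T v w) : v ∈ T ∧ w ∈ T := by
  obtain ⟨s, hs, ⟨rfl, rfl⟩ | ⟨rfl, rfl⟩⟩ := h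
  · exact mem_of_mem_sides hs
  · exact (mem_of_mem_sides hs).symm

lemma Adjacent.map {α β : Type} (f : α → β) {T : List α} {v w : α} (h : Adjacent T v w) :
    Adjacent (T.map f) (f v) (f w) := by
  obtain ⟨s, hs, h⟩ := h
  refine ⟨Prod.map f f s, ?_, h.imp (fun h => ⟨congrArg f h.1, congrArg f h.2⟩)
    fun h => ⟨congrArg f h.1, congrArg f h.2⟩⟩
  rw [sides_map]
  exact mem_map.2 ⟨s, hs, rfl⟩

lemma Adjacent.of_map {α β : Type} {f : α → β} {T : List α} {v w : β}
    (h : Adjacent (T.map f) v w) : ∃ v' w', v = f v' ∧ w = f w' ∧ Adjacent T v' w' := by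
  obtain ⟨s, hs, h⟩ := h
  rw [sides_map, mem_map] at hs
  obtain ⟨t, ht, rfl⟩ := hs
  rcases h with ⟨rfl, rfl⟩ | ⟨rfl, rfl⟩
  · exact ⟨t.1, t.2, rfl, rfl, t, ht, Or.inl ⟨rfl, rfl⟩⟩
  · exact ⟨t.2, t.1, rfl, rfl, t, ht, Or.inr ⟨rfl, rfl⟩⟩

lemma adjacent_iff {T : List Corner} {v w : Corner} :
    adjacent T v w = true ↔ Adjacent T v w := by
  simp only [adjacent, Adjacent, any_eq_true, or_eq_true, and_eq_true,
    Corner.same_iff]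

lemma has_iff {T : List Corner} {v : Corner} : has T v = true ↔ v ∈ T :=
  any_same_iff fun _ _ => Corner.same_iff

/-- The lists meet only in `v`, or in `v` and a common neighbour of it. -/
def Meet (v : Corner) (S T : List Corner) : Prop :=
  (∀ w, w ∈ S → w ∈ T → w = v) ∨ ∃ w, w ≠ v ∧ (∀ x, x ∈ S → x ∈ T → x = v ∨ x = w) ∧
    Adjacent S v w ∧ Adjacent T v w

lemma Meet.symm {v : Corner} {S T : List Corner} (h : Meet v S T) : Meet v T S := by
  rcases h with h | ⟨w, h1, h2, h3, h4⟩
  · exact Or.inl fun w h1 h2 => h w h2 h1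
  · exact Or.inr ⟨w, h1, fun x hx hx' => h2 x hx' hx, h4, h3⟩

lemma Meet.map {f : Corner → Corner} (hf : Injective f) {v : Corner} {S T : List Corner}
    (h : Meet v S T) : Meet (f v) (S.map f) (T.map f) := by
  rcases h with h | ⟨w, h1, h2, h3, h4⟩
  · left
    intro w hw hw'
    obtain ⟨x, hx, rfl⟩ := mem_map.1 hw
    rw [List.mem_map_of_injective hf] at hw'
    rw [h x hx hw']
  · refine Or.inr ⟨f w, hf.ne h1, ?_, h3.map f, h4.map f⟩
    intro w hw hw'
    obtain ⟨x, hx, rfl⟩ := mem_map.1 hw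
    rw [List.mem_map_of_injective hf] at hw'
    exact (h2 x hx hw').imp (congrArg f) (congrArg f)

lemma meetOK_sound {v : Corner} {S T : List Corner} (h : meetOK v S T = true) : Meet v S T := by
  have hm (w : Corner) : w ∈ S.filter (fun w => has T w && !Corner.same v w) ↔
      w ∈ S ∧ w ∈ T ∧ w ≠ v := by
    rw [List.mem_filter, and_eq_true, not_eq_true', ← not_eq_true, Corner.same_iff,
      has_iff, eq_comm, ne_eq]
  unfold meetOK at h
  split at h
  · rename_i he
    left
    intro w hw hw'
    by_contra hne
    have := (hm w).2 ⟨hw, hw', hne⟩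
    rw [he] at this
    exact absurd this not_mem_nil
  · rename_i w he
    simp only [and_eq_true, adjacent_iff] at h
    refine Or.inr ⟨w, ((hm w).1 (he ▸ List.mem_singleton_self w)).2.2, fun x hx hx' => ?_, h⟩
    by_contra! hne
    have := (hm x).2 ⟨hx, hx', hne.1⟩
    rw [he] at this
    exact hne.2 (List.mem_singleton.1 this)
  · exact absurd h (by decide)

lemma pairwise_of_pairsAll {α : Type} {r : α → α → Bool} : ∀ {l : List α}, pairsAll r l = true →
    l.Pairwise fun a b => r a b = true
  | [], _ => List.Pairwise.nil
  | a :: l, h => by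
    simp only [pairsAll, and_eq_true, all_eq_true] at h
    exact List.Pairwise.cons h.1 (pairwise_of_pairsAll h.2)

lemma connect_sound {α : Type} {r : α → α → Bool} {P Q : α → Prop}
    (hr : ∀ x s, r x s = true → Q x → P s → P x) : ∀ {n : ℕ} {seen rest : List α},
    (∀ x ∈ seen, P x) → (∀ x ∈ rest, Q x) → connect r n seen rest = true → ∀ x ∈ rest, P x
  | 0, seen, rest, _, _, h, x, hx => by
    rw [connect, List.isEmpty_iff] at h
    rw [h] at hx
    exact absurd hx not_mem_nil
  | n + 1, seen, rest, hs, hQ, h, x, hx => by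
    rw [connect] at h
    have step : ∀ y ∈ rest, seen.any (r y) = true → P y := by
      intro y hy hy'
      obtain ⟨s, hs', hys⟩ := any_eq_true.1 hy'
      exact hr y s hys (hQ y hy) (hs s hs')
    by_cases hx' : seen.any (r x) = true
    · exact step x hx hx'
    · refine connect_sound hr ?_ (fun y hy => hQ y (List.mem_filter.1 hy).1) h x
        (List.mem_filter.2 ⟨hx, by simpa using hx'⟩)
      intro y hy
      rcases mem_append.1 hy with hy | hy
      · exact step y (List.mem_filter.1 hy).1 (List.mem_filter.1 hy).2
      · exact hs y hy

/-- What the checks say about the tiles at a corner. -/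
structure StarFacts (M : Blueprint) (q : ℕ) (v : Corner) (S : List (List Corner)) : Prop where
  mem : ∀ T, T ∈ S ↔ M.IsTile T ∧ v ∈ T
  length : S.length = q
  meet : S.Pairwise (Meet v)
  side : ∀ T ∈ S, ∀ w, Adjacent T v w → (S.filter fun T' => has T' w).length = 2
  linked : ∀ T ∈ S, ∀ T' ∈ S, ReflTransGen
    (fun A B => A ∈ S ∧ B ∈ S ∧ ∃ w, w ≠ v ∧ w ∈ A ∧ w ∈ B) T T'

lemma StarFacts.map {M : Blueprint} {q : ℕ} {v : Corner} {S : List (List Corner)}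
    (h : StarFacts M q v S) (n : Shift) :
    StarFacts M q (v.move n) (S.map fun T => T.map (Corner.move n)) := by
  have hinj := M.isAction_corner.mv_injective n
  refine ⟨fun T => ?_, by rw [length_map, h.length], ?_, ?_, ?_⟩
  · rw [mem_map]
    constructor
    · rintro ⟨T₀, hT₀, rfl⟩
      exact ⟨((h.mem T₀).1 hT₀).1.move n, mem_map_of_mem ((h.mem T₀).1 hT₀).2⟩
    · rintro ⟨hT, hv⟩
      have e : (T.map (Corner.move (-n))).map (Corner.move n) = T := by
        rw [map_map]
        convert map_id T using 2
        funext w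
        simp [Corner.move_move, Corner.move_zero]
      refine ⟨T.map (Corner.move (-n)), (h.mem _).2 ⟨hT.move _, ?_⟩, e⟩
      rwa [← e, List.mem_map_of_injective hinj] at hv
  · rw [pairwise_map]
    exact h.meet.imp fun h => h.map hinj
  · intro T hT w hw
    obtain ⟨T₀, hT₀, rfl⟩ := mem_map.1 hT
    obtain ⟨v', w', hv', rfl, hvw⟩ := hw.of_map
    rw [← hinj hv'] at hvw
    rw [← h.side T₀ hT₀ w' hvw, List.filter_map, length_map]
    congr 2
    funext T'
    rw [comp_apply, Bool.eq_iff_iff, has_iff, has_iff, List.mem_map_of_injective hinj]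
  · intro T hT T' hT'
    obtain ⟨T₀, hT₀, rfl⟩ := mem_map.1 hT
    obtain ⟨T₁, hT₁, rfl⟩ := mem_map.1 hT'
    refine (h.linked T₀ hT₀ T₁ hT₁).lift (fun T => T.map (Corner.move n)) ?_
    rintro A B ⟨hA, hB, w, hw, hwA, hwB⟩
    exact ⟨mem_map_of_mem hA, mem_map_of_mem hB, _, hinj.ne hw, mem_map_of_mem hwA,
      mem_map_of_mem hwB⟩

variable {M : Blueprint} {p q r d : ℕ} {g : ℤ}

lemma mem_star {k j : ℕ} {T : List Corner} :
    T ∈ M.star k j ↔ M.IsTile T ∧ (((k, (0, 0, 0)), j) : Corner) ∈ T := by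
  simp only [star, mem_flatMap, mem_map, List.mem_filter, and_eq_true, Nat.beq_eq]
  constructor
  · rintro ⟨T₀, hT₀, w, ⟨hw, h1, h2⟩, rfl⟩
    refine ⟨⟨T₀, hT₀, _, rfl⟩, mem_map.2 ⟨w, hw, ?_⟩⟩
    simp [Corner.move, Node.move, Shift.add_eq, Shift.neg_eq, h1, h2, ← Prod.zero_eq_mk]
  · rintro ⟨⟨T₀, hT₀, n, rfl⟩, hv⟩
    obtain ⟨w, hw, hwv⟩ := mem_map.1 hv
    have h1 : w.1.1 = k := congrArg (fun v : Corner => v.1.1) hwv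
    have h2 : w.2 = j := congrArg (fun v : Corner => v.2) hwv
    have h3 : w.1.2 + n = 0 := congrArg (fun v : Corner => v.1.2) hwv
    refine ⟨T₀, hT₀, w, ⟨hw, h1, h2⟩, ?_⟩
    rw [Shift.neg_eq, eq_neg_of_add_eq_zero_right h3]

/-- Some plane meets the hull of `V` in the segment from `x` to `y`. -/
def IsSide (V : Set E3) (x y : E3) : Prop :=
  x ≠ y ∧ ∃ (l : E3 →L[ℝ] ℝ) (m : ℝ), l x = m ∧ l y = m ∧ ∀ t ∈ V, t ≠ x → t ≠ y → l t < m

lemma IsSide.symm {V : Set E3} {x y : E3} (h : IsSide V x y) : IsSide V y x :=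
  have ⟨h1, l, m, h2, h3, h4⟩ := h
  ⟨h1.symm, l, m, h3, h2, fun t ht h5 h6 => h4 t ht h6 h5⟩

lemma isSide_triangle {a b c : E3} (h₁ : ‖a - b‖ = ‖a - c‖) (h₂ : ‖a - b‖ = ‖b - c‖)
    (h : a ≠ b) : IsSide {a, b, c} a b := by
  refine ⟨h, innerSL ℝ ((a - c) + (b - c)), _, rfl, ?_, ?_⟩
  · rw [eq_comm, ← sub_eq_zero, ← map_sub, innerSL_apply_apply,
      show a - b = (a - c) - (b - c) by abel, real_inner_add_sub_eq_zero_iff, ← h₁, h₂]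
  · have e1 : ‖a - b‖ ^ 2 = ‖a - c‖ ^ 2 - 2 * inner ℝ (a - c) (b - c) + ‖b - c‖ ^ 2 := by
      rw [show a - b = (a - c) - (b - c) by abel, norm_sub_sq_real]
    have e2 : 0 < ‖a - b‖ := norm_pos_iff.2 (sub_ne_zero.2 h)
    rintro t (rfl | rfl | rfl) hta htb
    · exact absurd rfl hta
    · exact absurd rfl htb
    rw [← sub_pos, ← map_sub, innerSL_apply_apply, inner_add_left, real_inner_self_eq_norm_sq,
      real_inner_comm]
    rw [← h₁, ← h₂] at *
    nlinarith

structure IsRectangle (V : Set E3) (a b c d : E3) : Prop where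
  eq : V = {a, b, c, d}
  sum : a + c = b + d
  orth : inner ℝ (b - a) (d - a) = 0
  ne : a ≠ b
  ne' : a ≠ d

namespace IsRectangle

variable {V : Set E3} {a b c d : E3}

lemma rotate (h : IsRectangle V a b c d) : IsRectangle V b c d a := by
  have e : c - b = d - a := by rw [sub_eq_sub_iff_add_eq_add, add_comm, h.sum, add_comm]
  refine ⟨h.eq.trans (by ext; simp; tauto), by rw [← h.sum, add_comm], ?_, fun h0 => h.ne' ?_,
    h.ne.symm⟩
  · rw [e, ← neg_sub b a, inner_neg_right, real_inner_comm, h.orth, neg_zero]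
  · rw [h0, sub_self, eq_comm, sub_eq_zero] at e
    exact e.symm

lemma isSide (h : IsRectangle V a b c d) : IsSide V a b := by
  obtain ⟨rfl, h1, h2, h3, h4⟩ := h
  have e1 : inner ℝ (a - d) (a - b) = 0 := by
    rw [← neg_sub d a, ← neg_sub b a, inner_neg_neg, real_inner_comm, h2]
  have e2 : 0 < inner ℝ (a - d) (a - d) := real_inner_self_pos.2 (sub_ne_zero.2 h4)
  refine ⟨h3, innerSL ℝ (a - d), _, rfl, ?_, ?_⟩
  · rwa [eq_comm, ← sub_eq_zero, ← map_sub]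
  · rintro t (rfl | rfl | rfl | rfl) ht ht'
    · exact absurd rfl ht
    · exact absurd rfl ht'
    · rw [← sub_pos, ← map_sub, innerSL_apply_apply]
      rwa [show a - t = (a - b) + (a - d) by rw [eq_sub_of_add_eq' h1]; abel, inner_add_right, e1,
        zero_add]
    · rwa [← sub_pos, ← map_sub]

lemma not_isSide (h : IsRectangle V a b c d) : ¬ IsSide V a c := by
  rintro ⟨-, l, m, h1, h2, h3⟩
  have e := congrArg l h.sum
  rw [map_add, map_add, h1, h2] at e
  have e1 := h3 b (by simp [h.eq]) h.ne.symm h.rotate.ne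
  have e2 := h3 d (by simp [h.eq]) h.ne'.symm h.rotate.rotate.ne.symm
  linarith

end IsRectangle

lemma adjacent_induction {α : Type} {T : List α} {R : α → α → Prop} (hR : ∀ {x y}, R x y → R y x)
    (h : ∀ s ∈ sides T, R s.1 s.2) {v w : α} (hvw : Adjacent T v w) : R v w := by
  obtain ⟨s, hs, ⟨rfl, rfl⟩ | ⟨rfl, rfl⟩⟩ := hvw
  · exact h s hs
  · exact hR (h s hs)

lemma isTile_of_mem {T : List Corner} (hT : T ∈ M.tiles) : M.IsTile T :=
  ⟨T, hT, 0, by rw [show Corner.move 0 = id from funext Corner.move_zero, map_id]⟩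

namespace Valid

variable (h : M.Valid p q r d g) {T : List Corner} {v : Corner}
include h

lemma exists_star (hv : M.IsCorner v) : ∃ S, StarFacts M q v S := by
  have h1 := h.star
  simp only [starCheck, all_eq_true, List.mem_range] at h1
  have h2 := h1 v.1.1 hv.1 v.2 hv.2
  simp only [starOK, and_eq_true, all_eq_true, Nat.beq_eq] at h2
  obtain ⟨h3, h4, h5, h6⟩ := h2
  have h7 : StarFacts M q ((v.1.1, (0, 0, 0)), v.2) (M.star v.1.1 v.2) := by
    refine ⟨fun T => mem_star, h3, (pairwise_of_pairsAll h4).imp meetOK_sound, ?_, ?_⟩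
    · intro T hT w hw
      have := h5 T hT
      simp only [sideOK, all_eq_true, or_eq_true, not_eq_true', ← not_eq_true,
        adjacent_iff, Nat.beq_eq] at this
      exact (this w hw.mem.2).resolve_left (not_not.2 hw)
    · generalize M.star v.1.1 v.2 = S at *
      match S, h6 with
      | [], _ => simp
      | T₀ :: S', h6 =>
        set S := T₀ :: S' with hS
        have key := connect_sound (P := fun T => T ∈ S ∧ ReflTransGen
          (fun A B => A ∈ S ∧ B ∈ S ∧ ∃ w, w ≠ ((v.1.1, (0, 0, 0)), v.2) ∧ w ∈ A ∧ w ∈ B) T₀ T)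
          (Q := fun T => T ∈ S) (by
            rintro A B hAB hA ⟨hB, hB'⟩
            simp only [Blueprint.linked, any_eq_true, and_eq_true, has_iff,
              not_eq_true', ← not_eq_true, Corner.same_iff] at hAB
            obtain ⟨w, hwA, hwB, hw⟩ := hAB
            exact ⟨hA, hB'.tail ⟨hB, hA, w, fun h => hw h.symm, hwB, hwA⟩⟩)
          (by
            intro T hT
            have : T = T₀ := by simpa [hS] using hT
            rw [this]
            exact ⟨mem_cons_self, ReflTransGen.refl⟩) (fun T hT => hT) h6
        intro T hT T' hT'
        refine ReflTransGen.trans ?_ (key T' hT').2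
        refine (ReflTransGen.swap _ _ (key T hT).2).lift id ?_
        rintro A B ⟨hB, hA, w, hw, hwB, hwA⟩
        exact ⟨hA, hB, w, hw, hwA, hwB⟩
  have h8 := h7.map v.1.2
  have e : Corner.move v.1.2 ((v.1.1, (0, 0, 0)), v.2) = v := by
    simp [Corner.move, Node.move, Shift.add_eq, ← Prod.zero_eq_mk]
  rw [e] at h8
  exact ⟨_, h8⟩

lemma isSide_iff (hT : T ∈ M.tiles) {v w : Corner} (hv : v ∈ T) (hw : w ∈ T) :
    IsSide (M.cornerPt '' {v | v ∈ T}) (M.cornerPt v) (M.cornerPt w) ↔ Adjacent T v w := by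
  obtain ⟨hl, hp⟩ := h.tile_ok hT
  rcases h.p_eq with rfl | rfl
  · obtain ⟨a, b, c, rfl⟩ := List.length_eq_three.1 hl
    obtain ⟨h1, h2, h3⟩ := polygonOK_three hp
    change ‖M.cornerPt a - M.cornerPt b‖ = ‖M.cornerPt a - M.cornerPt c‖ at h1
    change ‖M.cornerPt a - M.cornerPt b‖ = ‖M.cornerPt b - M.cornerPt c‖ at h2
    change M.cornerPt a ≠ M.cornerPt b at h3
    have r1 := norm_sub_rev (M.cornerPt b) (M.cornerPt a)
    have r2 := norm_sub_rev (M.cornerPt c) (M.cornerPt a)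
    have r3 := norm_sub_rev (M.cornerPt c) (M.cornerPt b)
    have n (x y : E3) (e : ‖M.cornerPt a - M.cornerPt b‖ = ‖x - y‖) : x ≠ y := fun h0 => h3 (by
      rwa [h0, sub_self, norm_zero, norm_eq_zero, sub_eq_zero] at e)
    have e : M.cornerPt '' {v | v ∈ [a, b, c]} = {M.cornerPt a, M.cornerPt b, M.cornerPt c} := by
      simp only [image_cons, image_nil, insert_empty_eq]
    rw [e]
    constructor
    · intro hvw
      simp only [mem_cons, not_mem_nil, or_false] at hv hw
      rcases hv with rfl | rfl | rfl <;> rcases hw with rfl | rfl | rfl <;>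
        first | exact absurd rfl hvw.1 | simp [Adjacent, sides]
    · refine adjacent_induction (R := fun v w => IsSide _ (M.cornerPt v) (M.cornerPt w))
        IsSide.symm ?_
      have m1 := isSide_triangle h1 h2 h3
      have m2 := isSide_triangle (a := M.cornerPt b) (b := M.cornerPt c) (c := M.cornerPt a)
        (by rw [r1, h2]) (by rw [r2, ← h1, h2]) (n _ _ h2)
      have m3 := isSide_triangle (a := M.cornerPt c) (b := M.cornerPt a) (c := M.cornerPt b)
        (by rw [r2, r3, ← h1, h2]) (by rw [r2, h1]) (n _ _ (by rw [r2, h1]))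
      rw [show ({M.cornerPt b, M.cornerPt c, M.cornerPt a} : Set E3) = {M.cornerPt a, M.cornerPt b,
        M.cornerPt c} by ext; simp; tauto] at m2
      rw [show ({M.cornerPt c, M.cornerPt a, M.cornerPt b} : Set E3) = {M.cornerPt a, M.cornerPt b,
        M.cornerPt c} by ext; simp; tauto] at m3
      simpa [sides] using ⟨m1, m2, m3⟩
  · obtain ⟨a, b, c, d, rfl⟩ : ∃ a b c d, T = [a, b, c, d] := by
      match T, hl with
      | [a, b, c, d], _ => exact ⟨a, b, c, d, rfl⟩
    obtain ⟨h1, h2, h3, h4⟩ := polygonOK_four hp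
    have hr : IsRectangle (M.cornerPt '' {v | v ∈ [a, b, c, d]}) (M.cornerPt a) (M.cornerPt b)
        (M.cornerPt c) (M.cornerPt d) :=
      ⟨by simp only [image_cons, image_nil, insert_empty_eq], h1, h3, h4, fun h0 => h4 (by
        change ‖M.cornerPt b - M.cornerPt a‖ = ‖M.cornerPt d - M.cornerPt a‖ at h2
        rw [← h0, sub_self, norm_zero, norm_eq_zero, sub_eq_zero] at h2
        exact h2.symm)⟩
    constructor
    · intro hvw
      have n1 := hr.not_isSide
      have n2 := hr.rotate.not_isSide
      simp only [mem_cons, not_mem_nil, or_false] at hv hw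
      rcases hv with rfl | rfl | rfl | rfl <;> rcases hw with rfl | rfl | rfl | rfl <;>
        first
          | exact absurd rfl hvw.1
          | exact absurd hvw n1
          | exact absurd hvw.symm n1
          | exact absurd hvw n2
          | exact absurd hvw.symm n2
          | simp [Adjacent, sides]
    · refine adjacent_induction (R := fun v w => IsSide _ (M.cornerPt v) (M.cornerPt w))
        IsSide.symm ?_
      intro s hs
      have hs : s = (a, b) ∨ s = (b, c) ∨ s = (c, d) ∨ s = (d, a) := by simpa [sides] using hs
      rcases hs with rfl | rfl | rfl | rfl
      exacts [hr.isSide, hr.rotate.isSide, hr.rotate.rotate.isSide, hr.rotate.rotate.rotate.isSide]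

lemma edges_tile (hT : M.IsTile T) {e : Set E3} : e ∈ edges (M.tileSet T) ↔
    ∃ v w, Adjacent T v w ∧ e = segment ℝ (M.cornerPt v) (M.cornerPt w) := by
  have key : ∀ T ∈ M.tiles, ∀ e, e ∈ edges (M.tileSet T) ↔
      ∃ v w, Adjacent T v w ∧ e = segment ℝ (M.cornerPt v) (M.cornerPt w) := by
    intro T hT e
    obtain ⟨o, R, hs⟩ := h.tile_sphere (isTile_of_mem hT)
    rw [tileSet, listHull, mem_edges_iff hs]
    constructor
    · rintro ⟨_, ⟨v, hv, rfl⟩, _, ⟨w, hw, rfl⟩, h1, h2, h3⟩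
      exact ⟨v, w, (h.isSide_iff hT hv hw).1 ⟨h1, h3⟩, h2⟩
    · rintro ⟨v, w, hvw, rfl⟩
      obtain ⟨h1, h2⟩ := (h.isSide_iff hT hvw.mem.1 hvw.mem.2).2 hvw
      exact ⟨_, ⟨v, hvw.mem.1, rfl⟩, _, ⟨w, hvw.mem.2, rfl⟩, h1, rfl, h2⟩
  obtain ⟨T₀, hT₀, n, rfl⟩ := hT
  have hseg (v w : Corner) : segment ℝ (M.cornerPt (v.move n)) (M.cornerPt (w.move n)) =
      translate (M.vec n) (segment ℝ (M.cornerPt v) (M.cornerPt w)) := by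
    rw [← vec_add_cornerPt, ← vec_add_cornerPt, ← segment_translate_image]
    rfl
  rw [tileSet_move]
  constructor
  · intro he
    obtain ⟨e', he', rfl⟩ := (isSimilarity_translate (M.vec n)).exists_of_mem_faces_image he
    obtain ⟨v, w, hvw, rfl⟩ := (key T₀ hT₀ e').1 he'
    exact ⟨_, _, hvw.map _, (hseg v w).symm⟩
  · rintro ⟨v, w, hvw, rfl⟩
    obtain ⟨v', w', rfl, rfl, hvw'⟩ := hvw.of_map
    rw [hseg]
    exact (isSimilarity_translate (M.vec n)).image_mem_faces ((key T₀ hT₀ _).2 ⟨v', w', hvw', rfl⟩)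

end Valid

end Blueprint

namespace Blueprint

variable {M : Blueprint} {p q r d : ℕ} {g : ℤ}

namespace Valid

variable (h : M.Valid p q r d g) {T : List Corner} {x : E3} {v : Corner}
include h

lemma tile_nonempty (hT : M.IsTile T) : ∃ v, v ∈ T := by
  have := h.tile_length hT
  refine List.exists_mem_of_length_pos ?_
  rcases h.p_eq with h | h <;> omega

lemma adjacent_ne (hT : M.IsTile T) {v w : Corner} (hvw : Adjacent T v w) :
    v ≠ w := by
  rintro rfl
  have h1 := (h.edges_tile hT).2 ⟨v, v, hvw, rfl⟩
  have h2 := h1.2.2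
  rw [segment_same, vectorSpan_singleton, finrank_bot] at h2
  exact zero_ne_one h2

lemma exists_star_mem (hT : M.IsTile T) (hv : v ∈ T) :
    ∃ S, StarFacts M q v S ∧ T ∈ S := by
  obtain ⟨S, hS⟩ := h.exists_star (h.tile_corner hT hv)
  exact ⟨S, hS, (hS.mem T).2 ⟨hT, hv⟩⟩

lemma inter_cases {T T' : List Corner} (hT : M.IsTile T) (hT' : M.IsTile T')
    (hne : M.tileSet T ≠ M.tileSet T') (hv : v ∈ T) (hv' : v ∈ T') :
    ((∀ w, w ∈ T → w ∈ T' → w = v) ∧ M.tileSet T ∩ M.tileSet T' = {M.cornerPt v}) ∨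
    ∃ w, w ≠ v ∧ (∀ x, x ∈ T → x ∈ T' → x = v ∨ x = w) ∧ Adjacent T v w ∧ Adjacent T' v w ∧
      M.tileSet T ∩ M.tileSet T' = segment ℝ (M.cornerPt v) (M.cornerPt w) := by
  obtain ⟨S, hS, hTS⟩ := h.exists_star_mem hT hv
  have hTS' := (hS.mem T').2 ⟨hT', hv'⟩
  have hm : Meet v T T' := by
    have : Std.Symm (Meet v) := ⟨fun _ _ => Meet.symm⟩
    exact hS.meet.forall hTS hTS' fun h0 => hne (h0 ▸ rfl)
  have hi := h.tile_inter hT hT'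
  rcases hm with hm | ⟨w, hw, hm, h1, h2⟩
  · refine Or.inl ⟨hm, Set.Subset.antisymm (hi.trans ?_) ?_⟩
    · refine (convexHull_mono ?_).trans (convexHull_singleton (𝕜 := ℝ) (M.cornerPt v)).subset
      rintro _ ⟨w, ⟨h1, h2⟩, rfl⟩
      rw [hm w h1 h2]; rfl
    · rintro _ rfl
      exact ⟨mem_listHull hv, mem_listHull hv'⟩
  · refine Or.inr ⟨w, hw, hm, h1, h2, Set.Subset.antisymm (hi.trans ?_) ?_⟩
    · rw [← convexHull_pair]
      apply convexHull_mono
      rintro _ ⟨x, ⟨h3, h4⟩, rfl⟩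
      rcases hm x h3 h4 with rfl | rfl <;> simp
    · exact Set.subset_inter
        ((convex_convexHull ℝ _).segment_subset (mem_listHull hv) (mem_listHull h1.mem.2))
        ((convex_convexHull ℝ _).segment_subset (mem_listHull hv') (mem_listHull h2.mem.2))

lemma exists_common {T T' : List Corner} (hT : M.IsTile T) (hT' : M.IsTile T')
    (hx : x ∈ M.tileSet T ∩ M.tileSet T') : ∃ v, v ∈ T ∧ v ∈ T' := by
  by_contra! hne
  exact (inter_eq_empty (h.tile_inter hT hT') hne).subset hx

lemma tileSet_ne {A B : List Corner} (hA : M.IsTile A) (hB : M.IsTile B) (hAB : Meet v A B) :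
    M.tileSet A ≠ M.tileSet B := by
  intro h0
  rw [h.tileSet_eq_iff hA hB] at h0
  rcases hAB with hAB | ⟨x, -, hAB, -⟩
  · exact h.not_subset_pair hA v v fun x hx => Or.inl (hAB x hx ((h0 x).1 hx))
  · exact h.not_subset_pair hA v x fun y hy => hAB y hy ((h0 y).1 hy)

lemma two_tiles (hT : M.IsTile T) {e : Set E3} (he : e ∈ edges (M.tileSet T)) :
    ∃! F, (∃ T', M.IsTile T' ∧ F = M.tileSet T') ∧ F ≠ M.tileSet T ∧ e ∈ edges F := by
  obtain ⟨v, w, hvw, rfl⟩ := (h.edges_tile hT).1 he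
  obtain ⟨S, hS, hTS⟩ := h.exists_star_mem hT hvw.mem.1
  have hwv := (h.adjacent_ne hT hvw).symm
  have hl := hS.side T hTS w hvw
  obtain ⟨A, B, hAB⟩ := List.length_eq_two.1 hl
  have hmem (T' : List Corner) : (T' = A ∨ T' = B) ↔ M.IsTile T' ∧ v ∈ T' ∧ w ∈ T' := by
    have := List.mem_filter (p := fun T' => has T' w) (x := T') (as := S)
    rw [hAB, List.mem_pair, has_iff, hS.mem, and_assoc] at this
    exact this
  have hpw : Meet v A B := by
    have := hS.meet.filter fun T' => has T' w
    rw [hAB, List.pairwise_pair] at this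
    exact this
  obtain ⟨hA, hvA, hwA⟩ := (hmem A).1 (Or.inl rfl)
  obtain ⟨hB, hvB, hwB⟩ := (hmem B).1 (Or.inr rfl)
  have hne := h.tileSet_ne hA hB hpw
  have edge {T' : List Corner} (hT' : M.IsTile T') (hv : v ∈ T') (hw : w ∈ T')
      (hne : M.tileSet T' ≠ M.tileSet T) :
      segment ℝ (M.cornerPt v) (M.cornerPt w) ∈ edges (M.tileSet T') := by
    refine (h.edges_tile hT').2 ⟨v, w, ?_, rfl⟩
    rcases h.inter_cases hT' hT hne hv hvw.mem.1 with ⟨h1, -⟩ | ⟨x, -, h2, h3, -⟩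
    · exact absurd (h1 w hw hvw.mem.2) hwv
    · rwa [(h2 w hw hvw.mem.2).resolve_left hwv]
  have only {F : Set E3} (hF : ∃ T', M.IsTile T' ∧ F = M.tileSet T')
      (he : segment ℝ (M.cornerPt v) (M.cornerPt w) ∈ edges F) :
      F = M.tileSet A ∨ F = M.tileSet B := by
    obtain ⟨T', hT', rfl⟩ := hF
    have hsub := he.1.subset
    have h1 := (h.corner_mem_tileSet hT' hT hvw.mem.1).1 (hsub (left_mem_segment ℝ _ _))
    have h2 := (h.corner_mem_tileSet hT' hT hvw.mem.2).1 (hsub (right_mem_segment ℝ _ _))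
    exact ((hmem T').2 ⟨hT', h1, h2⟩).imp (congrArg _) (congrArg _)
  rcases (hmem T).2 ⟨hT, hvw.mem⟩ with rfl | rfl
  · refine ⟨M.tileSet B, ⟨⟨B, hB, rfl⟩, hne.symm, edge hB hvB hwB hne.symm⟩, ?_⟩
    rintro F ⟨hF, hFT, he⟩
    exact (only hF he).resolve_left hFT
  · refine ⟨M.tileSet A, ⟨⟨A, hA, rfl⟩, hne, edge hA hvA hwA hne⟩, ?_⟩
    rintro F ⟨hF, hFT, he⟩
    exact (only hF he).resolve_right hFT

lemma valency (hT : M.IsTile T) (hx : x ∈ vertices (M.tileSet T)) :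
    {F ∈ {F | ∃ T, M.IsTile T ∧ F = M.tileSet T} | x ∈ F}.ncard = q := by
  classical
  rw [h.vertices_tile hT] at hx
  obtain ⟨v, hv, rfl⟩ := hx
  obtain ⟨S, hS, -⟩ := h.exists_star_mem hT hv
  have e : {F ∈ {F | ∃ T, M.IsTile T ∧ F = M.tileSet T} | M.cornerPt v ∈ F} =
      ((S.map M.tileSet).toFinset : Set (Set E3)) := by
    ext F
    simp only [mem_ofPred_eq, List.coe_toFinset, mem_map]
    constructor
    · rintro ⟨⟨T', hT', rfl⟩, hvT⟩
      exact ⟨T', (hS.mem T').2 ⟨hT', (h.corner_mem_tileSet hT' hT hv).1 hvT⟩, rfl⟩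
    · rintro ⟨T', hT', rfl⟩
      obtain ⟨h1, h2⟩ := (hS.mem T').1 hT'
      exact ⟨⟨T', h1, rfl⟩, mem_listHull h2⟩
  rw [e, Set.ncard_coe_finset, List.toFinset_card_of_nodup, length_map, hS.length]
  rw [Nodup, pairwise_map]
  exact hS.meet.imp_of_mem fun hA hB => h.tileSet_ne ((hS.mem _).1 hA).1 ((hS.mem _).1 hB).1

lemma cycle {T T' : List Corner} (hT : M.IsTile T) (hT' : M.IsTile T')
    (hx : x ∈ M.tileSet T) (hx' : x ∈ M.tileSet T') :
    ReflTransGen (fun A B => A ∈ {F | ∃ T, M.IsTile T ∧ F = M.tileSet T} ∧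
      B ∈ {F | ∃ T, M.IsTile T ∧ F = M.tileSet T} ∧ ∃ e, e ∈ edges A ∧ e ∈ edges B ∧ x ∈ e)
      (M.tileSet T) (M.tileSet T') := by
  by_cases hne : M.tileSet T = M.tileSet T'
  · rw [hne]
  obtain ⟨v, hv, hv'⟩ := h.exists_common hT hT' ⟨hx, hx'⟩
  rcases h.inter_cases hT hT' hne hv hv' with ⟨-, h1⟩ | ⟨w, -, -, h1, h2, h3⟩
  · have hxv : x = M.cornerPt v := by
      have : x ∈ M.tileSet T ∩ M.tileSet T' := ⟨hx, hx'⟩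
      rwa [h1] at this
    obtain ⟨S, hS, hTS⟩ := h.exists_star_mem hT hv
    refine (hS.linked T hTS T' ((hS.mem T').2 ⟨hT', hv'⟩)).lift' M.tileSet ?_
    rintro A B ⟨hA, hB, w, hw, hwA, hwB⟩
    obtain ⟨hA, hvA⟩ := (hS.mem A).1 hA
    obtain ⟨hB, hvB⟩ := (hS.mem B).1 hB
    by_cases hAB : M.tileSet A = M.tileSet B
    · change ReflTransGen _ (M.tileSet A) (M.tileSet B)
      rw [hAB]
    rcases h.inter_cases hA hB hAB hvA hvB with ⟨h4, -⟩ | ⟨y, -, h4, h5, h6, -⟩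
    · exact absurd (h4 w hwA hwB) hw
    · refine ReflTransGen.single ⟨⟨A, hA, rfl⟩, ⟨B, hB, rfl⟩, _,
        (h.edges_tile hA).2 ⟨v, y, h5, rfl⟩, (h.edges_tile hB).2 ⟨v, y, h6, rfl⟩, ?_⟩
      rw [hxv]
      exact left_mem_segment ℝ _ _
  · exact ReflTransGen.single ⟨⟨T, hT, rfl⟩, ⟨T', hT', rfl⟩, _,
      (h.edges_tile hT).2 ⟨v, w, h1, rfl⟩, (h.edges_tile hT').2 ⟨v, w, h2, rfl⟩, h3 ▸ ⟨hx, hx'⟩⟩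

omit h in
lemma inTile_sound {v w : Corner} (hvw : (M.tiles.any fun T => inTile T v w) = true) :
    ∃ T, M.IsTile T ∧ v ∈ T ∧ w ∈ T := by
  obtain ⟨T, hT, hvw⟩ := any_eq_true.1 hvw
  simp only [inTile, any_eq_true (p := fun x : Corner => _ && _), and_eq_true,
    has_iff, Nat.beq_eq] at hvw
  obtain ⟨x, hx, h1, h2, h3⟩ := hvw
  refine ⟨_, ⟨T, hT, v.1.2 - x.1.2, rfl⟩, mem_map.2 ⟨x, hx, ?_⟩, mem_map.2 ⟨_, h3, ?_⟩⟩
  · simp only [Corner.move, Node.move, Shift.add_eq, h1, h2, add_sub_cancel]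
  · rw [Corner.move_move, Shift.add_eq, Shift.neg_eq]
    have : x.1.2 + -v.1.2 + (v.1.2 - x.1.2) = 0 := by abel
    rw [this, Corner.move_zero]

lemma corner_reachable {v w : Corner} (hv : M.IsCorner v) (hw : M.IsCorner w) :
    ReflTransGen (fun v w => ∃ T, M.IsTile T ∧ v ∈ T ∧ w ∈ T) v w := by
  set R : Corner → Corner → Prop := fun v w => ∃ T, M.IsTile T ∧ v ∈ T ∧ w ∈ T with hR
  have hsymm {v w : Corner} (hvw : ReflTransGen R v w) : ReflTransGen R w v := by
    refine (ReflTransGen.swap _ _ hvw).lift id ?_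
    rintro a b ⟨T, hT, h1, h2⟩
    exact ⟨T, hT, h2, h1⟩
  have hmove (n : Shift) {v w : Corner} (hvw : ReflTransGen R v w) :
      ReflTransGen R (v.move n) (w.move n) := by
    refine hvw.lift (Corner.move n) ?_
    rintro a b ⟨T, hT, h1, h2⟩
    exact ⟨_, hT.move n, mem_map_of_mem h1, mem_map_of_mem h2⟩
  have h1 := h.corner_chain
  rw [cornerChainOK] at h1
  have h2 := chainOK_sound (P := fun v => ReflTransGen R ((0, 0), 0) v)
    (fun a b => Corner.same_iff.1) (fun a b hab ha => ha.tail (inTile_sound hab)) (by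
      intro a ha
      rw [List.mem_singleton.1 ha]
      exact ReflTransGen.refl) h1
  have shift (k j : ℕ) (m n : Shift) : Corner.move m ((k, n), j) = ((k, m + n), j) := by
    simp [Corner.move, Node.move, Shift.add_eq, add_comm]
  have hG (n : Shift) : ReflTransGen R ((0, 0), 0) ((0, n), 0) := by
    refine related_of_generators (R := fun m n => ReflTransGen R ((0, m), 0) ((0, n), 0))
      ⟨fun _ => .refl, hsymm, .trans⟩ (fun m n n' hn => ?_) ?_ ?_ ?_ _
    · have := hmove m hn
      rwa [shift, shift] at this
    all_goals exact h2 _ (mem_append_right _ (by simp [generators]))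
  have base {v : Corner} (hv : M.IsCorner v) : ReflTransGen R ((0, 0), 0) v := by
    have h3 : ReflTransGen R ((0, 0), 0) ((v.1.1, 0), v.2) :=
      h2 _ (mem_append_left _ (mem_flatMap.2 ⟨v.1.1, List.mem_range.2 hv.1,
        mem_map.2 ⟨v.2, List.mem_range.2 hv.2, rfl⟩⟩))
    have h4 := hmove v.1.2 h3
    rw [shift, shift, add_zero] at h4
    exact ReflTransGen.trans (hG v.1.2) h4
  exact (hsymm (base hv)).trans (base hw)

lemma exists_tile (hv : M.IsCorner v) : ∃ T, M.IsTile T ∧ v ∈ T := by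
  obtain ⟨S, hS⟩ := h.exists_star hv
  have hl : 0 < S.length := by rw [hS.length]; exact h.q_pos
  obtain ⟨T, hT⟩ := List.exists_mem_of_length_pos hl
  exact ⟨T, (hS.mem T).1 hT⟩

lemma isNode_zero : ∃ A, M.IsNode A := by
  obtain ⟨D, -, hne, -⟩ := h.exists_length
  obtain ⟨L, hL⟩ := exists_mem_of_ne_nil _ hne
  exact ⟨(L.src, 0), (h.dartFacts hL).src_lt⟩

lemma isConnected_surface : IsConnected (⋃₀ {F | ∃ T, M.IsTile T ∧ F = M.tileSet T}) := by
  have e : ⋃₀ {F | ∃ T, M.IsTile T ∧ F = M.tileSet T} =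
      ⋃ T : {T // M.IsTile T}, M.tileSet T.1 := by
    ext x
    simp only [Set.mem_sUnion, mem_ofPred_eq, mem_iUnion, Subtype.exists]
    constructor
    · rintro ⟨_, ⟨T, hT, rfl⟩, hx⟩; exact ⟨T, hT, hx⟩
    · rintro ⟨T, hT, hx⟩; exact ⟨_, ⟨T, hT, rfl⟩, hx⟩
  rw [e]
  constructor
  · obtain ⟨A, hA⟩ := h.isNode_zero
    obtain ⟨T, hT, hv⟩ := h.exists_tile (v := (A, 0)) ⟨hA, h.rel_pos⟩
    exact ⟨_, mem_iUnion.2 ⟨⟨T, hT⟩, mem_listHull hv⟩⟩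
  · refine IsPreconnected.iUnion_of_reflTransGen
      (fun T => (convex_convexHull ℝ _).isPreconnected) ?_
    rintro ⟨T, hT⟩ ⟨T', hT'⟩
    obtain ⟨v, hv⟩ := h.tile_nonempty hT
    obtain ⟨w, hw⟩ := h.tile_nonempty hT'
    have hvw := h.corner_reachable (h.tile_corner hT hv) (h.tile_corner hT' hw)
    clear e
    induction hvw generalizing T' with
    | refl => exact ReflTransGen.single ⟨_, mem_listHull hv, mem_listHull hw⟩
    | tail _ h1 ih =>
      obtain ⟨T₁, hT₁, h2, h3⟩ := h1
      exact (ih T₁ hT₁ h2).tail ⟨_, mem_listHull h3, mem_listHull hw⟩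

lemma isRegularSurface : IsRegularSurface p q (M.replacement.boundary M.graph) := by
  rw [h.boundary_eq]
  refine ⟨?_, ?_, ?_, h.q_pos, ?_, ?_, h.isConnected_surface⟩
  · rintro _ ⟨T, hT, rfl⟩
    exact h.tile_isRegularPolygon hT
  · rintro _ ⟨T, hT, rfl⟩ _ ⟨T', hT', rfl⟩ hne
    rcases Set.eq_empty_or_nonempty (M.tileSet T ∩ M.tileSet T') with h0 | ⟨x, hx⟩
    · exact Or.inl h0
    right
    obtain ⟨v, hv, hv'⟩ := h.exists_common hT hT' hx
    rcases h.inter_cases hT hT' hne hv hv' with ⟨-, h1⟩ | ⟨w, -, -, h1, h2, h3⟩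
    · left
      refine ⟨_, ?_, ?_, h1⟩
      · rw [h.vertices_tile hT]; exact ⟨v, hv, rfl⟩
      · rw [h.vertices_tile hT']; exact ⟨v, hv', rfl⟩
    · right
      rw [h3, h.edges_tile hT, h.edges_tile hT']
      exact ⟨⟨v, w, h1, rfl⟩, v, w, h2, rfl⟩
  · rintro _ ⟨T, hT, rfl⟩ e he
    exact h.two_tiles hT he
  · rintro _ ⟨T, hT, rfl⟩ x hx
    exact h.valency hT hx
  · rintro x _ ⟨T, hT, rfl⟩ _ ⟨T', hT', rfl⟩ hx hx'
    exact h.cycle hT hT' hx hx'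

end Valid

end Blueprint

/-! ### The quotient graph and its symmetries -/

lemma mem_orbit_self (Λ : Submodule ℤ E3) (S : Set E3) :
    S ∈ {T | ∃ l ∈ Λ, T = translate l S} := ⟨0, zero_mem _, (translate_zero S).symm⟩

lemma orbit_eq {Λ : Submodule ℤ E3} {S T : Set E3} (h : ∃ l ∈ Λ, T = translate l S) :
    {U | ∃ l ∈ Λ, U = translate l T} = {U | ∃ l ∈ Λ, U = translate l S} := by
  obtain ⟨l, hl, rfl⟩ := h
  ext U
  constructor
  · rintro ⟨m, hm, rfl⟩
    exact ⟨m + l, add_mem hm hl, translate_add _ _ _⟩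
  · rintro ⟨m, hm, rfl⟩
    exact ⟨m - l, sub_mem hm hl, by rw [translate_add, sub_add_cancel]⟩

lemma ncard_orbits {Λ : Submodule ℤ E3} {𝓕 : Set (Set E3)} {R : List (Set E3)}
    (h1 : ∀ S ∈ R, S ∈ 𝓕) (h2 : ∀ S ∈ 𝓕, ∃ T ∈ R, ∃ l ∈ Λ, S = translate l T)
    (h3 : R.Pairwise fun S T => ¬ ∃ l ∈ Λ, T = translate l S) :
    (orbits Λ 𝓕).Finite ∧ (orbits Λ 𝓕).ncard = R.length := by
  classical
  have e : orbits Λ 𝓕 = ((R.map fun S => {T | ∃ l ∈ Λ, T = translate l S}).toFinset :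
      Set (Set (Set E3))) := by
    ext O
    simp only [orbits, Set.mem_image, List.coe_toFinset, mem_map, mem_ofPred_eq]
    constructor
    · rintro ⟨S, hS, rfl⟩
      obtain ⟨T, hT, hST⟩ := h2 S hS
      exact ⟨T, hT, (orbit_eq hST).symm⟩
    · rintro ⟨S, hS, rfl⟩
      exact ⟨S, h1 S hS, rfl⟩
  rw [e]
  refine ⟨Finset.finite_toSet _, ?_⟩
  rw [Set.ncard_coe_finset, List.toFinset_card_of_nodup, length_map]
  rw [Nodup, pairwise_map]
  refine h3.imp ?_
  intro S T hST he
  have := mem_orbit_self Λ T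
  rw [← he] at this
  exact hST this

lemma translate_pair (l x y : E3) : translate l {x, y} = {l + x, l + y} := by
  rw [translate, Set.image_pair]

namespace Blueprint

variable {M : Blueprint} {p q r d : ℕ} {g : ℤ}

noncomputable def ends (M : Blueprint) (L : Link) : Set E3 :=
  {M.centerPt (L.src, 0), M.centerPt L.dst}

lemma translate_ends (n : Shift) (L : Link) : translate (M.vec n) (M.ends L) =
    {M.centerPt (Arc.src (L, n)), M.centerPt (Arc.dst (L, n))} := by
  rw [ends, translate_pair, vec_add_centerPt, vec_add_centerPt]
  simp [Arc.src, Arc.dst, Node.move, Shift.add_eq]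

lemma ends_of_eq {a b : Arc} (h : b = a ∨ b = a.rev) :
    {M.centerPt a.src, M.centerPt a.dst} = translate (M.vec b.2) (M.ends b.1) := by
  rw [translate_ends]
  rcases h with rfl | rfl
  · rfl
  · change _ = {M.centerPt a.rev.src, M.centerPt a.rev.dst}
    rw [Arc.src_rev, Arc.dst_rev, Set.pair_comm]

lemma mk_centerPt_eq_iff {k k' : ℕ} {n n' : Shift}
    (hinj : ∀ m : Shift, M.centerPt (k, m) = M.centerPt (k', n') → (k, m) = (k', n')) :
    (QuotientAddGroup.mk (M.centerPt (k, n)) : E3 ⧸ M.lattice.toAddSubgroup) =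
      QuotientAddGroup.mk (M.centerPt (k', n')) ↔ k = k' := by
  rw [QuotientAddGroup.eq]
  change -M.centerPt (k, n) + M.centerPt (k', n') ∈ M.lattice ↔ _
  rw [mem_lattice]
  constructor
  · rintro ⟨m, hm⟩
    have h1 : M.centerPt (k', n') = M.centerPt (k, n) + M.vec m := by rw [← hm]; abel
    rw [← centerPt_move] at h1
    exact congrArg Prod.fst (hinj _ h1.symm)
  · rintro rfl
    refine ⟨n' - n, ?_⟩
    rw [centerPt_eq M k n, centerPt_eq M k n', sub_eq_add_neg n' n, vec_add, vec_neg]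
    abel

namespace Valid

variable (h : M.Valid p q r d g)
include h

lemma darts_pairwise : M.darts.Pairwise fun L K => L.src = K.src → L.dst ≠ K.dst := by
  have h1 := h.links
  simp only [linksOK, and_eq_true] at h1
  refine (pairwise_of_pairsAll h1.2.1.2.2).imp ?_
  intro L K hLK hs hd
  simp only [dartPairOK, hs, hd, or_eq_true, and_eq_true, not_eq_true',
    ← not_eq_true, Nat.beq_eq, Node.same_iff] at hLK
  simp at hLK

lemma ends_eq {L K : Link} (hL : L ∈ M.darts) (hK : K ∈ M.darts) {n : Shift}
    (he : M.ends K = translate (M.vec n) (M.ends L)) : K = L ∨ K = L.rev := by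
  have hK' : M.IsArc (K, 0) := hK
  have hL' : M.IsArc (L, n) := hL
  have e : M.ends K = {M.centerPt (Arc.src (K, 0)), M.centerPt (Arc.dst (K, 0))} := by
    rw [← translate_ends, vec_zero, translate_zero]
  rw [e, translate_ends, Set.pair_eq_pair_iff] at he
  rcases he with ⟨h1, h2⟩ | ⟨h1, h2⟩
  · left
    exact congrArg Prod.fst (h.arc_unique hK' hL'
      (h.center_injective (h.isNode_src hK') (h.isNode_src hL') h1)
      (h.center_injective (h.isNode_dst hK') (h.isNode_dst hL') h2))
  · right
    refine congrArg Prod.fst (h.arc_unique hK' hL'.rev ?_ ?_)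
    · exact h.center_injective (h.isNode_src hK') (h.isNode_dst hL') h1
    · rw [Arc.dst_rev]
      exact h.center_injective (h.isNode_dst hK') (h.isNode_src hL') h2

lemma links_pairwise : M.links.Pairwise fun L K =>
    ¬ ∃ l ∈ M.lattice, M.ends K = translate l (M.ends L) := by
  have h1 := h.darts_pairwise
  rw [darts, List.pairwise_append] at h1
  refine h1.1.imp_of_mem ?_
  rintro L K hL hK hLK ⟨l, hl, he⟩
  obtain ⟨n, rfl⟩ := M.mem_lattice.1 hl
  rcases h.ends_eq (M.mem_darts_of_mem_links hL) (M.mem_darts_of_mem_links hK) he with rfl | rfl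
  · exact hLK rfl rfl
  · exact h1.2.2 _ hK _ (mem_map_of_mem hL) rfl rfl

lemma ncard_quotientEdges : (quotientEdges M.lattice M.graph).ncard = M.links.length := by
  rw [quotientEdges, (ncard_orbits (R := M.links.map M.ends) ?_ ?_ ?_).2, length_map]
  · intro S hS
    obtain ⟨L, hL, rfl⟩ := mem_map.1 hS
    have ha : M.IsArc (L, 0) := M.mem_darts_of_mem_links hL
    refine ⟨_, _, h.adj_arc ha, ?_⟩
    rw [← translate_ends, vec_zero, translate_zero]
  · rintro _ ⟨u, v, huv, rfl⟩
    obtain ⟨a, ha, rfl, rfl⟩ := h.adj_iff.1 huv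
    obtain ⟨b, hb, hba⟩ := exists_link ha
    exact ⟨_, mem_map_of_mem hb, _, M.vec_mem_lattice _, ends_of_eq hba⟩
  · rw [pairwise_map]
    exact h.links_pairwise

lemma mk_center_eq_iff {A B : Node} (hA : M.IsNode A) (hB : M.IsNode B) :
    (QuotientAddGroup.mk (M.centerPt A) : E3 ⧸ M.lattice.toAddSubgroup) =
      QuotientAddGroup.mk (M.centerPt B) ↔ A.1 = B.1 :=
  mk_centerPt_eq_iff fun _ hm => h.center_injective (A := (A.1, _)) hA hB hm

lemma ncard_quotientVertices : (quotientVertices M.lattice M.graph).ncard = M.cen.length := by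
  classical
  have e : quotientVertices M.lattice M.graph = ((Finset.range M.cen.length).image fun k =>
      (QuotientAddGroup.mk (M.centerPt (k, 0)) : E3 ⧸ M.lattice.toAddSubgroup) : Finset _) := by
    ext x
    simp only [quotientVertices, Set.mem_image, Finset.coe_image, Finset.coe_range, Set.mem_Iio]
    constructor
    · rintro ⟨u, hu, rfl⟩
      obtain ⟨A, hA, rfl⟩ := h.mem_support_iff.1 hu
      exact ⟨A.1, hA, (h.mk_center_eq_iff (A := (A.1, 0)) hA hA).2 rfl⟩
    · rintro ⟨k, hk, rfl⟩
      exact ⟨_, h.mem_support_iff.2 ⟨(k, 0), hk, rfl⟩, rfl⟩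
  rw [e, Set.ncard_coe_finset, Finset.card_image_of_injOn, Finset.card_range]
  intro k hk k' hk' hkk
  rw [Finset.coe_range] at hk hk'
  exact (h.mk_center_eq_iff (A := (k, 0)) (B := (k', 0)) hk hk').1 hkk

lemma ncard_neighborSet {u : E3} (hu : u ∈ M.graph.support) :
    (M.graph.neighborSet u).ncard = d := by
  classical
  obtain ⟨A, hA, rfl⟩ := h.mem_support_iff.1 hu
  set R := (M.darts.filter fun L => Nat.beq L.src A.1).map fun L => M.centerPt (L.dst.move A.2)
    with hR
  have e : M.graph.neighborSet (M.centerPt A) = (R.toFinset : Set E3) := by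
    ext x
    rw [SimpleGraph.mem_neighborSet, h.adj_iff, List.coe_toFinset]
    simp only [hR, mem_ofPred_eq, mem_map, List.mem_filter, Nat.beq_eq]
    constructor
    · rintro ⟨a, ha, h1, rfl⟩
      have h1 := h.center_injective hA (h.isNode_src ha) h1
      refine ⟨a.1, ⟨ha, (congrArg Prod.fst h1).symm⟩, ?_⟩
      rw [show A.2 = a.2 from congrArg (fun A : Node => A.2) h1]
      rfl
    · rintro ⟨L, ⟨hL, hs⟩, rfl⟩
      exact ⟨(L, A.2), hL, by rw [show Arc.src (L, A.2) = A from Prod.ext hs rfl], rfl⟩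
  have h1 := h.degree
  simp only [degreeOK, all_eq_true, List.mem_range, Nat.beq_eq] at h1
  rw [e, Set.ncard_coe_finset, List.toFinset_card_of_nodup, hR, length_map, h1 _ hA]
  rw [hR, Nodup, pairwise_map]
  refine (h.darts_pairwise.filter _).imp_of_mem ?_
  intro L K hL hK hLK he
  simp only [List.mem_filter, Nat.beq_eq] at hL hK
  have h2 := h.center_injective (A := L.dst.move A.2) (B := K.dst.move A.2)
    (h.dartFacts hL.1).dst_lt (h.dartFacts hK.1).dst_lt he
  exact hLK (hL.2.trans hK.2.symm) (M.isAction_node.mv_injective _ h2)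

lemma multiplicity_eq {A B : Node} (hA : M.IsNode A) (hB : M.IsNode B) :
    multiplicity M.lattice M.graph (QuotientAddGroup.mk (M.centerPt A))
      (QuotientAddGroup.mk (M.centerPt B)) = (M.between A.1 B.1).length := by
  have hb {L : Link} : L ∈ M.between A.1 B.1 ↔ L ∈ M.links ∧
      ((L.src = A.1 ∧ L.dst.1 = B.1) ∨ (L.src = B.1 ∧ L.dst.1 = A.1)) := by
    simp [between]
  rw [multiplicity, (ncard_orbits (R := (M.between A.1 B.1).map M.ends) ?_ ?_ ?_).2,
    length_map]
  · intro S hS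
    obtain ⟨L, hL, rfl⟩ := mem_map.1 hS
    obtain ⟨hL, hs⟩ := hb.1 hL
    have ha : M.IsArc (L, 0) := M.mem_darts_of_mem_links hL
    have e : M.ends L = {M.centerPt (Arc.src (L, 0)), M.centerPt (Arc.dst (L, 0))} := by
      rw [← translate_ends, vec_zero, translate_zero]
    rcases hs with ⟨h1, h2⟩ | ⟨h1, h2⟩
    · exact ⟨_, _, h.adj_arc ha, (h.mk_center_eq_iff (h.isNode_src ha) hA).2 h1,
        (h.mk_center_eq_iff (h.isNode_dst ha) hB).2 h2, e⟩
    · exact ⟨_, _, (h.adj_arc ha).symm, (h.mk_center_eq_iff (h.isNode_dst ha) hA).2 h2,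
        (h.mk_center_eq_iff (h.isNode_src ha) hB).2 h1, by rw [e, Set.pair_comm]⟩
  · rintro _ ⟨u, v, huv, hu, hv, rfl⟩
    obtain ⟨a, ha, rfl, rfl⟩ := h.adj_iff.1 huv
    rw [h.mk_center_eq_iff (h.isNode_src ha) hA] at hu
    rw [h.mk_center_eq_iff (h.isNode_dst ha) hB] at hv
    obtain ⟨b, hb', hba⟩ := exists_link ha
    refine ⟨_, mem_map_of_mem (hb.2 ⟨hb', ?_⟩), _, M.vec_mem_lattice _, ends_of_eq hba⟩
    rcases hba with rfl | rfl
    exacts [Or.inl ⟨hu, hv⟩, Or.inr ⟨hv, hu⟩]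
  · rw [pairwise_map, between]
    exact h.links_pairwise.filter _

lemma hasSymmetricQuotient : HasSymmetricQuotient M.lattice M.graph := by
  classical
  have h1 := h.symmetric
  simp only [symmetricOK, or_eq_true, all_eq_true, List.mem_range, Nat.beq_eq] at h1
  rcases h1 with h1 | h1
  · have hcard := h.ncard_quotientVertices
    rw [h1, Set.ncard_eq_one] at hcard
    obtain ⟨x, hx⟩ := hcard
    have hs : ∀ a b : quotientVertices M.lattice M.graph, a = b := by
      rintro ⟨a, ha⟩ ⟨b, hb⟩
      rw [hx] at ha hb
      exact Subtype.ext (ha.trans hb.symm)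
    exact fun a b a' b' _ _ => ⟨1, fun _ _ => rfl, hs _ _, hs _ _⟩
  · have hm (a b : quotientVertices M.lattice M.graph) :
        multiplicity M.lattice M.graph a b = if a = b then 0 else 2 := by
      obtain ⟨_, u, hu, rfl⟩ := a
      obtain ⟨_, v, hv, rfl⟩ := b
      obtain ⟨A, hA, rfl⟩ := h.mem_support_iff.1 hu
      obtain ⟨B, hB, rfl⟩ := h.mem_support_iff.1 hv
      simp only [h.multiplicity_eq hA hB, h1 _ hA _ hB]
      exact if_congr ((h.mk_center_eq_iff hA hB).symm.trans Subtype.mk_eq_mk.symm) rfl rfl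
    intro a b a' b' hab hab'
    rw [hm] at hab hab'
    have hab : a ≠ b := fun h0 => by simp [h0] at hab
    have hab' : a' ≠ b' := fun h0 => by simp [h0] at hab'
    refine ⟨(Equiv.swap a a').trans (Equiv.swap (Equiv.swap a a' b) b'), fun x y => ?_, ?_, ?_⟩
    · simp only [hm, EmbeddingLike.apply_eq_iff_eq]
    · rw [Equiv.trans_apply, Equiv.swap_apply_left, Equiv.swap_apply_of_ne_of_ne _ hab']
      intro h0
      have := congrArg (Equiv.swap a a') h0
      rw [Equiv.swap_apply_right, Equiv.swap_apply_self] at this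
      exact hab this
    · rw [Equiv.trans_apply, Equiv.swap_apply_left]

lemma hasQuotientType {g' : ℕ} (hg : g = g') :
    HasQuotientType M.lattice M.graph g' M.cen.length d where
  lattice := h.isRankThreeLattice
  graph := h.isSkeletalGraph
  periodic := h.isPeriodic
  card_vertices := h.ncard_quotientVertices
  degree := fun u hu => h.ncard_neighborSet hu
  genus := by
    rw [h.ncard_quotientEdges]
    have := h.euler
    omega
  symmetric := h.hasSymmetricQuotient

end Valid

/-! #### Euclidean symmetries -/

noncomputable def matMap (m : Matrix3) : E3 →ₗ[ℝ] E3 where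
  toFun x := !₂[m.1.form x, m.2.1.form x, m.2.2.form x]
  map_add' x y := by ext i; fin_cases i <;> simp
  map_smul' c x := by ext i; fin_cases i <;> simp

lemma val_applyMat (m : Matrix3) (p : SurdPt) :
    (applyMat m p).val = matMap m p.val := by
  change !₂[(p.eval m.1).val, (p.eval m.2.1).val, (p.eval m.2.2).val] = _
  rw [SurdPt.val_eval, SurdPt.val_eval, SurdPt.val_eval]
  rfl

lemma matMap_transpose {m : Matrix3} (hm : orthogonalMat (transposeMat m) = true)
    (x : E3) : matMap (transposeMat m) (matMap m x) = x := by
  obtain ⟨⟨a, b, c⟩, ⟨a', b', c'⟩, a'', b'', c''⟩ := m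
  simp only [orthogonalMat, transposeMat, Shift.dot, and_eq_true] at hm
  obtain ⟨⟨h1, h2, h3⟩, h4, h5, h6⟩ := hm
  have c1 : (a * a + a' * a' + a'' * a'' : ℝ) = 1 := by
    exact_mod_cast of_decide_eq_true h1
  have c2 : (b * b + b' * b' + b'' * b'' : ℝ) = 1 := by
    exact_mod_cast of_decide_eq_true h2
  have c3 : (c * c + c' * c' + c'' * c'' : ℝ) = 1 := by
    exact_mod_cast of_decide_eq_true h3
  have c4 : (a * b + a' * b' + a'' * b'' : ℝ) = 0 := by
    exact_mod_cast of_decide_eq_true h4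
  have c5 : (a * c + a' * c' + a'' * c'' : ℝ) = 0 := by
    exact_mod_cast of_decide_eq_true h5
  have c6 : (b * c + b' * c' + b'' * c'' : ℝ) = 0 := by
    exact_mod_cast of_decide_eq_true h6
  ext i
  fin_cases i
  · simp [matMap, transposeMat, Shift.form_apply]
    linear_combination x 0 * c1 + x 1 * c4 + x 2 * c5
  · simp [matMap, transposeMat, Shift.form_apply]
    linear_combination x 0 * c4 + x 1 * c2 + x 2 * c6
  · simp [matMap, transposeMat, Shift.form_apply]
    linear_combination x 0 * c5 + x 1 * c6 + x 2 * c3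

lemma inner_matMap (m : Matrix3) (x y : E3) :
    inner ℝ (matMap m x) y = inner ℝ x (matMap (transposeMat m) y) := by
  simp [matMap, transposeMat, Shift.form_apply, PiLp.inner_apply, Fin.sum_univ_three]
  ring

lemma norm_matMap {m : Matrix3} (hm : orthogonalMat (transposeMat m) = true)
    (x : E3) : ‖matMap m x‖ = ‖x‖ := by
  rw [← sq_eq_sq₀ (norm_nonneg _) (norm_nonneg _), ← real_inner_self_eq_norm_sq, inner_matMap,
    matMap_transpose hm, real_inner_self_eq_norm_sq]

lemma mapNode_move (img : List Node) (sh : Matrix3) (n : Shift) (A : Node) :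
    mapNode img sh (A.move n) = (mapNode img sh A).move (combine sh n) := by
  have : combine sh (A.2 + n) = combine sh A.2 + combine sh n := by
    simp only [combine, Shift.smul, Shift.add_eq, Prod.fst_add, Prod.snd_add, Prod.ext_iff]
    refine ⟨?_, ?_, ?_⟩ <;> ring
  rw [mapNode, mapNode, Node.move_move, ← this]
  rfl

lemma mapOK_sound {m : Matrix3} {t : SurdPt} {img : List Node}
    {sh : Matrix3} (hm : M.mapOK m t img sh = true) :
    (∀ A, M.IsNode A → matMap m (M.centerPt A) + t.val = M.centerPt (mapNode img sh A)) ∧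
      ∀ a, M.IsArc a → ∃ b, M.IsArc b ∧ b.src = mapNode img sh a.src ∧
        b.dst = mapNode img sh a.dst := by
  simp only [mapOK, and_eq_true, all_eq_true, List.mem_range, SurdPt.same_iff] at hm
  obtain ⟨h1, ⟨e1, e2, e3⟩, h3⟩ := hm
  have hvec (n : Shift) : matMap m (M.vec n) = M.vec (combine sh n) := by
    have e1 := congrArg SurdPt.val e1
    have e2 := congrArg SurdPt.val e2
    have e3 := congrArg SurdPt.val e3
    rw [val_applyMat] at e1 e2 e3
    rw [vec_eq, map_add, map_add, map_smul, map_smul, map_smul, e1, e2, e3]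
    change (n.1 : ℝ) • M.vec sh.1 + (n.2.1 : ℝ) • M.vec sh.2.1 + (n.2.2 : ℝ) • M.vec sh.2.2 = _
    simp only [vec_eq, combine, Shift.add, Shift.smul]
    push_cast
    module
  have base (k : ℕ) (hk : k < M.cen.length) :
      matMap m (M.centerPt (k, 0)) + t.val = M.centerPt (img.getD k (0, (0, 0, 0))) := by
    have := congrArg SurdPt.val (h1 k hk)
    rw [SurdPt.val_add, val_applyMat] at this
    exact this
  constructor
  · intro A hA
    rw [show A = (A.1, A.2) from rfl, centerPt_eq, map_add, add_right_comm, base _ hA, hvec,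
      ← centerPt_move]
    rfl
  · intro a ha
    obtain ⟨b, hb, hs, hd⟩ := adjacentNodes_iff.1 (h3 a.1 ha)
    refine ⟨b.move (combine sh a.2), hb, ?_, ?_⟩
    · rw [Arc.src_move, hs, ← mapNode_move]
      congr 1
      simp [Node.move, Arc.src, Shift.add_eq, ← Prod.zero_eq_mk]
    · rw [Arc.dst_move, hd, ← mapNode_move]
      rfl

noncomputable def symMap {m : Matrix3} (hm : orthogonalMat (transposeMat m) = true)
    (t : E3) : E3 ≃ᵃⁱ[ℝ] E3 :=
  ((LinearIsometry.toLinearIsometryEquiv (⟨matMap m, norm_matMap hm⟩ : E3 →ₗᵢ[ℝ] E3)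
    rfl).toAffineIsometryEquiv).trans (AffineIsometryEquiv.constVAdd ℝ E3 t)

lemma symMap_apply {m : Matrix3} (hm : orthogonalMat (transposeMat m) = true)
    (t x : E3) : symMap hm t x = matMap m x + t := add_comm _ _

lemma Valid.symOK_sound (h : M.Valid p q r d g) {s : Sym} (hs : M.symOK s = true) :
    ∃ f : E3 ≃ᵃⁱ[ℝ] E3, (∀ x y, M.graph.Adj (f x) (f y) ↔ M.graph.Adj x y) ∧
      ∀ A, M.IsNode A → f (M.centerPt A) = M.centerPt (mapNode s.img s.sh A) := by
  simp only [symOK, and_eq_true] at hs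
  obtain ⟨⟨-, ho⟩, h1, h2⟩ := hs
  have fwd {m : Matrix3} {t : SurdPt} {img : List Node} {sh : Matrix3}
      (hm : M.mapOK m t img sh = true) {x y : E3} (hxy : M.graph.Adj x y) :
      M.graph.Adj (matMap m x + t.val) (matMap m y + t.val) := by
    obtain ⟨a, ha, rfl, rfl⟩ := h.adj_iff.1 hxy
    obtain ⟨h3, h4⟩ := mapOK_sound hm
    obtain ⟨b, hb, hs, hd⟩ := h4 a ha
    rw [h3 _ (h.isNode_src ha), h3 _ (h.isNode_dst ha), ← hs, ← hd]
    exact h.adj_arc hb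
  refine ⟨symMap ho s.tr.val, fun x y => ⟨fun hxy => ?_, fun hxy => ?_⟩, fun A hA => ?_⟩
  · have := fwd h2 hxy
    have inv (x : E3) : matMap (transposeMat s.mat) (symMap ho s.tr.val x) +
        (SurdPt.smul (-1) (applyMat (transposeMat s.mat) s.tr)).val = x := by
      rw [symMap_apply, SurdPt.val_smul, val_applyMat, map_add, matMap_transpose ho]
      push_cast
      module
    rwa [inv, inv] at this
  · rw [symMap_apply, symMap_apply]
    exact fwd h1 hxy
  · rw [symMap_apply]
    exact (mapOK_sound h1).1 A hA

lemma Valid.isEuclideanSymmetric (h : M.Valid p q r d g) : IsEuclideanSymmetric M.graph := by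
  have h1 := h.syms
  simp only [symsOK, and_eq_true, all_eq_true] at h1
  obtain ⟨h1, h2⟩ := h1
  split at h2
  · exact absurd h2 (by decide)
  rename_i d₀ l hd
  have hd₀ : M.IsArc (d₀, 0) := by rw [IsArc, hd]; exact mem_cons_self
  simp only [all_eq_true, any_eq_true] at h2
  have key (a : Arc) (ha : M.IsArc a) : ∃ f : E3 ≃ᵃⁱ[ℝ] E3,
      (∀ x y, M.graph.Adj (f x) (f y) ↔ M.graph.Adj x y) ∧
      f (M.centerPt (Arc.src (d₀, 0))) = M.centerPt a.src ∧
      f (M.centerPt (Arc.dst (d₀, 0))) = M.centerPt a.dst := by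
    obtain ⟨s, hs, hc⟩ := h2 a.1 ha
    obtain ⟨f, hf, hfA⟩ := h.symOK_sound (h1 s hs)
    simp only [carries, and_eq_true, Nat.beq_eq, Node.same_iff] at hc
    obtain ⟨hc1, hc2⟩ := hc
    set B := mapNode s.img s.sh (d₀.src, (0, 0, 0)) with hB
    refine ⟨f.trans (AffineIsometryEquiv.constVAdd ℝ E3 (M.vec (a.2 - B.2))), fun x y => ?_, ?_, ?_⟩
    · change M.graph.Adj (M.vec (a.2 - B.2) + f x) (M.vec (a.2 - B.2) + f y) ↔ _
      rw [h.isPeriodic _ (M.vec_mem_lattice _), hf]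
    · change M.vec (a.2 - B.2) + f (M.centerPt (Arc.src (d₀, 0))) = _
      rw [hfA _ (h.isNode_src hd₀), vec_add_centerPt]
      congr 1
      refine Prod.ext hc1 ?_
      change B.2 + (a.2 - B.2) = a.2
      abel
    · change M.vec (a.2 - B.2) + f (M.centerPt (Arc.dst (d₀, 0))) = _
      rw [hfA _ (h.isNode_dst hd₀), vec_add_centerPt]
      congr 1
      have e : Arc.dst (d₀, 0) = d₀.dst := Node.move_zero _
      rw [e, hc2, Node.move_move, Arc.dst]
      congr 1
      abel
  intro u v u' v' huv huv'
  obtain ⟨a, ha, rfl, rfl⟩ := h.adj_iff.1 huv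
  obtain ⟨b, hb, rfl, rfl⟩ := h.adj_iff.1 huv'
  obtain ⟨f, hf, hf1, hf2⟩ := key a ha
  obtain ⟨f', hf', hf1', hf2'⟩ := key b hb
  refine ⟨f.symm.trans f', fun x y => ?_, ?_, ?_⟩
  · change M.graph.Adj (f' (f.symm x)) (f' (f.symm y)) ↔ _
    rw [hf', ← hf, f.apply_symm_apply, f.apply_symm_apply]
  · change f' (f.symm _) = _
    rw [← hf1, f.symm_apply_apply, hf1']
  · change f' (f.symm _) = _
    rw [← hf2, f.symm_apply_apply, hf2']

end Blueprint

namespace Blueprint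

/-! ### The genus of the quotient surface -/

lemma move_normalSide (s : Corner × Corner) :
    s = ((normalSide s).1.move s.1.1.2, (normalSide s).2.move s.1.1.2) := by
  simp only [normalSide, Corner.move_move, Shift.neg_eq, neg_add_cancel, Corner.move_zero]

lemma normalSide_fst (s : Corner × Corner) : (normalSide s).1.1.2 = 0 := add_neg_cancel _

lemma normalSide_swap (s : Corner × Corner) :
    normalSide (normalSide s).swap = normalSide s.swap := by
  simp only [normalSide, Prod.swap, Corner.move_move, Shift.neg_eq]
  rw [show (Corner.move (-s.1.1.2) s.2).1.2 = s.2.1.2 + -s.1.1.2 from rfl]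
  congr 2 <;> abel

lemma sameSide_iff {s t : Corner × Corner} : sameSide s t = true ↔ s = t := by
  rw [sameSide, and_eq_true, Corner.same_iff, Corner.same_iff]
  exact Prod.ext_iff.symm

lemma foldr_insertSide (l : List (Corner × Corner)) :
    (∀ s ∈ l, ∃ t ∈ l.foldr insertSide [], t = normalSide s ∨ t = normalSide s.swap) ∧
    (∀ t ∈ l.foldr insertSide [], ∃ s ∈ l, t = normalSide s) ∧
    (l.foldr insertSide []).Pairwise fun t t' => t ≠ t' ∧ normalSide t.swap ≠ t' := by
  induction l with
  | nil => simp
  | cons s l ih =>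
    obtain ⟨h1, h2, h3⟩ := ih
    rw [List.foldr_cons, insertSide]
    split_ifs with hs
    · simp only [any_eq_true, or_eq_true, sameSide_iff] at hs
      obtain ⟨t, ht, hst⟩ := hs
      refine ⟨fun s' hs' => ?_, fun t ht => ?_, h3⟩
      · rcases mem_cons.1 hs' with rfl | hs'
        · exact ⟨t, ht, hst.imp Eq.symm Eq.symm⟩
        · exact h1 s' hs'
      · obtain ⟨s', hs', e⟩ := h2 t ht
        exact ⟨s', List.mem_cons_of_mem _ hs', e⟩
    · simp only [any_eq_true, or_eq_true, sameSide_iff, not_exists, not_and, not_or] at hs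
      refine ⟨fun s' hs' => ?_, fun t ht => ?_, List.Pairwise.cons (fun t ht => ?_) h3⟩
      · rcases mem_cons.1 hs' with rfl | hs'
        · exact ⟨_, mem_cons_self, Or.inl rfl⟩
        · obtain ⟨t, ht, e⟩ := h1 s' hs'
          exact ⟨t, List.mem_cons_of_mem _ ht, e⟩
      · rcases mem_cons.1 ht with rfl | ht
        · exact ⟨s, mem_cons_self, rfl⟩
        · obtain ⟨s', hs', e⟩ := h2 t ht
          exact ⟨s', List.mem_cons_of_mem _ hs', e⟩
      · rw [normalSide_swap]
        exact hs t ht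

variable {M : Blueprint} {p q r d : ℕ} {g : ℤ}

def sideSet (M : Blueprint) (s : Corner × Corner) : Set E3 :=
  segment ℝ (M.cornerPt s.1) (M.cornerPt s.2)

lemma sideSet_swap (s : Corner × Corner) : M.sideSet s.swap = M.sideSet s := segment_symm ℝ _ _

lemma translate_sideSet (n : Shift) (s : Corner × Corner) :
    translate (M.vec n) (M.sideSet s) = M.sideSet (s.1.move n, s.2.move n) := by
  rw [translate, sideSet, segment_translate_image, vec_add_cornerPt, vec_add_cornerPt]
  rfl

lemma sideSet_eq_translate (s : Corner × Corner) :
    M.sideSet s = translate (M.vec s.1.1.2) (M.sideSet (normalSide s)) := by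
  rw [translate_sideSet, ← move_normalSide]

namespace Valid

variable (h : M.Valid p q r d g)
include h

lemma sideSet_eq {s t : Corner × Corner} (hs : M.IsCorner s.1 ∧ M.IsCorner s.2)
    (ht : M.IsCorner t.1 ∧ M.IsCorner t.2) (he : M.sideSet s = M.sideSet t) (hne : t.1 ≠ t.2) :
    t = s ∨ t = s.swap := by
  have key (s : Corner × Corner) : M.sideSet s = listHull M.cornerPt [s.1, s.2] ∧
      ∀ x ∈ M.cornerPt '' {v | v ∈ [s.1, s.2]},
        dist x (midpoint ℝ (M.cornerPt s.1) (M.cornerPt s.2)) =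
          ‖(2 : ℝ)‖⁻¹ * dist (M.cornerPt s.1) (M.cornerPt s.2) := by
    rw [listHull, image_cons, image_cons, image_nil]
    refine ⟨by rw [insert_empty_eq, convexHull_pair]; rfl, ?_⟩
    rintro x (rfl | rfl | hx)
    · rw [dist_left_midpoint]
    · rw [dist_right_midpoint]
    · exact hx.elim
  have h1 := h.mem_iff_of_listHull_eq (by simpa using hs) (by simpa using ht) (key s).2 (key t).2
    ((key s).1.symm.trans (he.trans (key t).1))
  have h2 := (h1 t.1).2 (by simp)
  have h3 := (h1 t.2).2 (by simp)
  simp only [mem_cons, not_mem_nil, or_false] at h2 h3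
  rcases h2 with h2 | h2 <;> rcases h3 with h3 | h3
  · exact absurd (h2.trans h3.symm) hne
  · exact Or.inl (Prod.ext h2 h3)
  · exact Or.inr (Prod.ext h2 h3)
  · exact absurd (h2.trans h3.symm) hne

lemma orbits_tiles : (orbits M.lattice (M.replacement.boundary M.graph)).Finite ∧
    (orbits M.lattice (M.replacement.boundary M.graph)).ncard = M.tiles.length := by
  rw [h.boundary_eq, ← length_map M.tileSet]
  refine ncard_orbits ?_ ?_ ?_
  · intro S hS
    obtain ⟨T, hT, rfl⟩ := mem_map.1 hS
    exact ⟨T, isTile_of_mem hT, rfl⟩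
  · rintro S ⟨_, ⟨T, hT, n, rfl⟩, rfl⟩
    exact ⟨_, mem_map.2 ⟨T, hT, rfl⟩, _, M.vec_mem_lattice n, tileSet_move n T⟩
  · have h1 := h.tiles
    simp only [tilesOK, and_eq_true] at h1
    rw [pairwise_map]
    refine (pairwise_of_pairsAll h1.2).imp_of_mem ?_
    rintro T T' hT hT' hTT ⟨l, hl, he⟩
    obtain ⟨n, rfl⟩ := M.mem_lattice.1 hl
    rw [← tileSet_move, h.tileSet_eq_iff (isTile_of_mem hT') ((isTile_of_mem hT).move n)] at he
    rw [not_eq_true', ← not_eq_true] at hTT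
    apply hTT
    match T, he with
    | [], _ => rfl
    | v :: T, he =>
      simp only [sameTile, any_eq_true, and_eq_true, all_eq_true, Nat.beq_eq, has_iff]
      refine ⟨v.move n, (he _).2 mem_cons_self, rfl, rfl, fun x hx => (he _).2 ?_⟩
      have e : (Corner.move n v).1.2.add v.1.2.neg = n := by
        change v.1.2 + n + -v.1.2 = n
        abel
      rw [e]
      exact mem_map_of_mem hx

lemma orbits_edges : let 𝓔 := {e | ∃ T ∈ M.replacement.boundary M.graph, e ∈ edges T}
    (orbits M.lattice 𝓔).Finite ∧ (orbits M.lattice 𝓔).ncard = M.sideReps.length := by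
  intro 𝓔
  have hE (e : Set E3) : e ∈ 𝓔 ↔
      ∃ T v w, M.IsTile T ∧ Adjacent T v w ∧ e = M.sideSet (v, w) := by
    simp only [𝓔, h.boundary_eq, mem_ofPred_eq]
    constructor
    · rintro ⟨_, ⟨T, hT, rfl⟩, he⟩
      obtain ⟨v, w, hvw⟩ := (h.edges_tile hT).1 he
      exact ⟨T, v, w, hT, hvw⟩
    · rintro ⟨T, v, w, hT, hvw⟩
      exact ⟨_, ⟨T, hT, rfl⟩, (h.edges_tile hT).2 ⟨v, w, hvw⟩⟩
  obtain ⟨h1, h2, h3⟩ := foldr_insertSide (M.tiles.flatMap sides)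
  have hrep {t : Corner × Corner} (ht : t ∈ M.sideReps) :
      t.1.1.2 = 0 ∧ ∃ T, M.IsTile T ∧ Adjacent T t.1 t.2 := by
    obtain ⟨s, hs, rfl⟩ := h2 t ht
    obtain ⟨T, hT, hs⟩ := mem_flatMap.1 hs
    exact ⟨normalSide_fst s, _, (isTile_of_mem hT).move s.1.1.2.neg,
      Adjacent.map _ ⟨s, hs, Or.inl ⟨rfl, rfl⟩⟩⟩
  rw [← length_map M.sideSet]
  refine ncard_orbits ?_ ?_ ?_
  · intro S hS
    obtain ⟨t, ht, rfl⟩ := mem_map.1 hS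
    obtain ⟨-, T, hT, hA⟩ := hrep ht
    exact (hE _).2 ⟨T, t.1, t.2, hT, hA, rfl⟩
  · intro S hS
    obtain ⟨_, v, w, ⟨T, hT, n, rfl⟩, hA, rfl⟩ := (hE _).1 hS
    obtain ⟨v, w, rfl, rfl, s, hs, hvw⟩ := hA.of_map
    have e : M.sideSet (v, w) = M.sideSet s := by
      rcases hvw with ⟨rfl, rfl⟩ | ⟨rfl, rfl⟩
      · rfl
      · exact sideSet_swap s
    rw [show (Corner.move n v, Corner.move n w) = ((v, w).1.move n, (v, w).2.move n) from rfl,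
      ← translate_sideSet, e]
    obtain ⟨t, ht, rfl | rfl⟩ := h1 s (mem_flatMap.2 ⟨T, hT, hs⟩)
    · refine ⟨_, mem_map.2 ⟨_, ht, rfl⟩, _,
        add_mem (M.vec_mem_lattice n) (M.vec_mem_lattice s.1.1.2), ?_⟩
      rw [← translate_add, ← sideSet_eq_translate]
    · refine ⟨_, mem_map.2 ⟨_, ht, rfl⟩, _,
        add_mem (M.vec_mem_lattice n) (M.vec_mem_lattice s.swap.1.1.2), ?_⟩
      rw [← translate_add, ← sideSet_eq_translate, sideSet_swap]
  · rw [pairwise_map]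
    refine h3.imp_of_mem ?_
    rintro t t' ht ht' hne ⟨l, hl, he⟩
    obtain ⟨n, rfl⟩ := M.mem_lattice.1 hl
    obtain ⟨h0, T, hT, hA⟩ := hrep ht
    obtain ⟨h0', T', hT', hA'⟩ := hrep ht'
    rw [translate_sideSet] at he
    have hc := (hA.map (Corner.move n)).mem
    have hn := h.adjacent_ne (hT.move n) (hA.map (Corner.move n))
    rcases h.sideSet_eq ⟨h.tile_corner hT' hA'.mem.1, h.tile_corner hT' hA'.mem.2⟩
      ⟨h.tile_corner (hT.move n) hc.1, h.tile_corner (hT.move n) hc.2⟩ he hn with e | e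
    · apply hne.1
      have e1 : t.1.move n = t'.1 := congrArg Prod.fst e
      have e2 : t.2.move n = t'.2 := congrArg Prod.snd e
      have hn0 : n = 0 := by
        have : t.1.1.2 + n = t'.1.1.2 := congrArg (fun v : Corner => v.1.2) e1
        rwa [h0, h0', zero_add] at this
      rw [hn0, Corner.move_zero] at e1 e2
      exact Prod.ext e1 e2
    · apply hne.2
      have e1 : t.1.move n = t'.2 := congrArg Prod.fst e
      have e2 : t.2.move n = t'.1 := congrArg Prod.snd e
      have hn0 : t.2.1.2.neg = n := by
        have : t.2.1.2 + n = t'.1.1.2 := congrArg (fun v : Corner => v.1.2) e2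
        rw [h0'] at this
        exact neg_eq_of_add_eq_zero_right this
      rw [normalSide, Prod.fst_swap, Prod.snd_swap, hn0]
      exact Prod.ext e2 e1

lemma orbits_vertices :
    let 𝓥 := {z | ∃ T ∈ M.replacement.boundary M.graph, ∃ x ∈ vertices T, z = {x}}
    (orbits M.lattice 𝓥).Finite ∧
      (orbits M.lattice 𝓥).ncard = M.cen.length * M.rel.length := by
  intro 𝓥
  have hV (z : Set E3) : z ∈ 𝓥 ↔ ∃ v, M.IsCorner v ∧ z = {M.cornerPt v} := by
    simp only [𝓥, h.boundary_eq, mem_ofPred_eq]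
    constructor
    · rintro ⟨_, ⟨T, hT, rfl⟩, x, hx, rfl⟩
      rw [h.vertices_tile hT] at hx
      obtain ⟨v, hv, rfl⟩ := hx
      exact ⟨v, h.tile_corner hT hv, rfl⟩
    · rintro ⟨v, hv, rfl⟩
      obtain ⟨T, hT, hvT⟩ := h.exists_tile hv
      exact ⟨_, ⟨T, hT, rfl⟩, _, by rw [h.vertices_tile hT]; exact ⟨v, hvT, rfl⟩, rfl⟩
  have hl : M.cen.length * M.rel.length =
      (((List.range M.cen.length) ×ˢ (List.range M.rel.length)).map fun k =>
        ({M.cornerPt ((k.1, 0), k.2)} : Set E3)).length := by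
    rw [length_map, List.length_product, List.length_range, List.length_range]
  rw [hl]
  refine ncard_orbits ?_ ?_ ?_
  · intro S hS
    obtain ⟨k, hk, rfl⟩ := mem_map.1 hS
    rw [List.mem_product, List.mem_range, List.mem_range] at hk
    exact (hV _).2 ⟨((k.1, 0), k.2), hk, rfl⟩
  · intro S hS
    obtain ⟨v, hv, rfl⟩ := (hV S).1 hS
    refine ⟨_, mem_map.2 ⟨(v.1.1, v.2), ?_, rfl⟩, _, M.vec_mem_lattice v.1.2, ?_⟩
    · rw [List.mem_product, List.mem_range, List.mem_range]
      exact hv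
    · rw [translate, Set.image_singleton, vec_add_cornerPt]
      simp [Corner.move, Node.move, Shift.add_eq]
  · rw [pairwise_map]
    refine (Nodup.product (l₁ := List.range M.cen.length) (l₂ := List.range M.rel.length)
      List.nodup_range List.nodup_range).imp_of_mem ?_
    rintro k k' hk hk' hne ⟨l, hl, he⟩
    obtain ⟨n, rfl⟩ := M.mem_lattice.1 hl
    rw [List.mem_product, List.mem_range, List.mem_range] at hk hk'
    rw [translate, Set.image_singleton, vec_add_cornerPt, Set.singleton_eq_singleton_iff] at he
    have := h.corner_injective (v := ((k'.1, 0), k'.2)) (w := Corner.move n ((k.1, 0), k.2))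
      hk' hk he
    exact hne (Prod.ext (congrArg (fun v : Corner => v.1.1) this).symm
        (congrArg Prod.snd this).symm)

lemma hasQuotientGenus {g' : ℕ} (hg : g = g') :
    HasQuotientGenus M.lattice (M.replacement.boundary M.graph) g' := by
  refine ⟨h.orbits_tiles.1, h.orbits_edges.1, h.orbits_vertices.1, ?_⟩
  rw [h.orbits_tiles.2, h.orbits_edges.2, h.orbits_vertices.2, ← hg]
  exact of_decide_eq_true h.genus

end Valid
end Blueprint

/-! ### The solids of a blueprint -/

lemma IsGon.translate {n : ℕ} {s : Set E3} (h : IsGon n s) (l : E3) : IsGon n (translate l s) := by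
  obtain ⟨o, X, Y, h0, hXY, hX, hXs, hYs, hs⟩ := h
  have e : vectorSpan ℝ (TPPS.translate l s) = vectorSpan ℝ s := vectorSpan_vadd ℝ s l
  refine ⟨l + o, X, Y, h0, hXY, hX, e ▸ hXs, e ▸ hYs, ?_⟩
  rw [hs, TPPS.translate, ← range_comp]
  congr 1
  funext k
  simp [add_assoc]

lemma exists_mem_zip {l l' : List ℕ} (h : l.length = l'.length) :
    (∀ i ∈ l, ∃ s ∈ l.zip l', s.1 = i) ∧ ∀ j ∈ l', ∃ s ∈ l.zip l', s.2 = j := by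
  constructor
  · intro i hi
    rw [← List.map_fst_zip (l₂ := l') h.le] at hi
    exact mem_map.1 hi
  · intro j hj
    rw [← List.map_snd_zip (l₁ := l) h.ge] at hj
    exact mem_map.1 hj

abbrev coords (a : Shift) : Fin 3 → ℤ := ![a.1, a.2.1, a.2.2]

def orders : List (Fin 3 × Fin 3 × Fin 3) :=
  [(0, 1, 2), (0, 2, 1), (1, 0, 2), (1, 2, 0), (2, 0, 1), (2, 1, 0)]

lemma mem_signedPermutations (a : Shift) (σ : Equiv.Perm (Fin 3)) (s : Fin 3 → ℤˣ) :
    ((s 0 : ℤ) * coords a (σ 0), (s 1 : ℤ) * coords a (σ 1),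
      (s 2 : ℤ) * coords a (σ 2)) ∈ Blueprint.signedPermutations a := by
  have hs (i : Fin 3) : (s i : ℤ) ∈ ([1, -1] : List ℤ) := by
    rcases Int.units_eq_one_or (s i) with e | e <;> simp [e]
  have hσ : (σ 0, σ 1, σ 2) ∈ orders := by
    revert σ; decide
  refine mem_flatMap.2 ⟨(coords a (σ 0), coords a (σ 1),
    coords a (σ 2)), ?_, mem_flatMap.2 ⟨_, hs 0, mem_flatMap.2 ⟨_, hs 1,
    mem_map.2 ⟨_, hs 2, rfl⟩⟩⟩⟩
  exact mem_map_of_mem (f := fun k : Fin 3 × Fin 3 × Fin 3 => (coords a k.1,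
    coords a k.2.1, coords a k.2.2)) hσ

lemma exists_of_mem_signedPermutations {a b : Shift} (hb : b ∈ Blueprint.signedPermutations a) :
    ∃ (σ : Equiv.Perm (Fin 3)) (s : Fin 3 → ℤˣ),
    b = ((s 0 : ℤ) * coords a (σ 0), (s 1 : ℤ) * coords a (σ 1),
      (s 2 : ℤ) * coords a (σ 2)) := by
  obtain ⟨c, hc, hb⟩ := mem_flatMap.1 hb
  obtain ⟨s, hs, hb⟩ := mem_flatMap.1 hb
  obtain ⟨t, ht, hb⟩ := mem_flatMap.1 hb
  obtain ⟨u, hu, rfl⟩ := mem_map.1 hb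
  have hu' {z : ℤ} (hz : z ∈ ([1, -1] : List ℤ)) : ∃ y : ℤˣ, z = y := by
    simp only [mem_cons, not_mem_nil, or_false] at hz
    rcases hz with rfl | rfl
    exacts [⟨1, rfl⟩, ⟨-1, rfl⟩]
  obtain ⟨s, rfl⟩ := hu' hs
  obtain ⟨t, rfl⟩ := hu' ht
  obtain ⟨u, rfl⟩ := hu' hu
  have hσ : ∀ k ∈ orders, ∃ σ : Equiv.Perm (Fin 3), k = (σ 0, σ 1, σ 2) := by decide
  change c ∈ orders.map fun k => (coords a k.1,
        coords a k.2.1, coords a k.2.2) at hc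
  obtain ⟨k, hk, rfl⟩ := mem_map.1 hc
  obtain ⟨σ, rfl⟩ := hσ k hk
  exact ⟨σ, ![s, t, u], rfl⟩

lemma allPoints_eq (a : Shift) : allPoints a.1 a.2.1 a.2.2 =
    {x | ∃ b ∈ Blueprint.signedPermutations a, x = !₂[(b.1 : ℝ), (b.2.1 : ℝ), (b.2.2 : ℝ)]} := by
  have e (i : Fin 3) : (![(a.1 : ℝ), a.2.1, a.2.2] : Fin 3 → ℝ) i = (coords a i : ℤ) := by
    fin_cases i <;> rfl
  ext x
  constructor
  · rintro ⟨σ, s, -, hx⟩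
    refine ⟨_, mem_signedPermutations a σ s, ?_⟩
    ext i
    rw [hx i, e]
    fin_cases i <;> simp
  · rintro ⟨b, hb, rfl⟩
    obtain ⟨σ, s, rfl⟩ := exists_of_mem_signedPermutations hb
    refine ⟨σ, s, trivial, fun i => ?_⟩
    rw [e]
    fin_cases i <;> simp

namespace Blueprint

variable {M : Blueprint} {p q r d : ℕ} {g : ℤ}

lemma isSolid_nodeSet {c : ℤ} (hc : 0 < c) {a : Shift} (h : M.solidOK c a = true) {s : Solid}
    (hs : s.points = allPoints a.1 a.2.1 a.2.2) (A : Node) : IsSolid s (M.nodeSet A) := by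
  have hc' : (0 : ℝ) < c := by exact_mod_cast hc
  refine ⟨fun x => (c : ℝ) • LinearIsometryEquiv.refl ℝ E3 x + M.centerPt A,
    isSimilarity_iff.2 ⟨c, hc', _, _, fun _ => rfl⟩, ?_⟩
  have e : (fun x => (c : ℝ) • LinearIsometryEquiv.refl ℝ E3 x + M.centerPt A) =
      fun x => M.centerPt A + ((c : ℝ) • LinearMap.id : E3 →ₗ[ℝ] E3) x := by
    funext x; simp [add_comm]
  rw [e, ← Set.image_image (fun x => M.centerPt A + x), LinearMap.image_convexHull, nodeSet,
    nodeList,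
    listHull_node]
  refine congrArg (TPPS.translate (M.centerPt A)) (congrArg (convexHull ℝ) ?_)
  simp only [solidOK, and_eq_true, all_eq_true, any_eq_true, SurdPt.same_iff] at h
  have hv (b : Shift) : (scaled c b).val = (c : ℝ) • !₂[(b.1 : ℝ), (b.2.1 : ℝ), (b.2.2 : ℝ)] := by
    ext i
    fin_cases i <;> simp [scaled, SurdPt.val, Surd.val]
  rw [hs, allPoints_eq]
  refine Set.ext fun x => ?_
  constructor
  · rintro ⟨j, hj, rfl⟩
    have hj : j < M.rel.length := List.mem_range.1 hj
    obtain ⟨b, hb, e⟩ := h.2 _ (List.getElem_mem hj)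
    refine ⟨_, ⟨b, hb, rfl⟩, ?_⟩
    rw [relPt, List.getD_eq_getElem _ _ hj, e, hv]
    rfl
  · rintro ⟨_, ⟨b, hb, rfl⟩, rfl⟩
    obtain ⟨y, hy, e⟩ := h.1 b hb
    obtain ⟨j, hj, rfl⟩ := List.getElem_of_mem hy
    refine ⟨j, List.mem_range.2 hj, ?_⟩
    rw [relPt, List.getD_eq_getElem _ _ hj, ← e, hv]
    rfl

noncomputable def across (M : Blueprint) (a : Arc) (x : E3) : E3 :=
  if M.anti then (2 : ℝ) • M.mid a - x else x + (1 - 2 * M.alpha) • M.dir a.1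

noncomputable def basePts (M : Blueprint) (a : Arc) : Set E3 := M.cornerPt '' {v | v ∈ a.base}

lemma basePts_eq (a : Arc) :
    M.basePts a = translate (M.centerPt a.src) (M.relPt '' {i | i ∈ a.1.base}) := by
  ext x
  constructor
  · rintro ⟨v, hv, rfl⟩
    obtain ⟨h1, h2⟩ := Arc.mem_base.1 hv
    exact ⟨_, ⟨v.2, h2, rfl⟩, (by rw [cornerPt_eq, h1])⟩
  · rintro ⟨_, ⟨i, hi, rfl⟩, rfl⟩
    exact ⟨(a.src, i), Arc.mem_base.2 ⟨rfl, hi⟩, M.cornerPt_eq _⟩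

namespace Valid

variable (h : M.Valid p q r d g) {a : Arc}
include h

lemma across_eq (ha : M.IsArc a) {s : ℕ × ℕ} (hs : s ∈ a.1.base.zip a.1.top) :
    M.cornerPt (a.dst, s.2) = M.across a (M.cornerPt (a.src, s.1)) := by
  obtain ⟨h1, h2⟩ := (h.dartFacts ha).opposite s hs
  rw [across, cornerPt_eq, cornerPt_eq, centerPt_dst, mid]
  cases hanti : M.anti
  · rw [h2 hanti, if_neg (by simp)]
    module
  · rw [h1 hanti, if_pos rfl]
    module

lemma arcSet_eq (ha : M.IsArc a) :
    M.arcSet a = convexHull ℝ (M.basePts a ∪ M.across a '' M.basePts a) := by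
  have hf := h.dartFacts ha
  obtain ⟨hz1, hz2⟩ := exists_mem_zip (hf.base_length.trans hf.top_length.symm)
  have e : M.cornerPt '' {v | v ∈ a.corners} = M.basePts a ∪ M.across a '' M.basePts a := by
    ext x
    constructor
    · rintro ⟨v, hv, rfl⟩
      rcases Arc.mem_corners.1 hv with hv | hv
      · exact Or.inl ⟨v, hv, rfl⟩
      · obtain ⟨e1, e2⟩ := Arc.mem_top.1 hv
        obtain ⟨s, hs, e⟩ := hz2 _ e2
        refine Or.inr ⟨_, ⟨(a.src, s.1), Arc.mem_base.2 ⟨rfl, (List.of_mem_zip hs).1⟩, rfl⟩, ?_⟩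
        rw [← h.across_eq ha hs, e, ← e1]
    · rintro (⟨v, hv, rfl⟩ | ⟨_, ⟨v, hv, rfl⟩, rfl⟩)
      · exact ⟨v, Arc.mem_corners.2 (Or.inl hv), rfl⟩
      · obtain ⟨e1, e2⟩ := Arc.mem_base.1 hv
        obtain ⟨s, hs, e⟩ := hz1 _ e2
        refine ⟨(a.dst, s.2), Arc.mem_corners.2 (Or.inr (Arc.mem_top.2
          ⟨rfl, (List.of_mem_zip hs).2⟩)), ?_⟩
        rw [h.across_eq ha hs, e, ← e1]
  rw [arcSet, listHull, e]

lemma isGon_basePts (ha : M.IsArc a) : IsGon r (M.basePts a) := by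
  rw [basePts_eq]
  exact (h.dartFacts ha).gon.translate _

lemma isRegularPolygon_baseSet (ha : M.IsArc a) : IsRegularPolygon r (M.baseSet a) :=
  (h.isGon_basePts ha).isRegularPolygon h.three_le

lemma isPrism_arcSet (hanti : M.anti = false) (ha : M.IsArc a) :
    IsPrism r (M.arcSet a) := by
  have e : M.across a = fun x => x + (1 - 2 * M.alpha) • M.dir a.1 := by
    funext x; rw [across, if_neg (by simp [hanti])]
  have hα := h.alpha_lt
  rw [h.arcSet_eq ha, e]
  refine (h.isGon_basePts ha).isPrism h.three_le
    (smul_ne_zero (by linarith) (h.dir_ne_zero ha)) ?_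
  rw [basePts_eq]
  rintro _ ⟨_, ⟨i, hi, rfl⟩, rfl⟩ _ ⟨_, ⟨j, hj, rfl⟩, rfl⟩
  rw [add_sub_add_left_eq_sub, real_inner_smul_left, inner_sub_right, real_inner_comm,
    real_inner_comm (M.relPt j), (h.dartFacts ha).level i hi, (h.dartFacts ha).level j hj,
    sub_self, mul_zero]

lemma isAntiprism_arcSet (hanti : M.anti = true) (ha : M.IsArc a) :
    IsAntiprism 3 (M.arcSet a) := by
  have e : M.across a = fun x => (2 : ℝ) • M.mid a - x := by
    funext x; rw [across, if_pos hanti]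
  have hr : r = 3 := (h.links₁.2.2 hanti).1
  have hmid {b : Arc} {v : Corner} (hv : v ∈ b.base) :
      M.cornerPt v - M.mid b = (1 / 2 : ℝ) • ((2 : ℝ) • M.relPt v.2 - M.dir b.1) := by
    rw [cornerPt_eq, (Arc.mem_base.1 hv).1, mid]
    module
  obtain ⟨b, hb, hba⟩ := exists_link ha
  obtain ⟨R, hR⟩ := h.dist_mid hb
  have e' : M.mid b = M.mid a := by
    rcases hba with rfl | rfl
    exacts [rfl, mid_rev a]
  have hR : ∀ x ∈ M.basePts a, dist x (M.mid a) = R := by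
    rintro _ ⟨v, hv, rfl⟩
    rw [← e']
    exact hR _ v ((Arc.corners_iff hba v).2 (Arc.mem_corners.2 (Or.inl hv)))
  rw [h.arcSet_eq ha, e]
  refine (hr ▸ h.isGon_basePts ha).isAntiprism (fun x hx y hy => (hR x hx).trans (hR y hy).symm) ?_
  rintro _ ⟨v, hv, rfl⟩ _ ⟨w, hw, rfl⟩ hne
  rw [hmid hv, hmid hw, real_inner_smul_left, real_inner_smul_right,
    (h.dartFacts ha).perp hanti _ (Arc.mem_base.1 hv).2 _ (Arc.mem_base.1 hw).2, mul_zero, mul_zero]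
  rintro e
  exact hne (congrArg _ (Prod.ext ((Arc.mem_base.1 hv).1.trans (Arc.mem_base.1 hw).1.symm) e))

end Valid
end Blueprint

/-! ### The deformation retraction -/

lemma isDeformationRetract_of_segment {P G : Set E3} (hG : G ⊆ P) {ρ : E3 → E3}
    (hc : ContinuousOn ρ P) (h1 : ∀ x ∈ P, ρ x ∈ G) (h2 : ∀ x ∈ P, segment ℝ x (ρ x) ⊆ P)
    (h3 : ∀ x ∈ G, ρ x = x) : IsDeformationRetract P G := by
  refine ⟨hG, fun y => (1 - y.1) • y.2 + y.1 • ρ y.2, ?_, fun t ht x hx => h2 x hx ?_, ?_, ?_, ?_⟩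
  · have hs : ContinuousOn (fun y : ℝ × E3 => ρ y.2) (Set.Icc 0 1 ×ˢ P) :=
      hc.comp continuousOn_snd fun y hy => hy.2
    fun_prop
  · exact ⟨1 - t, t, by linarith [ht.2], ht.1, by ring, rfl⟩
  · intro x _; simp
  · intro x hx; simpa using h1 x hx
  · intro t _ x hx
    simp only [h3 x hx]
    module

/-- A convex set contains the part of a segment on either side of a point that it shares. -/
lemma segment_subset_union {K K' : Set E3} (hK : Convex ℝ K) (hK' : Convex ℝ K') {x y z : E3}
    (hx : x ∈ K) (hy : y ∈ K') (hz : z ∈ K) (hz' : z ∈ K') (hxyz : z ∈ segment ℝ x y) :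
    segment ℝ x y ⊆ K ∪ K' := by
  rw [segment_eq_image'] at hxyz ⊢
  obtain ⟨θ, ⟨h0, h1⟩, rfl⟩ := hxyz
  rintro _ ⟨τ, ⟨h2, h3⟩, rfl⟩
  rcases le_total τ θ with h4 | h4
  · exact Or.inl (Blueprint.add_smul_mem hK (s := 0) (by simpa using hx) hz h2 h4)
  · exact Or.inr (Blueprint.add_smul_mem hK' (t := 1) hz' (by simpa using hy) h4 h3)

/-- The coordinate of a point along the axis from `u` in direction `e`, relative to the length
of `e`. -/
noncomputable def axial (u e x : E3) : ℝ := inner ℝ (x - u) e / inner ℝ e e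

/-- Twice the distance from that axis, relative to the length of `e`. -/
noncomputable def radial (u e x : E3) : ℝ := 2 * ‖x - u - axial u e x • e‖ / ‖e‖

lemma axial_mem_of_mem_listHull {u e x : E3} {ι : Type} {f : ι → E3} {X : List ι} {s : Set ℝ}
    (hs : Convex ℝ s) (h : ∀ i ∈ X, axial u e (f i) ∈ s) (hx : x ∈ listHull f X) :
    axial u e x ∈ s := by
  refine convexHull_min (t := axial u e ⁻¹' s) (by rintro _ ⟨i, hi, rfl⟩; exact h i hi) ?_ hx
  intro x hx y hy a b ha hb hab
  have : axial u e (a • x + b • y) = a • axial u e x + b • axial u e y := by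
    rw [axial, show a • x + b • y - u = a • (x - u) + b • (y - u) by
      rw [eq_sub_of_add_eq hab]; module, inner_add_left, real_inner_smul_left,
      real_inner_smul_left, axial, axial, smul_eq_mul, smul_eq_mul]
    ring
  rw [Set.mem_preimage, this]
  exact hs hx hy ha hb hab

lemma continuous_axial (u e : E3) : Continuous (axial u e) := by
  unfold axial; fun_prop

lemma continuous_radial (u e : E3) : Continuous (radial u e) := by
  have := continuous_axial u e
  unfold radial; fun_prop

lemma radial_nonneg (u e x : E3) : 0 ≤ radial u e x := by unfold radial; positivity

lemma axial_add_smul {u e : E3} (he : e ≠ 0) (s : ℝ) : axial u e (u + s • e) = s := by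
  rw [axial, add_sub_cancel_left, real_inner_smul_left]
  exact mul_div_cancel_right₀ _ (inner_self_ne_zero.2 he)

lemma radial_add_smul {u e : E3} (he : e ≠ 0) (s : ℝ) : radial u e (u + s • e) = 0 := by
  rw [radial, axial_add_smul he]; simp

lemma axial_neg {u e : E3} (he : e ≠ 0) (x : E3) : axial (u + e) (-e) x = 1 - axial u e x := by
  have : inner ℝ e e ≠ (0 : ℝ) := inner_self_ne_zero.2 he
  rw [axial, axial, ← sub_sub, inner_neg_right, inner_neg_neg, inner_sub_left]
  field_simp
  ring

lemma radial_neg {u e : E3} (he : e ≠ 0) (x : E3) : radial (u + e) (-e) x = radial u e x := by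
  rw [radial, radial, axial_neg he, norm_neg]
  congr 3
  module

/-- Near one axis, the coordinate along another one that makes a large angle with it is small. -/
lemma axial_le_radial {u e f x : E3} (he : e ≠ 0) (hef : inner ℝ f f = (inner ℝ e e : ℝ))
    (h : 3 * inner ℝ e f ≤ (inner ℝ e e : ℝ)) (hx : axial u e x ≤ axial u f x) :
    axial u e x ≤ radial u e x := by
  rcases le_or_gt (axial u e x) 0 with h0 | h0
  · exact h0.trans (radial_nonneg _ _ _)
  have hE : (0 : ℝ) < inner ℝ e e := real_inner_self_pos.2 he
  have hn : 0 < ‖e‖ := norm_pos_iff.2 he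
  have hnf : ‖f‖ = ‖e‖ := by
    rw [real_inner_self_eq_norm_sq, real_inner_self_eq_norm_sq] at hef
    exact (sq_eq_sq₀ (norm_nonneg _) (norm_nonneg _)).1 hef
  set t := axial u e x with ht
  set w := x - u - t • e with hw
  have h1 : inner ℝ (x - u) f = t * inner ℝ e f + inner ℝ w f := by
    rw [show x - u = t • e + w by rw [hw]; abel, inner_add_left, real_inner_smul_left]
  have h2 : inner ℝ w f ≤ ‖w‖ * ‖e‖ := hnf ▸ real_inner_le_norm w f
  have h3 : t * inner ℝ e e ≤ inner ℝ (x - u) f := by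
    rwa [axial, hef, le_div_iff₀ hE] at hx
  have h4 : 2 * (t * inner ℝ e e) ≤ 3 * (‖w‖ * ‖e‖) := by nlinarith
  rw [real_inner_self_eq_norm_sq] at h4
  rw [radial, ← ht, ← hw, le_div_iff₀ hn]
  have h5 : 2 * (t * ‖e‖) ≤ 3 * ‖w‖ := by
    refine le_of_mul_le_mul_right ?_ hn
    nlinarith
  nlinarith [norm_nonneg w]

namespace Blueprint

variable {M : Blueprint} {p q r d : ℕ} {g : ℤ}

noncomputable def along (M : Blueprint) (a : Arc) : E3 → ℝ := axial (M.centerPt a.src) (M.dir a.1)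
noncomputable def off (M : Blueprint) (a : Arc) : E3 → ℝ := radial (M.centerPt a.src) (M.dir a.1)

open Classical in
noncomputable def arcsFrom (M : Blueprint) (A : Node) : Finset Arc :=
  (M.darts.toFinset.image fun L => (L, A.2)).filter fun a => a.src = A

lemma mem_arcsFrom {A : Node} {a : Arc} : a ∈ M.arcsFrom A ↔ M.IsArc a ∧ a.src = A := by
  classical
  simp only [arcsFrom, Finset.mem_filter, Finset.mem_image, List.mem_toFinset]
  constructor
  · rintro ⟨⟨L, hL, rfl⟩, h⟩
    exact ⟨hL, h⟩
  · rintro ⟨h, rfl⟩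
    exact ⟨⟨a.1, h, rfl⟩, rfl⟩

/-- The retraction of the solid of a node to the parts of the axes inside. -/
noncomputable def nodeMap (M : Blueprint) (A : Node) (x : E3) : E3 :=
  M.centerPt A + ∑ a ∈ M.arcsFrom A, max 0 (M.along a x - M.off a x) • M.dir a.1

/-- The position on the axis of a link of the image of a point of its solid. -/
noncomputable def arcCoord (M : Blueprint) (a : Arc) (x : E3) : ℝ :=
  M.along a x - (1 - 2 * M.along a x) / (1 - 2 * M.alpha) * min M.alpha (M.off a x)

noncomputable def arcMap (M : Blueprint) (a : Arc) (x : E3) : E3 :=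
  M.centerPt a.src + M.arcCoord a x • M.dir a.1

lemma continuous_nodeMap (A : Node) : Continuous (M.nodeMap A) := by
  have h1 (a : Arc) : Continuous (M.along a) := continuous_axial _ _
  have h2 (a : Arc) : Continuous (M.off a) := continuous_radial _ _
  unfold nodeMap
  fun_prop

lemma continuous_arcMap (a : Arc) : Continuous (M.arcMap a) := by
  have h1 : Continuous (M.along a) := continuous_axial _ _
  have h2 : Continuous (M.off a) := continuous_radial _ _
  unfold arcMap arcCoord
  fun_prop

namespace Valid

variable (h : M.Valid p q r d g) {a : Arc} {A : Node} {x : E3}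
include h

lemma along_rev (ha : M.IsArc a) (x : E3) : M.along a.rev x = 1 - M.along a x := by
  rw [along, Arc.src_rev, centerPt_dst, show M.dir a.rev.1 = -M.dir a.1 from dir_rev _ _]
  exact axial_neg (h.dir_ne_zero ha) x

lemma off_rev (ha : M.IsArc a) (x : E3) : M.off a.rev x = M.off a x := by
  rw [off, Arc.src_rev, centerPt_dst, show M.dir a.rev.1 = -M.dir a.1 from dir_rev _ _]
  exact radial_neg (h.dir_ne_zero ha) x

lemma arcCoord_rev (ha : M.IsArc a) (x : E3) :
    M.arcCoord a.rev x = 1 - M.arcCoord a x := by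
  rw [arcCoord, arcCoord, h.along_rev ha, h.off_rev ha]
  ring

lemma arcMap_rev (ha : M.IsArc a) (x : E3) : M.arcMap a.rev x = M.arcMap a x := by
  rw [arcMap, h.arcCoord_rev ha, axis_rev, arcMap]

lemma along_le (ha : M.IsArc a) (hx : x ∈ M.nodeSet a.src) : M.along a x ≤ M.alpha := by
  refine axial_mem_of_mem_listHull (convex_Iic _) (fun v hv => ?_) hx
  obtain ⟨h1, h2⟩ := M.mem_nodeList.1 hv
  rw [Set.mem_Iic, axial, cornerPt_eq, h1, add_sub_cancel_left,
    div_le_iff₀ (real_inner_self_pos.2 (h.dir_ne_zero ha))]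
  exact (h.dartFacts ha).le v.2 h2

lemma along_base (ha : M.IsArc a) (hx : x ∈ M.baseSet a) : M.along a x = M.alpha := by
  refine axial_mem_of_mem_listHull (convex_singleton _) (fun v hv => ?_) hx
  obtain ⟨h1, h2⟩ := Arc.mem_base.1 hv
  rw [Set.mem_singleton_iff, axial, cornerPt_eq, h1, add_sub_cancel_left,
    div_eq_iff (real_inner_self_pos.2 (h.dir_ne_zero ha)).ne']
  exact (h.dartFacts ha).level v.2 h2

lemma along_axis (ha : M.IsArc a) (c : ℝ) :
    M.along a (M.centerPt a.src + c • M.dir a.1) = c := axial_add_smul (h.dir_ne_zero ha) c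

lemma off_axis (ha : M.IsArc a) (c : ℝ) :
    M.off a (M.centerPt a.src + c • M.dir a.1) = 0 := radial_add_smul (h.dir_ne_zero ha) c

lemma along_le_off {a b : Arc} (ha : M.IsArc a) (hb : M.IsArc b) (hne : a ≠ b)
    (hs : a.src = b.src) (hx : M.along a x ≤ M.along b x) : M.along a x ≤ M.off a x := by
  obtain ⟨D, -, -, hD⟩ := h.exists_length
  have hab : a.1 ≠ b.1 := fun h0 => hne (Prod.ext h0 (congrArg (fun A : Node => A.2) hs))
  rw [along, along, ← hs] at hx
  exact axial_le_radial (h.dir_ne_zero ha) ((hD _ hb).trans (hD _ ha).symm)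
    (h.dart_pair ha hb hab (congrArg Prod.fst hs)).2.1 hx

omit h in
/-- A point whose largest coordinate belongs to `a` is mapped to the axis of `a`. -/
lemma nodeMap_eq (ha : M.IsArc a)
    (hx : ∀ b, M.IsArc b → b.src = a.src → b ≠ a → M.along b x ≤ M.off b x) :
    M.nodeMap a.src x = M.centerPt a.src + max 0 (M.along a x - M.off a x) • M.dir a.1 := by
  rw [nodeMap, Finset.sum_eq_single_of_mem a (mem_arcsFrom.2 ⟨ha, rfl⟩)]
  intro b hb hne
  obtain ⟨hb, hs⟩ := mem_arcsFrom.1 hb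
  rw [max_eq_left (sub_nonpos.2 (hx b hb hs hne)), zero_smul]

lemma nodeMap_base (ha : M.IsArc a) (hx : x ∈ M.baseSet a) :
    M.nodeMap a.src x = M.arcMap a x := by
  have h1 := h.along_base ha hx
  have h2 : 1 - 2 * M.alpha ≠ 0 := by linarith [h.alpha_lt]
  rw [nodeMap_eq ha, arcMap, arcCoord, h1, div_self h2, one_mul]
  · congr 2
    rcases le_total M.alpha (M.off a x) with h3 | h3
    · rw [min_eq_left h3, max_eq_left (by linarith), sub_self]
    · rw [min_eq_right h3, max_eq_right (by linarith)]
  · intro b hb hs hne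
    refine h.along_le_off hb ha hne hs ?_
    rw [h1]
    exact h.along_le hb (hs ▸ h.baseSet_subset_nodeSet ha hx)

lemma nodeMap_axis (ha : M.IsArc a) {c : ℝ} (hc : 0 ≤ c) :
    M.nodeMap a.src (M.centerPt a.src + c • M.dir a.1) = M.centerPt a.src + c • M.dir a.1 := by
  rw [nodeMap_eq ha, h.along_axis ha, h.off_axis ha, sub_zero, max_eq_right hc]
  intro b hb hs hne
  refine h.along_le_off hb ha hne hs ?_
  rw [h.along_axis ha, along, axial, hs, add_sub_cancel_left, real_inner_smul_left]
  obtain ⟨D, hD0, -, hD⟩ := h.exists_length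
  rw [hD _ hb, div_le_iff₀ hD0]
  have h1 := (h.dart_pair ha hb (fun h0 =>
      hne (Prod.ext h0 (congrArg (fun A : Node => A.2) hs.symm)).symm)
    (congrArg Prod.fst hs.symm)).2.1
  rw [hD _ ha] at h1
  nlinarith

lemma arcMap_axis (ha : M.IsArc a) (c : ℝ) :
    M.arcMap a (M.centerPt a.src + c • M.dir a.1) = M.centerPt a.src + c • M.dir a.1 := by
  rw [arcMap, arcCoord, h.along_axis ha, h.off_axis ha, min_eq_right h.alpha_pos.le, mul_zero,
    sub_zero]

lemma exists_nodeMap (hA : M.IsNode A) (hx : x ∈ M.nodeSet A) :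
    ∃ a c, M.IsArc a ∧ a.src = A ∧ 0 ≤ c ∧ c ≤ M.alpha ∧
      M.nodeMap A x = M.centerPt a.src + c • M.dir a.1 := by
  have key {a : Arc} (ha : M.IsArc a) (hs : a.src = A)
      (hm : ∀ b, M.IsArc b → b.src = a.src → b ≠ a → M.along b x ≤ M.off b x) :
      ∃ a c, M.IsArc a ∧ a.src = A ∧ 0 ≤ c ∧ c ≤ M.alpha ∧
      M.nodeMap A x = M.centerPt a.src + c • M.dir a.1 := by
    subst hs
    refine ⟨a, _, ha, rfl, le_max_left _ _, max_le h.alpha_pos.le ?_, nodeMap_eq ha hm⟩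
    linarith [h.along_le ha hx, show 0 ≤ M.off a x from radial_nonneg _ _ _]
  by_cases hex : ∃ a, M.IsArc a ∧ a.src = A ∧ M.off a x < M.along a x
  · obtain ⟨a, ha, hs, hlt⟩ := hex
    refine key ha hs fun b hb hbs hne => ?_
    rcases le_total (M.along b x) (M.along a x) with h1 | h1
    · exact h.along_le_off hb ha hne hbs h1
    · exact absurd (h.along_le_off ha hb hne.symm hbs.symm h1) (not_le.2 hlt)
  · push Not at hex
    obtain ⟨a, ha, hs⟩ := h.exists_arc hA
    exact key ha hs fun b hb hbs _ => hex b hb (hbs.trans hs)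

end Valid
end Blueprint

namespace Blueprint

variable {M : Blueprint} {p q r d : ℕ} {g : ℤ}

namespace Valid

variable (h : M.Valid p q r d g) {a : Arc} {x : E3}
include h

omit h in
lemma convex_cone {F : Set E3} (hF : Convex ℝ F) (u : E3) :
    Convex ℝ {x | ∃ f ∈ F, ∃ c : ℝ, 1 ≤ c ∧ x = u + c • (f - u)} := by
  rintro _ ⟨f, hf, c, hc, rfl⟩ _ ⟨f', hf', c', hc', rfl⟩ a b ha hb hab
  have h1 : 1 ≤ a * c + b * c' := by nlinarith
  refine ⟨(a * c / (a * c + b * c')) • f + (b * c' / (a * c + b * c')) • f',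
    hF hf hf' (by positivity) (by positivity) (by field_simp), a * c + b * c', h1, ?_⟩
  have e : a = 1 - b := by linarith
  match_scalars <;> field_simp <;> rw [e] <;> ring

lemma reflect_mem_base (hanti : M.anti = true) (ha : M.IsArc a)
    (hx : x ∈ M.basePts a) {β : ℝ} (h0 : 0 ≤ β) (h1 : β ≤ 1 / 2) :
    M.centerPt a.src + M.alpha • M.dir a.1 -
      β • (x - (M.centerPt a.src + M.alpha • M.dir a.1)) ∈ M.baseSet a := by
  set m := M.centerPt a.src + M.alpha • M.dir a.1 with hm
  have hmB : m ∈ M.baseSet a := h.contact_center_mem ha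
  have hf := h.dartFacts ha
  obtain ⟨i, j, k, hl⟩ := List.length_eq_three.1 (hf.base_length.trans (h.links₁.2.2 hanti).1)
  have hsum := hf.sum
  rw [(h.links₁.2.2 hanti).1, hl] at hsum
  simp only [map_cons, List.map_nil, List.sum_cons, List.sum_nil, add_zero] at hsum
  have hpt {i : ℕ} (hi : i ∈ a.1.base) : M.centerPt a.src + M.relPt i ∈ M.baseSet a := by
    rw [← cornerPt_eq M (a.src, i)]
    exact mem_listHull (Arc.mem_base.2 ⟨rfl, hi⟩)
  have key (y y' z : E3) (hy : y ∈ M.baseSet a) (hy' : y' ∈ M.baseSet a)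
      (hs : z + y + y' = (3 : ℝ) • m) : m - β • (z - m) ∈ M.baseSet a := by
    have hc : Convex ℝ (M.baseSet a) := convex_convexHull ℝ _
    have := hc hmB (hc hy hy' (by norm_num : (0 : ℝ) ≤ 1 / 2) (by norm_num : (0 : ℝ) ≤ 1 / 2)
      (by norm_num)) (by linarith : 0 ≤ 1 - 2 * β) (by linarith : 0 ≤ 2 * β) (by ring)
    convert this using 1
    rw [show z = (3 : ℝ) • m - y - y' by rw [← hs]; abel]
    module
  have hi : i ∈ a.1.base := by simp [hl]
  have hj : j ∈ a.1.base := by simp [hl]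
  have hk : k ∈ a.1.base := by simp [hl]
  have hs : (M.centerPt a.src + M.relPt i) + (M.centerPt a.src + M.relPt j) +
      (M.centerPt a.src + M.relPt k) = (3 : ℝ) • m := by
    rw [show (M.centerPt a.src + M.relPt i) + (M.centerPt a.src + M.relPt j) +
      (M.centerPt a.src + M.relPt k) = (3 : ℝ) • M.centerPt a.src +
        (M.relPt i + (M.relPt j + M.relPt k)) by module, hsum, hm]
    push_cast
    module
  rw [basePts_eq, hl] at hx
  obtain ⟨_, ⟨n, hn, rfl⟩, rfl⟩ := hx
  simp only [mem_ofPred_eq, mem_cons, not_mem_nil, or_false] at hn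
  rcases hn with rfl | rfl | rfl
  · exact key _ _ _ (hpt hj) (hpt hk) hs
  · exact key _ _ _ (hpt hi) (hpt hk) (by rw [← hs]; module)
  · exact key _ _ _ (hpt hi) (hpt hj) (by rw [← hs]; module)

lemma arcSet_subset_cone (ha : M.IsArc a) : M.arcSet a ⊆
    {x | ∃ f ∈ M.baseSet a, ∃ c : ℝ, 1 ≤ c ∧
      x = M.centerPt a.src + c • (f - M.centerPt a.src)} := by
  have h0 := h.alpha_pos
  have h1 := h.alpha_lt
  have hB : M.basePts a ⊆ M.baseSet a := subset_convexHull ℝ _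
  have hα : 1 ≤ (1 - M.alpha) / M.alpha := by rw [le_div_iff₀ h0]; linarith
  have hc := h.contact_center_mem ha
  rw [h.arcSet_eq ha]
  refine convexHull_min (Set.union_subset (fun x hx => ⟨x, hB hx, 1, le_rfl, by module⟩) ?_)
    (convex_cone (convex_convexHull ℝ _) _)
  rintro _ ⟨x, hx, rfl⟩
  cases hanti : M.anti
  · refine ⟨(M.alpha / (1 - M.alpha)) • x + ((1 - 2 * M.alpha) / (1 - M.alpha)) •
      (M.centerPt a.src + M.alpha • M.dir a.1), (convex_convexHull ℝ _) (hB hx) hc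
      (div_nonneg h0.le (by linarith)) (div_nonneg (by linarith) (by linarith)) ?_, _, hα, ?_⟩
    · have : 1 - M.alpha ≠ 0 := by linarith
      field_simp; ring
    · have : 1 - M.alpha ≠ 0 := by linarith
      rw [across, if_neg (by simp [hanti])]
      match_scalars <;> field_simp <;> ring
  · have h2 := h.alpha_le hanti
    refine ⟨_, h.reflect_mem_base hanti ha hx (β := M.alpha / (1 - M.alpha))
      (div_nonneg h0.le (by linarith)) ?_, _, hα, ?_⟩
    · rw [div_le_iff₀ (by linarith)]; linarith
    · have : 1 - M.alpha ≠ 0 := by linarith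
      rw [across, if_pos hanti, mid]
      match_scalars <;> field_simp <;> ring

lemma le_along (ha : M.IsArc a) (hx : x ∈ M.arcSet a) :
    M.alpha ≤ M.along a x := by
  obtain ⟨f, hf, c, hc, rfl⟩ := h.arcSet_subset_cone ha hx
  have h1 := h.along_base ha hf
  rw [along, axial, add_sub_cancel_left, real_inner_smul_left, mul_div_assoc]
  rw [along, axial] at h1
  rw [h1]
  nlinarith [h.alpha_pos]

lemma arcCoord_nonneg (ha : M.IsArc a) (hx : x ∈ M.arcSet a) :
    0 ≤ M.arcCoord a x := by
  have h1 := h.le_along ha hx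
  have h2 := h.alpha_pos
  have h3 : 0 < 1 - 2 * M.alpha := by linarith [h.alpha_lt]
  have h4 : (1 - 2 * M.along a x) / (1 - 2 * M.alpha) ≤ 1 := by
    rw [div_le_one h3]; linarith
  have h5 : 0 ≤ min M.alpha (M.off a x) := le_min h2.le (radial_nonneg _ _ _)
  have h6 : min M.alpha (M.off a x) ≤ M.alpha := min_le_left _ _
  rw [arcCoord]
  nlinarith

lemma arcCoord_le (ha : M.IsArc a) (hx : x ∈ M.arcSet a) :
    M.arcCoord a x ≤ 1 := by
  have := h.arcCoord_nonneg ha.rev (x := x) (by rwa [arcSet_rev])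
  rw [h.arcCoord_rev ha] at this
  linarith

/-- From each point of the solid of a link, the axis can be seen inside the union. -/
lemma segment_subset_src (ha : M.IsArc a) (hx : x ∈ M.arcSet a) {c : ℝ}
    (h0 : 0 ≤ c) (h1 : c ≤ 1 - M.alpha) :
    segment ℝ x (M.centerPt a.src + c • M.dir a.1) ⊆ M.arcSet a ∪ M.nodeSet a.src := by
  have hα := h.alpha_pos
  rcases le_total M.alpha c with h2 | h2
  · exact ((convex_convexHull ℝ _).segment_subset hx (h.axis_mem_arcSet ha h2 h1)).trans
      Set.subset_union_left
  rcases h2.eq_or_lt with rfl | h2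
  · exact ((convex_convexHull ℝ _).segment_subset hx (h.axis_mem_arcSet ha le_rfl h1)).trans
      Set.subset_union_left
  obtain ⟨f, hf, s, hs, rfl⟩ := h.arcSet_subset_cone ha hx
  have hlt : c / M.alpha < 1 := by rwa [div_lt_one hα]
  have hs0 : s - c / M.alpha ≠ 0 := by linarith
  set θ := (s - 1) / (s - c / M.alpha) with hθ
  have hθ0 : 0 ≤ θ := div_nonneg (by linarith) (by linarith)
  have hθ1 : θ ≤ 1 := by rw [hθ, div_le_one (by linarith)]; linarith
  have e1 : (1 - θ) * s + θ * (c / M.alpha) = 1 := by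
    have := div_mul_cancel₀ (s - 1) hs0
    rw [← hθ] at this
    linear_combination -this
  have hz : ((1 - θ) * s) • f + (θ * (c / M.alpha)) • (M.centerPt a.src + M.alpha • M.dir a.1) ∈
      M.baseSet a := (convex_convexHull ℝ _) hf (h.contact_center_mem ha)
    (mul_nonneg (by linarith) (by linarith)) (by positivity) e1
  refine segment_subset_union (convex_convexHull ℝ _) (convex_convexHull ℝ _) hx
    (h.axis_mem_nodeSet ha h0 h2.le) (M.baseSet_subset_arcSet a hz) (h.baseSet_subset_nodeSet ha hz)
    ⟨1 - θ, θ, by linarith, hθ0, by ring, ?_⟩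
  have e2 : (1 - θ) * s = 1 - θ * (c / M.alpha) := by linarith
  have e3 : θ * (c / M.alpha) * M.alpha = θ * c := by field_simp
  rw [smul_add (θ * _), smul_smul (θ * _), e3]
  linear_combination (norm := module) - e2 • M.centerPt a.src

lemma segment_arcMap_subset (ha : M.IsArc a) (hx : x ∈ M.arcSet a) :
    segment ℝ x (M.arcMap a x) ⊆ M.nodeSet a.src ∪ M.arcSet a ∪ M.nodeSet a.dst := by
  have h1 := h.alpha_lt
  rcases le_total (M.arcCoord a x) (1 - M.alpha) with h2 | h2
  · refine (h.segment_subset_src ha hx (h.arcCoord_nonneg ha hx) h2).trans ?_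
    rintro y (hy | hy)
    exacts [Or.inl (Or.inr hy), Or.inl (Or.inl hy)]
  · have hx' : x ∈ M.arcSet a.rev := by rwa [arcSet_rev]
    rw [← h.arcMap_rev ha]
    refine (h.segment_subset_src ha.rev hx' (h.arcCoord_nonneg ha.rev hx') ?_).trans ?_
    · rw [h.arcCoord_rev ha]; linarith
    · rw [arcSet_rev]
      rintro y (hy | hy)
      exacts [Or.inl (Or.inr hy), Or.inr hy]

end Valid
end Blueprint

namespace Blueprint

variable {M : Blueprint} {p q r d : ℕ} {g : ℤ}

/-- The solids, as translates of those of the base cell. -/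
noncomputable def piece (M : Blueprint) (i : (Fin M.cen.length ⊕ {L // L ∈ M.darts}) × Shift) :
    Set E3 :=
  match i with
  | (Sum.inl k, n) => M.nodeSet (k.1, n)
  | (Sum.inr L, n) => M.arcSet (L.1, n)

lemma piece_eq (i : (Fin M.cen.length ⊕ {L // L ∈ M.darts}) × Shift) :
    M.piece i = translate (M.vec i.2) (M.piece (i.1, 0)) := by
  obtain ⟨k | L, n⟩ := i
  · rw [piece, piece, ← nodeSet_move]
    simp [Node.move, Shift.add_eq]
  · rw [piece, piece, ← arcSet_move]
    simp [Arc.move, Shift.add_eq]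

lemma isCompact_piece (i : (Fin M.cen.length ⊕ {L // L ∈ M.darts}) × Shift) :
    IsCompact (M.piece i) := by
  obtain ⟨k | L, n⟩ := i <;> exact (finite_image_mem _ _).isCompact_convexHull (𝕜 := ℝ)

namespace Valid

variable (h : M.Valid p q r d g) {a : Arc} {A : Node} {x : E3}
include h

lemma finite_vec_norm_le (R : ℝ) : {n | ‖M.vec n‖ ≤ R}.Finite := by
  have := h.isRankThreeLattice.1
  have h1 : (Metric.closedBall (0 : E3) R ∩ (M.lattice.toAddSubgroup : Set E3)).Finite := by
    have : DiscreteTopology M.lattice.toAddSubgroup := h.isRankThreeLattice.1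
    exact Metric.finite_isBounded_inter_isClosed DiscreteTopology.isDiscrete
      Metric.isBounded_closedBall AddSubgroup.isClosed_of_discrete
  refine (h1.preimage (f := M.vec) h.isDual.vec_injective.injOn).subset fun n hn => ?_
  exact ⟨by simpa using hn, M.vec_mem_lattice n⟩

lemma locallyFinite_piece : LocallyFinite M.piece := by
  intro x
  refine ⟨Metric.closedBall x 1, Metric.closedBall_mem_nhds x one_pos, ?_⟩
  have hb : Bornology.IsBounded (⋃ j : Fin M.cen.length ⊕ {L // L ∈ M.darts}, M.piece (j, 0)) := by
    have : Finite {L // L ∈ M.darts} := M.darts.finite_toSet.to_subtype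
    exact Bornology.isBounded_iUnion.2 fun j => (isCompact_piece _).isBounded
  obtain ⟨R, hR⟩ := hb.exists_norm_le
  have : Finite {L // L ∈ M.darts} := M.darts.finite_toSet.to_subtype
  refine (Set.finite_univ.prod (h.finite_vec_norm_le (‖x‖ + 1 + R))).subset ?_
  rintro ⟨j, n⟩ ⟨y, hy, hyx⟩
  refine ⟨trivial, ?_⟩
  rw [piece_eq] at hy
  obtain ⟨z, hz, rfl⟩ := hy
  have h1 := hR z (mem_iUnion.2 ⟨j, hz⟩)
  rw [mem_closedBall_iff_norm] at hyx
  have e : M.vec n = x + (M.vec n + z - x) - z := by abel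
  change ‖M.vec n‖ ≤ _
  rw [e]
  exact (norm_sub_le _ _).trans (add_le_add ((norm_add_le _ _).trans (add_le_add le_rfl hyx)) h1)

lemma mem_polyhedron : x ∈ M.replacement.polyhedron M.graph ↔
    (∃ A, M.IsNode A ∧ x ∈ M.nodeSet A) ∨ ∃ a, M.IsArc a ∧ x ∈ M.arcSet a := by
  refine or_congr ?_ ?_
  · constructor
    · rintro ⟨u, hu, hx⟩
      obtain ⟨A, hA, rfl⟩ := h.mem_support_iff.1 hu
      exact ⟨A, hA, by rwa [h.node_center hA] at hx⟩
    · rintro ⟨A, hA, hx⟩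
      exact ⟨_, h.mem_support_iff.2 ⟨A, hA, rfl⟩, by rwa [h.node_center hA]⟩
  · constructor
    · rintro ⟨u, v, huv, hx⟩
      obtain ⟨a, ha, rfl, rfl⟩ := h.adj_iff.1 huv
      exact ⟨a, ha, by rwa [h.link_center ha] at hx⟩
    · rintro ⟨a, ha, hx⟩
      exact ⟨_, _, h.adj_arc ha, by rwa [h.link_center ha]⟩

lemma polyhedron_eq : M.replacement.polyhedron M.graph = ⋃ i, M.piece i := by
  ext x
  rw [h.mem_polyhedron, mem_iUnion]
  constructor
  · rintro (⟨A, hA, hx⟩ | ⟨a, ha, hx⟩)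
    · exact ⟨(Sum.inl ⟨A.1, hA⟩, A.2), hx⟩
    · exact ⟨(Sum.inr ⟨a.1, ha⟩, a.2), hx⟩
  · rintro ⟨⟨k | L, n⟩, hx⟩
    · exact Or.inl ⟨(k.1, n), k.2, hx⟩
    · exact Or.inr ⟨(L.1, n), L.2, hx⟩

lemma nodeMap_eq_arcMap (hA : M.IsNode A) (ha : M.IsArc a)
    (hx : x ∈ M.nodeSet A) (hxa : x ∈ M.arcSet a) : M.nodeMap A x = M.arcMap a x := by
  by_cases h1 : A = a.src
  · rw [h1] at hx ⊢
    exact h.nodeMap_base ha ((h.src_inter_arc ha).subset ⟨hx, hxa⟩)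
  by_cases h2 : A = a.dst
  · rw [h2] at hx ⊢
    have hx' : x ∈ M.baseSet a.rev := (h.dst_inter_arc ha).subset ⟨hx, hxa⟩
    exact (h.nodeMap_base ha.rev hx').trans (h.arcMap_rev ha x)
  · exact absurd ⟨hx, hxa⟩ (Set.eq_empty_iff_forall_notMem.1 (h.node_inter_arc hA ha h1 h2) x)

lemma arcMap_eq_arcMap {a b : Arc} (ha : M.IsArc a) (hb : M.IsArc b)
    (hxa : x ∈ M.arcSet a) (hxb : x ∈ M.arcSet b) : M.arcMap a x = M.arcMap b x := by
  by_cases hab : b = a ∨ b = a.rev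
  · rcases hab with rfl | rfl
    exacts [rfl, (h.arcMap_rev ha x).symm]
  rcases h.arc_inter_arc ha hb hab with h3 | ⟨a', _, ha', _, _, l, _, hl, hsub⟩
  · exact absurd ⟨hxa, hxb⟩ (Set.eq_empty_iff_forall_notMem.1 h3 x)
  · have haa := ha.of_eq ha'
    have hx : x ∈ M.nodeSet a'.src := h.baseSet_subset_nodeSet haa
      (listHull_mono (fun v hv => (hl v hv).1) (hsub ⟨hxa, hxb⟩))
    rw [← h.nodeMap_eq_arcMap (h.isNode_src haa) ha hx hxa,
      h.nodeMap_eq_arcMap (h.isNode_src haa) hb hx hxb]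

lemma exists_retraction : ∃ ρ : E3 → E3, (∀ A x, M.IsNode A → x ∈ M.nodeSet A →
    ρ x = M.nodeMap A x) ∧ ∀ a x, M.IsArc a → x ∈ M.arcSet a → ρ x = M.arcMap a x := by
  have key (x : E3) : ∃ y, (∀ A, M.IsNode A → x ∈ M.nodeSet A → y = M.nodeMap A x) ∧
      ∀ a, M.IsArc a → x ∈ M.arcSet a → y = M.arcMap a x := by
    by_cases h1 : ∃ A, M.IsNode A ∧ x ∈ M.nodeSet A
    · obtain ⟨A, hA, hx⟩ := h1
      refine ⟨M.nodeMap A x, fun B hB hxB => ?_, fun a ha hxa => h.nodeMap_eq_arcMap hA ha hx hxa⟩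
      by_contra hne
      exact Set.disjoint_left.1 (h.node_separated hA hB fun h0 => hne (h0 ▸ rfl)) hx hxB
    push Not at h1
    by_cases h2 : ∃ a, M.IsArc a ∧ x ∈ M.arcSet a
    · obtain ⟨a, ha, hx⟩ := h2
      exact ⟨M.arcMap a x, fun A hA hxA => absurd hxA (h1 A hA),
        fun b hb hxb => h.arcMap_eq_arcMap ha hb hx hxb⟩
    push Not at h2
    exact ⟨x, fun A hA hxA => absurd hxA (h1 A hA), fun a ha hxa => absurd hxa (h2 a ha)⟩
  choose ρ h1 h2 using key
  exact ⟨ρ, fun A x => h1 x A, fun a x => h2 x a⟩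

lemma axis_mem_realization (ha : M.IsArc a) {c : ℝ} (h0 : 0 ≤ c) (h1 : c ≤ 1) :
    M.centerPt a.src + c • M.dir a.1 ∈ realization M.graph := by
  refine ⟨_, _, h.adj_arc ha, 1 - c, c, by linarith, h0, by ring, ?_⟩
  rw [centerPt_dst]
  module

lemma isDeformationRetract :
    IsDeformationRetract (M.replacement.polyhedron M.graph) (realization M.graph) := by
  obtain ⟨ρ, h1, h2⟩ := h.exists_retraction
  have hα := h.alpha_lt
  refine isDeformationRetract_of_segment (ρ := ρ) ?_ ?_ ?_ ?_ ?_
  · rintro x ⟨u, v, huv, hx⟩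
    obtain ⟨a, ha, rfl, rfl⟩ := h.adj_iff.1 huv
    rw [h.mem_polyhedron]
    rcases h.edge_subset ha hx with (hx | hx) | hx
    exacts [Or.inl ⟨_, h.isNode_src ha, hx⟩, Or.inr ⟨_, ha, hx⟩, Or.inl ⟨_, h.isNode_dst ha, hx⟩]
  · rw [h.polyhedron_eq]
    refine h.locallyFinite_piece.continuousOn_iUnion (fun i => (isCompact_piece i).isClosed) ?_
    rintro ⟨k | L, n⟩
    · exact (continuous_nodeMap (M := M) (k.1, n)).continuousOn.congr fun x hx => h1 _ x k.2 hx
    · exact (continuous_arcMap (M := M) (L.1, n)).continuousOn.congr fun x hx => h2 _ x L.2 hx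
  · intro x hx
    rcases h.mem_polyhedron.1 hx with ⟨A, hA, hx⟩ | ⟨a, ha, hx⟩
    · obtain ⟨a, c, ha, -, h0, hc, e⟩ := h.exists_nodeMap hA hx
      rw [h1 A x hA hx, e]
      exact h.axis_mem_realization ha h0 (by linarith)
    · rw [h2 a x ha hx]
      exact h.axis_mem_realization ha (h.arcCoord_nonneg ha hx) (h.arcCoord_le ha hx)
  · intro x hx y hy
    rw [h.mem_polyhedron]
    rcases h.mem_polyhedron.1 hx with ⟨A, hA, hx⟩ | ⟨a, ha, hx⟩
    · obtain ⟨a, c, ha, rfl, h0, hc, e⟩ := h.exists_nodeMap hA hx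
      rw [h1 _ x hA hx, e] at hy
      exact Or.inl ⟨_, hA, (convex_convexHull ℝ _).segment_subset hx
        (h.axis_mem_nodeSet ha h0 hc) hy⟩
    · rw [h2 a x ha hx] at hy
      rcases h.segment_arcMap_subset ha hx hy with (hy | hy) | hy
      exacts [Or.inl ⟨_, h.isNode_src ha, hy⟩, Or.inr ⟨_, ha, hy⟩, Or.inl ⟨_, h.isNode_dst ha, hy⟩]
  · have key {a : Arc} (ha : M.IsArc a) {c : ℝ} (h0 : 0 ≤ c) (hc : c ≤ 1 - M.alpha) :
        ρ (M.centerPt a.src + c • M.dir a.1) = M.centerPt a.src + c • M.dir a.1 := by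
      rcases le_total c M.alpha with h3 | h3
      · rw [h1 _ _ (h.isNode_src ha) (h.axis_mem_nodeSet ha h0 h3), h.nodeMap_axis ha h0]
      · rw [h2 _ _ ha (h.axis_mem_arcSet ha h3 hc), h.arcMap_axis ha]
    rintro x ⟨u, v, huv, hx⟩
    obtain ⟨a, ha, rfl, rfl⟩ := h.adj_iff.1 huv
    rw [segment_eq_image'] at hx
    obtain ⟨c, ⟨h0, hc⟩, rfl⟩ := hx
    rw [show M.centerPt a.dst - M.centerPt a.src = M.dir a.1 by rw [centerPt_dst]; abel]
    rcases le_total c (1 - M.alpha) with h3 | h3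
    · exact key ha h0 h3
    · have := key ha.rev (c := 1 - c) (by linarith) (by linarith [h.alpha_pos])
      rwa [axis_rev] at this

lemma isDecoration : IsDecoration M.lattice M.graph M.replacement where
  node_solid u hu := by
    obtain ⟨A, hA, rfl⟩ := h.mem_support_iff.1 hu
    rw [h.node_center hA]
    exact h.isConvexSolid_nodeSet A
  link_solid u v huv := by
    obtain ⟨a, ha, rfl, rfl⟩ := h.adj_iff.1 huv
    rw [h.link_center ha]
    exact Or.inr (h.isConvexSolid_arcSet ha)
  link_symm u v huv := by
    obtain ⟨a, ha, rfl, rfl⟩ := h.adj_iff.1 huv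
    have := h.link_center ha.rev
    rw [Arc.src_rev, Arc.dst_rev, arcSet_rev] at this
    rw [h.link_center ha, this]
  node_periodic l hl u hu := by
    obtain ⟨A, hA, rfl⟩ := h.mem_support_iff.1 hu
    obtain ⟨n, rfl⟩ := M.mem_lattice.1 hl
    rw [vec_add_centerPt, h.node_center hA, h.node_center (A := A.move n) hA, nodeSet_move]
  link_periodic l hl u v huv := by
    obtain ⟨a, ha, rfl, rfl⟩ := h.adj_iff.1 huv
    obtain ⟨n, rfl⟩ := M.mem_lattice.1 hl
    rw [vec_add_centerPt, vec_add_centerPt, ← Arc.src_move, ← Arc.dst_move, h.link_center ha,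
      h.link_center (ha.move n), arcSet_move]
  vertex_mem u hu := by
    obtain ⟨A, hA, rfl⟩ := h.mem_support_iff.1 hu
    rw [h.node_center hA]
    exact h.center_mem
  edge_subset u v huv := by
    obtain ⟨a, ha, rfl, rfl⟩ := h.adj_iff.1 huv
    rw [h.node_center (h.isNode_src ha), h.node_center (h.isNode_dst ha), h.link_center ha]
    exact h.edge_subset ha
  contact_node u v huv := by
    obtain ⟨a, ha, rfl, rfl⟩ := h.adj_iff.1 huv
    rw [h.contact_center ha, h.node_center (h.isNode_src ha)]
    exact h.baseSet_mem_node_facets ha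
  contact_link u v huv _ := by
    obtain ⟨a, ha, rfl, rfl⟩ := h.adj_iff.1 huv
    rw [h.contact_center ha, h.link_center ha]
    exact h.baseSet_mem_arc_facets ha
  node_node u hu v hv huv _ := by
    obtain ⟨A, hA, rfl⟩ := h.mem_support_iff.1 hu
    obtain ⟨B, hB, rfl⟩ := h.mem_support_iff.1 hv
    rw [h.node_center hA, h.node_center hB,
      (h.node_separated hA hB fun h0 => huv (h0 ▸ rfl)).inter_eq]
    exact isThin_empty
  node_link w hw u v huv hu hv := by
    obtain ⟨A, hA, rfl⟩ := h.mem_support_iff.1 hw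
    obtain ⟨a, ha, rfl, rfl⟩ := h.adj_iff.1 huv
    rw [h.node_center hA, h.link_center ha,
      h.node_inter_arc hA ha (fun h0 => hu (h0 ▸ rfl)) fun h0 => hv (h0 ▸ rfl)]
    exact isThin_empty
  link_link u v u' v' huv huv' hne := by
    obtain ⟨a, ha, rfl, rfl⟩ := h.adj_iff.1 huv
    obtain ⟨b, hb, rfl, rfl⟩ := h.adj_iff.1 huv'
    rw [h.link_center ha, h.link_center hb]
    rcases h.arc_inter_arc ha hb (by
      rintro (rfl | rfl)
      exacts [hne rfl, hne (by rw [Arc.src_rev, Arc.dst_rev, Sym2.eq_swap])])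
      with h3 | ⟨_, _, _, _, _, l, hl, _, hsub⟩
    · rw [h3]; exact isThin_empty
    · exact IsThin.mono (isThin_listHull hl) hsub
  retract := h.isDeformationRetract

lemma exampleExists {s : Solid} {g' : ℕ} (hg : g = g') {L : Set E3 → Prop}
    (hs : ∀ A, IsSolid s (M.nodeSet A)) (hL : ∀ a, M.IsArc a → L (M.arcSet a))
    (hL' : ∀ a, M.IsArc a → ∃ n, IsPrism n (M.arcSet a) ∨ IsAntiprism n (M.arcSet a)) :
    ExampleExists g' g' M.cen.length d p q r s L := by
  have hs' : ∀ u ∈ M.graph.support, IsSolid s (M.replacement.node u) := by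
    intro u hu
    obtain ⟨A, hA, rfl⟩ := h.mem_support_iff.1 hu
    rw [h.node_center hA]
    exact hs A
  refine ⟨M.lattice, M.graph, M.replacement, h.hasQuotientType hg, h.isEuclideanSymmetric,
    ⟨h.isDecoration, ⟨fun u hu => ⟨s, hs' u hu⟩, fun u v huv => Or.inr ?_⟩, h.isRegularSurface, ?_⟩,
    h.hasQuotientGenus hg, hs', ?_⟩
  · obtain ⟨a, ha, rfl, rfl⟩ := h.adj_iff.1 huv
    rw [h.link_center ha]
    exact hL' a ha
  · intro u v huv
    obtain ⟨a, ha, rfl, rfl⟩ := h.adj_iff.1 huv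
    rw [h.contact_center ha]
    exact h.isRegularPolygon_baseSet ha
  · intro u v huv
    obtain ⟨a, ha, rfl, rfl⟩ := h.adj_iff.1 huv
    rw [h.link_center ha]
    exact hL a ha

lemma exampleExists_prism (hanti : M.anti = false) {c : ℤ} (hc : 0 < c) {a : Shift}
    (ha : M.solidOK c a = true) {s : Solid} (hs : s.points = allPoints a.1 a.2.1 a.2.2) {g' : ℕ}
    (hg : g = g') : ExampleExists g' g' M.cen.length d p q r s (IsPrism r) :=
  h.exampleExists hg (isSolid_nodeSet hc ha hs) (fun _ => h.isPrism_arcSet hanti)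
    fun _ ha => ⟨r, Or.inl (h.isPrism_arcSet hanti ha)⟩

lemma exampleExists_antiprism (hanti : M.anti = true) {c : ℤ} (hc : 0 < c) {a : Shift}
    (ha : M.solidOK c a = true) {s : Solid} (hs : s.points = allPoints a.1 a.2.1 a.2.2) {g' : ℕ}
    (hg : g = g') : ExampleExists g' g' M.cen.length d p q r s (IsAntiprism 3) :=
  h.exampleExists hg (isSolid_nodeSet hc ha hs) (fun _ => h.isAntiprism_arcSet hanti)
    fun _ ha => ⟨3, Or.inr (h.isAntiprism_arcSet hanti ha)⟩

end Valid
end Blueprint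

namespace Blueprint

/-! ### The four surfaces -/

def coords (M : Blueprint) (x : SurdPt) : Shift :=
  ((x.eval M.dual.1).1 / (M.lam.1.eval M.dual.1).1,
    (x.eval M.dual.2.1).1 / (M.lam.2.1.eval M.dual.2.1).1,
    (x.eval M.dual.2.2).1 / (M.lam.2.2.eval M.dual.2.2).1)

def locate (M : Blueprint) (x : SurdPt) : Node :=
  (((List.range M.cen.length).map fun k => (k, M.coords (x.sub (M.center (k, 0))))).find?
    fun A => (M.center A).same x).getD 0

def images (M : Blueprint) (m : Matrix3) (t : SurdPt) : List Node × Matrix3 :=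
  (M.cen.map fun c => M.locate ((applyMat m c).add t),
    M.coords (applyMat m M.lam.1), M.coords (applyMat m M.lam.2.1), M.coords (applyMat m M.lam.2.2))

def withSyms (M : Blueprint) (l : List (Matrix3 × SurdPt)) : Blueprint :=
  { M with
    syms := l.map fun s =>
      let f := M.images s.1 s.2
      let b := M.images (transposeMat s.1) (SurdPt.smul (-1) (applyMat (transposeMat s.1) s.2))
      ⟨s.1, s.2, f.1, f.2, b.1, b.2⟩ }

def steps {α : Type} (l : List α) : List (α × α) := l.zip l.tail

def trail (l : List (Node × List ℕ)) : List (Corner × Corner) :=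
  steps (l.flatMap fun s => s.2.map fun j => (s.1, j))

def bodyCentered : SurdPt × SurdPt × SurdPt :=
  (scaled 4 (1, 1, -1), scaled 4 (1, -1, 1), scaled 4 (-1, 1, 1))

def octahedron : List SurdPt :=
  [(1, 0, 0), (-1, 0, 0), (0, 1, 0), (0, -1, 0), (0, 0, 1), (0, 0, -1)].map (scaled 3)

def octahedronFaces : List (List ℕ) :=
  [[0, 2, 4], [0, 5, 2], [0, 4, 3], [0, 3, 5], [1, 4, 2], [1, 2, 5], [1, 3, 4], [1, 5, 3]]

def signChanges : List (Matrix3 × SurdPt) :=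
  [1, -1].flatMap fun a => [1, -1].flatMap fun b => [1, -1].map fun c =>
    (((a, 0, 0), (0, b, 0), (0, 0, c)), 0)

def octaEight : Blueprint := withSyms (l := signChanges) {
  lam := bodyCentered
  dual := ((1, 1, 0), (1, 0, 1), (0, 1, 1))
  cen := [0]
  rel := octahedron
  faces := octahedronFaces
  links := [⟨0, (0, 1, 0, 0), [0, 5, 2], [1, 4, 3]⟩, ⟨0, (0, 0, 1, 0), [0, 4, 3], [1, 5, 2]⟩,
    ⟨0, (0, 0, 0, 1), [1, 4, 2], [0, 5, 3]⟩, ⟨0, (0, 1, 1, 1), [0, 2, 4], [1, 3, 5]⟩]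
  anti := true
  al := (1, 0)
  den := 4
  syms := []
  nodeChain := steps [0, (0, 0, 1, 0), (0, 0, 1, 1), (0, 0, 0, 1), 0, (0, 1, 0, 0)]
  cornerChain := trail [(0, [0, 2, 1, 3, 4]), ((0, 0, 0, 1), [0]), (0, [2, 5]),
    ((0, 1, 0, 0), [3, 0]), ((0, 1, 1, 0), [2, 4]), ((0, 0, 1, 0), [0])] }

def truncatedOctaEight : Blueprint := withSyms (l := signChanges) {
  lam := (SurdPt.mul (6, 1) (scaled 1 (1, 1, -1)), SurdPt.mul (6, 1) (scaled 1 (1, -1, 1)),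
    SurdPt.mul (6, 1) (scaled 1 (-1, 1, 1)))
  dual := ((1, 1, 0), (1, 0, 1), (0, 1, 1))
  cen := [0]
  rel := [(-2, -1, 0), (-2, 0, -1), (-2, 0, 1), (-2, 1, 0), (-1, -2, 0), (-1, 0, -2), (-1, 0, 2),
    (-1, 2, 0), (0, -2, -1), (0, -2, 1), (0, -1, -2), (0, -1, 2), (0, 1, -2), (0, 1, 2), (0, 2, -1),
    (0, 2, 1), (1, -2, 0), (1, 0, -2), (1, 0, 2), (1, 2, 0), (2, -1, 0), (2, 0, -1), (2, 0, 1),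
    (2, 1, 0)].map (scaled 3)
  faces := [[13, 18, 22, 23, 19, 15], [12, 14, 19, 23, 21, 17], [9, 16, 20, 22, 18, 11],
    [8, 10, 17, 21, 20, 16], [2, 6, 13, 15, 7, 3], [1, 3, 7, 14, 12, 5], [0, 4, 9, 11, 6, 2],
    [0, 1, 5, 10, 8, 4], [20, 21, 23, 22], [0, 2, 3, 1], [7, 15, 19, 14], [4, 8, 16, 9],
    [6, 11, 18, 13], [5, 12, 17, 10]]
  links := [⟨0, (0, 1, 0, 0), [12, 14, 19, 23, 21, 17], [0, 2, 6, 11, 9, 4]⟩,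
    ⟨0, (0, 0, 1, 0), [9, 16, 20, 22, 18, 11], [1, 5, 12, 14, 7, 3]⟩,
    ⟨0, (0, 0, 0, 1), [2, 6, 13, 15, 7, 3], [8, 16, 20, 21, 17, 10]⟩,
    ⟨0, (0, 1, 1, 1), [13, 18, 22, 23, 19, 15], [0, 4, 8, 10, 5, 1]⟩]
  anti := false
  al := (6, -1)
  den := 10
  syms := []
  nodeChain := octaEight.nodeChain
  cornerChain := trail [(0, [0, 1, 2, 3, 7, 14, 12, 5, 10, 8, 4, 9, 11, 6, 13, 15, 19, 23, 20, 16,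
    20, 21, 17]), ((0, 1, 0, 0), [0, 4]), (0, [21, 22, 18]), ((0, 0, 1, 0), [3, 0, 1]),
    (0, [11, 6]), ((0, 0, 0, 1), [8, 4, 0])] }

def threeChain : List (Node × Node) := steps [0, (1, 0, 1, 0), (2, 0, 0, 0), (0, 0, 0, 1),
  (1, 0, 0, 0), (2, 1, 0, 0), (1, 1, 1, 0), (0, 1, 0, 0), (2, 1, 0, -1), (0, 0, 0, -1),
  (1, 0, 1, -1), (0, 0, 1, 0)]

def threeCubes : Blueprint := withSyms
  (l := [1, -1].flatMap fun s => [((1, 0, 0), (0, s, 0), (0, 0, 1)),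
      ((0, 0, 1), (1, 0, 0), (0, s, 0)),
    ((0, s, 0), (0, 0, 1), (1, 0, 0)), ((0, 0, 1), (0, s, 0), (1, 0, 0)),
    ((1, 0, 0), (0, 0, 1), (0, s, 0)), ((0, s, 0), (1, 0, 0), (0, 0, 1))].map fun m => (m, 0)) {
  lam := bodyCentered
  dual := ((1, 1, 0), (1, 0, 1), (0, 1, 1))
  cen := [(1, 0, 0), (0, 1, 0), (0, 0, 1)].map (scaled 4)
  rel := [(1, 1, 1), (1, 1, -1), (1, -1, 1), (1, -1, -1), (-1, 1, 1), (-1, 1, -1), (-1, -1, 1),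
    (-1, -1, -1)].map (scaled 1)
  faces := [[0, 2, 3, 1], [4, 5, 7, 6], [0, 1, 5, 4], [2, 6, 7, 3], [0, 4, 6, 2], [1, 3, 7, 5]]
  links := [⟨0, (2, 1, 0, 0), [0, 1, 5, 4], [2, 3, 7, 6]⟩,
    ⟨0, (2, 0, 0, -1), [2, 6, 7, 3], [0, 4, 5, 1]⟩, ⟨1, (0, 0, 0, 1), [0, 4, 6, 2], [1, 5, 7, 3]⟩,
    ⟨1, (0, 0, -1, 0), [1, 3, 7, 5], [0, 2, 6, 4]⟩, ⟨2, (1, 0, 1, 0), [0, 2, 3, 1], [4, 6, 7, 5]⟩,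
    ⟨2, (1, -1, 0, 0), [4, 5, 7, 6], [0, 1, 3, 2]⟩]
  anti := false
  al := (1, 0)
  den := 4
  syms := []
  nodeChain := threeChain
  cornerChain := trail [(0, [0, 1, 2, 3, 7, 4, 5, 6]), ((1, 0, 1, 0), [5]),
    ((2, 0, 0, 0), [0, 1, 3, 2, 4, 5, 7, 6, 0]), ((0, 0, 0, 1), [2, 0, 1]),
    ((1, 0, 0, 0), [0, 1, 3, 2, 6, 4, 5, 7, 2]), ((2, 1, 0, 0), [4, 0]), ((1, 1, 1, 0), [5]),
    ((0, 1, 0, 0), [0]), ((1, 1, 1, 0), [1, 0]), ((0, 1, 1, 1), [3]), ((2, 1, 1, 0), [0, 2]),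
    ((0, 0, 1, 0), [0])] }

def threeOctahedra : Blueprint := withSyms
  (l := [1, -1].flatMap fun s => [((s, 0, 0), (0, s, 0), (0, 0, s)),
    ((0, s, 0), (0, 0, -s), (-s, 0, 0)), ((0, 0, -s), (s, 0, 0), (0, -s, 0)),
    ((0, 0, -s), (0, s, 0), (-s, 0, 0)), ((0, s, 0), (s, 0, 0), (0, 0, s)),
    ((s, 0, 0), (0, 0, -s), (0, -s, 0))].map fun m => (m, scaled (4 - 4 * s) (1, 1, 1))) {
  lam := (scaled 4 (3, -1, 1), scaled 4 (-1, 3, 1), scaled 4 (-1, -1, -3))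
  dual := ((2, 1, -1), (1, 2, -1), (1, 1, -2))
  cen := [(1, 1, 1), (1, -1, -1), (-1, 1, -1)].map (scaled 4)
  rel := octahedron
  faces := octahedronFaces
  links := [⟨0, (2, 1, 0, 0), [0, 3, 5], [1, 2, 4]⟩, ⟨0, (2, 0, 0, -1), [1, 4, 2], [0, 5, 3]⟩,
    ⟨1, (0, 0, 0, 1), [1, 2, 5], [0, 3, 4]⟩, ⟨1, (0, 0, -1, 0), [0, 4, 3], [1, 5, 2]⟩,
    ⟨2, (1, 0, 1, 0), [0, 2, 4], [1, 3, 5]⟩, ⟨2, (1, -1, 0, 0), [1, 5, 3], [0, 4, 2]⟩]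
  anti := true
  al := (1, 0)
  den := 4
  syms := []
  nodeChain := threeChain
  cornerChain := trail [(0, [0, 2, 1, 3, 4, 0, 5]), ((2, 1, 0, 0), [1]),
    ((1, 0, 0, 0), [2, 0, 3, 1, 4, 0, 5]), ((0, 0, 0, 1), [0, 2]),
    ((2, 0, 0, 0), [0, 2, 1, 3, 4, 0, 5, 0]), ((1, 0, 1, 0), [3, 0]), ((2, 1, 1, 0), [3, 4]),
    ((0, 0, 1, 0), [0]), ((2, 1, 1, 0), [2, 0]), ((0, 1, 1, 1), [4]), ((1, 1, 1, 0), [1, 3]),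
    ((0, 1, 0, 0), [5, 0])] }

section

set_option maxRecDepth 100000
set_option maxHeartbeats 2000000

lemma valid_octaEight : octaEight.Valid 3 12 3 8 4 := by constructor <;> decide +kernel

lemma valid_truncatedOctaEight : truncatedOctaEight.Valid 4 5 6 8 4 := by
  constructor <;> decide +kernel

lemma valid_threeCubes : threeCubes.Valid 4 5 4 4 4 := by constructor <;> decide +kernel

lemma valid_threeOctahedra : threeOctahedra.Valid 3 8 3 4 4 := by constructor <;> decide +kernel

end

end Blueprint
end TPPS

/-- There are, up to similarity, only finitely many genus-four regular triply periodic polyhedral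
surfaces that are regular Archimedean decorations of a symmetric quotient graph of type `(4, 1, 8)`
or `(4, 3, 4)`. Among them are Octa-8 (an octahedron with triangular antiprisms), Truncated
Octa-8 (a truncated octahedron with hexagonal prisms), and the decorations by three cubes with
square prisms and by three octahedra with triangular antiprisms. -/
theorem mainTheorem7 :
    (∃ L : Set (Set (Set TPPS.E3)), L.Finite ∧
      (∀ S ∈ L, TPPS.ArisesFrom 4 4 1 8 S ∨ TPPS.ArisesFrom 4 4 3 4 S) ∧
      ∀ S : Set (Set TPPS.E3), TPPS.ArisesFrom 4 4 1 8 S ∨ TPPS.ArisesFrom 4 4 3 4 S →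
        ∃ S₀ ∈ L, TPPS.AreSimilarTilings S₀ S) ∧
    TPPS.ExampleExists 4 4 1 8 3 12 3 TPPS.Solid.octahedron (TPPS.IsAntiprism 3) ∧
    TPPS.ExampleExists 4 4 1 8 4 5 6 TPPS.Solid.truncatedOctahedron (TPPS.IsPrism 6) ∧
    TPPS.ExampleExists 4 4 3 4 4 5 4 TPPS.Solid.cube (TPPS.IsPrism 4) ∧
    TPPS.ExampleExists 4 4 3 4 3 8 3 TPPS.Solid.octahedron (TPPS.IsAntiprism 3) := by
  refine ⟨TPPS.finite_similarity_classes, ?_, ?_, ?_, ?_⟩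
  · exact TPPS.Blueprint.valid_octaEight.exampleExists_antiprism rfl (c := 3) (a := (1, 0, 0))
      (by decide) (by decide +kernel) (by simp [TPPS.Solid.points]) rfl
  · exact TPPS.Blueprint.valid_truncatedOctaEight.exampleExists_prism rfl (c := 3) (a := (0, 1, 2))
      (by decide) (by decide +kernel) (by simp [TPPS.Solid.points]) rfl
  · exact TPPS.Blueprint.valid_threeCubes.exampleExists_prism rfl (c := 1) (a := (1, 1, 1))
      (by decide) (by decide +kernel) (by simp [TPPS.Solid.points]) rfl
  · exact TPPS.Blueprint.valid_threeOctahedra.exampleExists_antiprism rfl (c := 3) (a := (1, 0, 0))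
      (by decide) (by decide +kernel) (by simp [TPPS.Solid.points]) rfl
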